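/- Let $S^3\subset\mathbb R^4$ be the unit sphere, $B^4$ the open unit ball, and let $\Sigma\subset S^3$ be a smoothly embedded, connected closed surface of genus $g\ge 0$. Let $A$ be a connected component of $S^3\setminus\Sigma$ and $\vec n$ the unit normal of $\Sigma$ in $S^3$ pointing into $A$. For an open set $E\subset S^3$ let $[\partial E]$ denote the boundary of the integration current over $E$, and let $B_r(q)$ be the open geodesic ball of $S^3$ of centre $q$ and radius $r$ (empty if $r\le 0$, all of $S^3$ if $r>\pi$). *Primitive family.* For $v\in B^4$ let $F_v(z)=(1-|v|^2)\frac{z-v}{|z-v|^2}-v$, let $d_v$ be the signed geodesic distance in $S^3$ to $F_v(\Sigma)$, positive on $F_v(A)$ and $\le 0$ elsewhere, and $[\Sigma(v,t)]=[\partial\{x\in S^3: d_v(x)<t\}]$. *Blow-up along $\Sigma$.* For $p\in\Sigma$ and $s=(s_1,s_2)$ with $s_1\ge 0$ put $\Lambda(p,s)=(1-s_1)(\cos s_2\,p+\sin s_2\,\vec n(p))$. For small $\varepsilon>0$, $\Lambda$ is injective on $\Sigma\times\{s_1\ge0,|s|\le 2\varepsilon\}$; let $\Omega_r=\Lambda(\Sigma\times\{s_1\ge0,\,|s|\le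 r\})$. Let $\varphi:\mathbb R\to\mathbb R$ be continuous, $0$ on $(-\infty,\varepsilon]$, strictly increasing on $[\varepsilon,2\varepsilon]$ and $1$ on $[2\varepsilon,\infty)$, and let $T:\overline{B^4}\to\overline{B^4}$ be given by $T(\Lambda(p,s))=\Lambda(p,\varphi(|s|)s)$ on $\Omega_{2\varepsilon}$ and $T=\mathrm{id}$ elsewhere. For $v\in S^3\cup\Omega_\varepsilon$ define a centre $q(v)\in S^3$ and a radius $r(v)\in[0,\pi]$ by $$q=-\sin\theta\,p-\cos\theta\,\vec n(p),\quad r=\tfrac{\pi}{2}-\theta\qquad\text{if } v=\Lambda(p,s)\in\Omega_\varepsilon,\ \theta=\arcsin(s_2/\varepsilon),$$ $$q=-T(v),\ r=0\ \text{ if } v\in A\setminus\Omega_\varepsilon,\qquad q=T(v),\ r=\pi\ \text{ if } v\in S^3\setminus(A\cup\Omega_\varepsilon).$$ Put $C(v,t)=[\partial B_{r(v)+t}(q(v))]$ if $v\in S^3\cup\Omega_\varepsilon$ and $C(v,t)=[\Sigma(T(v),t)]$ if $v\in B^4\setminus\Omega_\varepsilon$. *Canonical family and centre map.* Let $\rho:\overline{B^4}\to[0,\pi]$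 be any continuous function equal to $r$ on $S^3\cup\Omega_\varepsilon$, and $f:[0,1]^4\to\overline{B^4}$ any homeomorphism mapping $\partial[0,1]^4$ onto $S^3$. The canonical family is $$\Psi_\Sigma(x,t)=C\big(f(x),\,2\pi(2t-1)+\tfrac{\pi}{2}-\rho(f(x))\big),\qquad (x,t)\in[0,1]^4\times[0,1].$$ A map $Q:\partial[0,1]^4\to S^3$ is a centre map of $\Psi_\Sigma$ if for every $x\in\partial[0,1]^4$ the path $t\mapsto\Psi_\Sigma(x,t)$ is the foliation of $S^3$ by geodesic spheres centred at $Q(x)$, that is, there is a continuous strictly increasing $s:[0,1]\to\mathbb R$ with $s(0)\le0$, $s(1/2)=\pi/2$, $s(1)\ge\pi$ and $\Psi_\Sigma(x,t)=[\partial B_{s(t)}(Q(x))]$ for all $t\in[0,1]$; in particular $\Psi_\Sigma(x,1/2)=[\partial B_{\pi/2}(Q(x))]$. **Theorem.** There is $\varepsilon_0>0$, depending only on $\Sigma$, $A$ and $\vec n$, such that for every $\varepsilon\in(0,\varepsilon_0)$ and all $\varphi,\rho,f$ as above, the canonical family $\Psi_\Sigma$ has exactly one centre map $Q_\Sigma:\partial[0,1]^4\to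 S^3$; it is continuous, and, seen as a map $S^3\to S^3$ through the identification $f:\partial[0,1]^4\simeq S^3$ used in the construction, it has degree $$\deg(Q_\Sigma)=g=\mathrm{genus}(\Sigma).$$ Here the genus is determined by $\chi(\Sigma)=2-2g$, with $\chi(\Sigma)$ computed on a finite smooth triangulation; a continuous map $S^3\to S^3$ has degree $d$ if it is homotopic to a smooth map $F$ with $\int_{S^3}F^*\mathrm{vol}=d\int_{S^3}\mathrm{vol}$. -/

import Mathlib

open Set Filter Topology MeasureTheory
open scoped ContDiff RealInnerProductSpace

/-! ### The round three-sphere -/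

/-- Euclidean four-space. -/
abbrev E4 : Type := EuclideanSpace ℝ (Fin 4)

/-- The unit sphere of `ℝ⁴`. -/
abbrev S3 : Type := Metric.sphere (0 : E4) 1

/-- The closed unit ball of `ℝ⁴`. -/
abbrev Ball4 : Type := Metric.closedBall (0 : E4) 1

/-- The surface measure of the unit sphere (total mass `2 π ^ 2`). -/
noncomputable abbrev sphereMeasure : Measure S3 := (volume : Measure E4).toSphere

/-- The open geodesic ball of `S³` with centre `q` and radius `r`; the geodesic distance of two
points of the unit sphere is the angle between them. -/
def geodesicBall (q : E4) (r : ℝ) : Set S3 := {x | InnerProductGeometry.angle (x : E4) q < r}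

/-- The geodesic distance from `x` to the set `Y`. -/
noncomputable def geodesicInfDist (x : E4) (Y : Set E4) : ℝ :=
  sInf ((fun y => InnerProductGeometry.angle x y) '' Y)

/-! ### Two-dimensional currents that bound a region -/

/-- Smooth differential `2`-forms, given as restrictions of smooth forms of `ℝ⁴`. -/
abbrev TestForm : Type := {α : E4 → E4 [⋀^Fin 2]→L[ℝ] ℝ // ContDiff ℝ ∞ α}

/-- The value of a `3`-covector on the `3`-vector `*x`, that is on `v₁ ∧ v₂ ∧ v₃` whenever
`(x, v₁, v₂, v₃)` is a positive orthonormal basis of `ℝ⁴`: for `x` in `S³` this is the value on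
the unit `3`-vector orienting `S³` as the boundary of the ball. -/
noncomputable def evalOrientation (x : E4) (η : E4 [⋀^Fin 3]→L[ℝ] ℝ) : ℝ :=
  ∑ i : Fin 4, (-1 : ℝ) ^ (i : ℕ) * x i *
    η (fun j : Fin 3 => EuclideanSpace.single (i.succAbove j) (1 : ℝ))

/-- The `2`-current `∂[E]`, the boundary of the integration current over the region `E` of `S³`:
`α ↦ ∫_E dα`. -/
noncomputable def boundaryCurrent (E : Set S3) : TestForm → ℝ := fun α =>
  ∫ x in E, evalOrientation (x : E4) (extDeriv α.1 (x : E4)) ∂sphereMeasure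

/-! ### Closed embedded surfaces of the three-sphere -/

/-- `S` is a (smooth, connected) closed surface embedded in `S³`: near each of its points it is a
regular level set in `S³` of a smooth function. -/
structure IsClosedSurface (S : Set E4) : Prop where
  isCompact : IsCompact S
  isConnected : IsConnected S
  subset_sphere : S ⊆ Metric.sphere 0 1
  smooth : ∀ p ∈ S, ∃ (U : Set E4) (u : E4 → ℝ), IsOpen U ∧ p ∈ U ∧ ContDiffOn ℝ ∞ u U ∧
    (∀ x ∈ U, x ∈ Metric.sphere (0 : E4) 1 → (x ∈ S ↔ u x = 0)) ∧
    ∃ w : E4, ⟪w, p⟫ = 0 ∧ fderiv ℝ u p w ≠ 0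

/-- `h` is a smooth triangulation of `S` by the simplicial complex `K`: a homeomorphism whose
restriction to every simplex is a smooth immersion. -/
def IsSmoothTriangulation {N : ℕ} (K : Geometry.SimplicialComplex ℝ (EuclideanSpace ℝ (Fin N)))
    {S : Set E4} (h : K.space ≃ₜ S) : Prop :=
  ∀ s ∈ K.faces, ∃ G : EuclideanSpace ℝ (Fin N) → E4, ContDiff ℝ ∞ G ∧
    (∀ x : K.space, (x : EuclideanSpace ℝ (Fin N)) ∈ convexHull ℝ (s : Set _) →
      G x = (h x : E4)) ∧
    ∀ x ∈ convexHull ℝ (s : Set (EuclideanSpace ℝ (Fin N))),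
      ∀ w ∈ vectorSpan ℝ (s : Set (EuclideanSpace ℝ (Fin N))), fderiv ℝ G x w = 0 → w = 0

/-- The Euler characteristic `∑ (-1) ^ dim s` over the simplices `s` of a finite complex. -/
noncomputable def eulerCharacteristic {N : ℕ}
    {K : Geometry.SimplicialComplex ℝ (EuclideanSpace ℝ (Fin N))} (hK : K.faces.Finite) : ℤ :=
  ∑ s ∈ hK.toFinset, (-1 : ℤ) ^ (s.card - 1)

/-- The closed orientable surface `S` has genus `g`: its Euler characteristic, computed on a
finite smooth triangulation, is `2 - 2 g`. -/
def HasGenus (S : Set E4) (g : ℕ) : Prop :=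
  ∃ (N : ℕ) (K : Geometry.SimplicialComplex ℝ (EuclideanSpace ℝ (Fin N)))
    (hK : K.faces.Finite) (h : K.space ≃ₜ S),
    IsSmoothTriangulation K h ∧ eulerCharacteristic hK = 2 - 2 * (g : ℤ)

/-- `n` is the unit normal of `S` in `S³` that points into `A`, from the other side of `S`. -/
def IsUnitNormalInto (S A : Set E4) (n : E4 → E4) : Prop :=
  ∀ p ∈ S, ‖n p‖ = 1 ∧ ⟪p, n p⟫ = 0 ∧ (∀ w ∈ tangentConeAt ℝ S p, ⟪w, n p⟫ = 0) ∧
    (∀ᶠ s : ℝ in 𝓝[>] 0, Real.cos s • p + Real.sin s • n p ∈ A) ∧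
    (∀ᶠ s : ℝ in 𝓝[>] 0, Real.cos s • p - Real.sin s • n p ∉ A)

/-! ### The primitive canonical family -/

/-- The conformal map `F_v(z) = (1 - |v|²) (z - v) / |z - v|² - v` of `S³`, for `|v| < 1`. -/
noncomputable def conformalMap (v z : E4) : E4 :=
  ((1 - ‖v‖ ^ 2) / ‖z - v‖ ^ 2) • (z - v) - v

open Classical in
/-- The signed distance `d_v` to `F_v(S)`, positive in `F_v(A)`. -/
noncomputable def signedGeodesicDist (S A : Set E4) (v x : E4) : ℝ :=
  if x ∈ conformalMap v '' A then geodesicInfDist x (conformalMap v '' S)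
  else -geodesicInfDist x (conformalMap v '' S)

/-- The primitive canonical family `Σ_(v,t) = ∂{x ∈ S³ ; d_v(x) < t}`. -/
noncomputable def primitiveFamily (S A : Set E4) (v : E4) (t : ℝ) : TestForm → ℝ :=
  boundaryCurrent {x : S3 | signedGeodesicDist S A v (x : E4) < t}

/-! ### Blowing up the closed ball along the surface -/

/-- `Λ(p, s) = (1 - s₁) (cos s₂ p + sin s₂ n(p))`. -/
noncomputable def tubeMap (n : E4 → E4) (p : E4) (s : ℝ × ℝ) : E4 :=
  (1 - s.1) • (Real.cos s.2 • p + Real.sin s.2 • n p)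

/-- The Euclidean norm of a pair. -/
noncomputable def pairNorm (s : ℝ × ℝ) : ℝ := Real.sqrt (s.1 ^ 2 + s.2 ^ 2)

/-- The coordinates `(p, s)`, `p ∈ S`, `s₁ ≥ 0`, `|s| ≤ r`, of the point `v = Λ(p, s)`. For small
`r` there is at most one. -/
def tubeCoords (S : Set E4) (n : E4 → E4) (r : ℝ) (v : E4) : Set (E4 × (ℝ × ℝ)) :=
  {c | c.1 ∈ S ∧ 0 ≤ c.2.1 ∧ pairNorm c.2 ≤ r ∧ tubeMap n c.1 c.2 = v}

/-- The half tube `{Λ(p, s) ; p ∈ S, s₁ ≥ 0, |s| ≤ r}` around `S` in the closed ball. -/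
def tube (S : Set E4) (n : E4 → E4) (r : ℝ) : Set E4 := {v | (tubeCoords S n r v).Nonempty}

/-- A profile vanishing on `[0, ε]`, equal to `1` from `2ε` on, increasing in between. -/
def IsProfile (ε : ℝ) (φ : ℝ → ℝ) : Prop :=
  Continuous φ ∧ (∀ r ≤ ε, φ r = 0) ∧ StrictMonoOn φ (Icc ε (2 * ε)) ∧ ∀ r, 2 * ε ≤ r → φ r = 1

open Classical in
/-- The map `T` of the closed ball that collapses the half tube of radius `ε` onto `S`:
`Λ(p, s) ↦ Λ(p, φ(|s|) s)` on the half tube of radius `2ε`, the identity elsewhere. -/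
noncomputable def collapse (S : Set E4) (n : E4 → E4) (ε : ℝ) (φ : ℝ → ℝ) (v : E4) : E4 :=
  if h : (tubeCoords S n (2 * ε) v).Nonempty then
    tubeMap n h.some.1 (φ (pairNorm h.some.2) • h.some.2)
  else v

open Classical in
/-- The centre of the spheres attached to a point `v` of the tube of radius `ε` or of `S³`:
`- sin θ p - cos θ n(p)` at `Λ(p, s)`, with `sin θ = s₂ / ε`; otherwise `- T v` if `v ∈ A`, and
`T v` if `v` lies on the other side of `S`. -/
noncomputable def sphereCentre (S A : Set E4) (n : E4 → E4) (ε : ℝ) (φ : ℝ → ℝ) (v : E4) : E4 :=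
  if h : (tubeCoords S n ε v).Nonempty then
    -(h.some.2.2 / ε) • h.some.1 - Real.sqrt (1 - (h.some.2.2 / ε) ^ 2) • n h.some.1
  else if v ∈ A then -collapse S n ε φ v
  else collapse S n ε φ v

open Classical in
/-- The radius, for `t = 0`, of the spheres attached to a point `v` of the tube of radius `ε` or of
`S³`: `π / 2 - θ` at `Λ(p, s)`, with `sin θ = s₂ / ε`; otherwise `0` if `v ∈ A`, and `π` if `v`
lies on the other side of `S`. -/
noncomputable def sphereRadius (S A : Set E4) (n : E4 → E4) (ε : ℝ) (v : E4) : ℝ :=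
  if h : (tubeCoords S n ε v).Nonempty then Real.pi / 2 - Real.arcsin (h.some.2.2 / ε)
  else if v ∈ A then 0
  else Real.pi

open Classical in
/-- The primitive family after the blow-up, extended to the whole closed ball: at a point of `S³` or
of the tube it consists of geodesic spheres, elsewhere it is the primitive family at `T v`. -/
noncomputable def extendedFamily (S A : Set E4) (n : E4 → E4) (ε : ℝ) (φ : ℝ → ℝ)
    (v : E4) (t : ℝ) : TestForm → ℝ :=
  if ‖v‖ = 1 ∨ v ∈ tube S n ε then
    boundaryCurrent (geodesicBall (sphereCentre S A n ε φ v) (sphereRadius S A n ε v + t))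
  else primitiveFamily S A (collapse S n ε φ v) t

/-- `ρ` is a continuous extension of the radius to the closed ball, with values in `[0, π]`. -/
def IsRadiusExtension (S A : Set E4) (n : E4 → E4) (ε : ℝ) (ρ : E4 → ℝ) : Prop :=
  ContinuousOn ρ (Metric.closedBall 0 1) ∧
    (∀ v ∈ Metric.closedBall (0 : E4) 1, ρ v ∈ Icc 0 Real.pi) ∧
    ∀ v ∈ Metric.closedBall (0 : E4) 1, ‖v‖ = 1 ∨ v ∈ tube S n ε → ρ v = sphereRadius S A n ε v

/-! ### The canonical family on the cube and its centre map -/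

/-- The cube `[0,1]⁴`. -/
abbrev Cube4 : Type := Icc (0 : Fin 4 → ℝ) 1

/-- The boundary of the cube. -/
def cubeBoundary : Set Cube4 := {x | ∃ i, (x : Fin 4 → ℝ) i = 0 ∨ (x : Fin 4 → ℝ) i = 1}

/-- The homeomorphism `f` of the cube onto the closed ball maps boundary to boundary. -/
def PreservesBoundary (f : Cube4 ≃ₜ Ball4) : Prop :=
  ∀ x : Cube4, x ∈ cubeBoundary ↔ ‖(f x : E4)‖ = 1

/-- The identification of `S³` with the boundary of the cube given by `f`. -/
def sphereToCubeBoundary (f : Cube4 ≃ₜ Ball4) (hf : PreservesBoundary f) :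
    C(S3, cubeBoundary) where
  toFun v := ⟨f.symm ⟨v, Metric.sphere_subset_closedBall v.2⟩, by
    rw [hf]; simp⟩
  continuous_toFun := by fun_prop

/-- The canonical family of the surface, on `[0,1]⁴ × [0,1]`: the extended family with time
reparametrized so that, over the boundary of the cube, the great sphere occurs at `t = 1/2`. -/
noncomputable def canonicalFamily (S A : Set E4) (n : E4 → E4) (ε : ℝ) (φ : ℝ → ℝ) (ρ : E4 → ℝ)
    (f : Cube4 ≃ₜ Ball4) (x : Cube4) (t : ℝ) : TestForm → ℝ :=
  extendedFamily S A n ε φ (f x) (2 * Real.pi * (2 * t - 1) + Real.pi / 2 - ρ (f x))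

/-- `Q` is the centre map of the family `Ψ`: for every boundary point `x` of the cube,
`t ↦ Ψ(x, t)` is the foliation of `S³` by the geodesic spheres centred at `Q x`, with strictly
increasing radii (a geodesic ball of radius `≤ 0` is empty, one of radius `> π` is `S³`), and
`Ψ(x, 1/2)` is the boundary of the hemisphere centred at `Q x`. -/
def IsCentreMap (Ψ : Cube4 → ℝ → TestForm → ℝ) (Q : cubeBoundary → S3) : Prop :=
  ∀ x : cubeBoundary, ∃ s : ℝ → ℝ, ContinuousOn s (Icc 0 1) ∧ StrictMonoOn s (Icc 0 1) ∧
    s 0 ≤ 0 ∧ s (1 / 2) = Real.pi / 2 ∧ Real.pi ≤ s 1 ∧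
    ∀ t ∈ Icc (0 : ℝ) 1, Ψ x t = boundaryCurrent (geodesicBall (Q x : E4) (s t))

/-! ### The degree of a self-map of the three-sphere -/

open Classical in
/-- The extension of `F : S³ → S³` to `ℝ⁴` that is positively homogeneous of degree one. -/
noncomputable def homogeneousExtension (F : C(S3, S3)) (y : E4) : E4 :=
  if hy : y = 0 then 0
  else ‖y‖ • (F ⟨‖y‖⁻¹ • y, by simp [norm_smul, inv_mul_cancel₀ (norm_ne_zero_iff.2 hy)]⟩ : E4)

/-- The continuous map `q : S³ → S³` has degree `d`: it is homotopic to a smooth map `F` with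
`∫ F^* vol = d ∫ vol`. The homogeneous extension of `F` maps `x` to `F x` and agrees to first order
with `F` on the tangent space at `x`, so its Jacobian determinant at `x ∈ S³` is the density of
`F^* vol` with respect to `vol`; and it is smooth off the origin if and only if `F` is smooth. -/
def HasDegree (q : C(S3, S3)) (d : ℤ) : Prop :=
  ∃ F : C(S3, S3), ContDiffOn ℝ ∞ (homogeneousExtension F) {0}ᶜ ∧ q.Homotopic F ∧
    ∫ x : S3, (fderiv ℝ (homogeneousExtension F) (x : E4)).det ∂sphereMeasure
      = (d : ℝ) * sphereMeasure.real univ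

/-! Over the boundary of the cube the family consists of concentric geodesic spheres by
construction, and the time change makes the radius π/2 at t = 1/2, so a centre map exists. It is
unique because a hemisphere is determined by its boundary current
(`eq_of_boundaryCurrent_hemisphere_eq`). The content of the theorem is the degree.

Near S the sphere has coordinates (p, s), for the point cos s p + sin s n(p). The centre map keeps p
and the great circle through p and n(p), and replaces s by an angle β(s). It is the identity far
from S outside A and the antipodal map far from S inside A, so β(s) = s for s ≤ -2ε and β(s) = s - π
for s ≥ 2ε (`sphereCentre_eq_rotMap`). Two such maps whose angles differ by less than π are
homotopic (`homotopic_rotMap`), so β may be replaced by a smooth angle with the same behaviour.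

The degree integral is compared with that of the identity. Off the tube the smooth map is ± id, and
- id preserves the orientation of ℝ⁴. In the tube, the parallel surface at angle θ has area density
J(θ) = cos²θ a₁ + cos θ sin θ a₂ + sin²θ a₃, where a₁ is the area density of S and a₃ is that of the
normal map. The excess ∫ (β' J(β) - J) ds depends only on the end values of β and equals -∫ J over
an interval of length π, that is -(π/2)(a₁ + a₃) (`IsAdaptedFrame.integral_parallelDensity`). By
Gauss's equation in the sphere, a₁ + a₃ is the intrinsic curvature density. Hence the degree
integral is 2π² - (π/2) ∫ K (`integral_det_rotMap`), and ∫ K = 2πχ = 2π(2 - 2g) turns it into g ·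
2π², g times the volume of the sphere.

Gauss–Bonnet is derived from the triangulation. On one triangle it is Green's formula for the
connection form of a frame (`IsAdaptedFrame.integral_curvDensity`). In the sum the angles at each
vertex add up to 2π (`sum_cornerAngle`), the geodesic curvatures cancel along each edge, and each
edge lies in two triangles (`card_eq_two_and_sum_sideCurv`); so ∫ K = 2πV - πF with 3F = 2E. The
local structure of the triangulation is read off from velocities: every tangent vector of S is a
limit of difference quotients taken inside one triangle (`exists_seq_triangle`), and two triangles
entered with the same velocity from the same point coincide (`triFace_eq_of_velocity`). No
orientation of S is chosen: the frames follow the parametrizations, and both cyclic orders of every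
triangle are averaged. -/

/-! ### Boundary currents determine the centres of hemispheres -/

/-- The Euclidean volume form of `ℝ⁴`. -/
noncomputable def volumeForm4 : E4 [⋀^Fin 4]→L[ℝ] ℝ where
  toAlternatingMap := (Matrix.detRowAlternating (n := Fin 4) (R := ℝ)).compLinearMap
    (EuclideanSpace.equiv (Fin 4) ℝ).toLinearMap
  cont := by
    change Continuous fun v : Fin 4 → E4 => Matrix.det (Matrix.of fun i j => v i j)
    exact Continuous.matrix_det (continuous_matrix fun i j => by
      simp only [Matrix.of_apply]; fun_prop)

lemma volumeForm4_apply (v : Fin 4 → E4) :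
    volumeForm4 v = Matrix.det (Matrix.of fun i j => v i j) := rfl

/-- The cofactor of `w i` in the first row of the determinant is (-1)^i, the same sign as in
`evalOrientation`; the two signs cancel and leave the sum of the products `w i * x i`. -/
lemma evalOrientation_curryLeft_volumeForm4 (w x : E4) :
    evalOrientation x (volumeForm4.curryLeft w) = ⟪w, x⟫ := by
  have h : ∀ i : Fin 4, volumeForm4 (Matrix.vecCons w fun j : Fin 3 =>
      EuclideanSpace.single (i.succAbove j) (1 : ℝ)) = (-1) ^ (i : ℕ) * w i := by
    intro i
    rw [volumeForm4_apply]
    rw [Matrix.det_succ_row_zero]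
    rw [Finset.sum_eq_single i]
    · have h2 : ((Matrix.of fun a b => (Matrix.vecCons w (fun j : Fin 3 =>
          EuclideanSpace.single (i.succAbove j) (1 : ℝ)) : Fin 4 → E4) a b).submatrix Fin.succ
          i.succAbove) = 1 := by
        ext a b
        simp [Matrix.one_apply, eq_comm]
      rw [h2]
      simp
    · intro j _ hj
      obtain ⟨k, hk⟩ := Fin.exists_succAbove_eq hj
      rw [Matrix.det_eq_zero_of_row_eq_zero k, mul_zero]
      intro b
      simp [hk, Fin.succAbove_ne]
    · simp
  simp only [evalOrientation, ContinuousAlternatingMap.curryLeft_apply_apply, h,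
    PiLp.inner_apply, RCLike.inner_apply, conj_trivial]
  refine Finset.sum_congr rfl fun i _ => ?_
  have : ((-1 : ℝ) ^ (i : ℕ)) * (-1) ^ (i : ℕ) = 1 := by
    rw [← mul_pow]; norm_num
  linear_combination (x i * w i) * this

/-- A test form whose exterior derivative is, on the sphere, a given linear function. -/
lemma exists_testForm_linear (w : E4) : ∃ α : TestForm, ∀ x : E4,
    evalOrientation x (extDeriv α.1 x) = ⟪w, x⟫ := by
  -- The form is vol(w, x, ·, ·) / 3 at x. Contracting a constant k-form with the position vector
  -- and differentiating multiplies it by k, here 3.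
  set L : E4 →L[ℝ] E4 [⋀^Fin 2]→L[ℝ] ℝ :=
    (1 / 3 : ℝ) • (volumeForm4.curryLeft w).curryLeft with hL
  refine ⟨⟨L, L.contDiff⟩, fun x => ?_⟩
  have : extDeriv (fun x => L x) x = volumeForm4.curryLeft w := by
    rw [extDeriv, L.fderiv, hL]
    have h := ContinuousAlternatingMap.alternatizeUncurryFin_curryLeft (volumeForm4.curryLeft w)
    rw [← ContinuousAlternatingMap.alternatizeUncurryFinCLM_apply, map_smul,
      ContinuousAlternatingMap.alternatizeUncurryFinCLM_apply, h, ← Nat.cast_smul_eq_nsmul ℝ,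
      smul_smul]
    norm_num
  have h2 := evalOrientation_curryLeft_volumeForm4 w x
  rw [← this] at h2
  exact h2

lemma geodesicBall_pi_div_two (q : S3) :
    geodesicBall (q : E4) (Real.pi / 2) = {x : S3 | 0 < ⟪(x : E4), (q : E4)⟫} := by
  ext x
  simp [geodesicBall, InnerProductGeometry.angle, Real.arccos_lt_pi_div_two]

lemma measurableSet_hemisphere (q : E4) : MeasurableSet {x : S3 | 0 < ⟪(x : E4), q⟫} :=
  (isOpen_lt continuous_const (by fun_prop)).measurableSet

lemma isFiniteMeasure_sphereMeasure : IsFiniteMeasure sphereMeasure := by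
  unfold sphereMeasure; infer_instance

lemma integrable_inner_sphere (w : E4) :
    Integrable (fun x : S3 => ⟪w, (x : E4)⟫) sphereMeasure := by
  have := isFiniteMeasure_sphereMeasure
  exact (by fun_prop : Continuous fun x : S3 => ⟪w, (x : E4)⟫).integrable_of_hasCompactSupport
    (HasCompactSupport.of_compactSpace _)

/-- A hemisphere is determined by its boundary current. -/
lemma eq_of_boundaryCurrent_hemisphere_eq {q q' : S3}
    (h : boundaryCurrent (geodesicBall (q : E4) (Real.pi / 2)) =
      boundaryCurrent (geodesicBall (q' : E4) (Real.pi / 2))) : q = q' := by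
  by_contra hne
  -- With the linear function of q - q' the difference of the two integrands is nonnegative: where
  -- the hemispheres differ, ⟪q - q', x⟫ has the sign of the difference of their indicators.
  obtain ⟨α, hα⟩ := exists_testForm_linear ((q : E4) - q')
  have h1 := congrFun h α
  simp only [boundaryCurrent, hα, geodesicBall_pi_div_two] at h1
  set f : S3 → ℝ := fun x => ⟪(q : E4) - q', (x : E4)⟫ with hf
  have hfi := integrable_inner_sphere ((q : E4) - q')
  rw [← integral_indicator (measurableSet_hemisphere _),
    ← integral_indicator (measurableSet_hemisphere _), ← sub_eq_zero, ← integral_sub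
    (hfi.indicator (measurableSet_hemisphere _)) (hfi.indicator (measurableSet_hemisphere _))] at h1
  have hq : ‖(q : E4)‖ = 1 := by simp
  have hq' : ‖(q' : E4)‖ = 1 := by simp
  rw [integral_eq_zero_iff_of_nonneg] at h1
  · have hd : (q : E4) - q' ≠ 0 := sub_ne_zero.2 fun h => hne (Subtype.ext h)
    have hdn : 0 < ‖(q : E4) - q'‖ := norm_pos_iff.2 hd
    -- An open lune on which the difference of the integrands is positive; it contains the direction
    -- of q - q'.
    set U : Set S3 := {x | 0 < ⟪(x : E4), (q : E4)⟫} ∩ {x | ⟪(x : E4), (q' : E4)⟫ < 0} with hU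
    have hUo : IsOpen U := (isOpen_lt continuous_const (by fun_prop)).inter
      (isOpen_lt (by fun_prop) continuous_const)
    have hlt : ⟪(q : E4), (q' : E4)⟫ < 1 := by
      refine lt_of_le_of_ne ?_ ?_
      · simpa [hq, hq'] using real_inner_le_norm (q : E4) q'
      rw [Ne, inner_eq_one_iff_of_norm_eq_one hq hq']
      exact fun h => hne (Subtype.ext h)
    have hUn : U.Nonempty := by
      refine ⟨⟨‖(q : E4) - q'‖⁻¹ • ((q : E4) - q'), by simp [norm_smul, hdn.ne']⟩, ?_, ?_⟩
      · simp only [mem_ofPred_eq, inner_smul_left, inner_sub_left, real_inner_self_eq_norm_sq, hq]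
        rw [real_inner_comm]
        simp only [map_inv₀, conj_trivial]
        have : 0 < ‖(q : E4) - q'‖⁻¹ := by positivity
        nlinarith
      · simp only [mem_ofPred_eq, inner_smul_left, inner_sub_left, real_inner_self_eq_norm_sq, hq']
        simp only [map_inv₀, conj_trivial]
        have : 0 < ‖(q : E4) - q'‖⁻¹ := by positivity
        nlinarith
    have hpos := hUo.measure_pos sphereMeasure hUn
    refine hpos.ne' (measure_mono_null (fun x hx => ?_) (ae_iff.1 h1))
    have h3 : x ∉ {x : S3 | 0 < ⟪(x : E4), (q' : E4)⟫} := fun h => lt_asymm (show ⟪(x : E4), (q' : E4)⟫ < 0 from hx.2) h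
    have h4 : x ∈ {x : S3 | 0 < ⟪(x : E4), (q : E4)⟫} := hx.1
    have h5 : (0 : ℝ) < ⟪(q : E4) - q', (x : E4)⟫ := by
      rw [inner_sub_left, real_inner_comm, real_inner_comm (x : E4) (q' : E4)]
      have := hx.1; have := hx.2
      simp only [mem_ofPred_eq] at *
      linarith
    simp [indicator_of_mem h4, indicator_of_notMem h3, h5.ne']
  · intro x
    simp only [Pi.zero_apply, indicator_apply, mem_ofPred_eq, inner_sub_left,
      real_inner_comm (x : E4)]
    split_ifs <;> linarith
  · exact (hfi.indicator (measurableSet_hemisphere _)).sub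
      (hfi.indicator (measurableSet_hemisphere _))

/-- The time t = 1/2 suffices: there the radius is prescribed to be π/2 for every centre map. -/
lemma isCentreMap_unique {Ψ : Cube4 → ℝ → TestForm → ℝ} {Q Q' : cubeBoundary → S3}
    (h : IsCentreMap Ψ Q) (h' : IsCentreMap Ψ Q') : Q' = Q := by
  funext x
  obtain ⟨s, -, -, -, hs, -, h1⟩ := h x
  obtain ⟨s', -, -, -, hs', -, h1'⟩ := h' x
  have e := h1 (1 / 2) (by norm_num)
  have e' := h1' (1 / 2) (by norm_num)
  rw [hs] at e
  rw [hs'] at e'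
  exact eq_of_boundaryCurrent_hemisphere_eq (e'.symm.trans e)

/-- Over the boundary of the cube the canonical family consists of concentric spheres. -/
lemma isCentreMap_canonicalFamily {S A : Set E4} {n : E4 → E4} {ε : ℝ} {φ : ℝ → ℝ} {ρ : E4 → ℝ}
    (hρ : IsRadiusExtension S A n ε ρ) {f : Cube4 ≃ₜ Ball4} (hf : PreservesBoundary f)
    {Q : cubeBoundary → S3}
    (hQ : ∀ x : cubeBoundary, (Q x : E4) = sphereCentre S A n ε φ (f x)) :
    IsCentreMap (canonicalFamily S A n ε φ ρ f) Q := by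
  have hpi := Real.pi_pos
  intro x
  -- The subtraction of ρ in the family cancels the initial radius. The remaining radius is affine
  -- and runs from -3π/2 to 5π/2.
  refine ⟨fun t => 2 * Real.pi * (2 * t - 1) + Real.pi / 2, by fun_prop, fun a _ b _ hab => ?_,
    ?_, ?_, ?_, fun t _ => ?_⟩
  · simp only; nlinarith
  · simp only; nlinarith
  · simp
  · simp only; nlinarith
  · have h1 : ‖(f x : E4)‖ = 1 := (hf x).1 x.2
    rw [canonicalFamily, extendedFamily, if_pos (Or.inl h1), hQ,
      hρ.2.2 _ (f x).2 (Or.inl h1)]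
    congr 2
    ring

/-! ### Local equations and graph charts of the surface -/

/-- Inverse function theorem, smooth on a whole neighbourhood. -/
lemma exists_openPartialHomeomorph_of_hasFDerivAt_id {U : Set E4} (hU : IsOpen U) {f : E4 → E4}
    (hf : ContDiffOn ℝ ∞ f U) {x : E4} (hx : x ∈ U)
    (hfx : HasFDerivAt f (ContinuousLinearMap.id ℝ E4) x) :
    ∃ e : OpenPartialHomeomorph E4 E4, x ∈ e.source ∧ e.source ⊆ U ∧ (∀ y, e y = f y) ∧
      ContDiffOn ℝ ∞ e.symm e.target := by
  have hfx' : ContDiffAt ℝ ∞ f x := hf.contDiffAt (hU.mem_nhds hx)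
  have hs : HasStrictFDerivAt f ((ContinuousLinearEquiv.refl ℝ E4 : E4 ≃L[ℝ] E4) : E4 →L[ℝ] E4) x :=
    hfx'.hasStrictFDerivAt' hfx (by simp)
  set e := hs.toOpenPartialHomeomorph f with he
  have hd : ContinuousOn (fderiv ℝ f) U :=
    hf.continuousOn_fderiv_of_isOpen hU (by simp)
  -- Restriction to the open set where the derivative is invertible makes the inverse smooth at
  -- every point of the target, not only at the image of `x`.
  set V : Set E4 := U ∩ fderiv ℝ f ⁻¹' (range ((↑) : (E4 ≃L[ℝ] E4) → E4 →L[ℝ] E4)) with hV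
  have hVo : IsOpen V := hd.isOpen_inter_preimage hU ContinuousLinearEquiv.isOpen
  have hxV : x ∈ V := ⟨hx, ContinuousLinearEquiv.refl ℝ E4, by rw [hfx.fderiv]; rfl⟩
  refine ⟨e.restr V, ?_, ?_, fun y => rfl, ?_⟩
  · rw [e.restr_source' _ hVo]
    exact ⟨hs.mem_toOpenPartialHomeomorph_source, hxV⟩
  · rw [e.restr_source' _ hVo]
    exact fun y hy => hy.2.1
  · intro y hy
    have hy1 := (e.restr V).map_target hy
    rw [e.restr_source' _ hVo] at hy1
    obtain ⟨hy2, hy3, L, hL⟩ := hy1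
    refine (OpenPartialHomeomorph.contDiffAt_symm (e.restr V) (f₀' := L) hy ?_ ?_).contDiffWithinAt
    · have : DifferentiableAt ℝ f ((e.restr V).symm y) :=
        (hf.contDiffAt (hU.mem_nhds hy3)).differentiableAt (by simp)
      rw [hL]
      exact this.hasFDerivAt
    · exact hf.contDiffAt (hU.mem_nhds hy3)

/-- The radial projection to the unit sphere. -/
noncomputable def radial (y : E4) : E4 := ‖y‖⁻¹ • y

lemma norm_radial {y : E4} (hy : y ≠ 0) : ‖radial y‖ = 1 := by
  simp [radial, norm_smul, norm_ne_zero_iff.2 hy]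

lemma radial_eq_self {y : E4} (hy : ‖y‖ = 1) : radial y = y := by simp [radial, hy]

lemma radial_smul {r : ℝ} (hr : 0 < r) (y : E4) : radial (r • y) = radial y := by
  simp only [radial, norm_smul, Real.norm_eq_abs, abs_of_pos hr, smul_smul]
  congr 1
  field_simp

lemma norm_smul_radial (y : E4) : ‖y‖ • radial y = y := by
  rcases eq_or_ne y 0 with rfl | hy
  · simp
  · simp [radial, smul_smul, norm_ne_zero_iff.2 hy]

lemma contDiffOn_radial : ContDiffOn ℝ ∞ radial {0}ᶜ := fun y hy =>
  (((contDiffAt_norm ℝ (by simpa using hy)).inv (norm_ne_zero_iff.2 (by simpa using hy))).smul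
    contDiffAt_id).contDiffWithinAt

lemma contDiffAt_radial {y : E4} (hy : y ≠ 0) : ContDiffAt ℝ ∞ radial y :=
  contDiffOn_radial.contDiffAt (isOpen_compl_singleton.mem_nhds hy)

/-- An orthonormal basis with two prescribed last vectors. -/
lemma exists_orthonormalBasis_last_two {a b : E4} (ha : ‖a‖ = 1) (hb : ‖b‖ = 1)
    (hab : ⟪a, b⟫ = 0) : ∃ B : OrthonormalBasis (Fin 4) ℝ E4, B 2 = a ∧ B 3 = b := by
  have h := Orthonormal.exists_orthonormalBasis_extension_of_card_eq (𝕜 := ℝ) (E := E4)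
    (ι := Fin 4) (by simp) (v := ![0, 0, a, b]) (s := {2, 3}) ?_
  · obtain ⟨B, hB⟩ := h
    exact ⟨B, by simpa using hB 2 (by simp), by simpa using hB 3 (by simp)⟩
  · rw [orthonormal_iff_ite]
    rintro ⟨i, hi⟩ ⟨j, hj⟩
    simp only [mem_insert_iff, mem_singleton_iff] at hi hj
    rcases hi with rfl | rfl <;> rcases hj with rfl | rfl <;>
      simp [ha, hb, hab, real_inner_comm a b]

/-- `v` is a local defining function of `S` on the open set `V`, constant along rays. -/
structure IsLocalDefining (S V : Set E4) (v : E4 → ℝ) : Prop where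
  isOpen : IsOpen V
  contDiffOn : ContDiffOn ℝ ∞ v V
  ne_zero : ∀ x ∈ V, x ≠ 0
  mem_iff : ∀ x ∈ V, x ∈ S ↔ ‖x‖ = 1 ∧ v x = 0
  fderiv_self : ∀ x ∈ V, fderiv ℝ v x x = 0
  fderiv_ne : ∀ x ∈ V, fderiv ℝ v x ≠ 0

/-- The unit normal determined by a defining function. -/
noncomputable def unitGradient (v : E4 → ℝ) (x : E4) : E4 := ‖gradient v x‖⁻¹ • gradient v x

lemma hasFDerivAt_radial {p : E4} (hp : ‖p‖ = 1) :
    HasFDerivAt radial (ContinuousLinearMap.id ℝ E4 -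
      (innerSL ℝ p).smulRight p) p := by
  have hp0 : p ≠ 0 := fun h => by simp [h] at hp
  have h2 : HasFDerivAt (fun y : E4 => √(‖y‖ ^ 2)) ((1 / (2 * √(‖p‖ ^ 2))) •
      (2 • (innerSL ℝ p))) p :=
    (hasStrictFDerivAt_norm_sq p).hasFDerivAt.sqrt (by simp [hp])
  have h3 : HasFDerivAt (fun y : E4 => ‖y‖) (innerSL ℝ p) p := by
    refine (h2.congr_of_eventuallyEq (.of_forall fun y => ?_)).congr_fderiv ?_
    · simp
    · ext w; simp [hp]
  have h4 := ((hasDerivAt_inv (by simp [hp] : ‖p‖ ≠ 0)).comp_hasFDerivAt p h3).smul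
    (hasFDerivAt_id p)
  refine h4.congr_fderiv ?_
  ext w
  simp [hp, sub_eq_add_neg]

/-- Composition of a local equation with the radial projection is constant along rays, so its
gradient is tangent to the spheres about the origin. At p its derivative along the given w is that
of the original equation, because w is orthogonal to p; it stays nonzero nearby. -/
lemma IsClosedSurface.exists_isLocalDefining {S : Set E4} (hS : IsClosedSurface S) {p : E4}
    (hp : p ∈ S) : ∃ V v, p ∈ V ∧ IsLocalDefining S V v := by
  obtain ⟨U, u, hU, hpU, hu, hSu, w, hwp, hw⟩ := hS.smooth p hp
  have hp1 : ‖p‖ = 1 := by simpa using hS.subset_sphere hp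
  have hp0 : p ≠ 0 := fun h => by simp [h] at hp1
  set v : E4 → ℝ := fun y => u (radial y)
  set V₀ : Set E4 := {0}ᶜ ∩ radial ⁻¹' U
  have hV₀ : IsOpen V₀ :=
    contDiffOn_radial.continuousOn.isOpen_inter_preimage isOpen_compl_singleton hU
  have hv : ContDiffOn ℝ ∞ v V₀ :=
    hu.comp (contDiffOn_radial.mono inter_subset_left) fun y hy => hy.2
  have hd : ContinuousOn (fderiv ℝ v) V₀ := hv.continuousOn_fderiv_of_isOpen hV₀ (by simp)
  refine ⟨V₀ ∩ fderiv ℝ v ⁻¹' {0}ᶜ, v, ⟨⟨hp0, ?_⟩, ?_⟩,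
    hd.isOpen_inter_preimage hV₀ isOpen_compl_singleton, hv.mono inter_subset_left,
    fun x hx => hx.1.1, fun x hx => ?_, fun x hx => ?_, fun x hx => hx.2⟩
  · simpa [radial_eq_self hp1] using hpU
  · intro h
    have h1 : HasFDerivAt v ((fderiv ℝ u (radial p)).comp (ContinuousLinearMap.id ℝ E4 -
      (innerSL ℝ p).smulRight p)) p := by
      refine HasFDerivAt.comp p ?_ (hasFDerivAt_radial hp1)
      rw [radial_eq_self hp1]
      exact ((hu.contDiffAt (hU.mem_nhds hpU)).differentiableAt (by simp)).hasFDerivAt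
    rw [mem_singleton_iff, h1.fderiv] at h
    have h2 := congrArg (fun L => L w) h
    rw [real_inner_comm] at hwp
    simp [hwp, radial_eq_self hp1] at h2
    exact hw h2
  · constructor
    · intro hxS
      have h1 : ‖x‖ = 1 := by simpa using hS.subset_sphere hxS
      have h2 := hx.1.2
      rw [mem_preimage, radial_eq_self h1] at h2
      refine ⟨h1, ?_⟩
      simp only [v, radial_eq_self h1]
      exact (hSu x h2 (by simpa using h1)).1 hxS
    · rintro ⟨h1, h3⟩
      have h2 := hx.1.2
      simp only [mem_preimage, v, radial_eq_self h1] at h2 h3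
      exact (hSu x h2 (by simpa using h1)).2 h3
  · have h1 : HasFDerivAt v (fderiv ℝ v x) x :=
      ((hv.contDiffAt (hV₀.mem_nhds hx.1)).differentiableAt (by simp)).hasFDerivAt
    have h2 : HasDerivAt (fun t : ℝ => t • x) ((1 : ℝ) • x) 1 :=
      (hasDerivAt_id (1 : ℝ)).smul_const x
    rw [← one_smul ℝ x] at h1
    have h3 := HasFDerivAt.comp_hasDerivAt (1 : ℝ) h1 h2
    have h4 : HasDerivAt (fun t : ℝ => v (t • x)) 0 1 := by
      refine (hasDerivAt_const (1 : ℝ) (v x)).congr_of_eventuallyEq ?_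
      filter_upwards [lt_mem_nhds (zero_lt_one' ℝ)] with t ht
      simp only [v, radial_smul ht]
    simpa using h3.unique h4

namespace IsLocalDefining

variable {S V : Set E4} {v : E4 → ℝ}

lemma gradient_ne (h : IsLocalDefining S V v) {x : E4} (hx : x ∈ V) : gradient v x ≠ 0 := by
  simpa [gradient] using h.fderiv_ne x hx

lemma norm_unitGradient (h : IsLocalDefining S V v) {x : E4} (hx : x ∈ V) :
    ‖unitGradient v x‖ = 1 := by
  simp [unitGradient, norm_smul, norm_ne_zero_iff.2 (h.gradient_ne hx)]

lemma fderiv_apply (h : IsLocalDefining S V v) {x : E4} (hx : x ∈ V) (w : E4) :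
    fderiv ℝ v x w = ‖gradient v x‖ * ⟪unitGradient v x, w⟫ := by
  rw [unitGradient, inner_smul_left]
  have : ‖gradient v x‖ ≠ 0 := norm_ne_zero_iff.2 (h.gradient_ne hx)
  simp [gradient] at this ⊢
  field_simp

lemma inner_unitGradient_self (h : IsLocalDefining S V v) {x : E4} (hx : x ∈ V) :
    ⟪unitGradient v x, x⟫ = 0 := by
  have h1 := h.fderiv_apply hx x
  rw [h.fderiv_self x hx] at h1
  simpa [h.gradient_ne hx] using h1.symm

lemma contDiffOn_unitGradient (h : IsLocalDefining S V v) :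
    ContDiffOn ℝ ∞ (unitGradient v) V := by
  have h1 : ContDiffOn ℝ ∞ (gradient v) V :=
    ((InnerProductSpace.toDual ℝ E4).symm : (StrongDual ℝ E4) ≃ₗᵢ[ℝ] E4).contDiff.comp_contDiffOn
      (h.contDiffOn.fderiv_of_isOpen h.isOpen (by simp))
  exact ContDiffOn.smul (ContDiffOn.inv (h1.norm ℝ fun x hx => h.gradient_ne hx)
    fun x hx => norm_ne_zero_iff.2 (h.gradient_ne hx)) h1

end IsLocalDefining

/-- The orthogonal projection to the plane of the first two vectors of a basis. -/
noncomputable def planeProj (B : OrthonormalBasis (Fin 4) ℝ E4) : E4 →L[ℝ] E4 :=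
  (innerSL ℝ (B 0)).smulRight (B 0) + (innerSL ℝ (B 1)).smulRight (B 1)

lemma planeProj_apply (B : OrthonormalBasis (Fin 4) ℝ E4) (y : E4) :
    planeProj B y = ⟪B 0, y⟫ • B 0 + ⟪B 1, y⟫ • B 1 := rfl

lemma sum_inner_basis (B : OrthonormalBasis (Fin 4) ℝ E4) (y : E4) :
    ⟪B 0, y⟫ • B 0 + ⟪B 1, y⟫ • B 1 + ⟪B 2, y⟫ • B 2 + ⟪B 3, y⟫ • B 3 = y := by
  simpa [Fin.sum_univ_four] using B.sum_repr' y

lemma inner_sum_basis (B : OrthonormalBasis (Fin 4) ℝ E4) (a b c d : ℝ) :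
    ⟪B 0, a • B 0 + b • B 1 + c • B 2 + d • B 3⟫ = a ∧
    ⟪B 1, a • B 0 + b • B 1 + c • B 2 + d • B 3⟫ = b ∧
    ⟪B 2, a • B 0 + b • B 1 + c • B 2 + d • B 3⟫ = c ∧
    ⟪B 3, a • B 0 + b • B 1 + c • B 2 + d • B 3⟫ = d := by
  simp [inner_add_right, inner_smul_right]

/-- A surface as a graph over its tangent plane at `p`. The parametrization `ψ` depends only on the
components of its argument in the tangent plane, and fixes the points of the surface near `p`. -/
structure IsGraphChart (S V : Set E4) (p : E4) (B : OrthonormalBasis (Fin 4) ℝ E4) (Z Y : Set E4)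
    (ψ : E4 → E4) : Prop where
  isOpen : IsOpen Z
  zero_mem : 0 ∈ Z
  isOpen' : IsOpen Y
  mem : p ∈ Y
  contDiffOn : ContDiffOn ℝ ∞ ψ Z
  map_proj : ∀ z, ψ (planeProj B z) = ψ z
  proj_mem : ∀ z, planeProj B z ∈ Z ↔ z ∈ Z
  maps : ∀ z ∈ Z, ψ z ∈ S ∩ V
  proj_map : ∀ z ∈ Z, planeProj B (ψ z) = planeProj B z
  map_eq : ∀ q ∈ S ∩ Y, q ∈ Z ∧ ψ q = q
  hasFDerivAt : HasFDerivAt ψ (planeProj B) 0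

lemma planeProj_planeProj (B : OrthonormalBasis (Fin 4) ℝ E4) (z : E4) :
    planeProj B (planeProj B z) = planeProj B z := by
  simp [planeProj_apply, inner_add_right, inner_smul_right]

lemma planeProj_last (B : OrthonormalBasis (Fin 4) ℝ E4) : planeProj B (B 3) = 0 := by
  simp [planeProj_apply]

lemma IsGraphChart.map_zero {S V : Set E4} {p : E4} {B : OrthonormalBasis (Fin 4) ℝ E4}
    {Z Y : Set E4} {ψ : E4 → E4} (h : IsGraphChart S V p B Z Y ψ) (hp : p ∈ S) (hB : B 3 = p) :
    ψ 0 = p := by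
  have h1 := (h.map_eq p ⟨hp, h.mem⟩).2
  rw [← h.map_proj, ← hB, planeProj_last, hB] at h1
  exact h1

/-- The two coordinates in the tangent plane are completed by v / |∇v(p)| and (|y|² - 1) / 2. The
resulting map Φ has the identity as derivative at p, since `B 2` is the unit gradient and `B 3` is
p, and Φ takes its values in the tangent plane exactly on the surface. The chart is the inverse of Φ
after projection to that plane. -/
lemma IsLocalDefining.exists_isGraphChart {S V : Set E4} {v : E4 → ℝ}
    (h : IsLocalDefining S V v) {p : E4} (hpS : p ∈ S) (hpV : p ∈ V)
    {B : OrthonormalBasis (Fin 4) ℝ E4} (hB2 : B 2 = unitGradient v p) (hB3 : B 3 = p) :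
    ∃ Z Y ψ, IsGraphChart S V p B Z Y ψ := by
  set c := ‖gradient v p‖ with hc
  have hc0 : c ≠ 0 := norm_ne_zero_iff.2 (h.gradient_ne hpV)
  obtain ⟨hp1, hvp⟩ := (h.mem_iff p hpV).1 hpS
  set Φ : E4 → E4 := fun y => ⟪B 0, y⟫ • B 0 + ⟪B 1, y⟫ • B 1 + (c⁻¹ * v y) • B 2 +
    (2⁻¹ * (‖y‖ ^ 2 - 1)) • B 3 with hΦ
  have hvd : HasFDerivAt v (fderiv ℝ v p) p :=
    ((h.contDiffOn.contDiffAt (h.isOpen.mem_nhds hpV)).differentiableAt (by simp)).hasFDerivAt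
  have hΦd : HasFDerivAt Φ (ContinuousLinearMap.id ℝ E4) p := by
    have h0 := ((innerSL ℝ (B 0)).hasFDerivAt (x := p)).smul_const (B 0)
    have h1 := ((innerSL ℝ (B 1)).hasFDerivAt (x := p)).smul_const (B 1)
    have h2 := (hvd.const_mul c⁻¹).smul_const (B 2)
    have h3 := (((hasStrictFDerivAt_norm_sq p).hasFDerivAt.sub_const 1).const_mul
      (2⁻¹ : ℝ)).smul_const (B 3)
    refine (((h0.add h1).add h2).add h3).congr_fderiv ?_
    ext1 w
    conv_rhs => rw [ContinuousLinearMap.id_apply, ← sum_inner_basis B w]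
    have h4 : fderiv ℝ v p w = c * ⟪B 2, w⟫ := by rw [h.fderiv_apply hpV, hB2]
    simp [h4, hc0, hB3]
  have hΦs : ContDiffOn ℝ ∞ Φ V := by
    have h0 : ContDiff ℝ ∞ fun y : E4 => ⟪B 0, y⟫ := contDiff_const.inner ℝ contDiff_id
    have h1 : ContDiff ℝ ∞ fun y : E4 => ⟪B 1, y⟫ := contDiff_const.inner ℝ contDiff_id
    have h2 := h.contDiffOn
    have h3 : ContDiff ℝ ∞ fun y : E4 => ‖y‖ ^ 2 := contDiff_norm_sq ℝ
    exact (((h0.smul contDiff_const).contDiffOn.add (h1.smul contDiff_const).contDiffOn).add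
      ((contDiffOn_const.mul h2).smul contDiffOn_const)).add
      ((contDiff_const.mul (h3.sub contDiff_const)).smul contDiff_const).contDiffOn
  obtain ⟨e, hpe, heV, hΦe, hes⟩ :=
    exists_openPartialHomeomorph_of_hasFDerivAt_id h.isOpen hΦs hpV hΦd
  have hΦp : Φ p = 0 := by
    simp only [hΦ, hvp, hp1]
    rw [← hB3]
    simp 
  have h0t : (0 : E4) ∈ e.target := by rw [← hΦp, ← hΦe]; exact e.map_source hpe
  have key : ∀ z, planeProj B z ∈ e.target → e.symm (planeProj B z) ∈ S ∩ V ∧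
      planeProj B (e.symm (planeProj B z)) = planeProj B z := by
    intro z hz
    have h1 : Φ (e.symm (planeProj B z)) = planeProj B z := by rw [← hΦe]; exact e.right_inv hz
    have hV := heV (e.map_target hz)
    set y := e.symm (planeProj B z)
    obtain ⟨i0, i1, i2, i3⟩ := inner_sum_basis B ⟪B 0, y⟫ ⟪B 1, y⟫ (c⁻¹ * v y)
      (2⁻¹ * (‖y‖ ^ 2 - 1))
    have h1' : ⟪B 0, y⟫ • B 0 + ⟪B 1, y⟫ • B 1 + (c⁻¹ * v y) • B 2 +
      (2⁻¹ * (‖y‖ ^ 2 - 1)) • B 3 = planeProj B z := h1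
    rw [h1', planeProj_apply] at i0 i1 i2 i3
    simp [inner_add_right, inner_smul_right] at i0 i1 i2 i3
    refine ⟨⟨(h.mem_iff y hV).2 ⟨?_, ?_⟩, hV⟩, ?_⟩
    · nlinarith [norm_nonneg y]
    · simpa [hc0] using i2
    · rw [planeProj_apply, planeProj_apply, i0, i1]
  refine ⟨planeProj B ⁻¹' e.target, e.source ∩ planeProj B ⁻¹' e.target,
    fun z => e.symm (planeProj B z), e.open_target.preimage (planeProj B).continuous, ?_,
    e.open_source.inter (e.open_target.preimage (planeProj B).continuous), ⟨hpe, ?_⟩, ?_, ?_, ?_,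
    fun z hz => (key z hz).1, fun z hz => (key z hz).2, ?_, ?_⟩
  · simpa using h0t
  · rw [mem_preimage, ← hB3, planeProj_last]; exact h0t
  · exact hes.comp (planeProj B).contDiff.contDiffOn fun z hz => hz
  · intro z; simp only [planeProj_planeProj]
  · intro z; simp only [mem_preimage, planeProj_planeProj]
  · rintro q ⟨hqS, hqe, hqt⟩
    refine ⟨hqt, ?_⟩
    obtain ⟨hq1, hvq⟩ := (h.mem_iff q (heV hqe)).1 hqS
    have : planeProj B q = e q := by
      rw [hΦe]; simp [hΦ, hvq, hq1, planeProj_apply]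
    rw [this]
    exact e.left_inv hqe
  · have h1 : HasFDerivAt e.symm ((ContinuousLinearEquiv.refl ℝ E4).symm : E4 →L[ℝ] E4)
        (planeProj B 0) := by
      rw [map_zero]
      refine e.hasFDerivAt_symm (f' := ContinuousLinearEquiv.refl ℝ E4) h0t ?_
      have : e.symm 0 = p := by rw [← hΦp, ← hΦe]; exact e.left_inv hpe
      rw [this]
      exact hΦd.congr_of_eventuallyEq (.of_forall hΦe)
    exact h1.comp 0 (planeProj B).hasFDerivAt

/-- Directions of the tangent plane are tangent to the surface. -/
lemma IsGraphChart.mem_tangentConeAt {S V : Set E4} {p : E4} {B : OrthonormalBasis (Fin 4) ℝ E4}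
    {Z Y : Set E4} {ψ : E4 → E4} (h : IsGraphChart S V p B Z Y ψ) (hp : p ∈ S) (hB : B 3 = p)
    (w : E4) : planeProj B w ∈ tangentConeAt ℝ S p := by
  have h1 := h.hasFDerivAt.hasFDerivWithinAt (s := Z)
  have h2 := h1.mapsTo_tangent_cone
  rw [h.map_zero hp hB] at h2
  refine tangentConeAt_mono (image_subset_iff.2 fun z hz => (h.maps z hz).1) (h2 ?_)
  rw [tangentConeAt_of_mem_nhds (h.isOpen.mem_nhds h.zero_mem)]
  trivial

/-! ### Unit normals and the tubular neighbourhood -/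

/-- The point at signed distance `s` from `p` on the geodesic of the sphere normal to `S`. -/
noncomputable def normalExp (n : E4 → E4) (p : E4) (s : ℝ) : E4 :=
  Real.cos s • p + Real.sin s • n p

lemma norm_cos_smul_add_sin_smul {p w : E4} (hp : ‖p‖ = 1) (hw : ‖w‖ = 1) (hpw : ⟪p, w⟫ = 0)
    (s : ℝ) : ‖Real.cos s • p + Real.sin s • w‖ = 1 := by
  have h : ‖Real.cos s • p + Real.sin s • w‖ ^ 2 = 1 := by
    rw [norm_add_sq_real]
    simp [norm_smul, hp, hw, inner_smul_left, inner_smul_right, hpw]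
  nlinarith [norm_nonneg (Real.cos s • p + Real.sin s • w)]

namespace IsLocalDefining

variable {S A V : Set E4} {v : E4 → ℝ} {n : E4 → E4} {p : E4}

lemma exists_basis (h : IsLocalDefining S V v) (hpS : p ∈ S) (hpV : p ∈ V) :
    ∃ B : OrthonormalBasis (Fin 4) ℝ E4, B 2 = unitGradient v p ∧ B 3 = p :=
  exists_orthonormalBasis_last_two (h.norm_unitGradient hpV) ((h.mem_iff p hpV).1 hpS).1
    (h.inner_unitGradient_self hpV)

/-- The directions of the graph chart lie in the tangent cone, so `n p` is orthogonal to the tangent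
plane and to p. Only the line of the gradient is left. -/
lemma normal_eq_or (h : IsLocalDefining S V v) (hn : IsUnitNormalInto S A n) (hpS : p ∈ S)
    (hpV : p ∈ V) : n p = unitGradient v p ∨ n p = -unitGradient v p := by
  obtain ⟨B, hB2, hB3⟩ := h.exists_basis hpS hpV
  obtain ⟨Z, Y, ψ, hψ⟩ := h.exists_isGraphChart hpS hpV hB2 hB3
  obtain ⟨hn1, hn2, hn3, -, -⟩ := hn p hpS
  have h0 := hn3 _ (hψ.mem_tangentConeAt hpS hB3 (B 0))
  have h1 := hn3 _ (hψ.mem_tangentConeAt hpS hB3 (B 1))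
  simp [planeProj_apply] at h0 h1
  have h2 := sum_inner_basis B (n p)
  rw [h0, h1, hB3, hn2, hB2] at h2
  simp only [zero_smul, zero_add, add_zero] at h2
  have h3 : |⟪unitGradient v p, n p⟫| = 1 := by
    rw [← h2, norm_smul, h.norm_unitGradient hpV] at hn1
    simpa using hn1
  rcases eq_or_eq_neg_of_abs_eq h3 with h4 | h4
  · left; rw [← h2, h4, one_smul]
  · right; rw [← h2, h4, neg_one_smul]

lemma neg (h : IsLocalDefining S V v) : IsLocalDefining S V (fun x => -v x) where
  isOpen := h.isOpen
  contDiffOn := h.contDiffOn.neg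
  ne_zero := h.ne_zero
  mem_iff x hx := by rw [h.mem_iff x hx, neg_eq_zero]
  fderiv_self x hx := by simp [fderiv_fun_neg, h.fderiv_self x hx]
  fderiv_ne x hx := by simpa [fderiv_fun_neg] using h.fderiv_ne x hx

lemma exists_oriented (h : IsLocalDefining S V v) (hn : IsUnitNormalInto S A n) (hpS : p ∈ S)
    (hpV : p ∈ V) : ∃ v', IsLocalDefining S V v' ∧ n p = unitGradient v' p := by
  rcases h.normal_eq_or hn hpS hpV with h1 | h1
  · exact ⟨v, h, h1⟩
  · refine ⟨_, h.neg, ?_⟩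
    rw [h1]
    simp [unitGradient, gradient, fderiv_fun_neg]

end IsLocalDefining

/-- Smooth tubular coordinates on an open set. -/
structure IsTubeCoord (S : Set E4) (n : E4 → E4) (V : Set E4) (P : E4 → E4) (σ : E4 → ℝ) :
    Prop where
  isOpen : IsOpen V
  contDiffOn_foot : ContDiffOn ℝ ∞ P V
  contDiffOn_dist : ContDiffOn ℝ ∞ σ V
  contDiffOn_normal : ContDiffOn ℝ ∞ (fun y => n (P y)) V
  foot_mem : ∀ y ∈ V, P y ∈ S
  eq_smul : ∀ y ∈ V, y = ‖y‖ • normalExp n (P y) (σ y)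

/-- The map M, with the tangent plane, the angle and the norm as coordinates, has the identity as
derivative at 0; its inverse yields the foot point and the signed distance. The sides are decided by
connectedness: each half of the slice `⟪B 3, z⟫ = 0` of a small ball is mapped onto a connected set
that avoids S, and the condition on the normal at p places it inside A or outside A. Regularity of
`n` is a consequence: near p it agrees with the smooth field ν. -/
theorem exists_local_isTubeCoord {S A : Set E4} {n : E4 → E4} (hS : IsClosedSurface S)
    (hA : ∃ a ∈ Metric.sphere (0 : E4) 1 \ S,
      A = connectedComponentIn (Metric.sphere (0 : E4) 1 \ S) a)
    (hn : IsUnitNormalInto S A n) {p : E4} (hp : p ∈ S) :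
    ∃ (V : Set E4) (P : E4 → E4) (σ : E4 → ℝ) (δ : ℝ), IsTubeCoord S n V P σ ∧ 0 < δ ∧
      ∀ q ∈ S, dist q p < δ → ∀ s, |s| < δ → normalExp n q s ∈ V ∧ P (normalExp n q s) = q ∧
        σ (normalExp n q s) = s ∧ (0 < s → normalExp n q s ∈ A) ∧
        (s < 0 → normalExp n q s ∉ A) := by
  obtain ⟨V, v₀, hpV, hv₀⟩ := hS.exists_isLocalDefining hp
  obtain ⟨v, hv, hnp⟩ := hv₀.exists_oriented hn hp hpV
  obtain ⟨B, hB2, hB3⟩ := hv.exists_basis hp hpV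
  obtain ⟨Z, Y, ψ, hψ⟩ := hv.exists_isGraphChart hp hpV hB2 hB3
  have hψ0 := hψ.map_zero hp hB3
  set ν := unitGradient v with hν
  have hνs : ContDiffOn ℝ ∞ ν V := hv.contDiffOn_unitGradient
  set Z' : Set E4 := Z ∩ {z | 0 < 1 + ⟪B 3, z⟫} with hZ'
  have hZ'o : IsOpen Z' := hψ.isOpen.inter (isOpen_lt continuous_const (by fun_prop))
  have h0Z' : (0 : E4) ∈ Z' := ⟨hψ.zero_mem, by simp⟩
  set M : E4 → E4 := fun z => (1 + ⟪B 3, z⟫) •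
    (Real.cos ⟪B 2, z⟫ • ψ z + Real.sin ⟪B 2, z⟫ • ν (ψ z)) with hM
  have hψs : ContDiffOn ℝ ∞ ψ Z' := hψ.contDiffOn.mono inter_subset_left
  have hνψ : ContDiffOn ℝ ∞ (fun z => ν (ψ z)) Z' :=
    hνs.comp hψs fun z hz => (hψ.maps z hz.1).2
  have hi (i : Fin 4) : ContDiff ℝ ∞ fun z : E4 => ⟪B i, z⟫ := contDiff_const.inner ℝ contDiff_id
  have hMs : ContDiffOn ℝ ∞ M Z' :=
    (contDiff_const.add (hi 3)).contDiffOn.smul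
      (((Real.contDiff_cos.comp (hi 2)).contDiffOn.smul hψs).add
        ((Real.contDiff_sin.comp (hi 2)).contDiffOn.smul hνψ))
  have hMd : HasFDerivAt M (ContinuousLinearMap.id ℝ E4) 0 := by
    have hid (i : Fin 4) : HasFDerivAt (fun z : E4 => ⟪B i, z⟫) (innerSL ℝ (B i)) 0 :=
      (innerSL ℝ (B i)).hasFDerivAt
    have hνd : HasFDerivAt (fun z => ν (ψ z)) (fderiv ℝ (fun z => ν (ψ z)) 0) 0 :=
      ((hνψ.contDiffAt (hZ'o.mem_nhds h0Z')).differentiableAt (by simp)).hasFDerivAt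
    have h1 := ((hid 3).const_add (1 : ℝ)).smul
      (((hid 2).cos.smul hψ.hasFDerivAt).add ((hid 2).sin.smul hνd))
    refine h1.congr_fderiv ?_
    ext1 w
    conv_rhs => rw [ContinuousLinearMap.id_apply, ← sum_inner_basis B w]
    simp [hψ0, planeProj_apply, ← hB2]
    rw [← hB3]
  have hM0 : M 0 = p := by simp [hM, hψ0]
  obtain ⟨e, h0e, heZ, hMe, hes⟩ :=
    exists_openPartialHomeomorph_of_hasFDerivAt_id hZ'o hMs h0Z' hMd
  have hψn : ∀ z ∈ Z, ‖ψ z‖ = 1 ∧ ‖ν (ψ z)‖ = 1 ∧ ⟪ψ z, ν (ψ z)⟫ = 0 := by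
    intro z hz
    obtain ⟨h1, h2⟩ := hψ.maps z hz
    exact ⟨((hv.mem_iff _ h2).1 h1).1, hv.norm_unitGradient h2, by
      rw [real_inner_comm]; exact hv.inner_unitGradient_self h2⟩
  have hMn : ∀ z ∈ Z', ‖M z‖ = 1 + ⟪B 3, z⟫ := by
    intro z hz
    obtain ⟨h1, h2, h3⟩ := hψn z hz.1
    simp only [hM, norm_smul, norm_cos_smul_add_sin_smul h1 h2 h3, mul_one, Real.norm_eq_abs]
    exact abs_of_pos hz.2
  -- a ball on which the chart is under control
  obtain ⟨η, hη, hηe, hηM⟩ : ∃ η > 0, Metric.ball (0 : E4) η ⊆ e.source ∧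
      ∀ z ∈ Metric.ball (0 : E4) η, M z ∈ Y ∩ planeProj B ⁻¹' e.source := by
    have h1 : e.source ∈ 𝓝 (0 : E4) := e.open_source.mem_nhds h0e
    have h2 : Y ∩ planeProj B ⁻¹' e.source ∈ 𝓝 (M 0) := by
      rw [hM0]
      refine inter_mem (hψ.isOpen'.mem_nhds hψ.mem)
        ((e.open_source.preimage (planeProj B).continuous).mem_nhds ?_)
      rw [mem_preimage, ← hB3, planeProj_last]
      exact h0e
    obtain ⟨η, hη, h3⟩ := Metric.mem_nhds_iff.1 (inter_mem h1 (hMd.continuousAt h2))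
    exact ⟨η, hη, fun z hz => (h3 hz).1, fun z hz => (h3 hz).2⟩
  have hproj : ∀ q ∈ S ∩ Y, ∀ s : ℝ,
      M (planeProj B q + s • B 2) = Real.cos s • q + Real.sin s • ν q := by
    intro q hq s
    have h1 : ψ (planeProj B q + s • B 2) = q := by
      rw [← hψ.map_proj, map_add, planeProj_planeProj]
      simp [planeProj_apply B (B 2), hψ.map_proj, (hψ.map_eq q hq).2]
    have h2 : ⟪B 3, planeProj B q + s • B 2⟫ = 0 := by
      simp [inner_add_right, inner_smul_right, planeProj_apply]
    have h3 : ⟪B 2, planeProj B q + s • B 2⟫ = s := by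
      simp [inner_add_right, inner_smul_right, planeProj_apply]
    simp only [hM, h1, h2, h3, add_zero, one_smul]
  -- A point of S near p is also the image of its own projection to the tangent plane, and
  -- injectivity of the chart identifies `z` with that projection.
  have hcross : ∀ z ∈ Metric.ball (0 : E4) η, ⟪B 3, z⟫ = 0 → M z ∈ S → ⟪B 2, z⟫ = 0 := by
    intro z hz hz3 hzS
    obtain ⟨h1, h2⟩ := hηM z hz
    have h3 := hproj (M z) ⟨hzS, h1⟩ 0
    simp only [zero_smul, add_zero, Real.cos_zero, one_smul, Real.sin_zero] at h3
    have h4 : e (planeProj B (M z)) = e z := by rw [hMe, hMe]; exact h3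
    rw [← e.injOn h2 (hηe hz) h4]
    simp [planeProj_apply, inner_add_right, inner_smul_right]
  obtain ⟨a, ha, rfl⟩ := hA
  -- the two sides of the surface
  have hside : ∀ τ : ℝ, IsPreconnected (M '' {z ∈ Metric.ball (0 : E4) η |
        ⟪B 3, z⟫ = 0 ∧ 0 < τ * ⟪B 2, z⟫}) ∧
      M '' {z ∈ Metric.ball (0 : E4) η | ⟪B 3, z⟫ = 0 ∧ 0 < τ * ⟪B 2, z⟫} ⊆
        Metric.sphere (0 : E4) 1 \ S := by
    intro τ
    constructor
    · refine IsPreconnected.image (Convex.isPreconnected ?_) _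
        (hMs.continuousOn.mono fun z hz => heZ (hηe hz.1))
      refine (convex_ball 0 η).inter (Convex.inter ?_ ?_)
      · intro x hx y hy c d _ _ _
        change ⟪B 3, x⟫ = 0 at hx
        change ⟪B 3, y⟫ = 0 at hy
        change ⟪B 3, c • x + d • y⟫ = 0
        rw [inner_add_right, inner_smul_right, inner_smul_right, hx, hy]
        simp
      · exact convex_halfSpace_gt (f := fun z => τ * ⟪B 2, z⟫)
          ⟨fun x y => by simp [inner_add_right, mul_add], fun c x => by
            simp [inner_smul_right]; ring⟩ 0
    · rintro _ ⟨z, ⟨hz, hz3, hz2⟩, rfl⟩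
      refine ⟨?_, fun hzS => ?_⟩
      · simp [hMn z (heZ (hηe hz)), hz3]
      · simp [hcross z hz hz3 hzS] at hz2
  have hnear : ∀ τ : ℝ, |τ| = 1 → ∀ᶠ s : ℝ in 𝓝[>] 0, Real.cos s • p + Real.sin s • (τ • n p) ∈
      M '' {z ∈ Metric.ball (0 : E4) η | ⟪B 3, z⟫ = 0 ∧ 0 < τ * ⟪B 2, z⟫} := by
    intro τ hτ
    have hp' : planeProj B p = 0 := by rw [← hB3, planeProj_last]
    filter_upwards [Ioo_mem_nhdsGT hη] with s hs
    have h2 : τ * τ = 1 := by rw [← abs_mul_abs_self, hτ, one_mul]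
    refine ⟨(τ * s) • B 2, ⟨?_, ?_, ?_⟩, ?_⟩
    · simp [norm_smul, hτ, abs_of_pos hs.1, hs.2]
    · simp [inner_smul_right]
    · simp [inner_smul_right, ← mul_assoc, h2, hs.1]
    · have h3 := hproj p ⟨hp, hψ.mem⟩ (τ * s)
      rw [hp', zero_add] at h3
      rw [h3, hnp]
      rcases eq_or_eq_neg_of_abs_eq hτ with rfl | rfl <;> simp
  have hpos : M '' {z ∈ Metric.ball (0 : E4) η | ⟪B 3, z⟫ = 0 ∧ 0 < 1 * ⟪B 2, z⟫} ⊆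
      connectedComponentIn (Metric.sphere (0 : E4) 1 \ S) a := by
    obtain ⟨s, hs1, hs2⟩ := ((hnear 1 (by simp)).and (hn p hp).2.2.2.1).exists
    rw [one_smul] at hs1
    rw [connectedComponentIn_eq hs2]
    exact (hside 1).1.subset_connectedComponentIn hs1 (hside 1).2
  -- If A met the negative half it would contain all of it, including the points cos s p - sin s
  -- n(p) for small s > 0, which are not in A.
  have hneg : Disjoint (M '' {z ∈ Metric.ball (0 : E4) η | ⟪B 3, z⟫ = 0 ∧ 0 < -1 * ⟪B 2, z⟫})
      (connectedComponentIn (Metric.sphere (0 : E4) 1 \ S) a) := by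
    rw [Set.disjoint_left]
    intro x hx hxA
    obtain ⟨s, hs1, hs2⟩ := ((hnear (-1) (by simp)).and (hn p hp).2.2.2.2).exists
    rw [connectedComponentIn_eq hxA] at hs2
    refine hs2 ((hside (-1)).1.subset_connectedComponentIn hx (hside (-1)).2 ?_)
    simpa [sub_eq_add_neg] using hs1
  obtain ⟨δ, hδ, hδq⟩ : ∃ δ > 0, ∀ q, dist q p < δ → q ∈ Y ∩ V ∧ ∀ s : ℝ, |s| < δ →
      planeProj B q + s • B 2 ∈ Metric.ball (0 : E4) η := by
    have h1 : Continuous fun x : E4 × ℝ => planeProj B x.1 + x.2 • B 2 := by fun_prop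
    have h2 : (fun x : E4 × ℝ => planeProj B x.1 + x.2 • B 2) ⁻¹' Metric.ball (0 : E4) η ∈
        𝓝 (p, (0 : ℝ)) := by
      refine h1.continuousAt.preimage_mem_nhds (Metric.isOpen_ball.mem_nhds ?_)
      simp [← hB3, planeProj_last, hη]
    have h3 : (fun x : E4 × ℝ => x.1) ⁻¹' (Y ∩ V) ∈ 𝓝 (p, (0 : ℝ)) :=
      continuous_fst.continuousAt.preimage_mem_nhds
        (inter_mem (hψ.isOpen'.mem_nhds hψ.mem) (hv.isOpen.mem_nhds hpV))
    obtain ⟨δ, hδ, h4⟩ := Metric.mem_nhds_iff.1 (inter_mem h2 h3)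
    refine ⟨δ, hδ, fun q hq => ⟨(@h4 (q, 0) ?_).2, fun s hs => (@h4 (q, s) ?_).1⟩⟩
    · simpa [Prod.dist_eq, hδ] using hq
    · simpa [Prod.dist_eq] using ⟨hq, hs⟩
  have hz3 : ∀ (q : E4) (s : ℝ), ⟪B 3, planeProj B q + s • B 2⟫ = 0 := by
    intro q s; simp [inner_add_right, inner_smul_right, planeProj_apply]
  have hz2 : ∀ (q : E4) (s : ℝ), ⟪B 2, planeProj B q + s • B 2⟫ = s := by
    intro q s; simp [inner_add_right, inner_smul_right, planeProj_apply]
  have hAside : ∀ q ∈ S, dist q p < δ → ∀ s : ℝ, |s| < δ → (0 < s →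
      Real.cos s • q + Real.sin s • ν q ∈ connectedComponentIn (Metric.sphere (0 : E4) 1 \ S) a) ∧
      (s < 0 → Real.cos s • q + Real.sin s • ν q ∉
        connectedComponentIn (Metric.sphere (0 : E4) 1 \ S) a) := by
    intro q hq hqd s hs
    obtain ⟨⟨hqY, hqV⟩, hb⟩ := hδq q hqd
    rw [← hproj q ⟨hq, hqY⟩ s]
    refine ⟨fun h => hpos (mem_image_of_mem _ ⟨hb s hs, hz3 q s, ?_⟩),
      fun h => Set.disjoint_left.1 hneg (mem_image_of_mem _ ⟨hb s hs, hz3 q s, ?_⟩)⟩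
    · rw [hz2]; linarith
    · rw [hz2]; linarith
  -- The opposite sign would put a point of the negative side of ν into A, contrary to `hAside`.
  have hnν : ∀ q ∈ S, dist q p < δ → n q = ν q := by
    intro q hq hqd
    obtain ⟨⟨hqY, hqV⟩, hb⟩ := hδq q hqd
    rcases hv.normal_eq_or hn hq hqV with h1 | h1
    · exact h1
    · exfalso
      obtain ⟨s, hs1, hs2⟩ := ((Filter.Eventually.and (Ioo_mem_nhdsGT hδ) (hn q hq).2.2.2.1)).exists
      refine (hAside q hq hqd (-s) (by rw [abs_neg, abs_of_pos hs1.1]; exact hs1.2)).2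
        (by linarith [hs1.1]) ?_
      rw [h1] at hs2
      simpa using hs2
  have hPc : ContDiffOn ℝ ∞ (fun y => ψ (e.symm y)) e.target :=
    hψs.comp hes fun y hy => heZ (e.map_target hy)
  -- The restriction on the foot point keeps it within δ of p, where `n` and ν are known to agree.
  refine ⟨e.target ∩ (fun y => ψ (e.symm y)) ⁻¹' (Metric.ball p δ), fun y => ψ (e.symm y),
    fun y => ⟪B 2, e.symm y⟫, δ, ⟨hPc.continuousOn.isOpen_inter_preimage e.open_target
      Metric.isOpen_ball, hPc.mono inter_subset_left, ?_, ?_, ?_, ?_⟩, hδ, ?_⟩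
  · exact (hi 2).comp_contDiffOn (hes.mono inter_subset_left)
  · refine ContDiffOn.congr ((hνψ.comp hes fun y hy => heZ (e.map_target hy)).mono
      inter_subset_left) fun y hy => ?_
    exact hnν _ (hψ.maps _ (heZ (e.map_target hy.1)).1).1 hy.2
  · exact fun y hy => (hψ.maps _ (heZ (e.map_target hy.1)).1).1
  · intro y hy
    have h1 := heZ (e.map_target hy.1)
    have h2 : M (e.symm y) = y := by rw [← hMe]; exact e.right_inv hy.1
    have h3 := hMn _ h1
    rw [h2] at h3
    conv_lhs => rw [← h2]
    rw [h3, normalExp, hnν _ (hψ.maps _ h1.1).1 hy.2]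
  · intro q hq hqd s hs
    obtain ⟨⟨hqY, hqV⟩, hb⟩ := hδq q hqd
    have h1 : normalExp n q s = M (planeProj B q + s • B 2) := by
      rw [hproj q ⟨hq, hqY⟩, normalExp, hnν q hq hqd]
    have h2 : e.symm (normalExp n q s) = planeProj B q + s • B 2 := by
      rw [h1, ← hMe]; exact e.left_inv (hηe (hb s hs))
    have h3 : ψ (planeProj B q + s • B 2) = q := by
      rw [← hψ.map_proj, map_add, planeProj_planeProj]
      simp [planeProj_apply B (B 2), hψ.map_proj, (hψ.map_eq q ⟨hq, hqY⟩).2]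
    refine ⟨⟨?_, ?_⟩, ?_, ?_, ?_⟩
    · rw [h1, ← hMe]; exact e.map_source (hηe (hb s hs))
    · simpa [h2, h3] using hqd
    · simp only [h2, h3]
    · simp only [h2, hz2]
    · have := hAside q hq hqd s hs
      rwa [← hnν q hq hqd] at this

/-- A tubular neighbourhood of `S` in the sphere, of radius `δ`, given by its smooth coordinates
on the open cone `W` over it. -/
structure IsTube (S A : Set E4) (n : E4 → E4) (δ : ℝ) (W : Set E4) (P : E4 → E4) (σ : E4 → ℝ) :
    Prop extends IsTubeCoord S n W P σ where
  pos : 0 < δ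
  ne_zero : ∀ y ∈ W, y ≠ 0
  abs_dist_lt : ∀ y ∈ W, |σ y| < δ
  smul_mem : ∀ p ∈ S, ∀ s, |s| < δ → ∀ r : ℝ, 0 < r → r • normalExp n p s ∈ W ∧
    P (r • normalExp n p s) = p ∧ σ (r • normalExp n p s) = s
  mem_side : ∀ p ∈ S, ∀ s, 0 < s → s < δ → normalExp n p s ∈ A
  notMem_side : ∀ p ∈ S, ∀ s, s < 0 → -δ < s → normalExp n p s ∉ A

lemma dist_normalExp_le {S A : Set E4} {n : E4 → E4} (hS : IsClosedSurface S)
    (hn : IsUnitNormalInto S A n) {p : E4} (hp : p ∈ S) (s : ℝ) :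
    dist (normalExp n p s) p ≤ 2 * |s| := by
  have h1 : ‖p‖ = 1 := by simpa using hS.subset_sphere hp
  have h2 : ‖n p‖ = 1 := (hn p hp).1
  have h3 : |Real.cos s - 1| ≤ |s| := by
    have := Real.abs_cos_sub_cos_le s 0
    simpa using this
  have h4 : |Real.sin s| ≤ |s| := Real.abs_sin_le_abs
  rw [dist_eq_norm, show normalExp n p s - p = (Real.cos s - 1) • p + Real.sin s • n p by
    rw [normalExp, sub_smul, one_smul]; abel]
  refine (norm_add_le _ _).trans ?_
  rw [norm_smul, norm_smul, h1, h2, Real.norm_eq_abs, Real.norm_eq_abs]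
  linarith

lemma norm_normalExp {S A : Set E4} {n : E4 → E4} (hS : IsClosedSurface S)
    (hn : IsUnitNormalInto S A n) {p : E4} (hp : p ∈ S) (s : ℝ) : ‖normalExp n p s‖ = 1 :=
  norm_cos_smul_add_sin_smul (by simpa using hS.subset_sphere hp) (hn p hp).1 (hn p hp).2.1 s

-- Finitely many local coordinate systems cover S. If two points of S reach the same point by normal
-- geodesics shorter than δ, they are so close that one local system contains both, so the
-- coordinates are unique. The global coordinates thus agree locally with smooth ones. Conditions
-- are put on the radial projection, which makes W a cone.
open Classical in
theorem exists_isTube {S A : Set E4} {n : E4 → E4} (hS : IsClosedSurface S)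
    (hA : ∃ a ∈ Metric.sphere (0 : E4) 1 \ S,
      A = connectedComponentIn (Metric.sphere (0 : E4) 1 \ S) a)
    (hn : IsUnitNormalInto S A n) : ∃ δ W P σ, IsTube S A n δ W P σ := by
  choose! V P σ d hV hd hloc using fun p (hp : p ∈ S) => exists_local_isTubeCoord hS hA hn hp
  obtain ⟨t, htS, htc⟩ := hS.isCompact.elim_nhds_subcover (fun p => Metric.ball p (d p / 2))
    fun p hp => Metric.ball_mem_nhds p (half_pos (hd p hp))
  -- Two points of S with a common image are less than 4δ apart, and 4δ ≤ d p / 2 keeps the second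
  -- one in the system at p when the first is within d p / 2.
  obtain ⟨δ, hδ, hδt⟩ : ∃ δ > 0, ∀ p ∈ t, δ ≤ d p / 8 := by
    rcases t.eq_empty_or_nonempty with rfl | hne
    · exact ⟨1, one_pos, by simp⟩
    · obtain ⟨q, hq, hqm⟩ := t.exists_min_image d hne
      exact ⟨d q / 8, by linarith [hd q (htS q hq)], fun p hp => by linarith [hqm p hp]⟩
  have hcov : ∀ q ∈ S, ∃ p ∈ t, dist q p < d p / 2 := by
    intro q hq
    simpa using htc hq
  have huniq : ∀ q ∈ S, ∀ q' ∈ S, ∀ s s' : ℝ, |s| < δ → |s'| < δ →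
      normalExp n q s = normalExp n q' s' → q = q' ∧ s = s' := by
    intro q hq q' hq' s s' hs hs' he
    obtain ⟨p, hp, hqp⟩ := hcov q hq
    have h1 := dist_normalExp_le hS hn hq s
    have h2 := dist_normalExp_le hS hn hq' s'
    have h3 := hδt p hp
    have h4 := dist_triangle4 q' (normalExp n q' s') q p
    rw [dist_comm q' (normalExp n q' s'), ← he] at h4
    rw [← he] at h2
    obtain ⟨-, e1, e2, -⟩ := hloc p (htS p hp) q hq (by linarith [hd p (htS p hp)]) s
      (by linarith [hd p (htS p hp)])
    obtain ⟨-, e3, e4, -⟩ := hloc p (htS p hp) q' hq' (by linarith) s'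
      (by linarith [hd p (htS p hp)])
    rw [← he] at e3 e4
    exact ⟨e1.symm.trans e3, e2.symm.trans e4⟩
  set C : E4 → E4 × ℝ → Prop := fun y c => c.1 ∈ S ∧ |c.2| < δ ∧ radial y = normalExp n c.1 c.2
  set W : Set E4 := {y | y ≠ 0 ∧ ∃ c, C y c} with hW
  set c : E4 → E4 × ℝ := fun y => if h : ∃ c, C y c then h.choose else 0 with hc
  have hcs : ∀ y ∈ W, C y (c y) := by
    rintro y ⟨-, hy⟩
    simp only [hc, dif_pos hy]
    exact hy.choose_spec
  have hcu : ∀ y, y ≠ 0 → ∀ c', C y c' → y ∈ W ∧ c y = c' := by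
    intro y hy c' hc'
    have h1 : y ∈ W := ⟨hy, c', hc'⟩
    obtain ⟨h2, h3, h4⟩ := hcs y h1
    obtain ⟨h5, h6⟩ := huniq _ h2 _ hc'.1 _ _ h3 hc'.2.1 (h4.symm.trans hc'.2.2)
    exact ⟨h1, Prod.ext h5 h6⟩
  have hlocal : ∀ y ∈ W, ∃ p ∈ t, radial y ∈ V p ∧
      ∀ᶠ y' in 𝓝 y, y' ∈ W ∧ c y' = (P p (radial y'), σ p (radial y')) := by
    intro y hy
    obtain ⟨h1, h2, h3⟩ := hcs y hy
    obtain ⟨p, hp, hqp⟩ := hcov _ h1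
    have hd' := hd p (htS p hp)
    have hδ' := hδt p hp
    obtain ⟨e1, e2, e3, -⟩ := hloc p (htS p hp) _ h1 (by linarith) _
      (by linarith : |(c y).2| < d p)
    rw [← h3] at e1 e2 e3
    refine ⟨p, hp, e1, ?_⟩
    have hV' := hV p (htS p hp)
    have hr : ContinuousAt radial y := (contDiffAt_radial hy.1).continuousAt
    have hσ : ContinuousAt (σ p) (radial y) :=
      (hV'.contDiffOn_dist.contDiffAt (hV'.isOpen.mem_nhds e1)).continuousAt
    have h4 : ∀ᶠ y' in 𝓝 y, |σ p (radial y')| < δ := by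
      have : ContinuousAt (fun y' => |σ p (radial y')|) y := (hσ.comp hr).abs
      refine this.eventually_lt continuousAt_const ?_
      simpa [e3] using h2
    filter_upwards [h4, hr.eventually_mem (hV'.isOpen.mem_nhds e1),
      isOpen_compl_singleton.mem_nhds hy.1] with y' i1 i2 i3
    refine hcu y' i3 (P p (radial y'), σ p (radial y')) ⟨hV'.foot_mem _ i2, i1, ?_⟩
    have := hV'.eq_smul _ i2
    rwa [norm_radial i3, one_smul] at this
  have hsm : ∀ y ∈ W, ContDiffAt ℝ ∞ (fun y => (c y).1) y ∧ ContDiffAt ℝ ∞ (fun y => (c y).2) y ∧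
      ContDiffAt ℝ ∞ (fun y => n (c y).1) y := by
    intro y hy
    obtain ⟨p, hp, h1, h2⟩ := hlocal y hy
    have hV' := hV p (htS p hp)
    have hr := contDiffAt_radial hy.1
    have hn := hV'.isOpen.mem_nhds h1
    refine ⟨((hV'.contDiffOn_foot.contDiffAt hn).comp y hr).congr_of_eventuallyEq ?_,
      ((hV'.contDiffOn_dist.contDiffAt hn).comp y hr).congr_of_eventuallyEq ?_,
      ((hV'.contDiffOn_normal.contDiffAt hn).comp y hr).congr_of_eventuallyEq ?_⟩ <;>
    · filter_upwards [h2] with y' hy'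
      simp [hy'.2]
  refine ⟨δ, W, fun y => (c y).1, fun y => (c y).2, ⟨?_, fun y hy => (hsm y hy).1.contDiffWithinAt,
    fun y hy => (hsm y hy).2.1.contDiffWithinAt, fun y hy => (hsm y hy).2.2.contDiffWithinAt,
    fun y hy => (hcs y hy).1, ?_⟩, hδ, fun y hy => hy.1, fun y hy => (hcs y hy).2.1, ?_, ?_, ?_⟩
  · rw [isOpen_iff_mem_nhds]
    intro y hy
    obtain ⟨p, hp, h1, h2⟩ := hlocal y hy
    exact h2.mono fun y' h => h.1
  · intro y hy
    rw [← (hcs y hy).2.2, norm_smul_radial]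
  · intro p hp s hs r hr
    have h1 : ‖normalExp n p s‖ = 1 := norm_normalExp hS hn hp s
    have h2 : normalExp n p s ≠ 0 := fun h => by simp [h] at h1
    have h3 := hcu (r • normalExp n p s) (smul_ne_zero hr.ne' h2) (p, s)
      ⟨hp, hs, by rw [radial_smul hr, radial_eq_self h1]⟩
    simp [h3.1, h3.2]
  · intro p hp s hs hsδ
    obtain ⟨q, hq, hpq⟩ := hcov p hp
    have := hd q (htS q hq)
    have := hδt q hq
    exact (hloc q (htS q hq) p hp (by linarith) s (by rw [abs_of_pos hs]; linarith)).2.2.2.1 hs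
  · intro p hp s hs hsδ
    obtain ⟨q, hq, hpq⟩ := hcov p hp
    have := hd q (htS q hq)
    have := hδt q hq
    exact (hloc q (htS q hq) p hp (by linarith) s (by rw [abs_of_neg hs]; linarith)).2.2.2.2 hs

namespace IsTube

variable {S A : Set E4} {n : E4 → E4} {δ : ℝ} {W : Set E4} {P : E4 → E4} {σ : E4 → ℝ}

lemma contDiffAt_foot (h : IsTube S A n δ W P σ) {y : E4} (hy : y ∈ W) : ContDiffAt ℝ ∞ P y :=
  h.contDiffOn_foot.contDiffAt (h.isOpen.mem_nhds hy)

lemma contDiffAt_dist (h : IsTube S A n δ W P σ) {y : E4} (hy : y ∈ W) : ContDiffAt ℝ ∞ σ y :=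
  h.contDiffOn_dist.contDiffAt (h.isOpen.mem_nhds hy)

lemma contDiffAt_normal (h : IsTube S A n δ W P σ) {y : E4} (hy : y ∈ W) :
    ContDiffAt ℝ ∞ (fun y => n (P y)) y :=
  h.contDiffOn_normal.contDiffAt (h.isOpen.mem_nhds hy)

lemma mem_of_mem (h : IsTube S A n δ W P σ) {p : E4} (hp : p ∈ S) : p ∈ W := by
  have := (h.smul_mem p hp 0 (by simpa using h.pos) 1 one_pos).1
  simpa [normalExp] using this

lemma foot_of_mem (h : IsTube S A n δ W P σ) {p : E4} (hp : p ∈ S) : P p = p := by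
  have := (h.smul_mem p hp 0 (by simpa using h.pos) 1 one_pos).2.1
  simpa [normalExp] using this

lemma contDiffAt_normal_comp (h : IsTube S A n δ W P σ) {p : E4} (hp : p ∈ S) :
    ContDiffAt ℝ ∞ (fun y => n (P y)) p := h.contDiffAt_normal (h.mem_of_mem hp)

lemma radial_eq (h : IsTube S A n δ W P σ) {y : E4} (hy : y ∈ W) :
    radial y = normalExp n (P y) (σ y) := by
  have h1 : 0 < ‖y‖ := norm_pos_iff.2 (h.ne_zero y hy)
  exact (inv_smul_eq_iff₀ h1.ne').2 (h.eq_smul y hy)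

/-- The closed tube of radius `r < δ`, as a cone with the vertex removed, is relatively closed. -/
lemma isOpen_compl_closedTube (hS : IsClosedSurface S)
    (h : IsTube S A n δ W P σ) {r : ℝ} (hr : r < δ) :
    IsOpen {y : E4 | y ≠ 0 ∧ ¬ (y ∈ W ∧ |σ y| ≤ r)} := by
  -- The normal is known to be regular only in the form n ∘ P; hence `P c.1` in place of `c.1`,
  -- which is the same point on S.
  set K : Set E4 := (fun c : E4 × ℝ => normalExp n (P c.1) c.2) '' (S ×ˢ Icc (-r) r) with hK
  have hKc : IsCompact K := by
    refine (hS.isCompact.prod isCompact_Icc).image_of_continuousOn ?_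
    rintro ⟨p, s⟩ ⟨hp, hs⟩
    have h1 : ContinuousAt P p := (h.contDiffAt_foot (h.mem_of_mem hp)).continuousAt
    have h2 := (h.contDiffAt_normal_comp hp).continuousAt
    refine ContinuousAt.continuousWithinAt ?_
    unfold normalExp
    have h3 : ContinuousAt (fun c : E4 × ℝ => P c.1) (p, s) := h1.comp continuousAt_fst
    have h4 : ContinuousAt (fun c : E4 × ℝ => n (P c.1)) (p, s) :=
      ContinuousAt.comp (f := Prod.fst) (g := fun y => n (P y)) h2 continuousAt_fst
    exact ((Real.continuous_cos.comp continuous_snd).continuousAt.smul h3).add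
      ((Real.continuous_sin.comp continuous_snd).continuousAt.smul h4)
  have : {y : E4 | y ≠ 0 ∧ ¬ (y ∈ W ∧ |σ y| ≤ r)} = {0}ᶜ ∩ radial ⁻¹' Kᶜ := by
    ext y
    simp only [mem_ofPred_eq, mem_inter_iff, mem_compl_iff, mem_singleton_iff, mem_preimage]
    refine and_congr_right fun hy => not_congr ⟨fun ⟨h1, h2⟩ => ?_, ?_⟩
    · refine ⟨(P y, σ y), ⟨h.foot_mem y h1, abs_le.1 h2⟩, ?_⟩
      simp only
      rw [h.foot_of_mem (h.foot_mem y h1), h.radial_eq h1]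
    · rintro ⟨⟨p, s⟩, ⟨hp, hs⟩, he⟩
      simp only at he hp hs
      rw [h.foot_of_mem hp] at he
      have h1 := h.smul_mem p hp s ((abs_le.2 hs).trans_lt hr) ‖y‖ (norm_pos_iff.2 hy)
      rw [he, norm_smul_radial] at h1
      exact ⟨h1.1, by rw [h1.2.2]; exact abs_le.2 hs⟩
  rw [this]
  exact contDiffOn_radial.continuousOn.isOpen_inter_preimage isOpen_compl_singleton
    hKc.isClosed.isOpen_compl

end IsTube

/-! ### Self-maps of the sphere that rotate the normal great circles -/

/-- Near a point off `S`, the complement of `S` in the sphere lies on one side. -/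
lemma eventually_radial_mem_iff {S A : Set E4} (hS : IsClosedSurface S)
    (hA : ∃ a ∈ Metric.sphere (0 : E4) 1 \ S,
      A = connectedComponentIn (Metric.sphere (0 : E4) 1 \ S) a) {y : E4} (hy : y ≠ 0)
    (hyS : radial y ∉ S) : ∀ᶠ y' in 𝓝 y, (radial y' ∈ A ↔ radial y ∈ A) := by
  obtain ⟨a, ha, rfl⟩ := hA
  have h1 : {0}ᶜ ∩ radial ⁻¹' Sᶜ ∈ 𝓝 y :=
    (contDiffOn_radial.continuousOn.isOpen_inter_preimage isOpen_compl_singleton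
      hS.isCompact.isClosed.isOpen_compl).mem_nhds ⟨hy, hyS⟩
  obtain ⟨r, hr, hb⟩ := Metric.mem_nhds_iff.1 h1
  have hsub : radial '' Metric.ball y r ⊆ Metric.sphere (0 : E4) 1 \ S := by
    rintro _ ⟨z, hz, rfl⟩
    exact ⟨by simpa using norm_radial (hb hz).1, (hb hz).2⟩
  have hcon : IsPreconnected (radial '' Metric.ball y r) :=
    (convex_ball y r).isPreconnected.image _
      (contDiffOn_radial.continuousOn.mono fun z hz => (hb hz).1)
  have key : ∀ u ∈ Metric.ball y r, ∀ w ∈ Metric.ball y r,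
      radial u ∈ connectedComponentIn (Metric.sphere (0 : E4) 1 \ S) a →
      radial w ∈ connectedComponentIn (Metric.sphere (0 : E4) 1 \ S) a := by
    intro u hu w hw h
    rw [connectedComponentIn_eq h]
    exact hcon.subset_connectedComponentIn (mem_image_of_mem _ hu) hsub (mem_image_of_mem _ hw)
  filter_upwards [Metric.ball_mem_nhds y hr] with y' hy'
  have hyy := Metric.mem_ball_self (x := y) hr
  exact ⟨key y' hy' y hyy, key y hyy y' hy'⟩

/-- The self-map of `ℝ⁴`, homogeneous of degree one, that turns the point `Λ(p, s)` of the tube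
to the point at angle `β s` in the plane of `p` and `n p`, and is `∓ id` on the two sides. -/
noncomputable def rotMap (A : Set E4) (n : E4 → E4) (W : Set E4) (P : E4 → E4) (σ : E4 → ℝ)
    (β : ℝ → ℝ) (y : E4) : E4 :=
  open Classical in
  if y ∈ W then ‖y‖ • normalExp n (P y) (β (σ y))
  else if radial y ∈ A then -y else y

section rotMap

variable {S A : Set E4} {n : E4 → E4} {δ : ℝ} {W : Set E4} {P : E4 → E4} {σ : E4 → ℝ}
  {β : ℝ → ℝ} {r : ℝ}

lemma rotMap_of_mem {y : E4} (hy : y ∈ W) :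
    rotMap A n W P σ β y = ‖y‖ • normalExp n (P y) (β (σ y)) := if_pos hy

/-- Off the closed tube of radius `r`, the map is `∓ id`. -/
lemma rotMap_of_notMem (h : IsTube S A n δ W P σ) (hβ : ∀ s, s ≤ -r → β s = s)
    (hβ' : ∀ s, r ≤ s → β s = s - Real.pi) {y : E4} (hr : 0 ≤ r)
    (hy : ¬ (y ∈ W ∧ |σ y| ≤ r)) :
    (radial y ∈ A → rotMap A n W P σ β y = -y) ∧ (radial y ∉ A → rotMap A n W P σ β y = y) := by
  by_cases hW : y ∈ W
  · have h1 : r < |σ y| := by by_contra! h2; exact hy ⟨hW, h2⟩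
    have h2 := h.abs_dist_lt y hW
    have h3 := h.eq_smul y hW
    have hy0 := h.ne_zero y hW
    rw [rotMap_of_mem hW, h.radial_eq hW]
    -- Between the radii r and δ both descriptions apply: on the side of A the angle is shifted by
    -- -π, which gives the antipode of y; on the other side it is unchanged.
    rcases lt_abs.1 h1 with h4 | h4
    · have h5 := h.mem_side _ (h.foot_mem y hW) (σ y) (by linarith) ((le_abs_self _).trans_lt h2)
      refine ⟨fun _ => ?_, fun h6 => absurd h5 h6⟩
      rw [hβ' _ h4.le, normalExp, Real.cos_sub_pi, Real.sin_sub_pi, neg_smul, neg_smul,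
        ← neg_add, smul_neg]
      exact congrArg Neg.neg h3.symm
    · have h5 := h.notMem_side _ (h.foot_mem y hW) (σ y) (by linarith)
        (by linarith [neg_le_abs (σ y)])
      refine ⟨fun h6 => absurd h6 h5, fun _ => ?_⟩
      rw [hβ _ (by linarith)]
      exact h3.symm
  · simp only [rotMap, if_neg hW]
    exact ⟨fun h => if_pos h, fun h => if_neg h⟩

/-- Off the closed tube of radius `r`, the map is locally `id` or `- id`. -/
lemma eventuallyEq_rotMap (hS : IsClosedSurface S)
    (hA : ∃ a ∈ Metric.sphere (0 : E4) 1 \ S,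
      A = connectedComponentIn (Metric.sphere (0 : E4) 1 \ S) a)
    (h : IsTube S A n δ W P σ) (hβ : ∀ s, s ≤ -r → β s = s)
    (hβ' : ∀ s, r ≤ s → β s = s - Real.pi) (hr : 0 ≤ r) (hrδ : r < δ) {y : E4} (hy0 : y ≠ 0)
    (hy : ¬ (y ∈ W ∧ |σ y| ≤ r)) :
    rotMap A n W P σ β =ᶠ[𝓝 y] (fun y => -y) ∨ rotMap A n W P σ β =ᶠ[𝓝 y] (fun y => y) := by
  have h1 : radial y ∉ S := by
    intro hyS
    have h2 := h.smul_mem _ hyS 0 (by simpa using h.pos) ‖y‖ (norm_pos_iff.2 hy0)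
    simp only [normalExp, Real.cos_zero, one_smul, Real.sin_zero, zero_smul, add_zero,
      norm_smul_radial] at h2
    exact hy ⟨h2.1, by rw [h2.2.2]; simpa using hr⟩
  have h2 := eventually_radial_mem_iff hS hA hy0 h1
  have h3 := (h.isOpen_compl_closedTube hS hrδ).mem_nhds ⟨hy0, hy⟩
  by_cases hyA : radial y ∈ A
  · left
    filter_upwards [h2, h3] with y' h4 h5
    exact (rotMap_of_notMem h hβ hβ' hr h5.2).1 (h4.2 hyA)
  · right
    filter_upwards [h2, h3] with y' h4 h5
    exact (rotMap_of_notMem h hβ hβ' hr h5.2).2 (fun h6 => hyA (h4.1 h6))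

lemma norm_rotMap (hS : IsClosedSurface S) (hn : IsUnitNormalInto S A n)
    (h : IsTube S A n δ W P σ) (y : E4) : ‖rotMap A n W P σ β y‖ = ‖y‖ := by
  unfold rotMap
  split_ifs with h1 h2
  · rw [norm_smul, norm_normalExp hS hn (h.foot_mem y h1), norm_norm, mul_one]
  · exact norm_neg y
  · rfl

lemma rotMap_smul (h : IsTube S A n δ W P σ) {c : ℝ} (hc : 0 < c) (y : E4) :
    rotMap A n W P σ β (c • y) = c • rotMap A n W P σ β y := by
  by_cases hy : y ∈ W
  · have h1 := h.smul_mem _ (h.foot_mem y hy) _ (h.abs_dist_lt y hy) (c * ‖y‖)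
      (mul_pos hc (norm_pos_iff.2 (h.ne_zero y hy)))
    rw [mul_smul, ← h.eq_smul y hy] at h1
    rw [rotMap_of_mem hy, rotMap_of_mem h1.1, h1.2.1, h1.2.2, norm_smul, mul_smul,
      Real.norm_eq_abs, abs_of_pos hc]
  · have h2 : c • y ∉ W := by
      intro h2
      have h1 := h.smul_mem _ (h.foot_mem _ h2) _ (h.abs_dist_lt _ h2) (c⁻¹ * ‖c • y‖)
        (mul_pos (inv_pos.2 hc) (norm_pos_iff.2 (h.ne_zero _ h2)))
      rw [mul_smul, ← h.eq_smul _ h2, inv_smul_smul₀ hc.ne'] at h1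
      exact hy h1.1
    have h3 := radial_smul hc y
    rw [rotMap, rotMap, if_neg hy, if_neg h2]
    by_cases hyA : radial y ∈ A
    · rw [if_pos hyA, if_pos (by rwa [h3]), smul_neg]
    · rw [if_neg hyA, if_neg (by rwa [h3])]

/-- Kept apart from smoothness because the angle of the centre map involves the profile φ, which is
only continuous. -/
lemma continuousAt_rotMap (hS : IsClosedSurface S)
    (hA : ∃ a ∈ Metric.sphere (0 : E4) 1 \ S,
      A = connectedComponentIn (Metric.sphere (0 : E4) 1 \ S) a)
    (h : IsTube S A n δ W P σ) (hβ : ∀ s, s ≤ -r → β s = s)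
    (hβ' : ∀ s, r ≤ s → β s = s - Real.pi) (hr : 0 ≤ r) (hrδ : r < δ) (hβc : Continuous β)
    {y : E4} (hy0 : y ≠ 0) : ContinuousAt (rotMap A n W P σ β) y := by
  by_cases hy : y ∈ W ∧ |σ y| ≤ r
  · have h1 : rotMap A n W P σ β =ᶠ[𝓝 y] fun y => ‖y‖ • normalExp n (P y) (β (σ y)) := by
      filter_upwards [h.isOpen.mem_nhds hy.1] with y' hy' using rotMap_of_mem hy'
    refine ContinuousAt.congr ?_ h1.symm
    have h2 := (h.contDiffAt_foot hy.1).continuousAt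
    have h3 := (h.contDiffAt_normal hy.1).continuousAt
    have h4 : ContinuousAt (fun y => β (σ y)) y :=
      hβc.continuousAt.comp (h.contDiffAt_dist hy.1).continuousAt
    exact continuous_norm.continuousAt.smul (((Real.continuous_cos.continuousAt.comp h4).smul
      h2).add ((Real.continuous_sin.continuousAt.comp h4).smul h3))
  · rcases eventuallyEq_rotMap hS hA h hβ hβ' hr hrδ hy0 hy with h1 | h1
    · exact continuous_neg.continuousAt.congr h1.symm
    · exact continuous_id.continuousAt.congr h1.symm

lemma contDiffAt_rotMap (hS : IsClosedSurface S)
    (hA : ∃ a ∈ Metric.sphere (0 : E4) 1 \ S,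
      A = connectedComponentIn (Metric.sphere (0 : E4) 1 \ S) a)
    (h : IsTube S A n δ W P σ) (hβ : ∀ s, s ≤ -r → β s = s)
    (hβ' : ∀ s, r ≤ s → β s = s - Real.pi) (hr : 0 ≤ r) (hrδ : r < δ) (hβc : ContDiff ℝ ∞ β)
    {y : E4} (hy0 : y ≠ 0) : ContDiffAt ℝ ∞ (rotMap A n W P σ β) y := by
  by_cases hy : y ∈ W ∧ |σ y| ≤ r
  · have h1 : rotMap A n W P σ β =ᶠ[𝓝 y] fun y => ‖y‖ • normalExp n (P y) (β (σ y)) := by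
      filter_upwards [h.isOpen.mem_nhds hy.1] with y' hy' using rotMap_of_mem hy'
    refine ContDiffAt.congr_of_eventuallyEq ?_ h1
    have h2 := h.contDiffAt_foot hy.1
    have h3 := h.contDiffAt_normal hy.1
    have h4 : ContDiffAt ℝ ∞ (fun y => β (σ y)) y :=
      hβc.contDiffAt.comp y (h.contDiffAt_dist hy.1)
    exact (contDiffAt_norm ℝ hy0).smul (((Real.contDiff_cos.contDiffAt.comp y h4).smul
      h2).add ((Real.contDiff_sin.contDiffAt.comp y h4).smul h3))
  · rcases eventuallyEq_rotMap hS hA h hβ hβ' hr hrδ hy0 hy with h1 | h1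
    · exact contDiff_neg.contDiffAt.congr_of_eventuallyEq h1
    · exact contDiff_id.contDiffAt.congr_of_eventuallyEq h1

end rotMap


/-- Two maps into the sphere that are nowhere antipodal are homotopic. -/
lemma homotopic_of_ne_neg {X : Type*} [TopologicalSpace X] (f g : C(X, S3))
    (h : ∀ x, (f x : E4) ≠ -(g x : E4)) : f.Homotopic g := by
  have hne : ∀ (t : unitInterval) (x : X),
      ((1 - t : ℝ) • (f x : E4) + (t : ℝ) • (g x : E4)) ≠ 0 := by
    intro t x h0
    have h1 : (1 - t : ℝ) • (f x : E4) = -((t : ℝ) • (g x : E4)) := eq_neg_of_add_eq_zero_left h0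
    have h2 := congrArg norm h1
    rw [norm_neg, norm_smul, norm_smul, norm_eq_of_mem_sphere, norm_eq_of_mem_sphere, mul_one,
      mul_one, Real.norm_eq_abs, Real.norm_eq_abs, abs_of_nonneg (sub_nonneg.2 t.2.2),
      abs_of_nonneg t.2.1] at h2
    have h3 : (t : ℝ) ≠ 0 := by intro h; rw [h] at h2; norm_num at h2
    rw [h2, ← smul_neg] at h1
    exact h x (smul_right_injective E4 h3 h1)
  refine ⟨{ toFun := fun c => ⟨radial ((1 - c.1 : ℝ) • (f c.2 : E4) + (c.1 : ℝ) • (g c.2 : E4)),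
              by simpa using norm_radial (hne c.1 c.2)⟩
            continuous_toFun := ?_
            map_zero_left := fun x => ?_
            map_one_left := fun x => ?_ }⟩
  · have h1 : Continuous fun c : unitInterval × X =>
        (1 - c.1 : ℝ) • (f c.2 : E4) + (c.1 : ℝ) • (g c.2 : E4) := by fun_prop
    have h2 : Continuous fun c : unitInterval × X =>
        radial ((1 - c.1 : ℝ) • (f c.2 : E4) + (c.1 : ℝ) • (g c.2 : E4)) :=
      contDiffOn_radial.continuousOn.comp_continuous h1 fun c => by
        simpa only [mem_compl_iff, mem_singleton_iff] using hne c.1 c.2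
    exact h2.subtype_mk _
  · ext1
    simp [radial]
  · ext1
    simp [radial]

section

variable {S A : Set E4} {n : E4 → E4} {δ : ℝ} {W : Set E4} {P : E4 → E4} {σ : E4 → ℝ}
  {β : ℝ → ℝ} {r : ℝ}

/-- The rotation map as a continuous self-map of the sphere. -/
lemma exists_continuousMap_rotMap (hS : IsClosedSurface S)
    (hA : ∃ a ∈ Metric.sphere (0 : E4) 1 \ S,
      A = connectedComponentIn (Metric.sphere (0 : E4) 1 \ S) a)
    (hn : IsUnitNormalInto S A n) (h : IsTube S A n δ W P σ) (hβ : ∀ s, s ≤ -r → β s = s)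
    (hβ' : ∀ s, r ≤ s → β s = s - Real.pi) (hr : 0 ≤ r) (hrδ : r < δ) (hβc : Continuous β) :
    ∃ F : C(S3, S3), ∀ x : S3, (F x : E4) = rotMap A n W P σ β x := by
  have h1 : ∀ x : S3, rotMap A n W P σ β x ∈ Metric.sphere (0 : E4) 1 := by
    intro x
    simp [norm_rotMap hS hn h]
  have h2 : Continuous fun x : S3 => rotMap A n W P σ β x := by
    rw [continuous_iff_continuousAt]
    intro x
    exact (continuousAt_rotMap hS hA h hβ hβ' hr hrδ hβc
      (ne_zero_of_mem_unit_sphere x)).comp continuousAt_subtype_val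
  exact ⟨⟨fun x => ⟨rotMap A n W P σ β x, h1 x⟩, h2.subtype_mk h1⟩, fun x => rfl⟩

lemma homogeneousExtension_eq_rotMap (hS : IsClosedSurface S) (hn : IsUnitNormalInto S A n)
    (h : IsTube S A n δ W P σ) {F : C(S3, S3)}
    (hF : ∀ x : S3, (F x : E4) = rotMap A n W P σ β x) :
    homogeneousExtension F = rotMap A n W P σ β := by
  funext y
  by_cases hy : y = 0
  · have h1 := norm_rotMap (β := β) hS hn h y
    rw [homogeneousExtension, dif_pos hy]
    rw [hy, norm_zero, norm_eq_zero] at h1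
    rw [hy, h1]
  · have h1 : 0 < ‖y‖ := norm_pos_iff.2 hy
    rw [homogeneousExtension, dif_neg hy, hF, ← rotMap_smul h h1, smul_inv_smul₀ h1.ne']

/-- Over the tube the two images lie on one great circle at an angle less than π; elsewhere they
coincide. So they are never antipodal. -/
lemma homotopic_rotMap (hS : IsClosedSurface S) (hn : IsUnitNormalInto S A n)
    (h : IsTube S A n δ W P σ) {β' : ℝ → ℝ} (hββ : ∀ s, |s| < δ → |β s - β' s| < Real.pi)
    {F F' : C(S3, S3)} (hF : ∀ x : S3, (F x : E4) = rotMap A n W P σ β x)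
    (hF' : ∀ x : S3, (F' x : E4) = rotMap A n W P σ β' x) : F.Homotopic F' := by
  refine homotopic_of_ne_neg F F' fun x hx => ?_
  rw [hF, hF'] at hx
  have hx1 : ‖(x : E4)‖ = 1 := norm_eq_of_mem_sphere x
  have hx0 : (x : E4) ≠ 0 := ne_zero_of_mem_unit_sphere x
  by_cases hW : (x : E4) ∈ W
  · rw [rotMap_of_mem hW, rotMap_of_mem hW, hx1, one_smul, one_smul] at hx
    have hp := h.foot_mem _ hW
    obtain ⟨hn1, hn2, -⟩ := hn _ hp
    have hp1 : ‖P x‖ = 1 := by simpa using hS.subset_sphere hp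
    have h1 : ⟪normalExp n (P x) (β (σ x)), normalExp n (P x) (β' (σ x))⟫ =
        Real.cos (β (σ x) - β' (σ x)) := by
      rw [Real.cos_sub]
      simp [normalExp, inner_add_left, inner_add_right, inner_smul_left, inner_smul_right, hn1,
        hn2, real_inner_comm _ (n _), hp1]
      ring
    rw [hx, inner_neg_left, real_inner_self_eq_norm_sq, norm_normalExp hS hn hp] at h1
    have h2 := hββ _ (h.abs_dist_lt _ hW)
    rw [abs_lt] at h2
    -- The cosine of the difference a of the angles would be -1, whereas 1 + cos a = 2 cos²(a/2) > 0
    -- for |a| < π.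
    have h3 : Real.cos (β (σ x) - β' (σ x)) + 1 = 0 := by rw [← h1]; norm_num
    have h4 : 0 < Real.cos ((β (σ x) - β' (σ x)) / 2) :=
      Real.cos_pos_of_mem_Ioo ⟨by linarith, by linarith⟩
    have h5 := Real.cos_sq ((β (σ x) - β' (σ x)) / 2)
    rw [mul_div_cancel₀ _ (two_ne_zero)] at h5
    nlinarith
  · simp only [rotMap, if_neg hW] at hx
    split_ifs at hx
    · rw [neg_neg, eq_comm, eq_neg_iff_add_eq_zero, ← two_smul ℝ, smul_eq_zero] at hx
      exact hx0 (hx.resolve_left two_ne_zero)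
    · rw [eq_neg_iff_add_eq_zero, ← two_smul ℝ, smul_eq_zero] at hx
      exact hx0 (hx.resolve_left two_ne_zero)

/-! ### The centre map as a rotation of normal great circles -/

/-- The angle, in the normal plane, of the centre attached to the point at signed distance `s`. -/
noncomputable def centreAngle (ε : ℝ) (φ : ℝ → ℝ) (s : ℝ) : ℝ :=
  φ |s| * s - Real.pi / 2 - Real.arcsin (s / ε)

lemma continuous_centreAngle {ε : ℝ} {φ : ℝ → ℝ} (hφ : IsProfile ε φ) :
    Continuous (centreAngle ε φ) := by
  have := hφ.1
  unfold centreAngle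
  exact ((((this.comp continuous_abs).mul continuous_id).sub continuous_const).sub
    (Real.continuous_arcsin.comp (continuous_id.div_const ε)))

/-- `Real.arcsin` is constant, equal to ∓π/2, beyond ∓1. Together with φ = 0 on [0, ε] this lets the
single formula for the angle cover the tube and both sides of it. -/
lemma centreAngle_of_le {ε : ℝ} {φ : ℝ → ℝ} (hε : 0 < ε) {s : ℝ} (hs : s ≤ -ε) :
    centreAngle ε φ s = φ |s| * s := by
  rw [centreAngle, Real.arcsin_of_le_neg_one (by rw [div_le_iff₀ hε]; linarith)]
  ring

lemma centreAngle_of_ge {ε : ℝ} {φ : ℝ → ℝ} (hε : 0 < ε) {s : ℝ} (hs : ε ≤ s) :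
    centreAngle ε φ s = φ |s| * s - Real.pi := by
  rw [centreAngle, Real.arcsin_of_one_le (by rw [le_div_iff₀ hε]; linarith)]
  ring

lemma centreAngle_of_abs_le {ε : ℝ} {φ : ℝ → ℝ} (hφ : IsProfile ε φ) {s : ℝ} (hs : |s| ≤ ε) :
    centreAngle ε φ s = - (Real.pi / 2) - Real.arcsin (s / ε) := by
  rw [centreAngle, hφ.2.1 _ hs]; ring

lemma pairNorm_zero_left (s : ℝ) : pairNorm (0, s) = |s| := by
  simp [pairNorm, Real.sqrt_sq_eq_abs]

lemma tubeMap_zero_left (n : E4 → E4) (p : E4) (s : ℝ) :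
    tubeMap n p (0, s) = normalExp n p s := by
  simp [tubeMap, normalExp]

/-- On the sphere, the coordinates of the half tube are those of the tubular neighbourhood. -/
lemma mem_tubeCoords_iff (hS : IsClosedSurface S) (hn : IsUnitNormalInto S A n)
    (h : IsTube S A n δ W P σ) (hr : r < δ) (hr1 : r < 1) {v : E4} (hv : ‖v‖ = 1)
    {c : E4 × (ℝ × ℝ)} :
    c ∈ tubeCoords S n r v ↔ (v ∈ W ∧ |σ v| ≤ r) ∧ c = (P v, (0, σ v)) := by
  obtain ⟨p, s₁, s⟩ := c
  constructor
  · rintro ⟨hp, hs1, hsr, he⟩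
    simp only at hp hs1 hsr he
    have h1 : s₁ ≤ r := by
      refine le_trans ?_ hsr
      rw [pairNorm]
      exact Real.le_sqrt_of_sq_le (by simpa using sq_nonneg s)
    have h2 : tubeMap n p (s₁, s) = (1 - s₁) • normalExp n p s := rfl
    -- The norm of Λ(p, s) is |1 - s₁|; being 1, with s₁ ≤ r < 1, it forces s₁ = 0.
    have h3 : s₁ = 0 := by
      have h4 := congrArg norm he
      rw [h2, norm_smul, norm_normalExp hS hn hp, hv, mul_one, Real.norm_eq_abs,
        abs_of_pos (by linarith)] at h4
      linarith
    subst h3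
    rw [pairNorm_zero_left] at hsr
    rw [tubeMap_zero_left] at he
    have h5 := h.smul_mem p hp s (by linarith) 1 one_pos
    rw [one_smul, he] at h5
    exact ⟨⟨h5.1, by rw [h5.2.2]; exact hsr⟩, by rw [h5.2.1, h5.2.2]⟩
  · rintro ⟨⟨hW, hs⟩, he⟩
    simp only [Prod.mk.injEq] at he
    obtain ⟨rfl, rfl, rfl⟩ := he
    refine ⟨h.foot_mem v hW, le_rfl, ?_, ?_⟩
    · simpa [pairNorm_zero_left] using hs
    · have := h.eq_smul v hW
      rw [hv, one_smul] at this
      rw [tubeMap_zero_left]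
      exact this.symm

lemma tubeCoords_nonempty_iff (hS : IsClosedSurface S) (hn : IsUnitNormalInto S A n)
    (h : IsTube S A n δ W P σ) (hr : r < δ) (hr1 : r < 1) {v : E4} (hv : ‖v‖ = 1) :
    (tubeCoords S n r v).Nonempty ↔ v ∈ W ∧ |σ v| ≤ r :=
  ⟨fun ⟨_, hc⟩ => ((mem_tubeCoords_iff hS hn h hr hr1 hv).1 hc).1,
    fun h1 => ⟨_, (mem_tubeCoords_iff hS hn h hr hr1 hv).2 ⟨h1, rfl⟩⟩⟩

lemma tubeCoords_some (hS : IsClosedSurface S) (hn : IsUnitNormalInto S A n)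
    (h : IsTube S A n δ W P σ) (hr : r < δ) (hr1 : r < 1) {v : E4} (hv : ‖v‖ = 1)
    (hne : (tubeCoords S n r v).Nonempty) : hne.some = (P v, (0, σ v)) :=
  ((mem_tubeCoords_iff hS hn h hr hr1 hv).1 hne.some_mem).2

lemma collapse_eq_normalExp (hS : IsClosedSurface S) (hn : IsUnitNormalInto S A n)
    (h : IsTube S A n δ W P σ) {ε : ℝ} {φ : ℝ → ℝ} (hr : 2 * ε < δ) (hr1 : 2 * ε < 1) {v : E4}
    (hv : ‖v‖ = 1) (hW : v ∈ W) (hs : |σ v| ≤ 2 * ε) :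
    collapse S n ε φ v = normalExp n (P v) (φ |σ v| * σ v) := by
  have h1 := (tubeCoords_nonempty_iff hS hn h hr hr1 hv).2 ⟨hW, hs⟩
  rw [collapse, dif_pos h1, tubeCoords_some hS hn h hr hr1 hv]
  simp only [pairNorm_zero_left, Prod.smul_mk, smul_eq_mul, mul_zero, tubeMap_zero_left]

/-- For |s| ≤ ε, -sin θ p - cos θ n(p) is the point at angle -(θ + π/2). For ε < |s| ≤ 2ε the centre
is T v at angle φ(|s|) s, or on the side of A its antipode, at that angle minus π. Farther away T is
the identity and both sides of the equation are ∓v. -/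
lemma sphereCentre_eq_rotMap (hS : IsClosedSurface S) (hn : IsUnitNormalInto S A n)
    (h : IsTube S A n δ W P σ) {ε : ℝ} {φ : ℝ → ℝ} (hφ : IsProfile ε φ) (hε : 0 < ε)
    (hr : 2 * ε < δ) (hr1 : 2 * ε < 1) {v : E4} (hv : ‖v‖ = 1) :
    sphereCentre S A n ε φ v = rotMap A n W P σ (centreAngle ε φ) v := by
  by_cases h1 : v ∈ W ∧ |σ v| ≤ ε
  · have h2 := (tubeCoords_nonempty_iff hS hn h (by linarith) (by linarith) hv).2 h1
    rw [sphereCentre, dif_pos h2, tubeCoords_some hS hn h (by linarith) (by linarith) hv,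
      rotMap_of_mem h1.1, hv, one_smul, centreAngle_of_abs_le hφ h1.2, normalExp]
    have h3 : |σ v / ε| ≤ 1 := by
      rw [abs_div, abs_of_pos hε, div_le_one hε]; exact h1.2
    rw [abs_le] at h3
    rw [show -(Real.pi / 2) - Real.arcsin (σ v / ε) = -(Real.arcsin (σ v / ε) + Real.pi / 2) by
      ring, Real.cos_neg, Real.sin_neg, Real.cos_add_pi_div_two, Real.sin_add_pi_div_two,
      Real.sin_arcsin h3.1 h3.2, Real.cos_arcsin, neg_smul (Real.sqrt _), ← sub_eq_add_neg]
  · have h2 : ¬ (tubeCoords S n ε v).Nonempty := fun h3 =>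
      h1 ((tubeCoords_nonempty_iff hS hn h (by linarith) (by linarith) hv).1 h3)
    rw [sphereCentre, dif_neg h2]
    have hvr : radial v = v := radial_eq_self hv
    by_cases h3 : v ∈ W ∧ |σ v| ≤ 2 * ε
    · have hW := h3.1
      have h4 : ε < |σ v| := by by_contra! h4; exact h1 ⟨h3.1, h4⟩
      have h5 := h.radial_eq hW
      rw [hvr] at h5
      have h6 := h.foot_mem v hW
      rw [collapse_eq_normalExp hS hn h hr hr1 hv hW h3.2, rotMap_of_mem hW, hv, one_smul]
      rcases lt_abs.1 h4 with h7 | h7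
      · have h8 := h.mem_side _ h6 (σ v) (by linarith) ((le_abs_self _).trans_lt
          (h.abs_dist_lt v hW))
        rw [← h5] at h8
        rw [if_pos h8, centreAngle_of_ge hε h7.le, normalExp, normalExp, Real.cos_sub_pi,
          Real.sin_sub_pi, neg_smul, neg_smul, ← neg_add]
      · have h8 := h.notMem_side _ h6 (σ v) (by linarith)
          (by linarith [neg_le_abs (σ v), h.abs_dist_lt v hW])
        rw [← h5] at h8
        rw [if_neg h8, centreAngle_of_le hε (by linarith)]
    · have h4 : ¬ (tubeCoords S n (2 * ε) v).Nonempty := fun h5 =>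
        h3 ((tubeCoords_nonempty_iff hS hn h hr hr1 hv).1 h5)
      have h5 := rotMap_of_notMem (β := centreAngle ε φ) (r := 2 * ε) h ?_ ?_ (by linarith) h3
      · rw [hvr] at h5
        simp only [collapse, dif_neg h4]
        split_ifs with h6
        · exact (h5.1 h6).symm
        · exact (h5.2 h6).symm
      · intro s hs
        rw [centreAngle_of_le hε (by linarith), hφ.2.2.2 _ (by linarith [neg_le_abs s]), one_mul]
      · intro s hs
        rw [centreAngle_of_ge hε (by linarith), hφ.2.2.2 _ (by linarith [le_abs_self s]), one_mul]

end

/-! ### The Gauss-Bonnet formula for a triangle -/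

/-- The standard triangle. -/
def stdTriangle : Set (ℝ × ℝ) := {x | 0 ≤ x.1 ∧ 0 ≤ x.2 ∧ x.1 + x.2 ≤ 1}

lemma isClosed_stdTriangle : IsClosed stdTriangle :=
  (isClosed_le continuous_const continuous_fst).inter
    ((isClosed_le continuous_const continuous_snd).inter
      (isClosed_le (continuous_fst.add continuous_snd) continuous_const))

lemma isCompact_stdTriangle : IsCompact stdTriangle := by
  refine IsCompact.of_isClosed_subset (isCompact_Icc (a := ((0, 0) : ℝ × ℝ)) (b := (1, 1)))
    isClosed_stdTriangle fun x hx => ?_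
  obtain ⟨h1, h2, h3⟩ := hx
  exact ⟨⟨h1, h2⟩, ⟨by simp only; linarith, by simp only; linarith⟩⟩

lemma integral_stdTriangle {f : ℝ × ℝ → ℝ} (hf : IntegrableOn f stdTriangle) :
    ∫ x in stdTriangle, f x = ∫ b in (0 : ℝ)..1, ∫ a in (0 : ℝ)..(1 - b), f (a, b) := by
  rw [← integral_indicator isClosed_stdTriangle.measurableSet, Measure.volume_eq_prod,
    integral_prod_symm]
  · rw [intervalIntegral.integral_of_le zero_le_one, ← integral_Icc_eq_integral_Ioc,
      ← integral_indicator measurableSet_Icc]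
    congr 1
    ext b
    by_cases hb : b ∈ Icc (0 : ℝ) 1
    · rw [indicator_of_mem hb, intervalIntegral.integral_of_le (by linarith [hb.2]),
        ← integral_Icc_eq_integral_Ioc, ← integral_indicator measurableSet_Icc]
      congr 1
      ext a
      have h1 : (a, b) ∈ stdTriangle ↔ a ∈ Icc 0 (1 - b) :=
        ⟨fun ⟨h1, h2, h3⟩ => ⟨h1, by simp only at h3; linarith⟩,
          fun ⟨h1, h2⟩ => ⟨h1, hb.1, by simp only; linarith⟩⟩
      simp only [indicator, h1]
    · rw [indicator_of_notMem hb]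
      have : ∀ a, stdTriangle.indicator f (a, b) = 0 := by
        intro a
        refine indicator_of_notMem (fun h => hb ?_) _
        obtain ⟨h1, h2, h3⟩ := h
        simp only at h1 h2 h3
        exact ⟨h2, by linarith⟩
      simp [this]
  · rw [← Measure.volume_eq_prod]
    exact hf.integrable_indicator isClosed_stdTriangle.measurableSet

lemma swap_preimage_stdTriangle : Prod.swap ⁻¹' stdTriangle = stdTriangle := by
  ext x
  simp only [stdTriangle, mem_preimage, mem_ofPred_eq, Prod.fst_swap, Prod.snd_swap]
  constructor <;> rintro ⟨h1, h2, h3⟩ <;> exact ⟨h2, h1, by linarith⟩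

lemma integral_stdTriangle_fderiv_fst {O : Set (ℝ × ℝ)} (hO : IsOpen O) (hΔ : stdTriangle ⊆ O)
    {η : ℝ × ℝ → ℝ} (hη : ContDiffOn ℝ 1 η O) :
    ∫ x in stdTriangle, fderiv ℝ η x (1, 0) =
      (∫ b in (0 : ℝ)..1, η (1 - b, b)) - ∫ b in (0 : ℝ)..1, η (0, b) := by
  have hc : ContinuousOn (fun x => fderiv ℝ η x (1, 0)) O :=
    (hη.continuousOn_fderiv_of_isOpen hO le_rfl).clm_apply continuousOn_const
  have hηc : ContinuousOn η O := hη.continuousOn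
  have hmem : ∀ b ∈ Icc (0 : ℝ) 1, ∀ a ∈ Icc (0 : ℝ) (1 - b), (a, b) ∈ O := fun b hb a ha =>
    hΔ ⟨ha.1, hb.1, by simp only; linarith [ha.2]⟩
  rw [integral_stdTriangle ((hc.mono hΔ).integrableOn_compact isCompact_stdTriangle),
    ← intervalIntegral.integral_sub]
  · refine intervalIntegral.integral_congr fun b hb => ?_
    rw [uIcc_of_le zero_le_one] at hb
    have hb' : (0 : ℝ) ≤ 1 - b := by linarith [hb.2]
    refine intervalIntegral.integral_eq_sub_of_hasDerivAt (f := fun a => η (a, b)) ?_ ?_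
    · intro a ha
      rw [uIcc_of_le hb'] at ha
      have h1 : HasFDerivAt η (fderiv ℝ η (a, b)) (a, b) :=
        ((hη.contDiffAt (hO.mem_nhds (hmem b hb a ha))).differentiableAt (by simp)).hasFDerivAt
      have h2 : HasDerivAt (fun a : ℝ => (a, b)) ((1 : ℝ), (0 : ℝ)) a :=
        (hasDerivAt_id a).prodMk (hasDerivAt_const a b)
      exact HasFDerivAt.comp_hasDerivAt a h1 h2
    · refine ContinuousOn.intervalIntegrable ?_
      rw [uIcc_of_le hb']
      exact hc.comp (by fun_prop) fun a ha => hmem b hb a ha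
  · refine ContinuousOn.intervalIntegrable ?_
    rw [uIcc_of_le zero_le_one]
    exact hηc.comp (by fun_prop) fun b hb => hmem b hb _ ⟨by linarith [hb.2], le_rfl⟩
  · refine ContinuousOn.intervalIntegrable ?_
    rw [uIcc_of_le zero_le_one]
    exact hηc.comp (by fun_prop) fun b hb => hmem b hb _ ⟨le_rfl, by linarith [hb.2]⟩

lemma integral_stdTriangle_fderiv_snd {O : Set (ℝ × ℝ)} (hO : IsOpen O) (hΔ : stdTriangle ⊆ O)
    {η : ℝ × ℝ → ℝ} (hη : ContDiffOn ℝ 1 η O) :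
    ∫ x in stdTriangle, fderiv ℝ η x (0, 1) =
      (∫ a in (0 : ℝ)..1, η (a, 1 - a)) - ∫ a in (0 : ℝ)..1, η (a, 0) := by
  set sw : (ℝ × ℝ) ≃L[ℝ] (ℝ × ℝ) := ContinuousLinearEquiv.prodComm ℝ ℝ ℝ with hsw
  have hO' : IsOpen (sw ⁻¹' O) := hO.preimage sw.continuous
  have hΔ' : stdTriangle ⊆ sw ⁻¹' O := by
    rw [← swap_preimage_stdTriangle]; exact preimage_mono hΔ
  have h1 := integral_stdTriangle_fderiv_fst hO' hΔ' (η := η ∘ sw)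
    (hη.comp sw.contDiff.contDiffOn fun x hx => hx)
  have h2 : ∀ x ∈ stdTriangle, fderiv ℝ (η ∘ sw) x (1, 0) = fderiv ℝ η (sw x) (0, 1) := by
    intro x hx
    rw [sw.comp_right_fderiv]
    rfl
  rw [setIntegral_congr_fun isClosed_stdTriangle.measurableSet h2] at h1
  have h3 : ∫ x in stdTriangle, fderiv ℝ η (sw x) (0, 1) =
      ∫ x in stdTriangle, fderiv ℝ η x (0, 1) := by
    have h4 : MeasurePreserving (Prod.swap : ℝ × ℝ → ℝ × ℝ) volume volume :=
      Measure.measurePreserving_swap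
    have h5 := h4.setIntegral_preimage_emb MeasurableEquiv.prodComm.measurableEmbedding
      (fun x => fderiv ℝ η x (0, 1)) stdTriangle
    rw [swap_preimage_stdTriangle] at h5
    exact h5
  rw [← h3, h1]
  rfl

/-- The area of the parallelogram spanned by `X` and `Y`, in the plane oriented by `E, F`. -/
noncomputable def wedge (E F X Y : E4) : ℝ := ⟪E, X⟫ * ⟪F, Y⟫ - ⟪F, X⟫ * ⟪E, Y⟫

/-- A parametrized surface `g` in the sphere with its unit normal `N` and an orthonormal frame
`E, F` of its tangent planes, obtained from the coordinate frame. -/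
structure IsAdaptedFrame (O : Set (ℝ × ℝ)) (g N E F : ℝ × ℝ → E4) : Prop where
  isOpen : IsOpen O
  contDiffOn : ContDiffOn ℝ ∞ g O
  contDiffOn_normal : ContDiffOn ℝ ∞ N O
  contDiffOn_fst : ContDiffOn ℝ ∞ E O
  contDiffOn_snd : ContDiffOn ℝ ∞ F O
  orthonormal : ∀ x ∈ O, Orthonormal ℝ ![g x, N x, E x, F x]
  inner_normal : ∀ x ∈ O, ∀ w, ⟪N x, fderiv ℝ g x w⟫ = 0
  inner_fst : ∀ x ∈ O, 0 < ⟪E x, fderiv ℝ g x (1, 0)⟫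
  inner_snd : ∀ x ∈ O, ⟪F x, fderiv ℝ g x (1, 0)⟫ = 0
  inner_snd_snd : ∀ x ∈ O, 0 < ⟪F x, fderiv ℝ g x (0, 1)⟫

/-- The density of the intrinsic curvature with respect to the parameters. -/
noncomputable def curvDensity (g N E F : ℝ × ℝ → E4) (x : ℝ × ℝ) : ℝ :=
  wedge (E x) (F x) (fderiv ℝ g x (1, 0)) (fderiv ℝ g x (0, 1)) +
    wedge (E x) (F x) (fderiv ℝ N x (1, 0)) (fderiv ℝ N x (0, 1))

lemma inner_fderiv_add {O : Set (ℝ × ℝ)} (hO : IsOpen O) {f h : ℝ × ℝ → E4}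
    (hf : ContDiffOn ℝ ∞ f O) (hh : ContDiffOn ℝ ∞ h O) {c : ℝ} (hc : ∀ x ∈ O, ⟪f x, h x⟫ = c)
    {x : ℝ × ℝ} (hx : x ∈ O) (w : ℝ × ℝ) :
    ⟪f x, fderiv ℝ h x w⟫ + ⟪fderiv ℝ f x w, h x⟫ = 0 := by
  have h1 : DifferentiableAt ℝ f x := (hf.contDiffAt (hO.mem_nhds hx)).differentiableAt (by simp)
  have h2 : DifferentiableAt ℝ h x := (hh.contDiffAt (hO.mem_nhds hx)).differentiableAt (by simp)
  rw [← fderiv_inner_apply ℝ h1 h2]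
  have h3 : (fun t => ⟪f t, h t⟫) =ᶠ[𝓝 x] fun _ => c := by
    filter_upwards [hO.mem_nhds hx] with y hy using hc y hy
  rw [h3.fderiv_eq]
  simp

lemma sum_inner_mul_inner_of_orthonormal {a b c d : E4} (h : Orthonormal ℝ ![a, b, c, d])
    (u v : E4) : ⟪u, v⟫ = ⟪a, u⟫ * ⟪a, v⟫ + ⟪b, u⟫ * ⟪b, v⟫ + ⟪c, u⟫ * ⟪c, v⟫ +
      ⟪d, u⟫ * ⟪d, v⟫ := by
  set B := basisOfOrthonormalOfCardEqFinrank h (by simp) with hB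
  have hBo : Orthonormal ℝ B := by rw [hB, coe_basisOfOrthonormalOfCardEqFinrank]; exact h
  have h1 := (B.toOrthonormalBasis hBo).sum_inner_mul_inner u v
  simp only [Fin.sum_univ_four, Module.Basis.coe_toOrthonormalBasis, hB,
    coe_basisOfOrthonormalOfCardEqFinrank] at h1
  rw [← h1]
  simp [real_inner_comm u]

lemma orthonormal_four_iff {a b c d : E4} : Orthonormal ℝ ![a, b, c, d] ↔
    (⟪a, a⟫ = 1 ∧ ⟪b, b⟫ = 1 ∧ ⟪c, c⟫ = 1 ∧ ⟪d, d⟫ = 1) ∧ ⟪a, b⟫ = 0 ∧ ⟪a, c⟫ = 0 ∧ ⟪a, d⟫ = 0 ∧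
      ⟪b, c⟫ = 0 ∧ ⟪b, d⟫ = 0 ∧ ⟪c, d⟫ = 0 := by
  rw [orthonormal_iff_ite]
  constructor
  · intro h
    exact ⟨⟨by simpa using h 0 0, by simpa using h 1 1, by simpa using h 2 2, by simpa using h 3 3⟩,
      by simpa using h 0 1, by simpa using h 0 2, by simpa using h 0 3, by simpa using h 1 2,
      by simpa using h 1 3, by simpa using h 2 3⟩
  · rintro ⟨⟨h1, h2, h3, h4⟩, h5, h6, h7, h8, h9, h10⟩ i j
    have hnorm : ∀ {u : E4}, ⟪u, u⟫ = 1 → ‖u‖ = 1 := fun {u} hu => by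
      rw [real_inner_self_eq_norm_sq] at hu
      nlinarith [norm_nonneg u]
    fin_cases i <;> fin_cases j <;>
      simp [hnorm h1, hnorm h2, hnorm h3, hnorm h4, h5, h6, h7, h8, h9, h10] <;>
      (rw [real_inner_comm]; assumption)

namespace IsAdaptedFrame

variable {O : Set (ℝ × ℝ)} {g N E F : ℝ × ℝ → E4}

lemma contDiffOn_fderiv_apply (hO : IsOpen O) {f : ℝ × ℝ → E4} (hf : ContDiffOn ℝ ∞ f O)
    (w : ℝ × ℝ) : ContDiffOn ℝ ∞ (fun x => fderiv ℝ f x w) O :=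
  (hf.fderiv_of_isOpen hO (by simp)).clm_apply contDiffOn_const

lemma differentiableAt (hO : IsOpen O) {f : ℝ × ℝ → E4} (hf : ContDiffOn ℝ ∞ f O) {x : ℝ × ℝ}
    (hx : x ∈ O) : DifferentiableAt ℝ f x :=
  (hf.contDiffAt (hO.mem_nhds hx)).differentiableAt (by simp)

/-- The connection form of the frame. -/
noncomputable def connForm (E F : ℝ × ℝ → E4) (w x : ℝ × ℝ) : ℝ := ⟪fderiv ℝ E x w, F x⟫

lemma contDiffOn_connForm (h : IsAdaptedFrame O g N E F) (w : ℝ × ℝ) :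
    ContDiffOn ℝ ∞ (connForm E F w) O :=
  (contDiffOn_fderiv_apply h.isOpen h.contDiffOn_fst w).inner ℝ h.contDiffOn_snd

lemma fderiv_connForm (h : IsAdaptedFrame O g N E F) {x : ℝ × ℝ} (hx : x ∈ O) (v w : ℝ × ℝ) :
    fderiv ℝ (connForm E F w) x v = ⟪fderiv ℝ E x w, fderiv ℝ F x v⟫ +
      ⟪fderiv ℝ (fderiv ℝ E) x v w, F x⟫ := by
  have h1 : DifferentiableAt ℝ (fun x => fderiv ℝ E x w) x :=
    differentiableAt h.isOpen (contDiffOn_fderiv_apply h.isOpen h.contDiffOn_fst w) hx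
  have h2 := differentiableAt h.isOpen h.contDiffOn_snd hx
  have h3 : DifferentiableAt ℝ (fderiv ℝ E) x :=
    ((h.contDiffOn_fst.fderiv_of_isOpen (m := ∞) h.isOpen (by simp)).contDiffAt
      (h.isOpen.mem_nhds hx)).differentiableAt (by simp)
  unfold connForm
  rw [fderiv_inner_apply ℝ h1 h2]
  congr 2
  rw [fderiv_clm_apply h3 (differentiableAt_const w)]
  simp

/-- Gauss's equation: the exterior derivative of the connection form is minus the curvature. -/
lemma curl_connForm (h : IsAdaptedFrame O g N E F) {x : ℝ × ℝ} (hx : x ∈ O) :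
    fderiv ℝ (connForm E F (0, 1)) x (1, 0) - fderiv ℝ (connForm E F (1, 0)) x (0, 1) =
      -curvDensity g N E F x := by
  have hsymm : fderiv ℝ (fderiv ℝ E) x (1, 0) (0, 1) = fderiv ℝ (fderiv ℝ E) x (0, 1) (1, 0) :=
    ((h.contDiffOn_fst.contDiffAt (h.isOpen.mem_nhds hx)).isSymmSndFDerivAt
      (by simpa using ENat.LEInfty.out)) _ _
  rw [h.fderiv_connForm hx, h.fderiv_connForm hx, hsymm, add_sub_add_right_eq_sub]
  have hon := fun y hy => orthonormal_four_iff.1 (h.orthonormal y hy)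
  have ee := fun w => inner_fderiv_add h.isOpen h.contDiffOn_fst h.contDiffOn_fst
    (fun y hy => (hon y hy).1.2.2.1) hx w
  have ff := fun w => inner_fderiv_add h.isOpen h.contDiffOn_snd h.contDiffOn_snd
    (fun y hy => (hon y hy).1.2.2.2) hx w
  have ge := fun w => inner_fderiv_add h.isOpen h.contDiffOn h.contDiffOn_fst
    (fun y hy => (hon y hy).2.2.1) hx w
  have gf := fun w => inner_fderiv_add h.isOpen h.contDiffOn h.contDiffOn_snd
    (fun y hy => (hon y hy).2.2.2.1) hx w
  have ne := fun w => inner_fderiv_add h.isOpen h.contDiffOn_normal h.contDiffOn_fst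
    (fun y hy => (hon y hy).2.2.2.2.1) hx w
  have nf := fun w => inner_fderiv_add h.isOpen h.contDiffOn_normal h.contDiffOn_snd
    (fun y hy => (hon y hy).2.2.2.2.2.1) hx w
  simp only [real_inner_comm (E x) (fderiv ℝ _ x _), real_inner_comm (F x) (fderiv ℝ _ x _)] at *
  have ee' : ∀ w, ⟪E x, fderiv ℝ E x w⟫ = 0 := fun w => by linarith [ee w]
  have ff' : ∀ w, ⟪F x, fderiv ℝ F x w⟫ = 0 := fun w => by linarith [ff w]
  have ge' : ∀ w, ⟪g x, fderiv ℝ E x w⟫ = -⟪E x, fderiv ℝ g x w⟫ := fun w => by linarith [ge w]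
  have gf' : ∀ w, ⟪g x, fderiv ℝ F x w⟫ = -⟪F x, fderiv ℝ g x w⟫ := fun w => by linarith [gf w]
  have ne' : ∀ w, ⟪N x, fderiv ℝ E x w⟫ = -⟪E x, fderiv ℝ N x w⟫ := fun w => by linarith [ne w]
  have nf' : ∀ w, ⟪N x, fderiv ℝ F x w⟫ = -⟪F x, fderiv ℝ N x w⟫ := fun w => by linarith [nf w]
  -- In the basis g, N, E, F the last two components drop out, since ⟪E, ∂E⟫ = 0 and ⟪F, ∂F⟫ = 0.
  -- The g components produce the area density, the curvature 1 of the ambient sphere, and the N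
  -- components produce the determinant of the normal map.
  rw [sum_inner_mul_inner_of_orthonormal (h.orthonormal x hx) (fderiv ℝ E x (0, 1)),
    sum_inner_mul_inner_of_orthonormal (h.orthonormal x hx) (fderiv ℝ E x (1, 0)),
    curvDensity, wedge, wedge]
  simp only [ee', ff', ge', gf', ne', nf']
  ring

end IsAdaptedFrame

/-- The unit vector orthogonal to `X` in the half plane of the plane of `X, Z` containing `Z`. -/
noncomputable def conormal (X Z : E4) : E4 :=
  ‖Z - (⟪X, Z⟫ / ‖X‖ ^ 2) • X‖⁻¹ • (Z - (⟪X, Z⟫ / ‖X‖ ^ 2) • X)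

/-- The part of Z orthogonal to X is (ad - bc)/(a² + b²) times the quarter turn -bE + aF of X, so a
positive orientation of (X, Z) makes the conormal the normalized quarter turn. -/
lemma conormal_eq {E F X Z : E4} (hE : ⟪E, E⟫ = 1) (hF : ⟪F, F⟫ = 1) (hEF : ⟪E, F⟫ = 0)
    {a b c d : ℝ} (hX : X = a • E + b • F) (hZ : Z = c • E + d • F) (hpos : 0 < a * d - b * c) :
    conormal X Z = (√(a ^ 2 + b ^ 2))⁻¹ • (-b • E + a • F) := by
  have hFE : ⟪F, E⟫ = 0 := by rw [real_inner_comm]; exact hEF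
  have hE1 : ‖E‖ = 1 := by
    rw [real_inner_self_eq_norm_sq] at hE; nlinarith [norm_nonneg E]
  have hF1 : ‖F‖ = 1 := by
    rw [real_inner_self_eq_norm_sq] at hF; nlinarith [norm_nonneg F]
  have hn : ∀ s t : ℝ, ‖s • E + t • F‖ ^ 2 = s ^ 2 + t ^ 2 := by
    intro s t
    rw [norm_add_sq_real]
    simp [norm_smul, hE1, hF1, inner_smul_left, inner_smul_right, hEF]
  have hab : 0 < a ^ 2 + b ^ 2 := by
    rcases eq_or_ne a 0 with rfl | ha
    · have : b ≠ 0 := by rintro rfl; simp at hpos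
      positivity
    · positivity
  have hXZ : ⟪X, Z⟫ = a * c + b * d := by
    rw [hX, hZ]
    simp [inner_add_left, inner_add_right, inner_smul_left, inner_smul_right, hE1, hF1, hEF, hFE]
    ring
  set k := (a * d - b * c) / (a ^ 2 + b ^ 2) with hk
  have hkpos : 0 < k := div_pos hpos hab
  have h1 : Z - (⟪X, Z⟫ / ‖X‖ ^ 2) • X = k • (-b • E + a • F) := by
    rw [hXZ, hX, hn, hZ, hk]
    have e1 : c - (a * c + b * d) / (a ^ 2 + b ^ 2) * a =
      (a * d - b * c) / (a ^ 2 + b ^ 2) * (-b) := by field_simp; ring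
    have e2 : d - (a * c + b * d) / (a ^ 2 + b ^ 2) * b =
      (a * d - b * c) / (a ^ 2 + b ^ 2) * a := by field_simp; ring
    simp only [smul_add, smul_smul, ← e1, ← e2]
    module
  have h2 : ‖-b • E + a • F‖ = √(a ^ 2 + b ^ 2) := by
    rw [← Real.sqrt_sq (norm_nonneg _), hn]; congr 1; ring
  rw [conormal, h1, norm_smul, Real.norm_eq_abs, abs_of_pos hkpos, h2, smul_smul]
  congr 1
  field_simp

/-- The total geodesic curvature of the edge of `g` that starts at `x` in the direction `w`, with
respect to the side of the direction `w'`. -/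
noncomputable def edgeCurv (g : ℝ × ℝ → E4) (x w w' : ℝ × ℝ) : ℝ :=
  ∫ u in (0 : ℝ)..1, ⟪deriv (deriv fun t : ℝ => g (x + t • w)) u,
    conormal (fderiv ℝ g (x + u • w) w) (fderiv ℝ g (x + u • w) w')⟫ /
      ‖fderiv ℝ g (x + u • w) w‖

/-- A positive second component keeps the angle strictly between 0 and π, where the arctangent
describes it without a choice of branch. -/
lemma angle_frame {E F X : E4} (hE : ⟪E, E⟫ = 1) (hF : ⟪F, F⟫ = 1) (hEF : ⟪E, F⟫ = 0)
    {a b : ℝ} (hX : X = a • E + b • F) (hb : 0 < b) :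
    InnerProductGeometry.angle E X = Real.pi / 2 - Real.arctan (a / b) := by
  have hE1 : ‖E‖ = 1 := by
    rw [real_inner_self_eq_norm_sq] at hE; nlinarith [norm_nonneg E]
  have hF1 : ‖F‖ = 1 := by
    rw [real_inner_self_eq_norm_sq] at hF; nlinarith [norm_nonneg F]
  have hn : ‖X‖ = √(a ^ 2 + b ^ 2) := by
    rw [← Real.sqrt_sq (norm_nonneg _), hX, norm_add_sq_real]
    simp [norm_smul, hE1, hF1, inner_smul_left, inner_smul_right, hEF]
  have hi : ⟪E, X⟫ = a := by
    rw [hX]; simp [inner_add_right, inner_smul_right, hE1, hEF]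
  rw [InnerProductGeometry.angle, Real.arccos, hi, hE1, hn, one_mul, Real.arctan_eq_arcsin]
  congr 2
  have h1 : √(1 + (a / b) ^ 2) = √(a ^ 2 + b ^ 2) / b := by
    rw [show 1 + (a / b) ^ 2 = (a ^ 2 + b ^ 2) / b ^ 2 by field_simp; ring,
      Real.sqrt_div (by positivity), Real.sqrt_sq hb.le]
  rw [h1]
  have : √(a ^ 2 + b ^ 2) ≠ 0 := by positivity
  field_simp

namespace IsAdaptedFrame

variable {O : Set (ℝ × ℝ)} {g N E F : ℝ × ℝ → E4}

lemma inner_self_fst (h : IsAdaptedFrame O g N E F) {x : ℝ × ℝ} (hx : x ∈ O) :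
    ⟪E x, E x⟫ = 1 := (orthonormal_four_iff.1 (h.orthonormal x hx)).1.2.2.1

lemma inner_self_snd (h : IsAdaptedFrame O g N E F) {x : ℝ × ℝ} (hx : x ∈ O) :
    ⟪F x, F x⟫ = 1 := (orthonormal_four_iff.1 (h.orthonormal x hx)).1.2.2.2

lemma inner_fst_snd (h : IsAdaptedFrame O g N E F) {x : ℝ × ℝ} (hx : x ∈ O) :
    ⟪E x, F x⟫ = 0 := (orthonormal_four_iff.1 (h.orthonormal x hx)).2.2.2.2.2.2

lemma inner_self_fderiv (h : IsAdaptedFrame O g N E F) {x : ℝ × ℝ} (hx : x ∈ O) (w : ℝ × ℝ) :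
    ⟪g x, fderiv ℝ g x w⟫ = 0 := by
  have := inner_fderiv_add h.isOpen h.contDiffOn h.contDiffOn
    (fun y hy => (orthonormal_four_iff.1 (h.orthonormal y hy)).1.1) hx w
  rw [real_inner_comm (g x)] at this
  linarith

lemma eq_of_tangent (h : IsAdaptedFrame O g N E F) {x : ℝ × ℝ} (hx : x ∈ O) {X : E4}
    (hg : ⟪g x, X⟫ = 0) (hN : ⟪N x, X⟫ = 0) : X = ⟪E x, X⟫ • E x + ⟪F x, X⟫ • F x := by
  refine ext_inner_left ℝ fun v => ?_
  rw [sum_inner_mul_inner_of_orthonormal (h.orthonormal x hx) v X, hg, hN, inner_add_right,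
    inner_smul_right, inner_smul_right, real_inner_comm (E x) v, real_inner_comm (F x) v]
  ring

lemma fderiv_eq (h : IsAdaptedFrame O g N E F) {x : ℝ × ℝ} (hx : x ∈ O) (w : ℝ × ℝ) :
    fderiv ℝ g x w = ⟪E x, fderiv ℝ g x w⟫ • E x + ⟪F x, fderiv ℝ g x w⟫ • F x :=
  h.eq_of_tangent hx (h.inner_self_fderiv hx w) (h.inner_normal x hx w)

lemma fderiv_apply_eq (x w : ℝ × ℝ) :
    fderiv ℝ g x w = w.1 • fderiv ℝ g x (1, 0) + w.2 • fderiv ℝ g x (0, 1) := by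
  rw [← map_smul, ← map_smul, ← map_add]
  congr 1
  ext <;> simp

/-- The components of `Dg w` and `Dg w'` in the frame have the orientation of `(w, w')`. -/
lemma wedge_fderiv_pos (h : IsAdaptedFrame O g N E F) {x : ℝ × ℝ} (hx : x ∈ O) {w w' : ℝ × ℝ}
    (hw : 0 < w.1 * w'.2 - w.2 * w'.1) :
    0 < ⟪E x, fderiv ℝ g x w⟫ * ⟪F x, fderiv ℝ g x w'⟫ -
      ⟪F x, fderiv ℝ g x w⟫ * ⟪E x, fderiv ℝ g x w'⟫ := by
  rw [fderiv_apply_eq x w, fderiv_apply_eq x w']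
  simp only [inner_add_right, inner_smul_right, h.inner_snd x hx]
  have := mul_pos hw (mul_pos (h.inner_fst x hx) (h.inner_snd_snd x hx))
  nlinarith

/-- Geodesic curvature is the rotation of the velocity aE + bF against the frame, (ab' - ba')/(a² +
b²), plus the rotation of the frame itself, the connection form. -/
lemma edgeCurv_integrand_eq (h : IsAdaptedFrame O g N E F) {x w w' : ℝ × ℝ}
    (hw : 0 < w.1 * w'.2 - w.2 * w'.1) {u : ℝ} (hu : x + u • w ∈ O) :
    ⟪deriv (deriv fun t : ℝ => g (x + t • w)) u,
      conormal (fderiv ℝ g (x + u • w) w) (fderiv ℝ g (x + u • w) w')⟫ /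
        ‖fderiv ℝ g (x + u • w) w‖ =
    (⟪E (x + u • w), fderiv ℝ g (x + u • w) w⟫ *
        fderiv ℝ (fun y => ⟪F y, fderiv ℝ g y w⟫) (x + u • w) w -
      ⟪F (x + u • w), fderiv ℝ g (x + u • w) w⟫ *
        fderiv ℝ (fun y => ⟪E y, fderiv ℝ g y w⟫) (x + u • w) w) /
      (⟪E (x + u • w), fderiv ℝ g (x + u • w) w⟫ ^ 2 +
        ⟪F (x + u • w), fderiv ℝ g (x + u • w) w⟫ ^ 2) + connForm E F w (x + u • w) := by
  set X : ℝ × ℝ → E4 := fun y => fderiv ℝ g y w with hX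
  have hXs : ContDiffOn ℝ ∞ X O := contDiffOn_fderiv_apply h.isOpen h.contDiffOn w
  have hline : ∀ t : ℝ, HasDerivAt (fun t : ℝ => x + t • w) w t := by
    intro t
    simpa using ((hasDerivAt_id t).smul_const w).const_add x
  have hd1 : deriv (fun t : ℝ => g (x + t • w)) =ᶠ[𝓝 u] fun t => X (x + t • w) := by
    have : ∀ᶠ t in 𝓝 u, x + t • w ∈ O :=
      (hline u).continuousAt.eventually_mem (h.isOpen.mem_nhds hu)
    filter_upwards [this] with t ht
    exact ((differentiableAt h.isOpen h.contDiffOn ht).hasFDerivAt.comp_hasDerivAt t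
      (hline t)).deriv
  have hd2 : deriv (deriv fun t : ℝ => g (x + t • w)) u = fderiv ℝ X (x + u • w) w := by
    rw [hd1.deriv_eq]
    exact ((differentiableAt h.isOpen hXs hu).hasFDerivAt.comp_hasDerivAt u (hline u)).deriv
  rw [hd2]
  set y := x + u • w with hy
  have hyO : y ∈ O := hu
  have dE := differentiableAt h.isOpen h.contDiffOn_fst hyO
  have dF := differentiableAt h.isOpen h.contDiffOn_snd hyO
  have dX := differentiableAt h.isOpen hXs hyO
  have e1 : fderiv ℝ (fun y => ⟪E y, X y⟫) y w = ⟪E y, fderiv ℝ X y w⟫ + ⟪fderiv ℝ E y w, X y⟫ :=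
    fderiv_inner_apply ℝ dE dX w
  have e2 : fderiv ℝ (fun y => ⟪F y, X y⟫) y w = ⟪F y, fderiv ℝ X y w⟫ + ⟪fderiv ℝ F y w, X y⟫ :=
    fderiv_inner_apply ℝ dF dX w
  have e3 : X y = ⟪E y, X y⟫ • E y + ⟪F y, X y⟫ • F y := h.fderiv_eq hyO w
  have e4 := inner_fderiv_add h.isOpen h.contDiffOn_fst h.contDiffOn_fst
    (fun z hz => h.inner_self_fst hz) hyO w
  have e5 := inner_fderiv_add h.isOpen h.contDiffOn_snd h.contDiffOn_snd
    (fun z hz => h.inner_self_snd hz) hyO w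
  have e6 := inner_fderiv_add h.isOpen h.contDiffOn_fst h.contDiffOn_snd
    (fun z hz => h.inner_fst_snd hz) hyO w
  rw [real_inner_comm (E y)] at e4
  rw [real_inner_comm (F y)] at e5
  have e7 : ⟪fderiv ℝ E y w, X y⟫ = ⟪F y, X y⟫ * connForm E F w y := by
    conv_lhs => rw [e3]
    rw [inner_add_right, inner_smul_right, inner_smul_right, real_inner_comm (E y), connForm]
    have : ⟪E y, fderiv ℝ E y w⟫ = 0 := by linarith
    rw [this]; ring
  have e8 : ⟪fderiv ℝ F y w, X y⟫ = -(⟪E y, X y⟫ * connForm E F w y) := by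
    conv_lhs => rw [e3]
    rw [inner_add_right, inner_smul_right, inner_smul_right, connForm, real_inner_comm (F y),
      real_inner_comm (E y)]
    have : ⟪F y, fderiv ℝ F y w⟫ = 0 := by linarith
    rw [this, show ⟪E y, fderiv ℝ F y w⟫ = -⟪fderiv ℝ E y w, F y⟫ by linarith]
    ring
  rw [e7] at e1
  rw [e8] at e2
  have hpos := h.wedge_fderiv_pos hyO hw
  have e9 := conormal_eq (h.inner_self_fst hyO) (h.inner_self_snd hyO) (h.inner_fst_snd hyO) e3
    (h.fderiv_eq hyO w') hpos
  have hX' : fderiv ℝ g y w = X y := rfl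
  rw [hX'] at hpos ⊢
  rw [e9]
  set a := ⟪E y, X y⟫ with ha
  set b := ⟪F y, X y⟫ with hb
  have hab : 0 < a ^ 2 + b ^ 2 := by
    rcases eq_or_ne a 0 with h0 | h0
    · have : b ≠ 0 := by intro h1; rw [h0, h1] at hpos; simp at hpos
      positivity
    · positivity
  have hnX : ‖X y‖ = √(a ^ 2 + b ^ 2) := by
    rw [← Real.sqrt_sq (norm_nonneg _), ← real_inner_self_eq_norm_sq]
    conv_lhs => rw [e3]
    have h3 := h.inner_fst_snd hyO
    have h4 : ⟪F y, E y⟫ = 0 := by rw [real_inner_comm]; exact h3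
    simp only [inner_add_left, inner_add_right, inner_smul_left, inner_smul_right,
      h.inner_self_fst hyO, h.inner_self_snd hyO, h3, h4]
    congr 1
    simp
    ring
  rw [hnX, inner_smul_right, inner_add_right, inner_smul_right, inner_smul_right,
    real_inner_comm (E y), real_inner_comm (F y)]
  have hs : √(a ^ 2 + b ^ 2) ≠ 0 := by positivity
  have hss : √(a ^ 2 + b ^ 2) ^ 2 = a ^ 2 + b ^ 2 := Real.sq_sqrt hab.le
  rw [show ⟪E y, fderiv ℝ X y w⟫ = fderiv ℝ (fun y => ⟪E y, X y⟫) y w -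
      b * connForm E F w y by linarith,
    show ⟪F y, fderiv ℝ X y w⟫ = fderiv ℝ (fun y => ⟪F y, X y⟫) y w +
      a * connForm E F w y by linarith]
  field_simp
  rw [hss]
  ring

end IsAdaptedFrame

namespace IsAdaptedFrame

variable {O : Set (ℝ × ℝ)} {g N E F : ℝ × ℝ → E4}

lemma inner_snd_fderiv (h : IsAdaptedFrame O g N E F) {x : ℝ × ℝ} (hx : x ∈ O) (w : ℝ × ℝ) :
    ⟪F x, fderiv ℝ g x w⟫ = w.2 * ⟪F x, fderiv ℝ g x (0, 1)⟫ := by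
  rw [fderiv_apply_eq x w, inner_add_right, inner_smul_right, inner_smul_right, h.inner_snd x hx]
  ring

lemma angle_fst_eq (h : IsAdaptedFrame O g N E F) {x : ℝ × ℝ} (hx : x ∈ O) (Y : E4) :
    InnerProductGeometry.angle (E x) Y = InnerProductGeometry.angle (fderiv ℝ g x (1, 0)) Y := by
  rw [h.fderiv_eq hx (1, 0), h.inner_snd x hx, zero_smul, add_zero,
    InnerProductGeometry.angle_smul_left_of_pos _ _ (h.inner_fst x hx)]

lemma fderiv_snd_ne_zero (h : IsAdaptedFrame O g N E F) {x : ℝ × ℝ} (hx : x ∈ O) :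
    fderiv ℝ g x (0, 1) ≠ 0 := by
  intro h0
  have := h.inner_snd_snd x hx
  rw [h0, inner_zero_right] at this
  exact this.false

lemma continuousOn_line (x w : ℝ × ℝ) {η : ℝ × ℝ → ℝ} (hη : ContinuousOn η O)
    (hl : ∀ u ∈ Icc (0 : ℝ) 1, x + u • w ∈ O) :
    IntervalIntegrable (fun u : ℝ => η (x + u • w)) volume 0 1 := by
  refine ContinuousOn.intervalIntegrable ?_
  rw [uIcc_of_le zero_le_one]
  exact hη.comp (by fun_prop) fun u hu => hl u hu

/-- The velocity of a horizontal edge is a multiple of E, so it does not turn against the frame. -/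
lemma edgeCurv_of_snd_eq_zero (h : IsAdaptedFrame O g N E F) {x w w' : ℝ × ℝ}
    (hw : 0 < w.1 * w'.2 - w.2 * w'.1) (hl : ∀ u ∈ Icc (0 : ℝ) 1, x + u • w ∈ O)
    (h0 : w.2 = 0) : edgeCurv g x w w' = ∫ u in (0 : ℝ)..1, connForm E F w (x + u • w) := by
  refine intervalIntegral.integral_congr fun u hu => ?_
  rw [uIcc_of_le zero_le_one] at hu
  have hb : ∀ y ∈ O, ⟪F y, fderiv ℝ g y w⟫ = 0 := fun y hy => by
    rw [h.inner_snd_fderiv hy, h0, zero_mul]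
  have hb' : (fun y => ⟪F y, fderiv ℝ g y w⟫) =ᶠ[𝓝 (x + u • w)] fun _ => 0 := by
    filter_upwards [h.isOpen.mem_nhds (hl u hu)] with y hy using hb y hy
  rw [h.edgeCurv_integrand_eq hw (hl u hu), hb'.fderiv_eq, hb _ (hl u hu)]
  simp

/-- On an edge that is not horizontal the component b has no zero, because F is orthogonal to ∂₁g
and ⟪F, ∂₂g⟫ > 0. So -arctan(a/b) is a primitive of the turning term on the whole edge and no
multiple of 2π has to be determined. -/
lemma edgeCurv_eq (h : IsAdaptedFrame O g N E F) {x w w' : ℝ × ℝ}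
    (hw : 0 < w.1 * w'.2 - w.2 * w'.1) (hl : ∀ u ∈ Icc (0 : ℝ) 1, x + u • w ∈ O)
    (h0 : w.2 ≠ 0) : edgeCurv g x w w' =
      Real.arctan (⟪E x, fderiv ℝ g x w⟫ / ⟪F x, fderiv ℝ g x w⟫) -
      Real.arctan (⟪E (x + w), fderiv ℝ g (x + w) w⟫ / ⟪F (x + w), fderiv ℝ g (x + w) w⟫) +
      ∫ u in (0 : ℝ)..1, connForm E F w (x + u • w) := by
  set a : ℝ × ℝ → ℝ := fun y => ⟪E y, fderiv ℝ g y w⟫ with ha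
  set b : ℝ × ℝ → ℝ := fun y => ⟪F y, fderiv ℝ g y w⟫ with hb
  have hXs : ContDiffOn ℝ ∞ (fun y => fderiv ℝ g y w) O :=
    contDiffOn_fderiv_apply h.isOpen h.contDiffOn w
  have has : ContDiffOn ℝ ∞ a O := h.contDiffOn_fst.inner ℝ hXs
  have hbs : ContDiffOn ℝ ∞ b O := h.contDiffOn_snd.inner ℝ hXs
  have hb0 : ∀ y ∈ O, b y ≠ 0 := fun y hy => by
    simp only [hb]
    rw [h.inner_snd_fderiv hy]
    exact mul_ne_zero h0 (h.inner_snd_snd y hy).ne'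
  have hda : ContinuousOn (fun y => fderiv ℝ a y w) O :=
    ((has.fderiv_of_isOpen (m := ∞) h.isOpen (by simp)).continuousOn).clm_apply
      continuousOn_const
  have hdb : ContinuousOn (fun y => fderiv ℝ b y w) O :=
    ((hbs.fderiv_of_isOpen (m := ∞) h.isOpen (by simp)).continuousOn).clm_apply
      continuousOn_const
  set q : ℝ × ℝ → ℝ := fun y => (a y * fderiv ℝ b y w - b y * fderiv ℝ a y w) /
    (a y ^ 2 + b y ^ 2) with hq
  have hpos : ∀ y ∈ O, 0 < a y ^ 2 + b y ^ 2 := fun y hy => by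
    have := hb0 y hy; positivity
  have hqc : ContinuousOn q O :=
    ((has.continuousOn.mul hdb).sub (hbs.continuousOn.mul hda)).div
      ((has.continuousOn.pow 2).add (hbs.continuousOn.pow 2)) fun y hy => (hpos y hy).ne'
  have hsum : edgeCurv g x w w' = (∫ u in (0 : ℝ)..1, q (x + u • w)) +
      ∫ u in (0 : ℝ)..1, connForm E F w (x + u • w) := by
    rw [← intervalIntegral.integral_add (continuousOn_line x w hqc hl)
      (continuousOn_line x w (h.contDiffOn_connForm w).continuousOn hl)]
    refine intervalIntegral.integral_congr fun u hu => ?_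
    rw [uIcc_of_le zero_le_one] at hu
    exact h.edgeCurv_integrand_eq hw (hl u hu)
  rw [hsum, add_left_inj]
  have hline : ∀ t : ℝ, HasDerivAt (fun t : ℝ => x + t • w) w t := by
    intro t
    simpa using ((hasDerivAt_id t).smul_const w).const_add x
  have hderiv : ∀ u ∈ uIcc (0 : ℝ) 1,
      HasDerivAt (fun u : ℝ => -Real.arctan (a (x + u • w) / b (x + u • w))) (q (x + u • w)) u := by
    intro u hu
    rw [uIcc_of_le zero_le_one] at hu
    have hO := hl u hu
    have d1 : HasDerivAt (fun u : ℝ => a (x + u • w)) (fderiv ℝ a (x + u • w) w) u := by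
      have hd : DifferentiableAt ℝ a (x + u • w) :=
        (has.contDiffAt (h.isOpen.mem_nhds hO)).differentiableAt (by simp)
      exact hd.hasFDerivAt.comp_hasDerivAt u (hline u)
    have d2 : HasDerivAt (fun u : ℝ => b (x + u • w)) (fderiv ℝ b (x + u • w) w) u := by
      have hd : DifferentiableAt ℝ b (x + u • w) :=
        (hbs.contDiffAt (h.isOpen.mem_nhds hO)).differentiableAt (by simp)
      exact hd.hasFDerivAt.comp_hasDerivAt u (hline u)
    have h1 := hb0 _ hO
    refine (d1.fun_div d2 h1).arctan.fun_neg.congr_deriv ?_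
    have h2 := hpos _ hO
    have h2' : b (x + u • w) ^ 2 + a (x + u • w) ^ 2 ≠ 0 := by rw [add_comm]; exact h2.ne'
    rw [hq]
    field_simp
    ring
  rw [intervalIntegral.integral_eq_sub_of_hasDerivAt hderiv (continuousOn_line x w hqc hl)]
  simp
  ring

/-- The local Gauss–Bonnet formula for a triangle. -/
theorem integral_curvDensity (h : IsAdaptedFrame O g N E F) (hΔ : stdTriangle ⊆ O) :
    ∫ x in stdTriangle, curvDensity g N E F x =
      InnerProductGeometry.angle (fderiv ℝ g (0, 0) (1, 0)) (fderiv ℝ g (0, 0) (0, 1)) +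
      InnerProductGeometry.angle (fderiv ℝ g (1, 0) (-1, 1)) (fderiv ℝ g (1, 0) (-1, 0)) +
      InnerProductGeometry.angle (fderiv ℝ g (0, 1) (0, -1)) (fderiv ℝ g (0, 1) (1, -1)) -
      Real.pi - (edgeCurv g (0, 0) (1, 0) (0, 1) + edgeCurv g (1, 0) (-1, 1) (-1, 0) +
        edgeCurv g (0, 1) (0, -1) (1, -1)) := by
  set η₁ := connForm E F (1, 0) with hη₁
  set η₂ := connForm E F (0, 1) with hη₂
  have hc1 : ContDiffOn ℝ 1 η₁ O := (h.contDiffOn_connForm _).of_le ENat.LEInfty.out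
  have hc2 : ContDiffOn ℝ 1 η₂ O := (h.contDiffOn_connForm _).of_le ENat.LEInfty.out
  have hconn : ∀ w y, connForm E F w y = w.1 * η₁ y + w.2 * η₂ y := by
    intro w y
    have : fderiv ℝ E y w = w.1 • fderiv ℝ E y (1, 0) + w.2 • fderiv ℝ E y (0, 1) :=
      fderiv_apply_eq y w
    rw [connForm, this, inner_add_left, inner_smul_left, inner_smul_left]
    rfl
  have i00 : ((0, 0) : ℝ × ℝ) ∈ O := hΔ ⟨by simp, by simp, by simp⟩
  have i10 : ((1, 0) : ℝ × ℝ) ∈ O := hΔ ⟨by simp, by simp, by simp⟩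
  have i01 : ((0, 1) : ℝ × ℝ) ∈ O := hΔ ⟨by simp, by simp, by simp⟩
  have l1 : ∀ u ∈ Icc (0 : ℝ) 1, ((0, 0) : ℝ × ℝ) + u • ((1, 0) : ℝ × ℝ) ∈ O := fun u hu =>
    hΔ ⟨by simpa using hu.1, by simp, by simpa using hu.2⟩
  have l2 : ∀ u ∈ Icc (0 : ℝ) 1, ((1, 0) : ℝ × ℝ) + u • ((-1, 1) : ℝ × ℝ) ∈ O := fun u hu =>
    hΔ ⟨by simp; linarith [hu.2], by simpa using hu.1, by simp⟩
  have l3 : ∀ u ∈ Icc (0 : ℝ) 1, ((0, 1) : ℝ × ℝ) + u • ((0, -1) : ℝ × ℝ) ∈ O := fun u hu =>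
    hΔ ⟨by simp, by simp; linarith [hu.2], by simpa using hu.1⟩
  have e1 := h.edgeCurv_of_snd_eq_zero (w' := (0, 1)) (by simp) l1 rfl
  have e2 := h.edgeCurv_eq (w' := (-1, 0)) (by simp) l2 (by simp)
  have e3 := h.edgeCurv_eq (w' := (1, -1)) (by simp) l3 (by simp)
  have arc2 : ∀ x ∈ O, Real.arctan (⟪E x, fderiv ℝ g x (-1, 1)⟫ / ⟪F x, fderiv ℝ g x (-1, 1)⟫) =
      Real.pi / 2 - InnerProductGeometry.angle (fderiv ℝ g x (1, 0)) (fderiv ℝ g x (-1, 1)) := by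
    intro x hx
    rw [← h.angle_fst_eq hx, angle_frame (h.inner_self_fst hx) (h.inner_self_snd hx)
      (h.inner_fst_snd hx) (h.fderiv_eq hx _)]
    · ring
    · rw [h.inner_snd_fderiv hx]; simpa using h.inner_snd_snd x hx
  have arc3 : ∀ x ∈ O, Real.arctan (⟪E x, fderiv ℝ g x (0, -1)⟫ / ⟪F x, fderiv ℝ g x (0, -1)⟫) =
      Real.pi / 2 - InnerProductGeometry.angle (fderiv ℝ g x (1, 0)) (fderiv ℝ g x (0, 1)) := by
    intro x hx
    have : fderiv ℝ g x (0, -1) = -fderiv ℝ g x (0, 1) := by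
      rw [← map_neg]; simp
    rw [this, inner_neg_right, inner_neg_right, neg_div_neg_eq,
      ← h.angle_fst_eq hx, angle_frame (h.inner_self_fst hx) (h.inner_self_snd hx)
      (h.inner_fst_snd hx) (h.fderiv_eq hx (0, 1)) (h.inner_snd_snd x hx)]
    ring
  simp only [show ((1, 0) : ℝ × ℝ) + (-1, 1) = (0, 1) by simp, arc2 _ i10, arc2 _ i01] at e2
  simp only [show ((0, 1) : ℝ × ℝ) + (0, -1) = (0, 0) by simp, arc3 _ i00, arc3 _ i01] at e3
  have g10 : InnerProductGeometry.angle (fderiv ℝ g (1, 0) (-1, 1)) (fderiv ℝ g (1, 0) (-1, 0)) =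
      Real.pi - InnerProductGeometry.angle (fderiv ℝ g (1, 0) (1, 0))
        (fderiv ℝ g (1, 0) (-1, 1)) := by
    rw [show ((-1, 0) : ℝ × ℝ) = -(1, 0) by simp, map_neg, InnerProductGeometry.angle_neg_right,
      InnerProductGeometry.angle_comm]
  -- The images of (1, 0) and (0, 1) and their difference are the sides of a Euclidean triangle; its
  -- angle sum π expresses the corner at (0, 1) by angles measured from ∂₁g.
  have g01 : InnerProductGeometry.angle (fderiv ℝ g (0, 1) (0, -1)) (fderiv ℝ g (0, 1) (1, -1)) =
      InnerProductGeometry.angle (fderiv ℝ g (0, 1) (1, 0)) (fderiv ℝ g (0, 1) (-1, 1)) -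
      InnerProductGeometry.angle (fderiv ℝ g (0, 1) (1, 0)) (fderiv ℝ g (0, 1) (0, 1)) := by
    have h1 := InnerProductGeometry.angle_add_angle_sub_add_angle_sub_eq_pi
      (fderiv ℝ g (0, 1) (1, 0)) (h.fderiv_snd_ne_zero i01)
    have h2 : fderiv ℝ g (0, 1) (-1, 1) =
        -(fderiv ℝ g (0, 1) (1, 0) - fderiv ℝ g (0, 1) (0, 1)) := by
      rw [← map_sub, ← map_neg]; simp
    have h3 : fderiv ℝ g (0, 1) (0, -1) = -fderiv ℝ g (0, 1) (0, 1) := by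
      rw [← map_neg]; simp
    have h4 : fderiv ℝ g (0, 1) (1, -1) =
        -(fderiv ℝ g (0, 1) (0, 1) - fderiv ℝ g (0, 1) (1, 0)) := by
      rw [← map_sub, ← map_neg]; simp
    rw [h2, h3, h4, InnerProductGeometry.angle_neg_neg, InnerProductGeometry.angle_neg_right]
    linarith
  have i1 : ContinuousOn (fun x => fderiv ℝ η₂ x (1, 0)) O :=
    ((hc2.continuousOn_fderiv_of_isOpen h.isOpen le_rfl)).clm_apply continuousOn_const
  have i2 : ContinuousOn (fun x => fderiv ℝ η₁ x (0, 1)) O :=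
    ((hc1.continuousOn_fderiv_of_isOpen h.isOpen le_rfl)).clm_apply continuousOn_const
  have hint : ∫ x in stdTriangle, curvDensity g N E F x =
      (∫ x in stdTriangle, fderiv ℝ η₁ x (0, 1)) - ∫ x in stdTriangle, fderiv ℝ η₂ x (1, 0) := by
    rw [← integral_sub ((i2.mono hΔ).integrableOn_compact isCompact_stdTriangle)
      ((i1.mono hΔ).integrableOn_compact isCompact_stdTriangle)]
    refine setIntegral_congr_fun isClosed_stdTriangle.measurableSet fun x hx => ?_
    have := h.curl_connForm (hΔ hx)
    linarith
  -- Green's formula on the triangle: its boundary terms are the connection form along the three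
  -- edges, which cancels against the same terms in the edge curvatures. Only the angles remain.
  rw [hint, integral_stdTriangle_fderiv_fst h.isOpen hΔ hc2,
    integral_stdTriangle_fderiv_snd h.isOpen hΔ hc1, g10, g01, e1, e2, e3]
  simp only [hconn]
  have j1 := continuousOn_line (O := O) (1, 0) (-1, 1) hc1.continuousOn l2
  have j2 := continuousOn_line (O := O) (1, 0) (-1, 1) hc2.continuousOn l2
  rw [intervalIntegral.integral_add (j1.const_mul _) (j2.const_mul _)]
  simp only [intervalIntegral.integral_const_mul]
  have k1 : ∫ u in (0 : ℝ)..1, η₁ ((1, 0) + u • (-1, 1)) = ∫ a in (0 : ℝ)..1, η₁ (a, 1 - a) := by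
    have := intervalIntegral.integral_comp_sub_left (fun a : ℝ => η₁ (a, 1 - a)) (1 : ℝ)
      (a := 0) (b := 1)
    simp only [sub_self, sub_zero, sub_sub_cancel] at this
    rw [← this]
    refine intervalIntegral.integral_congr fun u _ => ?_
    simp [sub_eq_add_neg]
  have k2 : ∫ u in (0 : ℝ)..1, η₂ ((1, 0) + u • (-1, 1)) = ∫ b in (0 : ℝ)..1, η₂ (1 - b, b) := by
    refine intervalIntegral.integral_congr fun u _ => ?_
    simp [sub_eq_add_neg]
  have k3 : ∫ u in (0 : ℝ)..1, η₂ ((0, 1) + u • (0, -1)) = ∫ b in (0 : ℝ)..1, η₂ (0, b) := by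
    have := intervalIntegral.integral_comp_sub_left (fun a : ℝ => η₂ (0, a)) (1 : ℝ)
      (a := 0) (b := 1)
    simp only [sub_self, sub_zero] at this
    rw [← this]
    refine intervalIntegral.integral_congr fun u _ => ?_
    simp [sub_eq_add_neg]
  have k4 : ∫ u in (0 : ℝ)..1, η₁ ((0, 0) + u • (1, 0)) = ∫ a in (0 : ℝ)..1, η₁ (a, 0) := by
    refine intervalIntegral.integral_congr fun u _ => ?_
    simp
  simp only [zero_mul, add_zero, zero_add, one_mul]
  rw [intervalIntegral.integral_const_mul, k1, k2, k3, k4]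
  ring

end IsAdaptedFrame

/-- Gram–Schmidt on the coordinate frame of a parametrized surface. -/
lemma exists_isAdaptedFrame {O : Set (ℝ × ℝ)} {g N : ℝ × ℝ → E4} (hO : IsOpen O)
    (hg : ContDiffOn ℝ ∞ g O) (hN : ContDiffOn ℝ ∞ N O) (hg1 : ∀ x ∈ O, ‖g x‖ = 1)
    (hN1 : ∀ x ∈ O, ‖N x‖ = 1) (hgN : ∀ x ∈ O, ⟪g x, N x⟫ = 0)
    (hNg : ∀ x ∈ O, ∀ w, ⟪N x, fderiv ℝ g x w⟫ = 0)
    (hinj : ∀ x ∈ O, ∀ w, fderiv ℝ g x w = 0 → w = 0) : ∃ E F, IsAdaptedFrame O g N E F := by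
  set X : ℝ × ℝ → E4 := fun x => fderiv ℝ g x (1, 0) with hX
  set Y : ℝ × ℝ → E4 := fun x => fderiv ℝ g x (0, 1) with hY
  have hXs : ContDiffOn ℝ ∞ X O := IsAdaptedFrame.contDiffOn_fderiv_apply hO hg _
  have hYs : ContDiffOn ℝ ∞ Y O := IsAdaptedFrame.contDiffOn_fderiv_apply hO hg _
  have hX0 : ∀ x ∈ O, X x ≠ 0 := fun x hx h0 => by simpa using hinj x hx _ h0
  set E : ℝ × ℝ → E4 := fun x => ‖X x‖⁻¹ • X x with hE
  have hEs : ContDiffOn ℝ ∞ E O := ((hXs.norm ℝ hX0).inv fun x hx => norm_ne_zero_iff.2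
    (hX0 x hx)).smul hXs
  have hE1 : ∀ x ∈ O, ‖E x‖ = 1 := fun x hx => norm_smul_inv_norm (𝕜 := ℝ) (hX0 x hx)
  set V : ℝ × ℝ → E4 := fun x => Y x - ⟪E x, Y x⟫ • E x with hV
  have hVs : ContDiffOn ℝ ∞ V O := hYs.sub ((hEs.inner ℝ hYs).smul hEs)
  have hV0 : ∀ x ∈ O, V x ≠ 0 := fun x hx h0 => by
    have h1 : fderiv ℝ g x ((0, 1) - (⟪E x, Y x⟫ * ‖X x‖⁻¹) • (1, 0)) = 0 := by
      rw [map_sub, map_smul, mul_smul]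
      exact h0
    simpa using hinj x hx _ h1
  have hEV : ∀ x ∈ O, ⟪E x, V x⟫ = 0 := fun x hx => by
    simp only [hV]
    rw [inner_sub_right, inner_smul_right, real_inner_self_eq_norm_sq, hE1 x hx]
    ring
  have hgD : ∀ x ∈ O, ∀ w, ⟪g x, fderiv ℝ g x w⟫ = 0 := fun x hx w => by
    have := inner_fderiv_add hO hg hg (c := 1)
      (fun y hy => by rw [real_inner_self_eq_norm_sq, hg1 y hy, one_pow]) hx w
    rw [real_inner_comm (g x)] at this
    linarith
  refine ⟨E, fun x => ‖V x‖⁻¹ • V x, ⟨hO, hg, hN, hEs, ((hVs.norm ℝ hV0).inv fun x hx =>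
    norm_ne_zero_iff.2 (hV0 x hx)).smul hVs, fun x hx => ?_, hNg, fun x hx => ?_, fun x hx => ?_,
    fun x hx => ?_⟩⟩
  · rw [orthonormal_four_iff]
    have h1 := norm_smul_inv_norm (𝕜 := ℝ) (hV0 x hx)
    have hgE : ⟪g x, E x⟫ = 0 := by simp only [hE]; rw [inner_smul_right, hgD x hx, mul_zero]
    have hNE : ⟪N x, E x⟫ = 0 := by simp only [hE]; rw [inner_smul_right, hNg x hx, mul_zero]
    refine ⟨⟨?_, ?_, ?_, ?_⟩, hgN x hx, hgE, ?_, hNE, ?_, ?_⟩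
    · rw [real_inner_self_eq_norm_sq, hg1 x hx, one_pow]
    · rw [real_inner_self_eq_norm_sq, hN1 x hx, one_pow]
    · rw [real_inner_self_eq_norm_sq, hE1 x hx, one_pow]
    · rw [real_inner_self_eq_norm_sq]
      simp only [RCLike.ofReal_real_eq_id, id_eq] at h1
      rw [h1, one_pow]
    · rw [inner_smul_right, inner_sub_right, hgD x hx, inner_smul_right, hgE]; simp
    · rw [inner_smul_right, inner_sub_right, hNg x hx, inner_smul_right, hNE]; simp
    · rw [inner_smul_right, hEV x hx, mul_zero]
  · simp only [hE]
    rw [inner_smul_left, real_inner_self_eq_norm_sq]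
    have := norm_pos_iff.2 (hX0 x hx)
    simp only [conj_trivial]
    positivity
  · have h1 : X x = ‖X x‖ • E x := by
      simp only [hE]
      rw [smul_smul, mul_inv_cancel₀ (norm_ne_zero_iff.2 (hX0 x hx)), one_smul]
    change ⟪_, X x⟫ = 0
    rw [h1, inner_smul_right, inner_smul_left, real_inner_comm, hEV x hx]
    simp
  · have h1 : Y x = V x + ⟪E x, Y x⟫ • E x := by simp [hV]
    change 0 < ⟪_, Y x⟫
    rw [h1, inner_smul_left, inner_add_right, inner_smul_right, real_inner_comm (E x),
      hEV x hx, real_inner_self_eq_norm_sq]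
    have := norm_pos_iff.2 (hV0 x hx)
    simp only [conj_trivial, mul_zero, add_zero]
    positivity

/-! ### The degree integral in tubular coordinates -/

/-- Polar coordinates: for a function of degree zero the radial integral is ∫₀¹ r³ dr = 1/4. This
moves the degree integral to open sets of ℝ⁴, where the change of variables formula applies. -/
lemma integral_sphereMeasure_eq {D : E4 → ℝ} (hD : ∀ (x : E4) (r : ℝ), 0 < r → D (r • x) = D x) :
    ∫ x : S3, D x ∂sphereMeasure = 4 * ∫ y in Metric.ball (0 : E4) 1, D y := by
  have hmp := Measure.measurePreserving_homeomorphUnitSphereProd (volume : Measure E4)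
  have hemb := (homeomorphUnitSphereProd E4).measurableEmbedding
  set ind : Ioi (0 : ℝ) → ℝ := indicator (Iio ⟨1, mem_Ioi.2 one_pos⟩) 1 with hind
  have h1 : ∫ y in Metric.ball (0 : E4) 1, D y =
      ∫ y : ({0}ᶜ : Set E4), (Metric.ball (0 : E4) 1).indicator D y ∂(Measure.comap Subtype.val (volume : Measure E4)) := by
    rw [← integral_indicator measurableSet_ball]
    have : (∫ y, (Metric.ball (0 : E4) 1).indicator D y) =
        ∫ y in ({0}ᶜ : Set E4), (Metric.ball (0 : E4) 1).indicator D y := by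
      rw [restrict_compl_singleton]
    rw [this, ← integral_subtype_comap (measurableSet_singleton _).compl]
  have h2 : ∀ y : ({0}ᶜ : Set E4), (Metric.ball (0 : E4) 1).indicator D y =
      (fun z : S3 × Ioi (0 : ℝ) => D z.1 * ind z.2) (homeomorphUnitSphereProd E4 y) := by
    intro y
    have hy : (y : E4) ≠ 0 := y.2
    have hpos := norm_pos_iff.2 hy
    simp only [hind]
    by_cases hb : ‖(y : E4)‖ < 1
    · rw [indicator_of_mem (by simpa using hb), indicator_of_mem, Pi.one_apply, mul_one,
        homeomorphUnitSphereProd_apply_fst_coe, hD _ _ (inv_pos.2 hpos)]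
      rw [mem_Iio, ← Subtype.coe_lt_coe]
      simpa using hb
    · rw [indicator_of_notMem (by simpa using hb), indicator_of_notMem, mul_zero]
      rw [mem_Iio, ← Subtype.coe_lt_coe]
      simpa using hb
  have h4 := h1.trans ((integral_congr_ae (Eventually.of_forall h2)).trans
    ((hmp.integral_comp hemb (fun z : S3 × Ioi (0 : ℝ) => D z.1 * ind z.2)).trans
      (integral_prod_mul (fun x : S3 => D x) ind)))
  rw [h4]
  have h3 : ∫ r, ind r ∂(Measure.volumeIoiPow (Module.finrank ℝ E4 - 1)) = 1 / 4 := by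
    rw [hind, integral_indicator measurableSet_Iio]
    simp only [Pi.one_apply, integral_const, smul_eq_mul, mul_one, measureReal_restrict_apply_univ]
    rw [measureReal_def, Measure.volumeIoiPow_apply_Iio]
    simp
    norm_num
  rw [h3]
  ring

lemma volume_real_ball_E4 : volume.real (Metric.ball (0 : E4) 1) = Real.pi ^ 2 / 2 := by
  rw [measureReal_def, InnerProductSpace.volume_ball_of_dim_even (k := 2) (by simp)]
  simp [Nat.factorial]
  positivity

/-- Euclidean four-space as a product. -/
noncomputable def splitE4 : E4 ≃L[ℝ] (ℝ × ℝ) × (ℝ × ℝ) :=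
  LinearEquiv.toContinuousLinearEquiv
  { toFun z := ((z 0, z 1), (z 2, z 3))
    map_add' x y := rfl
    map_smul' c x := rfl
    invFun v := !₂[v.1.1, v.1.2, v.2.1, v.2.2]
    left_inv z := by ext i; fin_cases i <;> rfl
    right_inv v := rfl }

lemma splitE4_apply (z : E4) : splitE4 z = ((z 0, z 1), (z 2, z 3)) := rfl

lemma measurePreserving_splitE4 : MeasurePreserving splitE4 := by
  have h1 : MeasurePreserving (WithLp.ofLp : E4 → Fin 4 → ℝ) :=
    PiLp.volume_preserving_ofLp (Fin 4)
  have h2 := volume_preserving_piFinSuccAbove (fun _ : Fin 4 => ℝ) 0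
  have h3 := volume_preserving_piFinSuccAbove (fun _ : Fin 3 => ℝ) 0
  have h4 := volume_preserving_finTwoArrow ℝ
  have h5 := ((MeasurePreserving.id (volume : Measure ℝ)).prod
    (((MeasurePreserving.id (volume : Measure ℝ)).prod h4).comp h3)).comp (h2.comp h1)
  exact (measurePreserving_prodAssoc volume volume volume).symm.comp h5

/-- The determinant of an endomorphism in terms of a fixed orthonormal basis. -/
lemma exists_det_eq_mul_det {a b c d : E4} (h : Orthonormal ℝ ![a, b, c, d]) :
    ∃ o : ℝ, |o| = 1 ∧ ∀ T : E4 →L[ℝ] E4, T.det = o * Matrix.det (Matrix.of fun i j : Fin 4 =>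
      ⟪![a, b, c, d] i, T (EuclideanSpace.single j 1)⟫) := by
  set B := basisOfOrthonormalOfCardEqFinrank h (by simp) with hB
  have hBo : Orthonormal ℝ B := by rw [hB, coe_basisOfOrthonormalOfCardEqFinrank]; exact h
  set Bo := B.toOrthonormalBasis hBo with hBod
  set e := EuclideanSpace.basisFun (Fin 4) ℝ with he
  have ho := Bo.det_to_matrix_orthonormalBasis_real e
  have hsq : Bo.toBasis.det e * Bo.toBasis.det e = 1 := by rcases ho with h | h <;> rw [h] <;> norm_num
  refine ⟨Bo.toBasis.det e, by rcases ho with h | h <;> rw [h] <;> simp, fun T => ?_⟩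
  have h1 := Bo.toBasis.det_comp (T : E4 →ₗ[ℝ] E4) e
  have h2 : Bo.toBasis.det (T ∘ e) = Matrix.det (Matrix.of fun i j : Fin 4 =>
      ⟪![a, b, c, d] i, T (EuclideanSpace.single j 1)⟫) := by
    rw [Module.Basis.det_apply]
    congr 1
    ext i j
    rw [Module.Basis.toMatrix_apply, OrthonormalBasis.coe_toBasis_repr_apply,
      OrthonormalBasis.repr_apply_apply]
    simp [hBod, hB, he]
  rw [← h2]
  change Bo.toBasis.det (T ∘ e) = T.det * _ at h1
  rw [h1]
  linear_combination (-T.det) * hsq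

/-- The tube around a parametrized surface: `((a, b), (s, r)) ↦ r (cos (β s) g + sin (β s) N)`. -/
noncomputable def tubeParam (g N : ℝ × ℝ → E4) (β : ℝ → ℝ) (z : (ℝ × ℝ) × (ℝ × ℝ)) : E4 :=
  z.2.2 • (Real.cos (β z.2.1) • g z.1 + Real.sin (β z.2.1) • N z.1)

lemma hasFDerivAt_tubeParam {g N : ℝ × ℝ → E4} {β : ℝ → ℝ} {z : (ℝ × ℝ) × (ℝ × ℝ)}
    (hg : DifferentiableAt ℝ g z.1) (hN : DifferentiableAt ℝ N z.1)
    (hβ : DifferentiableAt ℝ β z.2.1) : ∃ T : (ℝ × ℝ) × (ℝ × ℝ) →L[ℝ] E4,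
      HasFDerivAt (tubeParam g N β) T z ∧ ∀ v, T v =
        z.2.2 • (Real.cos (β z.2.1) • fderiv ℝ g z.1 v.1 + Real.sin (β z.2.1) • fderiv ℝ N z.1 v.1) +
        (z.2.2 * (v.2.1 * deriv β z.2.1)) •
          (-Real.sin (β z.2.1) • g z.1 + Real.cos (β z.2.1) • N z.1) +
        v.2.2 • (Real.cos (β z.2.1) • g z.1 + Real.sin (β z.2.1) • N z.1) := by
  have h1 : HasFDerivAt (fun z : (ℝ × ℝ) × (ℝ × ℝ) => g z.1) _ z :=
    hg.hasFDerivAt.comp z hasFDerivAt_fst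
  have h2 : HasFDerivAt (fun z : (ℝ × ℝ) × (ℝ × ℝ) => N z.1) _ z :=
    hN.hasFDerivAt.comp z hasFDerivAt_fst
  have h3 : HasFDerivAt (fun z : (ℝ × ℝ) × (ℝ × ℝ) => z.2.1) _ z :=
    (hasFDerivAt_fst (𝕜 := ℝ) (p := z.2)).comp z hasFDerivAt_snd
  have h4 : HasFDerivAt (fun z : (ℝ × ℝ) × (ℝ × ℝ) => z.2.2) _ z :=
    (hasFDerivAt_snd (𝕜 := ℝ) (p := z.2)).comp z hasFDerivAt_snd
  have h5 : HasFDerivAt (fun z : (ℝ × ℝ) × (ℝ × ℝ) => β z.2.1) _ z :=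
    hβ.hasDerivAt.comp_hasFDerivAt z h3
  refine ⟨_, h4.smul ((h5.cos.smul h1).add (h5.sin.smul h2)), fun v => ?_⟩
  simp
  module

namespace IsAdaptedFrame

variable {O : Set (ℝ × ℝ)} {g N E F : ℝ × ℝ → E4}

lemma inner_self_fderiv_normal (h : IsAdaptedFrame O g N E F) {x : ℝ × ℝ} (hx : x ∈ O)
    (w : ℝ × ℝ) : ⟪g x, fderiv ℝ N x w⟫ = 0 := by
  have := inner_fderiv_add h.isOpen h.contDiffOn h.contDiffOn_normal
    (fun y hy => (orthonormal_four_iff.1 (h.orthonormal y hy)).2.1) hx w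
  rw [real_inner_comm (N x), h.inner_normal x hx] at this
  linarith

lemma inner_normal_fderiv_normal (h : IsAdaptedFrame O g N E F) {x : ℝ × ℝ} (hx : x ∈ O)
    (w : ℝ × ℝ) : ⟪N x, fderiv ℝ N x w⟫ = 0 := by
  have := inner_fderiv_add h.isOpen h.contDiffOn_normal h.contDiffOn_normal
    (fun y hy => (orthonormal_four_iff.1 (h.orthonormal y hy)).1.2.1) hx w
  rw [real_inner_comm (N x)] at this
  linarith

/-- The area density of the parallel surface at angle `θ`. -/
noncomputable def parallelDensity (g N E F : ℝ × ℝ → E4) (x : ℝ × ℝ) (θ : ℝ) : ℝ :=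
  wedge (E x) (F x)
    (Real.cos θ • fderiv ℝ g x (1, 0) + Real.sin θ • fderiv ℝ N x (1, 0))
    (Real.cos θ • fderiv ℝ g x (0, 1) + Real.sin θ • fderiv ℝ N x (0, 1))

/-- In the basis g, N, E, F the Jacobian matrix consists of two off-diagonal blocks: the angle and
the radius move the point in the plane of g, N, and the surface parameters move it in the plane of
E, F. The sign `o` is chosen before β, so it cancels in the quotient of the Jacobians of two angle
functions. -/
lemma exists_det_tubeParam_eq (h : IsAdaptedFrame O g N E F) {x : ℝ × ℝ} (hx : x ∈ O) :
    ∃ o : ℝ, |o| = 1 ∧ ∀ (β : ℝ → ℝ) (s r : ℝ), DifferentiableAt ℝ β s →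
      (fderiv ℝ (tubeParam g N β ∘ splitE4) (splitE4.symm (x, (s, r)))).det =
        o * (r ^ 3 * (deriv β s * parallelDensity g N E F x (β s))) := by
  obtain ⟨o, ho, hdet⟩ := exists_det_eq_mul_det (h.orthonormal x hx)
  refine ⟨-o, by rwa [abs_neg], fun β s r hβ => ?_⟩
  obtain ⟨T, hT, hTv⟩ := hasFDerivAt_tubeParam (z := (x, (s, r)))
    (differentiableAt h.isOpen h.contDiffOn hx)
    (differentiableAt h.isOpen h.contDiffOn_normal hx) hβ
  have h1 : HasFDerivAt (tubeParam g N β ∘ splitE4) (T ∘L (splitE4 : E4 →L[ℝ] _))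
      (splitE4.symm (x, (s, r))) := by
    refine HasFDerivAt.comp _ ?_ splitE4.hasFDerivAt
    rwa [ContinuousLinearEquiv.apply_symm_apply]
  rw [h1.fderiv, hdet]
  have c0 : (T ∘L (splitE4 : E4 →L[ℝ] _)) (EuclideanSpace.single 0 1) = T ((1, 0), (0, 0)) := by
    simp [splitE4_apply]
  have c1 : (T ∘L (splitE4 : E4 →L[ℝ] _)) (EuclideanSpace.single 1 1) = T ((0, 1), (0, 0)) := by
    simp [splitE4_apply]
  have c2 : (T ∘L (splitE4 : E4 →L[ℝ] _)) (EuclideanSpace.single 2 1) = T ((0, 0), (1, 0)) := by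
    simp [splitE4_apply]
  have c3 : (T ∘L (splitE4 : E4 →L[ℝ] _)) (EuclideanSpace.single 3 1) = T ((0, 0), (0, 1)) := by
    simp [splitE4_apply]
  obtain ⟨⟨o1, o2, -, -⟩, o3, o4, o5, o6, o7, -⟩ := orthonormal_four_iff.1 (h.orthonormal x hx)
  have z0 : ((0, 0) : ℝ × ℝ) = 0 := rfl
  have gN : ⟪N x, g x⟫ = 0 := by rw [real_inner_comm]; exact o3
  have gE : ⟪E x, g x⟫ = 0 := by rw [real_inner_comm]; exact o4
  have gF : ⟪F x, g x⟫ = 0 := by rw [real_inner_comm]; exact o5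
  have NE : ⟪E x, N x⟫ = 0 := by rw [real_inner_comm]; exact o6
  have NF : ⟪F x, N x⟫ = 0 := by rw [real_inner_comm]; exact o7
  have a1 := h.inner_self_fderiv hx
  have a2 := h.inner_normal x hx
  have a3 := h.inner_self_fderiv_normal hx
  have a4 := h.inner_normal_fderiv_normal hx
  have hM : (Matrix.of fun i j : Fin 4 => ⟪![g x, N x, E x, F x] i,
      (T ∘L (splitE4 : E4 →L[ℝ] _)) (EuclideanSpace.single j 1)⟫) =
      !![0, 0, -(r * deriv β s * Real.sin (β s)), Real.cos (β s);
         0, 0, r * deriv β s * Real.cos (β s), Real.sin (β s);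
         r * ⟪E x, Real.cos (β s) • fderiv ℝ g x (1, 0) + Real.sin (β s) • fderiv ℝ N x (1, 0)⟫,
         r * ⟪E x, Real.cos (β s) • fderiv ℝ g x (0, 1) + Real.sin (β s) • fderiv ℝ N x (0, 1)⟫,
         0, 0;
         r * ⟪F x, Real.cos (β s) • fderiv ℝ g x (1, 0) + Real.sin (β s) • fderiv ℝ N x (1, 0)⟫,
         r * ⟪F x, Real.cos (β s) • fderiv ℝ g x (0, 1) + Real.sin (β s) • fderiv ℝ N x (0, 1)⟫,
         0, 0] := by
    ext i j
    fin_cases j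
    · simp only [Matrix.of_apply, Fin.zero_eta]
      rw [c0, hTv]
      fin_cases i <;> simp [inner_add_right, inner_smul_right, mul_add, a1, a2, a3, a4]
    · simp only [Matrix.of_apply, Fin.mk_one]
      rw [c1, hTv]
      fin_cases i <;> simp [inner_add_right, inner_smul_right, mul_add, a1, a2, a3, a4]
    · simp only [Matrix.of_apply, Fin.reduceFinMk]
      rw [c2, hTv]
      fin_cases i <;> simp [-inner_self_eq_norm_sq_to_K,
        inner_add_right, inner_smul_right, z0, o1, o2, o3, gN, gE, gF, NE, NF]
    · simp only [Matrix.of_apply, Fin.reduceFinMk]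
      rw [c3, hTv]
      fin_cases i <;> simp [-inner_self_eq_norm_sq_to_K,
        inner_add_right, inner_smul_right, z0, o1, o2, o3, gN, gE, gF, NE, NF]
  rw [hM, Matrix.det_succ_row_zero]
  simp [Fin.sum_univ_succ, Matrix.det_fin_three, Fin.succAbove]
  rw [parallelDensity, wedge]
  generalize ⟪E x, _⟫ = u₁, ⟪F x, _⟫ = u₂, ⟪E x, _⟫ = u₃, ⟪F x, _⟫ = u₄
  linear_combination (-o * r ^ 3 * deriv β s * (u₃ * u₄ - u₁ * u₂)) * Real.sin_sq_add_cos_sq (β s)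

end IsAdaptedFrame

namespace IsAdaptedFrame

variable {O : Set (ℝ × ℝ)} {g N E F : ℝ × ℝ → E4}

lemma parallelDensity_eq (g N E F : ℝ × ℝ → E4) (x : ℝ × ℝ) (θ : ℝ) :
    parallelDensity g N E F x θ =
      Real.cos θ ^ 2 * wedge (E x) (F x) (fderiv ℝ g x (1, 0)) (fderiv ℝ g x (0, 1)) +
      Real.cos θ * Real.sin θ * (wedge (E x) (F x) (fderiv ℝ g x (1, 0)) (fderiv ℝ N x (0, 1)) +
        wedge (E x) (F x) (fderiv ℝ N x (1, 0)) (fderiv ℝ g x (0, 1))) +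
      Real.sin θ ^ 2 * wedge (E x) (F x) (fderiv ℝ N x (1, 0)) (fderiv ℝ N x (0, 1)) := by
  simp only [parallelDensity, wedge, inner_add_right, inner_smul_right]
  ring

variable {S A : Set E4} {n : E4 → E4} {δ : ℝ} {W : Set E4} {P : E4 → E4} {σ : E4 → ℝ}

/-- The foot map sends the parallel surface back to g, and g is an immersion; hence so is the
parallel surface inside the tube. -/
lemma eq_zero_of_parallel_eq_zero (h : IsAdaptedFrame O g N E F) (ht : IsTube S A n δ W P σ)
    (hgS : ∀ x ∈ O, g x ∈ S) (hNn : ∀ x ∈ O, N x = n (g x)) {x : ℝ × ℝ} (hx : x ∈ O) {θ : ℝ}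
    (hθ : |θ| < δ) {w : ℝ × ℝ}
    (hw : Real.cos θ • fderiv ℝ g x w + Real.sin θ • fderiv ℝ N x w = 0) : w = 0 := by
  have dg := differentiableAt h.isOpen h.contDiffOn hx
  have dN := differentiableAt h.isOpen h.contDiffOn_normal hx
  have h1 : HasFDerivAt (fun y => Real.cos θ • g y + Real.sin θ • N y)
      (Real.cos θ • fderiv ℝ g x + Real.sin θ • fderiv ℝ N x) x :=
    (dg.hasFDerivAt.fun_const_smul _).fun_add (dN.hasFDerivAt.fun_const_smul _)
  have hmem : ∀ y ∈ O, Real.cos θ • g y + Real.sin θ • N y ∈ W ∧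
      P (Real.cos θ • g y + Real.sin θ • N y) = g y := by
    intro y hy
    have := ht.smul_mem (g y) (hgS y hy) θ hθ 1 one_pos
    rw [one_smul, normalExp, ← hNn y hy] at this
    exact ⟨this.1, this.2.1⟩
  have h2 : HasFDerivAt P (fderiv ℝ P (Real.cos θ • g x + Real.sin θ • N x))
      (Real.cos θ • g x + Real.sin θ • N x) :=
    ((ht.contDiffAt_foot (hmem x hx).1).differentiableAt (by simp)).hasFDerivAt
  have h3 := h2.comp x h1
  have h4 : (P ∘ fun y => Real.cos θ • g y + Real.sin θ • N y) =ᶠ[𝓝 x] g := by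
    filter_upwards [h.isOpen.mem_nhds hx] with y hy using (hmem y hy).2
  have h5 := (h3.congr_of_eventuallyEq h4.symm).unique dg.hasFDerivAt
  have h6 : fderiv ℝ g x w = 0 := by
    rw [← h5]
    change fderiv ℝ P _ (Real.cos θ • fderiv ℝ g x w + Real.sin θ • fderiv ℝ N x w) = 0
    rw [hw, map_zero]
  have h7 : w.1 • fderiv ℝ g x (1, 0) + w.2 • fderiv ℝ g x (0, 1) = 0 := by
    rw [← fderiv_apply_eq, h6]
  have h8 := congrArg (fun v => ⟪F x, v⟫) h7
  have h9 := congrArg (fun v => ⟪E x, v⟫) h7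
  simp only [inner_add_right, inner_smul_right, inner_zero_right, h.inner_snd x hx] at h8 h9
  have h10 : w.2 = 0 := by
    rcases mul_eq_zero.1 (by linarith : w.2 * ⟪F x, fderiv ℝ g x (0, 1)⟫ = 0) with h | h'
    · exact h
    · exact absurd h' (h.inner_snd_snd x hx).ne'
  have h11 : w.1 = 0 := by
    rw [h10, zero_mul, add_zero] at h9
    exact (mul_eq_zero.1 h9).resolve_right (h.inner_fst x hx).ne'
  exact Prod.ext h11 h10

/-- A zero of the density would be a degenerate direction of the parallel surface. There is none for
|θ| < δ, and the density is positive at θ = 0, so the intermediate value theorem fixes its sign.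
This removes the absolute value from the change of variables. -/
lemma parallelDensity_pos (h : IsAdaptedFrame O g N E F) (ht : IsTube S A n δ W P σ)
    (hgS : ∀ x ∈ O, g x ∈ S) (hNn : ∀ x ∈ O, N x = n (g x)) {x : ℝ × ℝ} (hx : x ∈ O) {θ : ℝ}
    (hθ : |θ| < δ) : 0 < parallelDensity g N E F x θ := by
  have hne : ∀ θ, |θ| < δ → parallelDensity g N E F x θ ≠ 0 := by
    intro θ hθ h0
    set L : ℝ × ℝ →L[ℝ] E4 := Real.cos θ • fderiv ℝ g x + Real.sin θ • fderiv ℝ N x with hL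
    have hinj : ∀ w, L w = 0 → w = 0 := fun w hw =>
      h.eq_zero_of_parallel_eq_zero ht hgS hNn hx hθ (by simpa [hL] using hw)
    have hLe : ∀ w, L w = ⟪E x, L w⟫ • E x + ⟪F x, L w⟫ • F x := by
      intro w
      refine h.eq_of_tangent hx ?_ ?_
      · simp [hL, inner_add_right, inner_smul_right, h.inner_self_fderiv hx,
          h.inner_self_fderiv_normal hx]
      · simp [hL, inner_add_right, inner_smul_right, h.inner_normal x hx,
          h.inner_normal_fderiv_normal hx]
    have h0' : ⟪E x, L (1, 0)⟫ * ⟪F x, L (0, 1)⟫ - ⟪F x, L (1, 0)⟫ * ⟪E x, L (0, 1)⟫ = 0 := by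
      rw [parallelDensity, wedge] at h0
      simpa [hL] using h0
    have key : ∀ p q : ℝ, p * ⟪E x, L (1, 0)⟫ + q * ⟪E x, L (0, 1)⟫ = 0 →
        p * ⟪F x, L (1, 0)⟫ + q * ⟪F x, L (0, 1)⟫ = 0 → ((p, q) : ℝ × ℝ) = 0 := by
      intro p q h1 h2
      refine hinj _ ?_
      have : ((p, q) : ℝ × ℝ) = p • (1, 0) + q • (0, 1) := by ext <;> simp
      rw [hLe, this, map_add, map_smul, map_smul, inner_add_right, inner_add_right]
      simp only [inner_smul_right, h1, h2]
      simp
    have f1 := key ⟪F x, L (0, 1)⟫ (-⟪F x, L (1, 0)⟫) (by linarith) (by ring)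
    have f2 := key ⟪E x, L (0, 1)⟫ (-⟪E x, L (1, 0)⟫) (by ring) (by linarith)
    have : L (1, 0) = 0 := by
      rw [hLe, show ⟪E x, L (1, 0)⟫ = 0 by simpa using congrArg Prod.snd f2,
        show ⟪F x, L (1, 0)⟫ = 0 by simpa using congrArg Prod.snd f1]
      simp
    simpa using hinj _ this
  have h0 : 0 < parallelDensity g N E F x 0 := by
    simp only [parallelDensity, Real.cos_zero, Real.sin_zero, one_smul, zero_smul, add_zero, wedge,
      h.inner_snd x hx, zero_mul, sub_zero]
    exact mul_pos (h.inner_fst x hx) (h.inner_snd_snd x hx)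
  by_contra! hle
  have hc : Continuous (parallelDensity g N E F x) := by
    simp only [funext (parallelDensity_eq g N E F x)]
    fun_prop
  obtain ⟨t, ht1, ht2⟩ := intermediate_value_uIcc (a := θ) (b := 0) hc.continuousOn
    (show (0 : ℝ) ∈ uIcc _ _ from (uIcc_of_le (hle.trans h0.le)) ▸ ⟨hle, h0.le⟩)
  refine hne t (lt_of_le_of_lt ?_ hθ) ht2
  rcases le_total θ 0 with h1 | h1
  · rw [uIcc_of_le h1] at ht1
    rw [abs_of_nonpos h1, abs_of_nonpos ht1.2]; linarith [ht1.1]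
  · rw [uIcc_of_ge h1] at ht1
    rw [abs_of_nonneg h1, abs_of_nonneg ht1.1]; exact ht1.2

lemma rotMap_tubeParam (ht : IsTube S A n δ W P σ) {x : ℝ × ℝ}
    (hgS : g x ∈ S) (hNn : N x = n (g x)) {s r : ℝ} (hs : |s| < δ) (hr : 0 < r)
    (β : ℝ → ℝ) (hg1 : ‖normalExp n (g x) s‖ = 1) :
    tubeParam g N id (x, (s, r)) ∈ W ∧ P (tubeParam g N id (x, (s, r))) = g x ∧
    σ (tubeParam g N id (x, (s, r))) = s ∧
    rotMap A n W P σ β (tubeParam g N id (x, (s, r))) = tubeParam g N β (x, (s, r)) := by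
  have h1 := ht.smul_mem _ hgS s hs r hr
  have h2 : tubeParam g N id (x, (s, r)) = r • normalExp n (g x) s := by
    simp [tubeParam, normalExp, hNn]
  rw [h2]
  refine ⟨h1.1, h1.2.1, h1.2.2, ?_⟩
  rw [rotMap_of_mem h1.1, h1.2.1, h1.2.2, norm_smul, hg1, mul_one, Real.norm_eq_abs,
    abs_of_pos hr, tubeParam, normalExp, hNn]

end IsAdaptedFrame

lemma convex_stdTriangle : Convex ℝ stdTriangle := by
  rintro ⟨a, b⟩ ⟨h1, h2, h3⟩ ⟨c, d⟩ ⟨h4, h5, h6⟩ s t hs ht hst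
  simp only at h1 h2 h3 h4 h5 h6
  refine ⟨?_, ?_, ?_⟩
  · simp; positivity
  · simp; positivity
  · simp only [Prod.fst_add, Prod.smul_fst, Prod.snd_add, Prod.smul_snd, smul_eq_mul]
    nlinarith

/-- The integrand is the derivative of G ∘ β - G, so β enters only through its values at ±d. -/
lemma integral_deriv_mul_comp_sub {β G G' : ℝ → ℝ} {d : ℝ} (hd : 0 ≤ d) (hβ : ContDiff ℝ ∞ β)
    (hG : ∀ θ, HasDerivAt G (G' θ) θ) (hG' : Continuous G') :
    IntegrableOn (fun s => deriv β s * G' (β s) - G' s) (Ioo (-d) d) ∧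
    ∫ s in Ioo (-d) d, (deriv β s * G' (β s) - G' s) =
      (G (β d) - G d) - (G (β (-d)) - G (-d)) := by
  have hc : Continuous fun s => deriv β s * G' (β s) - G' s :=
    ((hβ.continuous_deriv (by simp)).mul (hG'.comp hβ.continuous)).sub hG'
  refine ⟨(hc.continuousOn.integrableOn_Icc (μ := volume) (a := -d) (b := d)).mono_set
    Ioo_subset_Icc_self, ?_⟩
  rw [← integral_Ioc_eq_integral_Ioo, ← intervalIntegral.integral_of_le (by linarith)]
  refine intervalIntegral.integral_eq_sub_of_hasDerivAt (f := fun s => G (β s) - G s)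
    (fun s _ => ?_) (hc.intervalIntegrable _ _)
  have h1 : HasDerivAt β (deriv β s) s := (hβ.differentiable (by simp) s).hasDerivAt
  refine (((hG _).comp s h1).sub (hG s)).congr_deriv ?_
  ring

lemma integral_mul_mul_pow {a : ℝ × ℝ → ℝ} {u : ℝ → ℝ} {U : Set (ℝ × ℝ)} {I : Set ℝ}
    (ha : IntegrableOn a U) (hu : IntegrableOn u I) :
    IntegrableOn (fun z : (ℝ × ℝ) × (ℝ × ℝ) => a z.1 * (u z.2.1 * z.2.2 ^ 3))
      (U ×ˢ (I ×ˢ Ioo 0 1)) ∧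
    ∫ z in U ×ˢ (I ×ˢ Ioo 0 1), a z.1 * (u z.2.1 * z.2.2 ^ 3) =
      (∫ x in U, a x) * ((∫ s in I, u s) * (1 / 4)) := by
  have hr : IntegrableOn (fun r : ℝ => r ^ 3) (Ioo 0 1) :=
    ((by fun_prop : Continuous fun r : ℝ => r ^ 3).continuousOn.integrableOn_Icc
      (μ := volume) (a := 0) (b := 1)).mono_set Ioo_subset_Icc_self
  constructor
  · rw [IntegrableOn, Measure.volume_eq_prod, ← Measure.prod_restrict]
    refine Integrable.mul_prod (f := a) (g := fun w : ℝ × ℝ => u w.1 * w.2 ^ 3) ha ?_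
    rw [Measure.volume_eq_prod, ← Measure.prod_restrict]
    exact Integrable.mul_prod (f := u) (g := fun r : ℝ => r ^ 3) hu hr
  · rw [Measure.volume_eq_prod, setIntegral_prod_mul a (fun w : ℝ × ℝ => u w.1 * w.2 ^ 3),
      Measure.volume_eq_prod ℝ, setIntegral_prod_mul u (fun r : ℝ => r ^ 3),
      ← integral_Ioc_eq_integral_Ioo (f := fun r : ℝ => r ^ 3),
      ← intervalIntegral.integral_of_le zero_le_one, integral_pow]
    norm_num

namespace IsAdaptedFrame

variable {O : Set (ℝ × ℝ)} {g N E F : ℝ × ℝ → E4}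

lemma continuousOn_wedge (h : IsAdaptedFrame O g N E F) {X Y : ℝ × ℝ → E4}
    (hX : ContDiffOn ℝ ∞ X O) (hY : ContDiffOn ℝ ∞ Y O) (v w : ℝ × ℝ) :
    ContinuousOn (fun x => wedge (E x) (F x) (fderiv ℝ X x v) (fderiv ℝ Y x w)) O := by
  have h1 := (contDiffOn_fderiv_apply h.isOpen hX v).continuousOn
  have h2 := (contDiffOn_fderiv_apply h.isOpen hY w).continuousOn
  have h3 := h.contDiffOn_fst.continuousOn
  have h4 := h.contDiffOn_snd.continuousOn
  exact ((h3.inner h1).mul (h4.inner h2)).sub ((h4.inner h1).mul (h3.inner h2))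

/-- With β(-d) = -d and β(d) = d - π, the s-integral is minus the integral of the density over an
interval of length π. There cos² and sin² integrate to π/2 and cos · sin to 0: the mean curvature
term disappears and the curvature density remains. The factor 1/4 is ∫₀¹ r³ dr. -/
lemma integral_parallelDensity (h : IsAdaptedFrame O g N E F) (hΔ : stdTriangle ⊆ O) {β : ℝ → ℝ}
    {d : ℝ} (hd : 0 ≤ d) (hβ : ContDiff ℝ ∞ β) (hβ1 : β (-d) = -d) (hβ2 : β d = d - Real.pi) :
    IntegrableOn (fun z : (ℝ × ℝ) × (ℝ × ℝ) => z.2.2 ^ 3 * (deriv β z.2.1 *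
      parallelDensity g N E F z.1 (β z.2.1) - parallelDensity g N E F z.1 z.2.1))
      (interior stdTriangle ×ˢ (Ioo (-d) d ×ˢ Ioo 0 1)) ∧
    ∫ z in interior stdTriangle ×ˢ (Ioo (-d) d ×ˢ Ioo 0 1), z.2.2 ^ 3 * (deriv β z.2.1 *
      parallelDensity g N E F z.1 (β z.2.1) - parallelDensity g N E F z.1 z.2.1) =
      -(Real.pi / 8) * ∫ x in stdTriangle, curvDensity g N E F x := by
  have hint : ∀ {a : ℝ × ℝ → ℝ}, ContinuousOn a O → IntegrableOn a (interior stdTriangle) :=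
    fun ha => ((ha.mono hΔ).integrableOn_compact isCompact_stdTriangle).mono_set interior_subset
  set a₁ : ℝ × ℝ → ℝ :=
    fun x => wedge (E x) (F x) (fderiv ℝ g x (1, 0)) (fderiv ℝ g x (0, 1)) with ha₁
  set a₂ : ℝ × ℝ → ℝ := fun x => wedge (E x) (F x) (fderiv ℝ g x (1, 0)) (fderiv ℝ N x (0, 1)) +
    wedge (E x) (F x) (fderiv ℝ N x (1, 0)) (fderiv ℝ g x (0, 1)) with ha₂
  set a₃ : ℝ × ℝ → ℝ :=
    fun x => wedge (E x) (F x) (fderiv ℝ N x (1, 0)) (fderiv ℝ N x (0, 1)) with ha₃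
  have hc1 : ContinuousOn a₁ O := h.continuousOn_wedge h.contDiffOn h.contDiffOn (1, 0) (0, 1)
  have hc2 : ContinuousOn a₂ O := (h.continuousOn_wedge h.contDiffOn h.contDiffOn_normal (1, 0) (0, 1)).add
    (h.continuousOn_wedge h.contDiffOn_normal h.contDiffOn (1, 0) (0, 1))
  have hc3 : ContinuousOn a₃ O := h.continuousOn_wedge h.contDiffOn_normal h.contDiffOn_normal (1, 0) (0, 1)
  obtain ⟨i1, e1⟩ := integral_deriv_mul_comp_sub (G := fun θ => (Real.sin θ * Real.cos θ + θ) / 2)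
    (G' := fun θ => Real.cos θ ^ 2) hd hβ (fun θ => by
      refine ((((Real.hasDerivAt_sin θ).mul (Real.hasDerivAt_cos θ)).add
        (hasDerivAt_id θ)).div_const 2).congr_deriv ?_
      linear_combination (1 / 2 : ℝ) * (-Real.sin_sq_add_cos_sq θ)) (by fun_prop)
  obtain ⟨i2, e2⟩ := integral_deriv_mul_comp_sub (G := fun θ => Real.sin θ ^ 2 / 2)
    (G' := fun θ => Real.cos θ * Real.sin θ) hd hβ (fun θ => by
      refine (((Real.hasDerivAt_sin θ).pow 2).div_const 2).congr_deriv ?_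
      simp; ring) (by fun_prop)
  obtain ⟨i3, e3⟩ := integral_deriv_mul_comp_sub (G := fun θ => (θ - Real.sin θ * Real.cos θ) / 2)
    (G' := fun θ => Real.sin θ ^ 2) hd hβ (fun θ => by
      refine (((hasDerivAt_id θ).sub ((Real.hasDerivAt_sin θ).mul
        (Real.hasDerivAt_cos θ))).div_const 2).congr_deriv ?_
      linear_combination (1 / 2 : ℝ) * (-Real.sin_sq_add_cos_sq θ)) (by fun_prop)
  rw [hβ1, hβ2, Real.sin_sub_pi, Real.cos_sub_pi] at e1 e3
  rw [hβ1, hβ2, Real.sin_sub_pi] at e2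
  obtain ⟨j1, f1⟩ := integral_mul_mul_pow (hint hc1) i1
  obtain ⟨j2, f2⟩ := integral_mul_mul_pow (hint hc2) i2
  obtain ⟨j3, f3⟩ := integral_mul_mul_pow (hint hc3) i3
  have hfun : (fun z : (ℝ × ℝ) × (ℝ × ℝ) => z.2.2 ^ 3 * (deriv β z.2.1 *
      parallelDensity g N E F z.1 (β z.2.1) - parallelDensity g N E F z.1 z.2.1)) = fun z =>
      (a₁ z.1 * ((deriv β z.2.1 * Real.cos (β z.2.1) ^ 2 - Real.cos z.2.1 ^ 2) * z.2.2 ^ 3) +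
      a₂ z.1 * ((deriv β z.2.1 * (Real.cos (β z.2.1) * Real.sin (β z.2.1)) -
        Real.cos z.2.1 * Real.sin z.2.1) * z.2.2 ^ 3)) +
      a₃ z.1 * ((deriv β z.2.1 * Real.sin (β z.2.1) ^ 2 - Real.sin z.2.1 ^ 2) * z.2.2 ^ 3) := by
    funext z
    simp only [parallelDensity_eq, ha₁, ha₂, ha₃]
    ring
  rw [hfun]
  refine ⟨(j1.add j2).add j3, ?_⟩
  have hfr : volume (frontier stdTriangle) = 0 := convex_stdTriangle.addHaar_frontier volume
  have hI : ∀ a : ℝ × ℝ → ℝ, ∫ x in interior stdTriangle, a x = ∫ x in stdTriangle, a x := fun a =>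
    setIntegral_congr_set (interior_ae_eq_of_null_frontier hfr)
  refine ((integral_add (j1.add j2) j3).trans (congrArg₂ (· + ·)
    ((integral_add j1 j2).trans (congrArg₂ (· + ·) f1 f2)) f3)).trans ?_
  rw [e1, e2, e3, hI, hI, hI]
  have hK : ∫ x in stdTriangle, curvDensity g N E F x =
      (∫ x in stdTriangle, a₁ x) + ∫ x in stdTriangle, a₃ x :=
    integral_add ((hc1.mono hΔ).integrableOn_compact isCompact_stdTriangle)
      ((hc3.mono hΔ).integrableOn_compact isCompact_stdTriangle)
  rw [hK]
  ring

end IsAdaptedFrame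

namespace IsAdaptedFrame

variable {O : Set (ℝ × ℝ)} {g N E F : ℝ × ℝ → E4}
variable {S A : Set E4} {n : E4 → E4} {δ : ℝ} {W : Set E4} {P : E4 → E4} {σ : E4 → ℝ}

/-- The part of the solid tube over a parametrized triangle. -/
def solidTube (g N : ℝ × ℝ → E4) (d : ℝ) (T : Set (ℝ × ℝ)) : Set E4 :=
  (tubeParam g N id ∘ splitE4) '' (splitE4 ⁻¹' (T ×ˢ (Ioo (-d) d ×ˢ Ioo 0 1)))

lemma mem_solidTube {d : ℝ} {T : Set (ℝ × ℝ)} {y : E4} : y ∈ solidTube g N d T ↔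
    ∃ x ∈ T, ∃ s ∈ Ioo (-d) d, ∃ r ∈ Ioo (0 : ℝ) 1, tubeParam g N id (x, (s, r)) = y := by
  constructor
  · rintro ⟨z, ⟨h1, h2, h3⟩, rfl⟩
    exact ⟨_, h1, _, h2, _, h3, rfl⟩
  · rintro ⟨x, hx, s, hs, r, hr, rfl⟩
    exact ⟨splitE4.symm (x, (s, r)), by simp [hx, hs.1, hs.2, hr.1, hr.2], by simp⟩

/-- Change of variables by `tubeParam` with the angle s itself. It is injective, as foot point,
distance and norm recover the parameters. In these coordinates the rotation becomes `tubeParam` with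
angle β, so by the chain rule its Jacobian times J(s) equals β'(s) J(β(s)). -/
lemma integral_solidTube (h : IsAdaptedFrame O g N E F) (hS : IsClosedSurface S)
    (hn : IsUnitNormalInto S A n) (ht : IsTube S A n δ W P σ)
    (hgS : ∀ x ∈ O, g x ∈ S) (hNn : ∀ x ∈ O, N x = n (g x)) (hΔ : stdTriangle ⊆ O)
    (hinj : InjOn g (interior stdTriangle)) {β : ℝ → ℝ} {d : ℝ} (hd : 0 ≤ d) (hdδ : d < δ)
    (hβ : ContDiff ℝ ∞ β) (hβ1 : β (-d) = -d) (hβ2 : β d = d - Real.pi)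
    (hdiff : ∀ y : E4, y ≠ 0 → DifferentiableAt ℝ (rotMap A n W P σ β) y) :
    MeasurableSet (solidTube g N d (interior stdTriangle)) ∧
    IntegrableOn (fun y => (fderiv ℝ (rotMap A n W P σ β) y).det - 1)
      (solidTube g N d (interior stdTriangle)) ∧
    ∫ y in solidTube g N d (interior stdTriangle), ((fderiv ℝ (rotMap A n W P σ β) y).det - 1) =
      -(Real.pi / 8) * ∫ x in stdTriangle, curvDensity g N E F x := by
  set D : E4 → ℝ := fun y => (fderiv ℝ (rotMap A n W P σ β) y).det - 1 with hD
  set R : Set ((ℝ × ℝ) × (ℝ × ℝ)) := interior stdTriangle ×ˢ (Ioo (-d) d ×ˢ Ioo 0 1) with hR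
  set M : E4 → E4 := tubeParam g N id ∘ splitE4 with hM
  have hRm : MeasurableSet (splitE4 ⁻¹' R) := splitE4.continuous.measurable
    (isOpen_interior.prod (isOpen_Ioo.prod isOpen_Ioo)).measurableSet
  have hnorm : ∀ x ∈ O, ∀ s, ‖normalExp n (g x) s‖ = 1 := fun x hx s =>
    norm_normalExp hS hn (hgS x hx) s
  have habs : ∀ s ∈ Ioo (-d) d, |s| < δ := fun s hs => (abs_lt.2 hs).trans hdδ
  have hMd : ∀ z ∈ splitE4 ⁻¹' R, HasFDerivAt M (fderiv ℝ M z) z := by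
    intro z hz
    have hx : (splitE4 z).1 ∈ O := hΔ (interior_subset hz.1)
    obtain ⟨T, hT, -⟩ := hasFDerivAt_tubeParam (β := id) (z := splitE4 z)
      (differentiableAt h.isOpen h.contDiffOn hx)
      (differentiableAt h.isOpen h.contDiffOn_normal hx) differentiableAt_id
    exact (hT.comp z splitE4.hasFDerivAt).differentiableAt.hasFDerivAt
  have hMinj : InjOn M (splitE4 ⁻¹' R) := by
    intro z hz z' hz' he
    have hx := hΔ (interior_subset hz.1)
    have hx' := hΔ (interior_subset hz'.1)
    have e1 := rotMap_tubeParam ht (hgS _ hx) (hNn _ hx) (habs _ hz.2.1) hz.2.2.1 id (hnorm _ hx _)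
    have e2 := rotMap_tubeParam ht (hgS _ hx') (hNn _ hx') (habs _ hz'.2.1) hz'.2.2.1 id
      (hnorm _ hx' _)
    change tubeParam g N id (splitE4 z) = tubeParam g N id (splitE4 z') at he
    simp only [Prod.mk.eta] at e1 e2
    rw [← he] at e2
    have f1 := hinj hz.1 hz'.1 (e1.2.1.symm.trans e2.2.1)
    have f2 := e1.2.2.1.symm.trans e2.2.2.1
    have nz : ∀ w : (ℝ × ℝ) × (ℝ × ℝ), w ∈ R → ‖tubeParam g N id w‖ = w.2.2 := by
      intro w hw
      have hx := hΔ (interior_subset hw.1)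
      have := hnorm _ hx w.2.1
      rw [normalExp, ← hNn _ hx] at this
      rw [tubeParam, norm_smul, id, this, mul_one, Real.norm_eq_abs, abs_of_pos hw.2.2.1]
    have f3 : (splitE4 z).2.2 = (splitE4 z').2.2 := by
      rw [← nz _ hz, ← nz _ hz', he]
    exact splitE4.injective (Prod.ext f1 (Prod.ext f2 f3))
  have hdet : ∀ z ∈ splitE4 ⁻¹' R, |(fderiv ℝ M z).det| • D (M z) =
      (fun z : (ℝ × ℝ) × (ℝ × ℝ) => z.2.2 ^ 3 * (deriv β z.2.1 *
        parallelDensity g N E F z.1 (β z.2.1) - parallelDensity g N E F z.1 z.2.1))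
        (splitE4 z) := by
    intro z hz
    obtain ⟨⟨x, s, r⟩, rfl⟩ : ∃ w, z = splitE4.symm w := ⟨splitE4 z, by simp⟩
    simp only [mem_preimage, ContinuousLinearEquiv.apply_symm_apply] at hz ⊢
    obtain ⟨hx, hs, hr⟩ := hz
    simp only at hx hs hr
    have hxO := hΔ (interior_subset hx)
    obtain ⟨o, ho, hod⟩ := h.exists_det_tubeParam_eq hxO
    have e1 := hod id s r differentiableAt_id
    have e2 := hod β s r (hβ.differentiable (by simp) s)
    have hpos := h.parallelDensity_pos ht hgS hNn hxO (habs s hs)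
    have hMz : M (splitE4.symm (x, s, r)) = tubeParam g N id (x, (s, r)) := by simp [hM]
    have hne : M (splitE4.symm (x, s, r)) ≠ 0 := by
      rw [hMz]
      exact ht.ne_zero _ (rotMap_tubeParam ht (hgS _ hxO) (hNn _ hxO) (habs s hs) hr.1 id
        (hnorm _ hxO _)).1
    have hcomp : rotMap A n W P σ β ∘ M =ᶠ[𝓝 (splitE4.symm (x, s, r))]
        tubeParam g N β ∘ splitE4 := by
      have : splitE4 ⁻¹' R ∈ 𝓝 (splitE4.symm (x, s, r)) :=
        ((isOpen_interior.prod (isOpen_Ioo.prod isOpen_Ioo)).preimage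
          splitE4.continuous).mem_nhds (by simpa [hR] using ⟨hx, hs, hr⟩)
      filter_upwards [this] with w hw
      have hwO := hΔ (interior_subset hw.1)
      exact (rotMap_tubeParam ht (hgS _ hwO) (hNn _ hwO) (habs _ hw.2.1) hw.2.2.1 β
        (hnorm _ hwO _)).2.2.2
    have hchain : (fderiv ℝ (rotMap A n W P σ β) (M (splitE4.symm (x, s, r)))).det *
        (fderiv ℝ M (splitE4.symm (x, s, r))).det =
        (fderiv ℝ (tubeParam g N β ∘ splitE4) (splitE4.symm (x, s, r))).det := by
      rw [← hcomp.fderiv_eq, fderiv_comp _ (hdiff _ hne)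
        (hMd _ (by simpa [hR] using ⟨hx, hs, hr⟩)).differentiableAt]
      exact (LinearMap.det_comp _ _).symm
    rw [e2, e1] at hchain
    have ho0 : o ≠ 0 := by rintro rfl; simp at ho
    have hr3 : 0 < r ^ 3 := pow_pos hr.1 3
    simp only [deriv_id, one_mul, id] at hchain e1
    have h4 : (fderiv ℝ (rotMap A n W P σ β) (M (splitE4.symm (x, s, r)))).det *
        parallelDensity g N E F x s = deriv β s * parallelDensity g N E F x (β s) := by
      apply mul_left_cancel₀ (mul_ne_zero ho0 hr3.ne')
      linear_combination hchain
    rw [e1, abs_mul, ho, one_mul, abs_of_pos (mul_pos hr3 hpos)]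
    simp only [hD, smul_eq_mul]
    linear_combination r ^ 3 * h4
  have hmp := measurePreserving_splitE4
  have hemb : MeasurableEmbedding splitE4 :=
    splitE4.toHomeomorph.measurableEmbedding
  obtain ⟨i1, i2⟩ := h.integral_parallelDensity hΔ hd hβ hβ1 hβ2
  have hMd' : ∀ z ∈ splitE4 ⁻¹' R, HasFDerivWithinAt M (fderiv ℝ M z) (splitE4 ⁻¹' R) z :=
    fun z hz => (hMd z hz).hasFDerivWithinAt
  refine ⟨?_, ?_, ?_⟩
  · exact hRm.image_of_continuousOn_injOn (fun z hz => (hMd z hz).continuousAt.continuousWithinAt)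
      hMinj
  · refine (integrableOn_image_iff_integrableOn_abs_det_fderiv_smul volume hRm hMd' hMinj D).2 ?_
    refine IntegrableOn.congr_fun ?_ (fun z hz => (hdet z hz).symm) hRm
    exact (hmp.integrableOn_comp_preimage hemb).2 i1
  · refine (integral_image_eq_integral_abs_det_fderiv_smul volume hRm hMd' hMinj D).trans ?_
    rw [setIntegral_congr_fun hRm hdet, ← i2]
    exact hmp.setIntegral_preimage_emb hemb (fun z : (ℝ × ℝ) × (ℝ × ℝ) => z.2.2 ^ 3 *
      (deriv β z.2.1 * parallelDensity g N E F z.1 (β z.2.1) -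
        parallelDensity g N E F z.1 z.2.1)) R

end IsAdaptedFrame

namespace IsAdaptedFrame

variable {O : Set (ℝ × ℝ)} {g N E F : ℝ × ℝ → E4}
variable {S A : Set E4} {n : E4 → E4} {δ : ℝ} {W : Set E4} {P : E4 → E4} {σ : E4 → ℝ}

lemma volume_solidTube_eq_zero (h : IsAdaptedFrame O g N E F) {d : ℝ} {T : Set (ℝ × ℝ)}
    (hTO : T ⊆ O) (hT : volume T = 0) : volume (solidTube g N d T) = 0 := by
  refine addHaar_image_eq_zero_of_differentiableOn_of_addHaar_eq_zero volume (fun z hz => ?_) ?_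
  · have hx : (splitE4 z).1 ∈ O := hTO hz.1
    obtain ⟨L, hL, -⟩ := hasFDerivAt_tubeParam (β := id) (z := splitE4 z)
      (differentiableAt h.isOpen h.contDiffOn hx)
      (differentiableAt h.isOpen h.contDiffOn_normal hx) differentiableAt_id
    exact (hL.comp z splitE4.hasFDerivAt).differentiableAt.differentiableWithinAt
  · rw [measurePreserving_splitE4.measure_preimage_emb splitE4.toHomeomorph.measurableEmbedding,
      Measure.volume_eq_prod, Measure.prod_prod, hT, zero_mul]

end IsAdaptedFrame

open IsAdaptedFrame in
/-- The degree integral of the rotation map is given by the total curvature of the surface. -/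
theorem integral_det_rotMap {S A : Set E4} {n : E4 → E4} {δ : ℝ} {W : Set E4} {P : E4 → E4}
    {σ : E4 → ℝ} (hS : IsClosedSurface S)
    (hA : ∃ a ∈ Metric.sphere (0 : E4) 1 \ S,
      A = connectedComponentIn (Metric.sphere (0 : E4) 1 \ S) a)
    (hn : IsUnitNormalInto S A n) (ht : IsTube S A n δ W P σ) {β : ℝ → ℝ} {r : ℝ}
    (hr : 0 ≤ r) (hrδ : r < δ) (hβ : ContDiff ℝ ∞ β) (hβ1 : ∀ s, s ≤ -r → β s = s)
    (hβ2 : ∀ s, r ≤ s → β s = s - Real.pi) {ι : Type*} [Fintype ι] {O : ι → Set (ℝ × ℝ)}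
    {g E F : ι → ℝ × ℝ → E4}
    (h : ∀ i, IsAdaptedFrame (O i) (g i) (fun x => n (g i x)) (E i) (F i))
    (hgS : ∀ i, ∀ x ∈ O i, g i x ∈ S) (hΔ : ∀ i, stdTriangle ⊆ O i)
    (hinj : ∀ i, InjOn (g i) (interior stdTriangle))
    (hdisj : Pairwise (Function.onFun Disjoint fun i => g i '' interior stdTriangle))
    (hcover : S ⊆ ⋃ i, g i '' stdTriangle) :
    ∫ x : S3, (fderiv ℝ (rotMap A n W P σ β) (x : E4)).det ∂sphereMeasure =
      2 * Real.pi ^ 2 - Real.pi / 2 *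
        ∑ i, ∫ x in stdTriangle, curvDensity (g i) (fun x => n (g i x)) (E i) (F i) x := by
  -- The open tube of radius d contains the closed tube of radius r, off which the map is locally ±
  -- id, and stays inside the tubular neighbourhood.
  obtain ⟨d, hrd, hdδ⟩ := exists_between hrδ
  have hd : 0 ≤ d := hr.trans hrd.le
  have hdiff : ∀ y : E4, y ≠ 0 → DifferentiableAt ℝ (rotMap A n W P σ β) y := fun y hy =>
    (contDiffAt_rotMap hS hA ht hβ1 hβ2 hr hrδ hβ hy).differentiableAt (by simp)
  set D : E4 → ℝ := fun y => (fderiv ℝ (rotMap A n W P σ β) y).det - 1 with hD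
  set C : ι → Set E4 := fun i =>
    solidTube (g i) (fun x => n (g i x)) d (interior stdTriangle) with hC
  have key := fun i => (h i).integral_solidTube hS hn ht (hgS i) (fun _ _ => rfl) (hΔ i) (hinj i)
    hd hdδ hβ (hβ1 _ (by linarith)) (hβ2 _ hrd.le) hdiff
  have hnorm : ∀ i, ∀ x ∈ O i, ∀ s, ‖normalExp n (g i x) s‖ = 1 := fun i x hx s =>
    norm_normalExp hS hn (hgS i x hx) s
  have habs : ∀ s ∈ Ioo (-d) d, |s| < δ := fun s hs => (abs_lt.2 hs).trans hdδ
  have hfr : volume (stdTriangle \ interior stdTriangle) = 0 := by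
    rw [← isClosed_stdTriangle.frontier_eq]
    exact convex_stdTriangle.addHaar_frontier volume
  have hCB : ⋃ i, C i ⊆ Metric.ball 0 1 := by
    refine iUnion_subset fun i y hy => ?_
    obtain ⟨x, hx, s, hs, r, hr, rfl⟩ := mem_solidTube.1 hy
    have := hnorm i x (hΔ i (interior_subset hx)) s
    rw [normalExp] at this
    rw [mem_ball_zero_iff, tubeParam, norm_smul, id, this, mul_one, Real.norm_eq_abs,
      abs_of_pos hr.1]
    exact hr.2
  have hCdisj : Pairwise (Function.onFun Disjoint C) := by
    intro i j hij
    refine disjoint_left.2 fun y hy hy' => ?_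
    obtain ⟨x, hx, s, hs, r, hr, rfl⟩ := mem_solidTube.1 hy
    obtain ⟨x', hx', s', hs', r', hr', he⟩ := mem_solidTube.1 hy'
    have hxO := hΔ i (interior_subset hx)
    have hxO' := hΔ j (interior_subset hx')
    have e1 := (rotMap_tubeParam (N := fun x => n (g i x)) ht (hgS _ _ hxO) rfl (habs s hs) hr.1
      id (hnorm _ _ hxO _)).2.1
    have e2 := (rotMap_tubeParam (N := fun x => n (g j x)) ht (hgS _ _ hxO') rfl (habs s' hs')
      hr'.1 id (hnorm _ _ hxO' _)).2.1
    rw [he, e1] at e2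
    exact disjoint_left.1 (hdisj hij) ⟨x, hx, rfl⟩ ⟨x', hx', e2.symm⟩
  -- A nonzero point of the ball outside the open pieces lies either over the boundary of a
  -- parameter triangle, which accounts for a null set, or off the closed tube of radius r, where
  -- the Jacobian is 1.
  have hnull : ∀ᵐ y : E4, y ∈ Metric.ball (0 : E4) 1 \ ⋃ i, C i → D y = 0 := by
    have h1 : ∀ᵐ y : E4, ∀ i,
        y ∉ solidTube (g i) (fun x => n (g i x)) d (stdTriangle \ interior stdTriangle) :=
      ae_all_iff.2 fun i => compl_mem_ae_iff.2
        ((h i).volume_solidTube_eq_zero (sdiff_subset.trans (hΔ i)) hfr)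
    filter_upwards [h1, compl_mem_ae_iff.2 (measure_singleton (0 : E4))] with y hy hy0 hyB
    by_cases hyW : y ∈ W ∧ |σ y| ≤ r
    · exfalso
      obtain ⟨i, hi⟩ := mem_iUnion.1 (hcover (ht.foot_mem y hyW.1))
      obtain ⟨x, hx, hxe⟩ := hi
      have hs : σ y ∈ Ioo (-d) d := abs_lt.1 (hyW.2.trans_lt hrd)
      have hyr : ‖y‖ ∈ Ioo (0 : ℝ) 1 := ⟨norm_pos_iff.2 hy0, by simpa using hyB.1⟩
      have hyt : tubeParam (g i) (fun x => n (g i x)) id (x, (σ y, ‖y‖)) = y := by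
        conv_rhs => rw [ht.eq_smul y hyW.1, ← hxe]
        rfl
      by_cases hxi : x ∈ interior stdTriangle
      · exact hyB.2 (mem_iUnion.2 ⟨i, mem_solidTube.2 ⟨x, hxi, _, hs, _, hyr, hyt⟩⟩)
      · exact hy i (mem_solidTube.2 ⟨x, ⟨hx, hxi⟩, _, hs, _, hyr, hyt⟩)
    · rcases eventuallyEq_rotMap hS hA ht hβ1 hβ2 hr hrδ hy0 hyW with he | he
      · simp only [hD]
        rw [he.fderiv_eq, fderiv_fun_neg, fderiv_fun_id]
        -- The dimension four is even, so the antipodal side also contributes with Jacobian +1.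
        have : (-ContinuousLinearMap.id ℝ E4).det = 1 := by
          rw [show -ContinuousLinearMap.id ℝ E4 = (-1 : ℝ) • ContinuousLinearMap.id ℝ E4 from
            (neg_one_smul ℝ _).symm]
          rw [ContinuousLinearMap.det, ContinuousLinearMap.toLinearMap_smul, LinearMap.det_smul]
          simp [Even.neg_one_pow (show Even 4 by decide)]
        rw [this, sub_self]
      · simp only [hD]
        rw [he.fderiv_eq, fderiv_fun_id]
        simp [ContinuousLinearMap.det]
  have hint : IntegrableOn D (⋃ i, C i) := integrableOn_finite_iUnion.2 fun i => (key i).2.1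
  have hintB : IntegrableOn D (Metric.ball 0 1) :=
    hint.of_ae_sdiff_eq_zero measurableSet_ball.nullMeasurableSet hnull
  have h1 : ∫ y in Metric.ball (0 : E4) 1, D y = ∑ i, -(Real.pi / 8) *
      ∫ x in stdTriangle, curvDensity (g i) (fun x => n (g i x)) (E i) (F i) x := by
    rw [setIntegral_eq_of_subset_of_ae_sdiff_eq_zero measurableSet_ball.nullMeasurableSet hCB hnull,
      integral_iUnion_fintype (fun i => (key i).1) hCdisj fun i => (key i).2.1]
    exact Finset.sum_congr rfl fun i _ => (key i).2.2
  have h2 : ∫ y in Metric.ball (0 : E4) 1, (fderiv ℝ (rotMap A n W P σ β) y).det =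
      (∫ y in Metric.ball (0 : E4) 1, D y) + Real.pi ^ 2 / 2 := by
    have : ∀ y, (fderiv ℝ (rotMap A n W P σ β) y).det = D y + 1 := fun y => by simp [hD]
    simp only [this]
    rw [integral_add hintB (integrableOn_const (by finiteness))]
    simp [← volume_real_ball_E4, measureReal_def]
  have h3 : ∀ (x : E4) (c : ℝ), 0 < c → (fderiv ℝ (rotMap A n W P σ β) (c • x)).det =
      (fderiv ℝ (rotMap A n W P σ β) x).det := by
    intro x c hc
    rcases eq_or_ne x 0 with rfl | hx
    · rw [smul_zero]
    have e1 : rotMap A n W P σ β = fun y => c⁻¹ • rotMap A n W P σ β (c • y) := by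
      funext y
      rw [rotMap_smul ht hc, smul_smul, inv_mul_cancel₀ hc.ne', one_smul]
    have e2 : fderiv ℝ (rotMap A n W P σ β) x = fderiv ℝ (rotMap A n W P σ β) (c • x) := by
      conv_lhs => rw [e1]
      rw [fderiv_fun_const_smul (f := fun y => rotMap A n W P σ β (c • y)) ((hdiff _ (smul_ne_zero hc.ne' hx)).comp x
        (differentiableAt_id.const_smul c)), fderiv_comp_smul, smul_smul, inv_mul_cancel₀ hc.ne', one_smul]
    rw [e2]
  rw [integral_sphereMeasure_eq
    (D := fun y => (fderiv ℝ (rotMap A n W P σ β) y).det) h3, h2, h1, ← Finset.mul_sum]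
  ring

/-! ### Tangent vectors and the simplices of the triangulation -/

/-- Difference quotients of an immersion converge only if those of the points do, along a
subsequence. -/
lemma exists_tendsto_of_fderiv_injective {X : Type*} [NormedAddCommGroup X] [NormedSpace ℝ X]
    [FiniteDimensional ℝ X] {f : X → E4} {L : X →L[ℝ] E4} {q₀ : X} (hf : HasFDerivAt f L q₀)
    {V : Submodule ℝ X} (hL : ∀ w ∈ V, L w = 0 → w = 0) {q : ℕ → X}
    (hq : Tendsto q atTop (𝓝 q₀)) (hqV : ∀ k, q k - q₀ ∈ V) {c : ℕ → ℝ} {ζ : E4}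
    (hc : Tendsto (fun k => c k • (f (q k) - f q₀)) atTop (𝓝 ζ)) :
    ∃ w ∈ V, ∃ φ : ℕ → ℕ, StrictMono φ ∧
      Tendsto (fun k => c (φ k) • (q (φ k) - q₀)) atTop (𝓝 w) ∧ L w = ζ := by
  -- In finite dimension an injective L is bounded below on V. This bounds the difference quotients
  -- of the points, so a subsequence converges.
  obtain ⟨C, hC0, hC⟩ : ∃ C : ℝ, 0 < C ∧ ∀ w ∈ V, ‖w‖ ≤ C * ‖L w‖ := by
    have hker : LinearMap.ker ((L : X →ₗ[ℝ] E4).domRestrict V) = ⊥ := by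
      rw [LinearMap.ker_eq_bot']
      rintro ⟨w, hw⟩ h0
      exact Subtype.ext (hL w hw h0)
    obtain ⟨K, hK, hKl⟩ := LinearMap.exists_antilipschitzWith _ hker
    refine ⟨K, hK, fun w hw => ?_⟩
    have := hKl.le_mul_dist (⟨w, hw⟩ : V) 0
    simpa [dist_eq_norm] using this
  have hlo := hf.isLittleO.comp_tendsto hq
  have hev : ∀ᶠ k in atTop, ‖c k • (q k - q₀)‖ ≤ 2 * C * (‖ζ‖ + 1) := by
    have h1 := hlo.bound (c := (2 * C)⁻¹) (by positivity)
    have h2 : ∀ᶠ k in atTop, ‖c k • (f (q k) - f q₀)‖ < ‖ζ‖ + 1 :=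
      (hc.norm).eventually (gt_mem_nhds (by linarith))
    filter_upwards [h1, h2] with k hk1 hk2
    simp only [Function.comp_apply] at hk1
    have h3 := hC _ (hqV k)
    have h4 : ‖L (q k - q₀)‖ ≤ ‖f (q k) - f q₀‖ + ‖f (q k) - f q₀ - L (q k - q₀)‖ := by
      have := norm_sub_le (f (q k) - f q₀) (f (q k) - f q₀ - L (q k - q₀))
      simpa using this
    have h5 : ‖q k - q₀‖ ≤ 2 * C * ‖f (q k) - f q₀‖ := by
      have h6 : C * ((2 * C)⁻¹ * ‖q k - q₀‖) = ‖q k - q₀‖ / 2 := by field_simp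
      nlinarith [mul_le_mul_of_nonneg_left (h4.trans (add_le_add_right hk1 _)) hC0.le]
    rw [norm_smul] at hk2 ⊢
    calc ‖c k‖ * ‖q k - q₀‖ ≤ ‖c k‖ * (2 * C * ‖f (q k) - f q₀‖) := by gcongr
      _ = 2 * C * (‖c k‖ * ‖f (q k) - f q₀‖) := by ring
      _ ≤ _ := by gcongr
  obtain ⟨w, -, φ, hφ, hw⟩ := tendsto_subseq_of_frequently_bounded
    (x := fun k => c k • (q k - q₀)) (Metric.isBounded_closedBall (x := (0 : X))
      (r := 2 * C * (‖ζ‖ + 1))) (hev.mono fun k hk => mem_closedBall_zero_iff.2 hk).frequently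
  have hwV : w ∈ V := (Submodule.closed_of_finiteDimensional V).mem_of_tendsto hw
    (Eventually.of_forall fun k => V.smul_mem _ (hqV _))
  refine ⟨w, hwV, φ, hφ, hw, ?_⟩
  have h1 : (fun k => c (φ k) • (f (q (φ k)) - f q₀ - L (q (φ k) - q₀))) =o[atTop]
      fun _ => (1 : ℝ) := by
    have h2 := (hlo.comp_tendsto hφ.tendsto_atTop)
    have h3 := (Asymptotics.isBigO_refl (fun k => c (φ k)) atTop).smul_isLittleO h2
    exact h3.trans_isBigO (hw.isBigO_one ℝ)
  have h2 := (Asymptotics.isLittleO_one_iff ℝ).1 h1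
  have h3 : Tendsto (fun k => L (c (φ k) • (q (φ k) - q₀))) atTop (𝓝 (L w)) :=
    (L.continuous.tendsto w).comp hw
  have h4 := hc.comp hφ.tendsto_atTop
  refine tendsto_nhds_unique h3 ?_
  have h5 := h4.sub h2
  rw [sub_zero] at h5
  refine h5.congr fun k => ?_
  simp only [Function.comp_apply]
  rw [← smul_sub, sub_sub_cancel, map_smul]

lemma IsClosedSurface.exists_isGraphChart {S : Set E4} (hS : IsClosedSurface S) {p : E4}
    (hp : p ∈ S) : ∃ V B Z Y ψ, IsGraphChart S V p B Z Y ψ ∧ B 3 = p := by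
  obtain ⟨V, v, hpV, hv⟩ := hS.exists_isLocalDefining hp
  obtain ⟨B, hB2, hB3⟩ := hv.exists_basis hp hpV
  obtain ⟨Z, Y, ψ, hψ⟩ := hv.exists_isGraphChart hp hpV hB2 hB3
  exact ⟨V, B, Z, Y, ψ, hψ, hB3⟩

namespace IsGraphChart

variable {S V : Set E4} {p : E4} {B : OrthonormalBasis (Fin 4) ℝ E4} {Z Y : Set E4} {ψ : E4 → E4}

lemma planeProj_self (hB : B 3 = p) : planeProj B p = 0 := by rw [← hB, planeProj_last]

/-- The derivative of a map into the surface takes values in the tangent plane. -/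
lemma planeProj_fderiv (h : IsGraphChart S V p B Z Y ψ) (hB : B 3 = p) {X : Type*}
    [NormedAddCommGroup X] [NormedSpace ℝ X] {f : X → E4} {L : X →L[ℝ] E4} {x : X}
    (hf : HasFDerivAt f L x) (hx : f x = p) (hS : ∀ᶠ y in 𝓝 x, f y ∈ S) (w : X) :
    planeProj B (L w) = L w := by
  have h1 : f =ᶠ[𝓝 x] fun y => ψ (planeProj B (f y)) := by
    have h2 : ∀ᶠ y in 𝓝 x, f y ∈ Y :=
      hf.continuousAt.eventually_mem (h.isOpen'.mem_nhds (by rw [hx]; exact h.mem))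
    filter_upwards [hS, h2] with y hy1 hy2
    rw [h.map_proj, (h.map_eq _ ⟨hy1, hy2⟩).2]
  have h2 : HasFDerivAt (fun y => planeProj B (f y)) (planeProj B ∘L L) x :=
    (planeProj B).hasFDerivAt.comp x hf
  have h3 : HasFDerivAt ψ (planeProj B) (planeProj B (f x)) := by
    rw [hx, planeProj_self hB]; exact h.hasFDerivAt
  have h4 := ((h3.comp x h2).congr_of_eventuallyEq h1).unique hf
  have h5 := congrArg (fun T : X →L[ℝ] E4 => T w) h4
  simpa [planeProj_planeProj] using h5

/-- Every tangent vector is the velocity of a sequence of points of the surface. -/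
lemma exists_seq (h : IsGraphChart S V p B Z Y ψ) (hp : p ∈ S) (hB : B 3 = p) {ζ : E4}
    (hζ : planeProj B ζ = ζ) : ∃ (c : ℕ → ℝ) (y : ℕ → E4), (∀ k, 0 < c k) ∧ (∀ k, y k ∈ S) ∧
      Tendsto y atTop (𝓝 p) ∧ Tendsto (fun k => c k • (y k - p)) atTop (𝓝 ζ) := by
  have h0 := h.map_zero hp hB
  have hd : HasDerivAt (fun t : ℝ => ψ (t • ζ)) ζ 0 := by
    have h1 : HasDerivAt (fun t : ℝ => t • ζ) ζ 0 := by
      simpa using (hasDerivAt_id (0 : ℝ)).smul_const ζ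
    have h2 : HasFDerivAt ψ (planeProj B) ((0 : ℝ) • ζ) := by rw [zero_smul]; exact h.hasFDerivAt
    have h3 := h2.comp_hasDerivAt (0 : ℝ) h1
    rwa [hζ] at h3
  have hZ : ∀ᶠ t : ℝ in 𝓝 0, t • ζ ∈ Z := by
    have : ContinuousAt (fun t : ℝ => t • ζ) 0 := by fun_prop
    exact this.eventually_mem (h.isOpen.mem_nhds (by rw [zero_smul]; exact h.zero_mem))
  have hlim : Tendsto (fun k : ℕ => 1 / ((k : ℝ) + 1)) atTop (𝓝 0) :=
    tendsto_one_div_add_atTop_nhds_zero_nat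
  obtain ⟨m, hm⟩ := eventually_atTop.1 (hlim.eventually hZ)
  have hlim' : Tendsto (fun k : ℕ => 1 / (((k + m : ℕ) : ℝ) + 1)) atTop (𝓝[≠] 0) := by
    refine tendsto_nhdsWithin_iff.2 ⟨hlim.comp (tendsto_add_atTop_nat m),
      Eventually.of_forall fun k => ?_⟩
    have : (0 : ℝ) < ((k + m : ℕ) : ℝ) + 1 := by positivity
    exact (one_div_pos.2 this).ne'
  refine ⟨fun k => ((k + m : ℕ) : ℝ) + 1, fun k => ψ ((1 / (((k + m : ℕ) : ℝ) + 1)) • ζ),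
    fun k => by positivity, fun k => (h.maps _ (hm _ (Nat.le_add_left m k))).1, ?_, ?_⟩
  · have := hd.continuousAt.tendsto.comp (hlim'.mono_right nhdsWithin_le_nhds)
    rw [zero_smul, h0] at this
    exact this
  · have := hd.tendsto_slope_zero.comp hlim'
    refine this.congr fun k => ?_
    simp [h0]

end IsGraphChart

/-- Smooth maps into the surface that extend the triangulation from every closed simplex. -/
structure IsChartedTriangulation {N : ℕ}
    (K : Geometry.SimplicialComplex ℝ (EuclideanSpace ℝ (Fin N))) {S : Set E4} (h : K.space ≃ₜ S)
    (Γ : Finset (EuclideanSpace ℝ (Fin N)) → EuclideanSpace ℝ (Fin N) → E4)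
    (O : Finset (EuclideanSpace ℝ (Fin N)) → Set (EuclideanSpace ℝ (Fin N))) : Prop where
  isOpen : ∀ s ∈ K.faces, IsOpen (O s)
  subset : ∀ s ∈ K.faces, convexHull ℝ (s : Set (EuclideanSpace ℝ (Fin N))) ⊆ O s
  contDiffOn : ∀ s ∈ K.faces, ContDiffOn ℝ ∞ (Γ s) (O s)
  maps : ∀ s ∈ K.faces, ∀ x ∈ O s, Γ s x ∈ S
  eq : ∀ s ∈ K.faces, ∀ x : K.space,
    (x : EuclideanSpace ℝ (Fin N)) ∈ convexHull ℝ (s : Set (EuclideanSpace ℝ (Fin N))) →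
    Γ s x = (h x : E4)
  injective : ∀ s ∈ K.faces, ∀ x ∈ convexHull ℝ (s : Set (EuclideanSpace ℝ (Fin N))),
    ∀ w ∈ vectorSpan ℝ (s : Set (EuclideanSpace ℝ (Fin N))), fderiv ℝ (Γ s) x w = 0 → w = 0

/-- Along a segment of C issuing from x the two maps agree, hence so do their one-sided derivatives;
the directions of these segments span the vector span. -/
lemma fderiv_eqOn_vectorSpan {X : Type*} [NormedAddCommGroup X] [NormedSpace ℝ X] {f g : X → E4}
    {C : Set X} (hC : Convex ℝ C) {x : X} (hx : x ∈ C) (hf : DifferentiableAt ℝ f x)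
    (hg : DifferentiableAt ℝ g x) (hfg : EqOn f g C) {w : X} (hw : w ∈ vectorSpan ℝ C) :
    fderiv ℝ f x w = fderiv ℝ g x w := by
  rw [vectorSpan_eq_span_vsub_set_right ℝ hx] at hw
  induction hw using Submodule.span_induction with
  | mem v hv =>
    obtain ⟨y, hy, rfl⟩ := hv
    have hl : HasDerivAt (fun t : ℝ => x + t • (y - x)) (y - x) 0 := by
      simpa using ((hasDerivAt_id (0 : ℝ)).smul_const (y - x)).const_add x
    have h1 : ∀ {k : X → E4}, DifferentiableAt ℝ k x →
        HasDerivWithinAt (fun t : ℝ => k (x + t • (y - x))) (fderiv ℝ k x (y - x)) (Icc 0 1) 0 := by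
      intro k hk
      have h2 : HasFDerivAt k (fderiv ℝ k x) (x + (0 : ℝ) • (y - x)) := by
        simpa using hk.hasFDerivAt
      exact (h2.comp_hasDerivAt (0 : ℝ) hl).hasDerivWithinAt
    have h3 : HasDerivWithinAt (fun t : ℝ => g (x + t • (y - x))) (fderiv ℝ f x (y - x))
        (Icc 0 1) 0 := by
      refine (h1 hf).congr (fun t ht => (hfg ?_).symm) (hfg (by simpa using hx)).symm
      have := hC hx hy (sub_nonneg.2 ht.2) ht.1 (by ring)
      convert this using 1
      module
    exact (uniqueDiffOn_Icc zero_lt_one 0 ⟨le_rfl, zero_le_one⟩).eq_deriv _ h3 (h1 hg)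
  | zero => simp
  | add u v _ _ hu hv => rw [map_add, map_add, hu, hv]
  | smul c v _ hv => rw [map_smul, map_smul, hv]

lemma vectorSpan_convexHull {X : Type*} [AddCommGroup X] [Module ℝ X] (s : Set X) :
    vectorSpan ℝ (convexHull ℝ s) = vectorSpan ℝ s := by
  rw [← direction_affineSpan, affineSpan_convexHull, direction_affineSpan]

/-- The given smooth extensions may leave S off the simplex. Composition with the foot map, a smooth
retraction onto S, brings them back; it changes neither the values on the simplex nor, therefore,
the derivatives in its directions. -/
lemma IsSmoothTriangulation.exists_charts {N : ℕ}
    {K : Geometry.SimplicialComplex ℝ (EuclideanSpace ℝ (Fin N))} {S A : Set E4}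
    {h : K.space ≃ₜ S} (hh : IsSmoothTriangulation K h) {n : E4 → E4} {δ : ℝ} {W : Set E4}
    {P : E4 → E4} {σ : E4 → ℝ} (ht : IsTube S A n δ W P σ) :
    ∃ Γ O, IsChartedTriangulation K h Γ O := by
  choose! G hG1 hG2 hG3 using hh
  have hGS : ∀ s ∈ K.faces, ∀ x ∈ convexHull ℝ (s : Set (EuclideanSpace ℝ (Fin N))),
      G s x ∈ S := fun s hs x hx => by
    rw [hG2 s hs ⟨x, K.convexHull_subset_space hs hx⟩ hx]
    exact (h _).2
  refine ⟨fun s x => P (G s x), fun s => G s ⁻¹' W,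
    fun s hs => ht.isOpen.preimage (hG1 s hs).continuous,
    fun s hs x hx => ht.mem_of_mem (hGS s hs x hx),
    fun s hs => ht.contDiffOn_foot.comp (hG1 s hs).contDiffOn fun x hx => hx,
    fun s hs x hx => ht.foot_mem _ hx, fun s hs x hx => ?_, fun s hs x hx w hw h0 => ?_⟩
  · rw [ht.foot_of_mem (hGS s hs x hx), hG2 s hs x hx]
  · refine hG3 s hs x hx w hw ?_
    rw [← h0]
    have hd := (hG1 s hs).differentiable (by simp) x
    refine fderiv_eqOn_vectorSpan (convex_convexHull ℝ (s : Set _)) hx hd ?_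
      (fun y hy => (ht.foot_of_mem (hGS s hs y hy)).symm) (by rwa [vectorSpan_convexHull])
    exact ((ht.contDiffAt_foot (ht.mem_of_mem (hGS s hs x hx))).differentiableAt
      (by simp)).comp x hd

namespace IsChartedTriangulation

variable {N : ℕ} {K : Geometry.SimplicialComplex ℝ (EuclideanSpace ℝ (Fin N))} {S : Set E4}
  {h : K.space ≃ₜ S} {Γ : Finset (EuclideanSpace ℝ (Fin N)) → EuclideanSpace ℝ (Fin N) → E4}
  {O : Finset (EuclideanSpace ℝ (Fin N)) → Set (EuclideanSpace ℝ (Fin N))}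

lemma isClosed_hull (s : Finset (EuclideanSpace ℝ (Fin N))) :
    IsClosed (convexHull ℝ (s : Set (EuclideanSpace ℝ (Fin N)))) :=
  (s.finite_toSet.isCompact_convexHull ℝ).isClosed

lemma hasFDerivAt (H : IsChartedTriangulation K h Γ O) {s : Finset (EuclideanSpace ℝ (Fin N))}
    (hs : s ∈ K.faces) {x : EuclideanSpace ℝ (Fin N)} (hx : x ∈ O s) :
    HasFDerivAt (Γ s) (fderiv ℝ (Γ s) x) x :=
  (((H.contDiffOn s hs).contDiffAt ((H.isOpen s hs).mem_nhds hx)).differentiableAt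
    (by simp)).hasFDerivAt

/-- Every tangent vector of the surface comes, in the sense of difference quotients, from one of
the simplices at the point. -/
lemma exists_seq (H : IsChartedTriangulation K h Γ O) (hK : K.faces.Finite) {x₀ : K.space}
    {V : Set E4} {B : OrthonormalBasis (Fin 4) ℝ E4} {Z Y : Set E4} {ψ : E4 → E4}
    (hψ : IsGraphChart S V (h x₀ : E4) B Z Y ψ) (hB : B 3 = h x₀) {ζ : E4}
    (hζ : planeProj B ζ = ζ) :
    ∃ s ∈ K.faces, (x₀ : EuclideanSpace ℝ (Fin N)) ∈ convexHull ℝ (s : Set _) ∧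
      ∃ (c : ℕ → ℝ) (x : ℕ → EuclideanSpace ℝ (Fin N)), (∀ k, 0 < c k) ∧
        (∀ k, x k ∈ convexHull ℝ (s : Set _)) ∧ Tendsto x atTop (𝓝 x₀) ∧
        Tendsto (fun k => c k • (Γ s (x k) - Γ s x₀)) atTop (𝓝 ζ) := by
  obtain ⟨c, y, hc, hy, hyp, hyζ⟩ := hψ.exists_seq (h x₀).2 hB hζ
  set x : ℕ → K.space := fun k => h.symm ⟨y k, hy k⟩ with hx
  have hxl : Tendsto x atTop (𝓝 x₀) := by
    have h1 : Tendsto (fun k => (⟨y k, hy k⟩ : S)) atTop (𝓝 (h x₀)) :=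
      tendsto_subtype_rng.2 hyp
    have := (h.symm.continuous.tendsto (h x₀)).comp h1
    rwa [h.symm_apply_apply] at this
  have hhx : ∀ k, (h (x k) : E4) = y k := fun k => by simp [hx]
  -- The complex has finitely many faces, so one of them contains infinitely many terms of the
  -- sequence; being closed, it also contains the limit.
  have h1 : ∃ s ∈ K.faces, ∃ᶠ k in atTop,
      (x k : EuclideanSpace ℝ (Fin N)) ∈ convexHull ℝ (s : Set _) := by
    by_contra! hcon
    have h2 : ∀ s ∈ K.faces, ∀ᶠ k in atTop,
        (x k : EuclideanSpace ℝ (Fin N)) ∉ convexHull ℝ (s : Set _) := hcon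
    obtain ⟨k, hk⟩ := ((eventually_all_finite hK).2 h2).exists
    obtain ⟨s, hs, hxs⟩ := K.mem_space_iff.1 (x k).2
    exact hk s hs hxs
  obtain ⟨s, hs, hfr⟩ := h1
  obtain ⟨φ, hφ, hφs⟩ := extraction_of_frequently_atTop hfr
  have hxl' : Tendsto (fun k => (x (φ k) : EuclideanSpace ℝ (Fin N))) atTop (𝓝 x₀) :=
    (continuous_subtype_val.tendsto x₀).comp (hxl.comp hφ.tendsto_atTop)
  have hx0 : (x₀ : EuclideanSpace ℝ (Fin N)) ∈ convexHull ℝ (s : Set _) :=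
    (isClosed_hull s).mem_of_tendsto hxl' (Eventually.of_forall hφs)
  refine ⟨s, hs, hx0, fun k => c (φ k), fun k => x (φ k), fun k => hc _, hφs, hxl', ?_⟩
  refine (hyζ.comp hφ.tendsto_atTop).congr fun k => ?_
  simp only [Function.comp_apply]
  rw [H.eq s hs _ (hφs k), H.eq s hs _ hx0, hhx]

lemma sub_mem_vectorSpan {s : Finset (EuclideanSpace ℝ (Fin N))}
    {x y : EuclideanSpace ℝ (Fin N)} (hx : x ∈ convexHull ℝ (s : Set _))
    (hy : y ∈ convexHull ℝ (s : Set _)) :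
    x - y ∈ vectorSpan ℝ (s : Set (EuclideanSpace ℝ (Fin N))) := by
  rw [← vectorSpan_convexHull]
  exact vsub_mem_vectorSpan ℝ hx hy

lemma finrank_vectorSpan_add_one {s : Finset (EuclideanSpace ℝ (Fin N))} (hs : s ∈ K.faces) :
    Module.finrank ℝ (vectorSpan ℝ (s : Set (EuclideanSpace ℝ (Fin N)))) + 1 = s.card := by
  have h1 := (K.indep hs)
  have : Nonempty s := (K.nonempty_of_mem_faces hs).to_subtype
  have h2 := h1.finrank_vectorSpan_add_one
  have h3 : range ((↑) : s → EuclideanSpace ℝ (Fin N)) = (s : Set (EuclideanSpace ℝ (Fin N))) :=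
    Subtype.range_coe (s := (s : Set (EuclideanSpace ℝ (Fin N))))
  rw [h3] at h2
  simpa using h2

/-- At a vertex the derivative maps the directions of the simplex injectively into a tangent plane
of S, so there are at most two independent ones. -/
lemma card_le_three (H : IsChartedTriangulation K h Γ O) (hS : IsClosedSurface S)
    {s : Finset (EuclideanSpace ℝ (Fin N))} (hs : s ∈ K.faces) : s.card ≤ 3 := by
  obtain ⟨x, hx⟩ := K.nonempty_of_mem_faces hs
  have hxs : x ∈ convexHull ℝ (s : Set _) := subset_convexHull ℝ _ hx
  have hxO := H.subset s hs hxs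
  obtain ⟨V, B, Z, Y, ψ, hψ, hB⟩ := hS.exists_isGraphChart (H.maps s hs x hxO)
  have hev : ∀ᶠ y in 𝓝 x, Γ s y ∈ S := by
    filter_upwards [(H.isOpen s hs).mem_nhds hxO] with y hy using H.maps s hs y hy
  set L := fderiv ℝ (Γ s) x with hL
  have hpl := hψ.planeProj_fderiv hB (H.hasFDerivAt hs hxO) rfl hev
  set ℓ : vectorSpan ℝ (s : Set (EuclideanSpace ℝ (Fin N))) →ₗ[ℝ] ℝ × ℝ :=
    (((innerSL ℝ (B 0)).prod (innerSL ℝ (B 1)) ∘L L : _ →L[ℝ] ℝ × ℝ) :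
      EuclideanSpace ℝ (Fin N) →ₗ[ℝ] ℝ × ℝ).domRestrict _ with hℓ
  have hinj : Function.Injective ℓ := by
    rw [← LinearMap.ker_eq_bot, LinearMap.ker_eq_bot']
    rintro ⟨w, hw⟩ h0
    refine Subtype.ext (H.injective s hs x hxs w hw ?_)
    have h1 : (⟪B 0, L w⟫, ⟪B 1, L w⟫) = ((0, 0) : ℝ × ℝ) := h0
    have h2 := Prod.ext_iff.1 h1
    simp only at h2
    rw [← hL, ← hpl, planeProj_apply, h2.1, h2.2]
    simp
  have h1 := LinearMap.finrank_le_finrank_of_injective hinj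
  have h2 := finrank_vectorSpan_add_one hs
  simp at h1
  omega

/-- Every point of the complex lies in a triangle. -/
lemma exists_triangle (H : IsChartedTriangulation K h Γ O) (hS : IsClosedSurface S)
    (hK : K.faces.Finite) (x₀ : K.space) : ∃ s ∈ K.faces, s.card = 3 ∧
      (x₀ : EuclideanSpace ℝ (Fin N)) ∈ convexHull ℝ (s : Set _) := by
  obtain ⟨V, B, Z, Y, ψ, hψ, hB⟩ := hS.exists_isGraphChart (h x₀).2
  have hBo := B.inner_eq_ite
  have key : ∀ m : ℕ, ∃ s : K.faces, (x₀ : EuclideanSpace ℝ (Fin N)) ∈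
      convexHull ℝ ((s : Finset (EuclideanSpace ℝ (Fin N))) : Set _) ∧
      ∃ w ∈ vectorSpan ℝ ((s : Finset (EuclideanSpace ℝ (Fin N))) : Set
        (EuclideanSpace ℝ (Fin N))), fderiv ℝ (Γ s) x₀ w = B 0 + (m : ℝ) • B 1 := by
    intro m
    obtain ⟨s, hs, hx0, c, x, hc, hx, hxl, hl⟩ := H.exists_seq hK hψ hB
      (ζ := B 0 + (m : ℝ) • B 1) (by simp [planeProj_apply, inner_add_right, inner_smul_right])
    obtain ⟨w, hw, φ, hφ, hwl, hLw⟩ := exists_tendsto_of_fderiv_injective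
      (H.hasFDerivAt hs (H.subset s hs hx0)) (H.injective s hs _ hx0) hxl
      (fun k => sub_mem_vectorSpan (hx k) hx0) hl
    exact ⟨⟨s, hs⟩, hx0, w, hw, hLw⟩
  choose s hs w hw hL using key
  have : Finite K.faces := hK.to_subtype
  obtain ⟨m, m', hne, he⟩ := Finite.exists_ne_map_eq_of_infinite s
  refine ⟨s m, (s m).2, ?_, hs m⟩
  refine le_antisymm (H.card_le_three hS (s m).2) ?_
  rw [← finrank_vectorSpan_add_one (s m).2]
  have hw' := hw m'
  have hL' := hL m'
  rw [← he] at hw' hL'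
  have hli : LinearIndependent ℝ ![(⟨w m, hw m⟩ : vectorSpan ℝ
      (((s m : Finset (EuclideanSpace ℝ (Fin N))) : Set (EuclideanSpace ℝ (Fin N))))),
      ⟨w m', hw'⟩] := by
    rw [LinearIndependent.pair_iff]
    intro a b hab
    have h1 : a • w m + b • w m' = 0 := congrArg Subtype.val hab
    have h2 := congrArg (fderiv ℝ (Γ (s m)) x₀) h1
    rw [map_add, map_smul, map_smul, hL, hL', ContinuousLinearMap.map_zero] at h2
    have h3 := congrArg (fun v => ⟪B 0, v⟫) h2
    have h4 := congrArg (fun v => ⟪B 1, v⟫) h2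
    simp [inner_add_right, inner_smul_right] at h3 h4
    have h5 : (m : ℝ) - m' ≠ 0 := sub_ne_zero.2 (by exact_mod_cast hne)
    have h6 : a * ((m : ℝ) - m') = 0 := by
      have : b = -a := by linarith
      rw [this] at h4; linarith
    have h7 : a = 0 := (mul_eq_zero.1 h6).resolve_right h5
    exact ⟨h7, by linarith⟩
  have := hli.fintype_card_le_finrank
  simp at this
  omega

end IsChartedTriangulation

/-! ### Triangles of a complex and their affine parametrizations -/

section Triangles

variable {X : Type*}

open Classical in
/-- The face spanned by two points. -/
noncomputable def edgeFace (x y : X) : Finset X := {x, y}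

open Classical in
/-- The face spanned by three points. -/
noncomputable def triFace (x y z : X) : Finset X := {x, y, z}

@[simp] lemma mem_edgeFace {x y w : X} : w ∈ edgeFace x y ↔ w = x ∨ w = y := by simp [edgeFace]

@[simp] lemma mem_triFace {x y z w : X} : w ∈ triFace x y z ↔ w = x ∨ w = y ∨ w = z := by
  simp [triFace]

lemma coe_edgeFace (x y : X) : (edgeFace x y : Set X) = {x, y} := by ext; simp

lemma coe_triFace (x y z : X) : (triFace x y z : Set X) = {x, y, z} := by ext; simp

lemma edgeFace_comm (x y : X) : edgeFace x y = edgeFace y x := by ext; simp [or_comm]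

lemma triFace_rotate (x y z : X) : triFace y z x = triFace x y z := by ext; simp; tauto

lemma triFace_swap (x y z : X) : triFace x z y = triFace x y z := by ext; simp; tauto

/-- The points are the vertices of a triangle of the complex. -/
def IsTriangle (K : Set (Finset X)) (x y z : X) : Prop :=
  triFace x y z ∈ K ∧ x ≠ y ∧ x ≠ z ∧ y ≠ z

lemma IsTriangle.rotate {K : Set (Finset X)} {x y z : X} (h : IsTriangle K x y z) :
    IsTriangle K y z x :=
  ⟨by rw [triFace_rotate]; exact h.1, h.2.2.2, h.2.1.symm, h.2.2.1.symm⟩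

lemma IsTriangle.swap {K : Set (Finset X)} {x y z : X} (h : IsTriangle K x y z) :
    IsTriangle K x z y :=
  ⟨by rw [triFace_swap]; exact h.1, h.2.2.1, h.2.1, h.2.2.2.symm⟩

variable [AddCommGroup X] [Module ℝ X]

/-- The affine parametrization of a triangle. -/
def triPoint (x y z : X) (q : ℝ × ℝ) : X := x + q.1 • (y - x) + q.2 • (z - x)

lemma triPoint_mem_convexHull (x y z : X) {q : ℝ × ℝ} (hq : q ∈ stdTriangle) :
    triPoint x y z q ∈ convexHull ℝ (triFace x y z : Set X) := by
  have hc := convex_convexHull ℝ (triFace x y z : Set X)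
  have hx : x ∈ convexHull ℝ (triFace x y z : Set X) := subset_convexHull ℝ _ (by simp)
  have hy : y ∈ convexHull ℝ (triFace x y z : Set X) := subset_convexHull ℝ _ (by simp)
  have hz : z ∈ convexHull ℝ (triFace x y z : Set X) := subset_convexHull ℝ _ (by simp)
  have h1 := hc.sum_mem (t := Finset.univ) (w := ![1 - q.1 - q.2, q.1, q.2]) (z := ![x, y, z])
    (by intro i _; fin_cases i <;> simp <;> linarith [hq.1, hq.2.1, hq.2.2])
    (by simp [Fin.sum_univ_three]; ring)
    (by intro i _; fin_cases i; exacts [hx, hy, hz])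
  convert h1 using 1
  simp [Fin.sum_univ_three, triPoint]
  module

lemma exists_triPoint_eq {x y z p : X} (hp : p ∈ convexHull ℝ (triFace x y z : Set X)) :
    ∃ q ∈ stdTriangle, triPoint x y z q = p := by
  have hconv : Convex ℝ (triPoint x y z '' stdTriangle) := by
    rintro _ ⟨q, hq, rfl⟩ _ ⟨q', hq', rfl⟩ a b ha hb hab
    refine ⟨a • q + b • q', convex_stdTriangle hq hq' ha hb hab, ?_⟩
    have : a = 1 - b := by linarith
    subst this
    simp [triPoint]
    module
  refine (convexHull_min (t := triPoint x y z '' stdTriangle) ?_ hconv) hp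
  intro v hv
  rw [coe_triFace] at hv
  rcases hv with rfl | rfl | rfl
  · exact ⟨(0, 0), by simp [stdTriangle], by simp [triPoint]⟩
  · exact ⟨(1, 0), by simp [stdTriangle], by simp [triPoint]⟩
  · exact ⟨(0, 1), by simp [stdTriangle], by simp [triPoint]⟩

end Triangles

lemma mem_interior_stdTriangle {q : ℝ × ℝ} :
    q ∈ interior stdTriangle ↔ 0 < q.1 ∧ 0 < q.2 ∧ q.1 + q.2 < 1 := by
  constructor
  · intro hq
    have h1 : ∀ (v : ℝ × ℝ), ∀ᶠ t : ℝ in 𝓝 0, q + t • v ∈ stdTriangle := by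
      intro v
      have : ContinuousAt (fun t : ℝ => q + t • v) 0 := by fun_prop
      exact this.eventually_mem (by simpa using mem_interior_iff_mem_nhds.1 hq)
    have h2 : ∀ v : ℝ × ℝ, ∃ t : ℝ, 0 < t ∧ q + t • v ∈ stdTriangle := by
      intro v
      obtain ⟨t, ht, ht0⟩ := (((h1 v).filter_mono nhdsWithin_le_nhds).and
        (self_mem_nhdsWithin (a := (0 : ℝ)) (s := Ioi 0))).exists
      exact ⟨t, ht0, ht⟩
    obtain ⟨t, ht, ht'⟩ := h2 (-1, 0)
    obtain ⟨s, hs, hs'⟩ := h2 (0, -1)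
    obtain ⟨r, hr, hr'⟩ := h2 (1, 0)
    have a1 := ht'.1; have a2 := hs'.2.1; have a3 := hr'.2.2
    simp at a1 a2 a3
    exact ⟨by linarith, by linarith, by linarith⟩
  · intro hq
    refine mem_interior.2 ⟨{q | 0 < q.1 ∧ 0 < q.2 ∧ q.1 + q.2 < 1},
      fun q hq => ⟨hq.1.le, hq.2.1.le, hq.2.2.le⟩, ?_, hq⟩
    exact (isOpen_lt continuous_const continuous_fst).inter
      ((isOpen_lt continuous_const continuous_snd).inter
        (isOpen_lt (continuous_fst.add continuous_snd) continuous_const))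

section Complex

variable {N : ℕ} {K : Geometry.SimplicialComplex ℝ (EuclideanSpace ℝ (Fin N))}
  {x y z : EuclideanSpace ℝ (Fin N)}

lemma IsTriangle.eq_zero (h : IsTriangle K.faces x y z) {a b : ℝ}
    (hab : a • (y - x) + b • (z - x) = 0) : a = 0 ∧ b = 0 := by
  classical
  obtain ⟨hf, hxy, hxz, hyz⟩ := h
  let e : Fin 3 → triFace x y z := ![⟨x, by simp⟩, ⟨y, by simp⟩, ⟨z, by simp⟩]
  have he : Function.Injective e := by
    intro i j hij
    have h0 := congrArg Subtype.val hij
    fin_cases i <;> fin_cases j <;> first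
      | rfl
      | exact absurd h0 hxy
      | exact absurd h0 hxz
      | exact absurd h0 hyz
      | exact absurd h0.symm hxy
      | exact absurd h0.symm hxz
      | exact absurd h0.symm hyz
  have h2 := affineIndependent_iff.1 ((K.indep hf).comp_embedding ⟨e, he⟩) Finset.univ
    ![-a - b, a, b] (by simp [Fin.sum_univ_three]; ring) (by
      rw [Fin.sum_univ_three]
      change (-a - b) • x + a • y + b • z = 0
      rw [← hab]; module)
  exact ⟨h2 1 (by simp), h2 2 (by simp)⟩

lemma IsTriangle.triPoint_injective (h : IsTriangle K.faces x y z) :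
    Function.Injective (triPoint x y z) := by
  intro q q' he
  have h1 : (q.1 - q'.1) • (y - x) + (q.2 - q'.2) • (z - x) = 0 := by
    have : triPoint x y z q - triPoint x y z q' = 0 := sub_eq_zero.2 he
    rw [← this, triPoint, triPoint]; module
  obtain ⟨h2, h3⟩ := h.eq_zero h1
  exact Prod.ext (sub_eq_zero.1 h2) (sub_eq_zero.1 h3)

/-- A face containing an interior point of a triangle contains the triangle. -/
lemma IsTriangle.subset_of_mem (h : IsTriangle K.faces x y z) {q : ℝ × ℝ}
    (hq : q ∈ interior stdTriangle) {s : Finset (EuclideanSpace ℝ (Fin N))} (hs : s ∈ K.faces)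
    (hqs : triPoint x y z q ∈ convexHull ℝ (s : Set _)) : triFace x y z ⊆ s := by
  obtain ⟨q1, q2, q3⟩ := mem_interior_stdTriangle.1 hq
  -- Two faces meet in the hull of their common vertices. If one vertex of the triangle were
  -- missing, the point would lie on the line through the other two, against the positivity of its
  -- three barycentric weights.
  have hm : triPoint x y z q ∈
      convexHull ℝ ((triFace x y z : Set (EuclideanSpace ℝ (Fin N))) ∩ s) := by
    rw [← K.convexHull_inter_convexHull h.1 hs]
    exact ⟨triPoint_mem_convexHull x y z (interior_subset hq), hqs⟩
  have hseg : ∀ {u v : EuclideanSpace ℝ (Fin N)},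
      (((triFace x y z : Set (EuclideanSpace ℝ (Fin N))) ∩ s) ⊆ {u, v}) →
      ∃ t : ℝ, triPoint x y z q = u + t • (v - u) := by
    intro u v huv
    have := convexHull_mono huv hm
    rw [convexHull_pair, segment_eq_image'] at this
    obtain ⟨t, -, ht⟩ := this
    exact ⟨t, ht.symm⟩
  intro w hw
  by_contra hws
  simp only [mem_triFace] at hw
  rcases hw with rfl | rfl | rfl
  · obtain ⟨t, ht⟩ := hseg (u := y) (v := z) (by
      rintro v ⟨hv1, hv2⟩
      simp only [Finset.mem_coe, mem_triFace] at hv1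
      rcases hv1 with rfl | h' | h'
      · exact absurd hv2 hws
      · simp [h']
      · simp [h'])
    have h1 : (q.1 - (1 - t)) • (y - w) + (q.2 - t) • (z - w) = 0 := by
      have : triPoint w y z q - (y + t • (z - y)) = 0 := sub_eq_zero.2 ht
      rw [← this, triPoint]; module
    have h2 := h.eq_zero h1
    linarith [h2.1, h2.2]
  · obtain ⟨t, ht⟩ := hseg (u := x) (v := z) (by
      rintro v ⟨hv1, hv2⟩
      simp only [Finset.mem_coe, mem_triFace] at hv1
      rcases hv1 with h' | rfl | h'
      · simp [h']
      · exact absurd hv2 hws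
      · simp [h'])
    have h1 : q.1 • (w - x) + (q.2 - t) • (z - x) = 0 := by
      have : triPoint x w z q - (x + t • (z - x)) = 0 := sub_eq_zero.2 ht
      rw [← this, triPoint]; module
    linarith [(h.eq_zero h1).1]
  · obtain ⟨t, ht⟩ := hseg (u := x) (v := y) (by
      rintro v ⟨hv1, hv2⟩
      simp only [Finset.mem_coe, mem_triFace] at hv1
      rcases hv1 with h' | h' | rfl
      · simp [h']
      · simp [h']
      · exact absurd hv2 hws)
    have h1 : (q.1 - t) • (y - x) + q.2 • (w - x) = 0 := by
      have : triPoint x y w q - (x + t • (y - x)) = 0 := sub_eq_zero.2 ht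
      rw [← this, triPoint]; module
    linarith [(h.eq_zero h1).2]

/-- A face containing an interior point of an edge contains the edge. -/
lemma pair_subset_of_mem (h : edgeFace x y ∈ K.faces)
    (hxy : x ≠ y) {t : ℝ} (ht : t ∈ Ioo (0 : ℝ) 1) {s : Finset (EuclideanSpace ℝ (Fin N))}
    (hs : s ∈ K.faces) (hts : x + t • (y - x) ∈ convexHull ℝ (s : Set _)) : edgeFace x y ⊆ s := by
  have hm : x + t • (y - x) ∈
      convexHull ℝ ((edgeFace x y : Set (EuclideanSpace ℝ (Fin N))) ∩ s) := by
    rw [← K.convexHull_inter_convexHull h hs]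
    refine ⟨?_, hts⟩
    rw [coe_edgeFace, convexHull_pair, segment_eq_image']
    exact ⟨t, Ioo_subset_Icc_self ht, rfl⟩
  have hyx : y - x ≠ 0 := sub_ne_zero.2 hxy.symm
  intro w hw
  by_contra hws
  have hsing : ∀ {u : EuclideanSpace ℝ (Fin N)},
      (((edgeFace x y : Set (EuclideanSpace ℝ (Fin N))) ∩ s) ⊆ {u}) →
      x + t • (y - x) = u := by
    intro u hu
    have := convexHull_mono hu hm
    rwa [convexHull_singleton, mem_singleton_iff] at this
  simp only [mem_edgeFace] at hw
  rcases hw with rfl | rfl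
  · have h1 := hsing (u := y) (by
      rintro v ⟨hv1, hv2⟩
      simp only [Finset.mem_coe, mem_edgeFace] at hv1
      rcases hv1 with rfl | h'
      · exact absurd hv2 hws
      · simp [h'])
    have h2 : (t - 1) • (y - w) = 0 := by
      rw [← sub_eq_zero.2 h1]; module
    rcases smul_eq_zero.1 h2 with h3 | h3
    · linarith [ht.2]
    · exact hyx h3
  · have h1 := hsing (u := x) (by
      rintro v ⟨hv1, hv2⟩
      simp only [Finset.mem_coe, mem_edgeFace] at hv1
      rcases hv1 with h' | rfl
      · simp [h']
      · exact absurd hv2 hws)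
    have h2 : t • (w - x) = 0 := by
      rw [← sub_eq_zero.2 h1]; module
    rcases smul_eq_zero.1 h2 with h3 | h3
    · linarith [ht.1]
    · exact hyx h3

end Complex

/-! ### Parametrized triangles of the surface -/

section TriMap

variable {N : ℕ} {K : Geometry.SimplicialComplex ℝ (EuclideanSpace ℝ (Fin N))} {S : Set E4}
  {h : K.space ≃ₜ S} {Γ : Finset (EuclideanSpace ℝ (Fin N)) → EuclideanSpace ℝ (Fin N) → E4}
  {O : Finset (EuclideanSpace ℝ (Fin N)) → Set (EuclideanSpace ℝ (Fin N))}
  {x y z : EuclideanSpace ℝ (Fin N)}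

/-- The parametrization of a triangle of the surface. -/
noncomputable def triMap (Γ : Finset (EuclideanSpace ℝ (Fin N)) → EuclideanSpace ℝ (Fin N) → E4)
    (x y z : EuclideanSpace ℝ (Fin N)) (q : ℝ × ℝ) : E4 := Γ (triFace x y z) (triPoint x y z q)

/-- The angle at the vertex `x` of a triangle of the surface. -/
noncomputable def cornerAngle
    (Γ : Finset (EuclideanSpace ℝ (Fin N)) → EuclideanSpace ℝ (Fin N) → E4)
    (x y z : EuclideanSpace ℝ (Fin N)) : ℝ :=
  InnerProductGeometry.angle (fderiv ℝ (Γ (triFace x y z)) x (y - x))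
    (fderiv ℝ (Γ (triFace x y z)) x (z - x))

/-- The conormal along the side `x y` of a triangle of the surface. -/
noncomputable def sideConormal
    (Γ : Finset (EuclideanSpace ℝ (Fin N)) → EuclideanSpace ℝ (Fin N) → E4)
    (x y z : EuclideanSpace ℝ (Fin N)) (u : ℝ) : E4 :=
  conormal (fderiv ℝ (Γ (triFace x y z)) (x + u • (y - x)) (y - x))
    (fderiv ℝ (Γ (triFace x y z)) (x + u • (y - x)) (z - x))

/-- The total curvature of the side `x y` of a triangle of the surface. -/
noncomputable def sideCurv
    (Γ : Finset (EuclideanSpace ℝ (Fin N)) → EuclideanSpace ℝ (Fin N) → E4)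
    (x y z : EuclideanSpace ℝ (Fin N)) : ℝ :=
  ∫ u in (0 : ℝ)..1, ⟪deriv (deriv fun t : ℝ => Γ (triFace x y z) (x + t • (y - x))) u,
    sideConormal Γ x y z u⟫ / ‖fderiv ℝ (Γ (triFace x y z)) (x + u • (y - x)) (y - x)‖

/-- The linear part of `triPoint`. -/
noncomputable def triDirection (x y z : EuclideanSpace ℝ (Fin N)) :
    ℝ × ℝ →L[ℝ] EuclideanSpace ℝ (Fin N) :=
  (ContinuousLinearMap.fst ℝ ℝ ℝ).smulRight (y - x) +
    (ContinuousLinearMap.snd ℝ ℝ ℝ).smulRight (z - x)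

lemma triDirection_apply (w : ℝ × ℝ) :
    triDirection x y z w = w.1 • (y - x) + w.2 • (z - x) := rfl

lemma triPoint_eq (q : ℝ × ℝ) : triPoint x y z q = x + triDirection x y z q := by
  rw [triPoint, triDirection_apply, add_assoc]

lemma contDiff_triPoint : ContDiff ℝ ∞ (triPoint x y z) := by
  have : triPoint x y z = fun q => x + triDirection x y z q := funext triPoint_eq
  rw [this]
  exact contDiff_const.add (triDirection x y z).contDiff

lemma hasFDerivAt_triPoint (q : ℝ × ℝ) :
    HasFDerivAt (triPoint x y z) (triDirection x y z) q := by
  have : triPoint x y z = fun q => x + triDirection x y z q := funext triPoint_eq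
  rw [this]
  exact (triDirection x y z).hasFDerivAt.const_add x

lemma triDirection_mem_vectorSpan (w : ℝ × ℝ) :
    triDirection x y z w ∈ vectorSpan ℝ (triFace x y z : Set (EuclideanSpace ℝ (Fin N))) := by
  rw [triDirection_apply]
  exact Submodule.add_mem _
    (Submodule.smul_mem _ _ (vsub_mem_vectorSpan ℝ (by simp) (by simp)))
    (Submodule.smul_mem _ _ (vsub_mem_vectorSpan ℝ (by simp) (by simp)))

namespace IsChartedTriangulation

lemma triPoint_mem (H : IsChartedTriangulation K h Γ O) (ht : IsTriangle K.faces x y z) {q : ℝ × ℝ}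
    (hq : q ∈ stdTriangle) : triPoint x y z q ∈ O (triFace x y z) :=
  H.subset _ ht.1 (triPoint_mem_convexHull x y z hq)

lemma contDiffAt_triMap (H : IsChartedTriangulation K h Γ O) (ht : IsTriangle K.faces x y z)
    {q : ℝ × ℝ} (hq : triPoint x y z q ∈ O (triFace x y z)) :
    ContDiffAt ℝ ∞ (triMap Γ x y z) q :=
  ((H.contDiffOn _ ht.1).contDiffAt ((H.isOpen _ ht.1).mem_nhds hq)).comp q
    contDiff_triPoint.contDiffAt

lemma fderiv_triMap (H : IsChartedTriangulation K h Γ O) (ht : IsTriangle K.faces x y z)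
    {q : ℝ × ℝ} (hq : triPoint x y z q ∈ O (triFace x y z)) :
    fderiv ℝ (triMap Γ x y z) q =
      fderiv ℝ (Γ (triFace x y z)) (triPoint x y z q) ∘L triDirection x y z :=
  ((H.hasFDerivAt ht.1 hq).comp q (hasFDerivAt_triPoint q)).fderiv

lemma fderiv_triMap_injective (H : IsChartedTriangulation K h Γ O) (ht : IsTriangle K.faces x y z)
    {q : ℝ × ℝ} (hq : q ∈ stdTriangle) {w : ℝ × ℝ} (hw : fderiv ℝ (triMap Γ x y z) q w = 0) :
    w = 0 := by
  rw [H.fderiv_triMap ht (H.triPoint_mem ht hq)] at hw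
  have h1 := H.injective _ ht.1 _ (triPoint_mem_convexHull x y z hq) _
    (triDirection_mem_vectorSpan w) hw
  have h2 := ht.eq_zero h1
  exact Prod.ext h2.1 h2.2

lemma triMap_eq (H : IsChartedTriangulation K h Γ O) (ht : IsTriangle K.faces x y z)
    {q : ℝ × ℝ} (hq : q ∈ stdTriangle) :
    triMap Γ x y z q = h ⟨triPoint x y z q,
      K.convexHull_subset_space ht.1 (triPoint_mem_convexHull x y z hq)⟩ :=
  H.eq _ ht.1 ⟨_, _⟩ (triPoint_mem_convexHull x y z hq)

/-- The local Gauss–Bonnet formula for a triangle of the surface. -/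
lemma exists_isAdaptedFrame_triMap (H : IsChartedTriangulation K h Γ O) (hS : IsClosedSurface S)
    {A : Set E4} {n : E4 → E4} (hn : IsUnitNormalInto S A n) {δ : ℝ} {W : Set E4} {P : E4 → E4}
    {σ : E4 → ℝ} (hT : IsTube S A n δ W P σ) (ht : IsTriangle K.faces x y z) :
    ∃ U E F, IsAdaptedFrame U (triMap Γ x y z) (fun q => n (triMap Γ x y z q)) E F ∧
      (∀ q ∈ U, triMap Γ x y z q ∈ S) ∧ stdTriangle ⊆ U ∧
      ∫ q in stdTriangle, curvDensity (triMap Γ x y z) (fun q => n (triMap Γ x y z q)) E F q =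
        cornerAngle Γ x y z + cornerAngle Γ y z x + cornerAngle Γ z x y - Real.pi -
          (sideCurv Γ x y z + sideCurv Γ y z x + sideCurv Γ z x y) := by
  set g := triMap Γ x y z with hg
  -- The open set where the extended parametrization is an immersion: it contains the closed
  -- triangle, and adapted frames exist on it.
  set U : Set (ℝ × ℝ) := {q | triPoint x y z q ∈ O (triFace x y z) ∧
    Function.Injective (fderiv ℝ g q)} with hU
  have hV : IsOpen (triPoint x y z ⁻¹' O (triFace x y z)) :=
    (H.isOpen _ ht.1).preimage contDiff_triPoint.continuous
  have hgV : ContDiffOn ℝ ∞ g (triPoint x y z ⁻¹' O (triFace x y z)) := fun q hq =>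
    (H.contDiffAt_triMap ht hq).contDiffWithinAt
  have hUo : IsOpen U := by
    have h1 : ContinuousOn (fderiv ℝ g) (triPoint x y z ⁻¹' O (triFace x y z)) :=
      hgV.continuousOn_fderiv_of_isOpen hV (by simp)
    exact h1.isOpen_inter_preimage hV ContinuousLinearMap.isOpen_injective
  have hUV : U ⊆ triPoint x y z ⁻¹' O (triFace x y z) := fun q hq => hq.1
  have hgS : ∀ q ∈ U, g q ∈ S := fun q hq => H.maps _ ht.1 _ hq.1
  have hsub : stdTriangle ⊆ U := fun q hq => ⟨H.triPoint_mem ht hq,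
    (injective_iff_map_eq_zero _).2 fun w hw => H.fderiv_triMap_injective ht hq hw⟩
  have hnS : ContDiffOn ℝ ∞ (fun q => n (g q)) U := by
    intro q hq
    have h1 := (hT.contDiffAt_normal_comp (hgS q hq)).comp q (H.contDiffAt_triMap ht hq.1)
    refine (h1.contDiffWithinAt (s := U)).congr (fun q' hq' => ?_) ?_
    · simp only [Function.comp_apply]; rw [hT.foot_of_mem (hgS q' hq')]
    · simp only [Function.comp_apply]; rw [hT.foot_of_mem (hgS q hq)]
  obtain ⟨E, F, hEF⟩ := exists_isAdaptedFrame hUo (hgV.mono hUV) hnS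
    (fun q hq => by simpa using hS.subset_sphere (hgS q hq)) (fun q hq => (hn _ (hgS q hq)).1)
    (fun q hq => (hn _ (hgS q hq)).2.1) (fun q hq w => by
      obtain ⟨V, B, Z, Y, ψ, hψ, hB⟩ := hS.exists_isGraphChart (hgS q hq)
      have h1 := hψ.planeProj_fderiv hB (((H.contDiffAt_triMap ht hq.1).differentiableAt
        (by simp)).hasFDerivAt) rfl (by
          filter_upwards [hUo.mem_nhds hq] with q' hq' using hgS q' hq') w
      rw [real_inner_comm]
      refine (hn _ (hgS q hq)).2.2.1 _ ?_
      rw [← h1]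
      exact hψ.mem_tangentConeAt (hgS q hq) hB _)
    (fun q hq w hw => hq.2 (by rw [hw, ContinuousLinearMap.map_zero]))
  refine ⟨U, E, F, hEF, hgS, hsub, ?_⟩
  rw [hEF.integral_curvDensity hsub]
  have hfd : ∀ q ∈ stdTriangle, ∀ w, fderiv ℝ g q w =
      fderiv ℝ (Γ (triFace x y z)) (triPoint x y z q) (w.1 • (y - x) + w.2 • (z - x)) := by
    intro q hq w
    rw [H.fderiv_triMap ht (H.triPoint_mem ht hq)]; rfl
  have m0 : ((0, 0) : ℝ × ℝ) ∈ stdTriangle := by simp [stdTriangle]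
  have m1 : ((1, 0) : ℝ × ℝ) ∈ stdTriangle := by simp [stdTriangle]
  have m2 : ((0, 1) : ℝ × ℝ) ∈ stdTriangle := by simp [stdTriangle]
  -- An affine reparametrization carries each edge of the standard triangle to a side a b, with c
  -- the third vertex; the three edges correspond to the three cyclic orders of x, y, z.
  have side : ∀ (p w w' : ℝ × ℝ) (a b c : EuclideanSpace ℝ (Fin N)),
      triFace a b c = triFace x y z → (∀ u ∈ Icc (0 : ℝ) 1, p + u • w ∈ stdTriangle) →
      triPoint x y z p = a → triDirection x y z w = b - a → triDirection x y z w' = c - a →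
      edgeCurv g p w w' = sideCurv Γ a b c := by
    intro p w w' a b c hf hm hp hw hw'
    have hpt : ∀ u : ℝ, triPoint x y z (p + u • w) = a + u • (b - a) := by
      intro u
      rw [triPoint_eq, map_add, map_smul, hw, ← add_assoc, ← triPoint_eq, hp]
    rw [edgeCurv, sideCurv]
    refine intervalIntegral.integral_congr fun u hu => ?_
    rw [uIcc_of_le zero_le_one] at hu
    have h1 : (fun t : ℝ => g (p + t • w)) = fun t : ℝ => Γ (triFace a b c) (a + t • (b - a)) := by
      funext t; rw [hg, triMap, hpt, hf]
    simp only [h1, sideConormal, hf]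
    rw [hg, H.fderiv_triMap ht (H.triPoint_mem ht (hm u hu))]
    simp only [ContinuousLinearMap.comp_apply, hpt, hw, hw']
  rw [side (0, 0) (1, 0) (0, 1) x y z rfl
      (fun u hu => by simpa [stdTriangle] using hu)
      (by simp [triPoint]) (by simp [triDirection_apply]) (by simp [triDirection_apply]),
    side (1, 0) (-1, 1) (-1, 0) y z x (triFace_rotate x y z)
      (fun u hu => by simpa [stdTriangle] using hu.symm)
      (by simp [triPoint]) (by simp [triDirection_apply]) (by simp [triDirection_apply]),
    side (0, 1) (0, -1) (1, -1) z x y (by rw [← triFace_rotate, triFace_rotate, triFace_rotate])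
      (fun u hu => by simpa [stdTriangle] using hu.symm)
      (by simp [triPoint]) (by simp [triDirection_apply]) (by simp [triDirection_apply])]
  rw [hfd _ m0, hfd _ m0, hfd _ m1, hfd _ m1, hfd _ m2, hfd _ m2]
  have e1 : triFace y z x = triFace x y z := triFace_rotate x y z
  have e2 : triFace z x y = triFace x y z := by rw [← triFace_rotate]
  simp only [cornerAngle, e1, e2, triPoint]
  congr 4 <;> simp

end IsChartedTriangulation

end TriMap

/-! ### Triangles and velocities at a point -/

namespace IsChartedTriangulation

variable {N : ℕ} {K : Geometry.SimplicialComplex ℝ (EuclideanSpace ℝ (Fin N))} {S : Set E4}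
  {h : K.space ≃ₜ S} {Γ : Finset (EuclideanSpace ℝ (Fin N)) → EuclideanSpace ℝ (Fin N) → E4}
  {O : Finset (EuclideanSpace ℝ (Fin N)) → Set (EuclideanSpace ℝ (Fin N))}
  {x y z x' y' z' : EuclideanSpace ℝ (Fin N)}

/-- Every face is contained in a triangle. -/
lemma exists_triangle_superset (H : IsChartedTriangulation K h Γ O) (hS : IsClosedSurface S)
    (hK : K.faces.Finite) {s : Finset (EuclideanSpace ℝ (Fin N))} (hs : s ∈ K.faces) :
    ∃ t ∈ K.faces, t.card = 3 ∧ s ⊆ t := by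
  have hc := H.card_le_three hS hs
  have h0 := (K.nonempty_of_mem_faces hs).card_pos
  have hcases : s.card = 1 ∨ s.card = 2 ∨ s.card = 3 := by omega
  rcases hcases with h1 | h1 | h1
  · obtain ⟨x, rfl⟩ := Finset.card_eq_one.1 h1
    have hx : x ∈ K.space := K.vertices_subset_space hs
    obtain ⟨t, ht, ht3, hxt⟩ := H.exists_triangle hS hK ⟨x, hx⟩
    exact ⟨t, ht, ht3, Finset.singleton_subset_iff.2 ((K.vertex_mem_convexHull_iff hs ht).1 hxt)⟩
  · classical
    obtain ⟨x, y, hxy, hsx⟩ := Finset.card_eq_two.1 h1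
    have he : s = edgeFace x y := by rw [hsx]; ext; simp
    rw [he] at hs ⊢
    have hm : x + (1 / 2 : ℝ) • (y - x) ∈ convexHull ℝ (edgeFace x y : Set _) := by
      rw [coe_edgeFace, convexHull_pair, segment_eq_image']
      exact ⟨1 / 2, by norm_num, rfl⟩
    obtain ⟨t, ht, ht3, hxt⟩ := H.exists_triangle hS hK ⟨_, K.convexHull_subset_space hs hm⟩
    exact ⟨t, ht, ht3, pair_subset_of_mem hs hxy (by norm_num) ht hxt⟩
  · exact ⟨s, hs, h1, subset_rfl⟩

/-- The face that carries the difference quotients is enlarged to a triangle and the points are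
written in its affine parameters. Since the parametrization is an immersion, the difference
quotients of the parameters also converge along a subsequence, to a vector v that points into the
standard triangle. The vertices may be labelled in any way. -/
lemma exists_seq_triangle (H : IsChartedTriangulation K h Γ O) (hS : IsClosedSurface S)
    (hK : K.faces.Finite) {x₀ : K.space}
    {V : Set E4} {B : OrthonormalBasis (Fin 4) ℝ E4} {Z Y : Set E4} {ψ : E4 → E4}
    (hψ : IsGraphChart S V (h x₀ : E4) B Z Y ψ) (hB : B 3 = h x₀) {ζ : E4}
    (hζ : planeProj B ζ = ζ) :
    ∃ t ∈ K.faces, t.card = 3 ∧ (x₀ : EuclideanSpace ℝ (Fin N)) ∈ convexHull ℝ (t : Set _) ∧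
      ∀ x y z, triFace x y z = t → IsTriangle K.faces x y z → ∀ q₀ ∈ stdTriangle,
        triPoint x y z q₀ = x₀ → ∃ (c : ℕ → ℝ) (q : ℕ → ℝ × ℝ) (v : ℝ × ℝ), (∀ k, 0 < c k) ∧
          (∀ k, q k ∈ stdTriangle) ∧ Tendsto (fun k => c k • (q k - q₀)) atTop (𝓝 v) ∧
          fderiv ℝ (triMap Γ x y z) q₀ v = ζ := by
  obtain ⟨s, hs, hx0s, c, X, hc, hX, hXl, hl⟩ := H.exists_seq hK hψ hB hζ
  obtain ⟨t, ht, ht3, hst⟩ := H.exists_triangle_superset hS hK hs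
  have hmono : convexHull ℝ (s : Set (EuclideanSpace ℝ (Fin N))) ⊆ convexHull ℝ (t : Set _) :=
    convexHull_mono (Finset.coe_subset.2 hst)
  refine ⟨t, ht, ht3, hmono hx0s, fun x y z hxyz hT q₀ hq₀ hq₀x => ?_⟩
  subst hxyz
  choose q hq hqX using fun k => exists_triPoint_eq (hmono (hX k))
  obtain ⟨q', hq', φ, hφ, hφl⟩ := isCompact_stdTriangle.tendsto_subseq hq
  have hq0 : q' = q₀ := by
    refine hT.triPoint_injective ?_
    rw [hq₀x]
    refine tendsto_nhds_unique
      (((contDiff_triPoint (x := x) (y := y) (z := z)).continuous.tendsto q').comp hφl) ?_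
    refine (hXl.comp hφ.tendsto_atTop).congr fun k => ?_
    simp [hqX]
  subst hq0
  have hfd := ((H.contDiffAt_triMap hT (H.triPoint_mem hT hq')).differentiableAt
    (by simp)).hasFDerivAt
  have hlim : Tendsto (fun k => c (φ k) • (triMap Γ x y z (q (φ k)) - triMap Γ x y z q')) atTop
      (𝓝 ζ) := by
    refine (hl.comp hφ.tendsto_atTop).congr fun k => ?_
    simp only [Function.comp_apply, triMap, hqX, hq₀x]
    rw [H.eq _ ht ⟨X (φ k), K.convexHull_subset_space hs (hX _)⟩ (hmono (hX _)),
      H.eq _ ht _ (hmono hx0s), H.eq _ hs _ hx0s,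
      H.eq _ hs ⟨X (φ k), K.convexHull_subset_space hs (hX _)⟩ (hX _)]
  obtain ⟨v, -, φ', hφ', hv, hLv⟩ := exists_tendsto_of_fderiv_injective hfd (V := ⊤)
    (fun w _ hw => H.fderiv_triMap_injective hT hq' hw) hφl (fun k => Submodule.mem_top) hlim
  exact ⟨fun k => c (φ (φ' k)), fun k => q (φ (φ' k)), v, fun k => hc _, fun k => hq _, hv, hLv⟩

/-- Coordinates on the tangent plane. -/
noncomputable def planeCoord (B : OrthonormalBasis (Fin 4) ℝ E4) : E4 →L[ℝ] ℝ × ℝ :=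
  (innerSL ℝ (B 0)).prod (innerSL ℝ (B 1))

lemma planeCoord_apply (B : OrthonormalBasis (Fin 4) ℝ E4) (v : E4) :
    planeCoord B v = (⟪B 0, v⟫, ⟪B 1, v⟫) := rfl

lemma planeProj_eq_of_planeCoord_eq {B : OrthonormalBasis (Fin 4) ℝ E4} {v w : E4}
    (hvw : planeCoord B v = planeCoord B w) : planeProj B v = planeProj B w := by
  rw [planeCoord_apply, planeCoord_apply, Prod.mk.injEq] at hvw
  rw [planeProj_apply, planeProj_apply, hvw.1, hvw.2]

/-- Triangles whose interiors contain curves with the same velocity at a common point agree. -/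
lemma triFace_eq_of_velocity (H : IsChartedTriangulation K h Γ O) (hS : IsClosedSurface S)
    (hT : IsTriangle K.faces x y z) (hT' : IsTriangle K.faces x' y' z') {q q' v v' : ℝ × ℝ}
    (hq : q ∈ stdTriangle) (hq' : q' ∈ stdTriangle)
    (hqq : triPoint x y z q = triPoint x' y' z' q')
    (hv : fderiv ℝ (triMap Γ x y z) q v = fderiv ℝ (triMap Γ x' y' z') q' v')
    (hint : ∀ᶠ e : ℝ × (ℝ × ℝ) in 𝓝[>] 0 ×ˢ 𝓝 v, q + e.1 • e.2 ∈ interior stdTriangle)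
    (hint' : ∀ᶠ e : ℝ × (ℝ × ℝ) in 𝓝[>] 0 ×ˢ 𝓝 v', q' + e.1 • e.2 ∈ interior stdTriangle) :
    triFace x y z = triFace x' y' z' := by
  set g := triMap Γ x y z with hg
  set g' := triMap Γ x' y' z' with hg'
  have hgp : g q = g' q' := by
    rw [hg, hg', H.triMap_eq hT hq, H.triMap_eq hT' hq']
    congr 3
  have hgS : g q ∈ S := H.maps _ hT.1 _ (H.triPoint_mem hT hq)
  obtain ⟨V, B, Z, Y, ψ, hψ, hB⟩ := hS.exists_isGraphChart hgS
  have hs := (H.contDiffAt_triMap hT (H.triPoint_mem hT hq))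
  have hs' := (H.contDiffAt_triMap hT' (H.triPoint_mem hT' hq'))
  have hd := (hs.differentiableAt (by simp)).hasFDerivAt
  have hd' := hs'.hasStrictFDerivAt (by simp)
  have hevO : ∀ᶠ p in 𝓝 q', triPoint x' y' z' p ∈ O (triFace x' y' z') :=
    contDiff_triPoint.continuous.continuousAt.eventually_mem
      ((H.isOpen _ hT'.1).mem_nhds (H.triPoint_mem hT' hq'))
  have hevS : ∀ᶠ p in 𝓝 q', g' p ∈ S := hevO.mono fun p hp => H.maps _ hT'.1 _ hp
  set L' : ℝ × ℝ →L[ℝ] ℝ × ℝ := planeCoord B ∘L fderiv ℝ g' q' with hL'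
  have hinj : Function.Injective L' := by
    refine (injective_iff_map_eq_zero _).2 fun w hw => H.fderiv_triMap_injective hT' hq' ?_
    have h1 := hψ.planeProj_fderiv hB hd'.hasFDerivAt hgp.symm hevS w
    rw [← hg', ← h1, planeProj_eq_of_planeCoord_eq (w := 0) (by rw [map_zero]; exact hw), map_zero]
  let e : (ℝ × ℝ) ≃L[ℝ] (ℝ × ℝ) :=
    (LinearEquiv.ofInjectiveEndo (L' : ℝ × ℝ →ₗ[ℝ] ℝ × ℝ) hinj).toContinuousLinearEquiv
  have hstr : HasStrictFDerivAt (fun p => planeCoord B (g' p)) (e : ℝ × ℝ →L[ℝ] ℝ × ℝ) q' :=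
    ((planeCoord B).hasStrictFDerivAt.comp q' hd')
  -- The curve g(q + s v) of the first triangle is pulled back to the parameters of the second by
  -- inverting g' in tangent plane coordinates. The result starts at q' with velocity v', so it
  -- enters the interior of the second parameter triangle for small s > 0.
  set Φ := hstr.localInverse _ e q' with hΦ
  set r : ℝ → ℝ × ℝ := fun s => planeCoord B (g (q + s • v)) with hr
  have hline : HasDerivAt (fun s : ℝ => q + s • v) v 0 := by
    simpa using ((hasDerivAt_id (0 : ℝ)).smul_const v).const_add q
  have hq0 : q + (0 : ℝ) • v = q := by simp
  have hgd : HasDerivAt (fun s : ℝ => g (q + s • v)) (fderiv ℝ g q v) 0 := by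
    have h1 : HasFDerivAt g (fderiv ℝ g q) (q + (0 : ℝ) • v) := by rw [hq0]; exact hd
    exact h1.comp_hasDerivAt (0 : ℝ) hline
  have hrd : HasDerivAt r (L' v') 0 := by
    have h1 := (planeCoord B).hasFDerivAt.comp_hasDerivAt (0 : ℝ) hgd
    rw [hv] at h1
    exact h1
  have hr0 : r 0 = planeCoord B (g' q') := by simp only [hr, hq0, hgp]
  have hΦ0 : Φ (r 0) = q' := by rw [hr0]; exact hstr.localInverse_apply_image
  have hΦd : HasDerivAt (fun s => Φ (r s)) v' 0 := by
    have h1 : HasFDerivAt Φ (e.symm : ℝ × ℝ →L[ℝ] ℝ × ℝ) (r 0) := by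
      rw [hr0]; exact hstr.to_localInverse.hasFDerivAt
    refine (h1.comp_hasDerivAt (0 : ℝ) hrd).congr_deriv ?_
    exact e.symm_apply_apply v'
  have hslope : Tendsto (fun s : ℝ => s⁻¹ • (Φ (r s) - q')) (𝓝[>] 0) (𝓝 v') := by
    have := (hasDerivAt_iff_tendsto_slope_zero.1 hΦd).mono_left
      (nhdsGT_le_nhdsNE (0 : ℝ))
    simpa [hΦ0] using this
  have a1 : ∀ᶠ s in 𝓝[>] (0 : ℝ), Φ (r s) ∈ interior stdTriangle := by
    have h1 := (tendsto_id.prodMk hslope).eventually hint'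
    filter_upwards [h1, self_mem_nhdsWithin] with s hs1 hs0
    have hs0' : s ≠ 0 := (mem_Ioi.1 hs0).ne'
    simpa [smul_smul, mul_inv_cancel₀ hs0'] using hs1
  have a2 : ∀ᶠ s in 𝓝[>] (0 : ℝ), q + s • v ∈ interior stdTriangle :=
    (tendsto_id.prodMk tendsto_const_nhds).eventually hint
  have hrc : Tendsto r (𝓝[>] 0) (𝓝 (planeCoord B (g' q'))) := by
    rw [← hr0]; exact hrd.continuousAt.tendsto.mono_left nhdsWithin_le_nhds
  have a3 : ∀ᶠ s in 𝓝[>] (0 : ℝ), planeCoord B (g' (Φ (r s))) = r s :=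
    hrc.eventually hstr.eventually_right_inverse
  have hYn : Y ∈ 𝓝 (g q) := hψ.isOpen'.mem_nhds hψ.mem
  have a4 : ∀ᶠ s in 𝓝[>] (0 : ℝ), g (q + s • v) ∈ Y := by
    have := (hgd.continuousAt.tendsto.mono_left (nhdsWithin_le_nhds (s := Ioi 0)))
    exact this.eventually (by rw [hq0]; exact hYn)
  have a5 : ∀ᶠ s in 𝓝[>] (0 : ℝ), g' (Φ (r s)) ∈ Y := by
    have h1 : Tendsto (fun s => Φ (r s)) (𝓝[>] 0) (𝓝 q') := by
      have := (hΦd.continuousAt.tendsto.mono_left (nhdsWithin_le_nhds (s := Ioi 0)))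
      rwa [hΦ0] at this
    exact (hs'.continuousAt.tendsto.comp h1).eventually (by rw [← hg', ← hgp]; exact hYn)
  obtain ⟨s, b1, b2, b3, b4, b5⟩ := (a1.and (a2.and (a3.and (a4.and a5)))).exists
  have m1 : g' (Φ (r s)) ∈ S := H.maps _ hT'.1 _ (H.triPoint_mem hT' (interior_subset b1))
  have m2 : g (q + s • v) ∈ S := H.maps _ hT.1 _ (H.triPoint_mem hT (interior_subset b2))
  -- Both points lie on S near the base point and have the same projection to the tangent plane; S
  -- is a graph there, so they are equal. The corresponding point of the complex is interior to both
  -- triangles.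
  have heq : g' (Φ (r s)) = g (q + s • v) := by
    rw [← (hψ.map_eq _ ⟨m1, b5⟩).2, ← (hψ.map_eq _ ⟨m2, b4⟩).2, ← hψ.map_proj (g' _),
      ← hψ.map_proj (g _)]
    exact congrArg ψ (planeProj_eq_of_planeCoord_eq b3)
  rw [hg, hg', H.triMap_eq hT (interior_subset b2), H.triMap_eq hT' (interior_subset b1)] at heq
  have heq' := congrArg Subtype.val (h.injective (Subtype.ext heq))
  simp only at heq'
  refine subset_antisymm ?_ ?_
  · exact hT.subset_of_mem b2 hT'.1 (by
      rw [← heq']; exact triPoint_mem_convexHull _ _ _ (interior_subset b1))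
  · exact hT'.subset_of_mem b1 hT.1 (by
      rw [heq']; exact triPoint_mem_convexHull _ _ _ (interior_subset b2))

end IsChartedTriangulation

/-! ### Areas of plane sectors -/

/-- The open sector spanned by two vectors. -/
def sector (X Y : ℂ) : Set ℂ := {ζ | ∃ a b : ℝ, 0 < a ∧ 0 < b ∧ a • X + b • Y = ζ}

lemma sector_swap (X Y : ℂ) : sector Y X = sector X Y := by
  ext ζ
  exact ⟨fun ⟨a, b, ha, hb, h⟩ => ⟨b, a, hb, ha, by rw [add_comm]; exact h⟩,
    fun ⟨a, b, ha, hb, h⟩ => ⟨b, a, hb, ha, by rw [add_comm]; exact h⟩⟩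

/-- Cramer's rule. The coefficients are multiplied by the square of the determinant rather than by
the determinant, so that both orientations of (X, Y) are covered. -/
lemma mem_sector {X Y ζ : ℂ} (hD : X.re * Y.im - X.im * Y.re ≠ 0) :
    ζ ∈ sector X Y ↔ 0 < (X.re * Y.im - X.im * Y.re) * (ζ.re * Y.im - ζ.im * Y.re) ∧
      0 < (X.re * Y.im - X.im * Y.re) * (X.re * ζ.im - X.im * ζ.re) := by
  set D := X.re * Y.im - X.im * Y.re with hDd
  have hD2 : 0 < D ^ 2 := by positivity
  constructor
  · rintro ⟨a, b, ha, hb, rfl⟩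
    have e1 : D * ((a • X + b • Y).re * Y.im - (a • X + b • Y).im * Y.re) = a * D ^ 2 := by
      simp; rw [hDd]; ring
    have e2 : D * (X.re * (a • X + b • Y).im - X.im * (a • X + b • Y).re) = b * D ^ 2 := by
      simp; rw [hDd]; ring
    rw [e1, e2]
    exact ⟨by positivity, by positivity⟩
  · rintro ⟨h1, h2⟩
    refine ⟨D * (ζ.re * Y.im - ζ.im * Y.re) / D ^ 2, D * (X.re * ζ.im - X.im * ζ.re) / D ^ 2,
      div_pos h1 hD2, div_pos h2 hD2, ?_⟩
    apply Complex.ext <;> simp only [Complex.add_re, Complex.add_im, Complex.smul_re, Complex.smul_im,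
      smul_eq_mul] <;> field_simp <;> rw [hDd] <;> ring

lemma measurableSet_sector {X Y : ℂ} (hD : X.re * Y.im - X.im * Y.re ≠ 0) :
    MeasurableSet (sector X Y) := by
  have : sector X Y =
      {ζ | 0 < (X.re * Y.im - X.im * Y.re) * (ζ.re * Y.im - ζ.im * Y.re)} ∩
      {ζ | 0 < (X.re * Y.im - X.im * Y.re) * (X.re * ζ.im - X.im * ζ.re)} := by
    ext ζ; exact mem_sector hD
  rw [this]
  refine (isOpen_lt (by fun_prop) ?_).measurableSet.inter
    (isOpen_lt (by fun_prop) ?_).measurableSet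
  · exact continuous_const.mul ((Complex.continuous_re.mul continuous_const).sub
      (Complex.continuous_im.mul continuous_const))
  · exact continuous_const.mul ((continuous_const.mul Complex.continuous_im).sub
      (continuous_const.mul Complex.continuous_re))

/-- Invariance under rotations and reflections reduces the area of any sector to one with first side
1 and second side in the upper half plane. -/
lemma measureReal_sector_map (L : ℂ ≃ₗᵢ[ℝ] ℂ) (X Y : ℂ) :
    volume.real (sector (L X) (L Y) ∩ Metric.ball 0 1) =
      volume.real (sector X Y ∩ Metric.ball 0 1) := by
  have h1 : L ⁻¹' (sector (L X) (L Y) ∩ Metric.ball 0 1) = sector X Y ∩ Metric.ball 0 1 := by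
    ext ζ
    simp only [preimage_inter, mem_inter_iff, mem_preimage, mem_ball_zero_iff, L.norm_map]
    refine and_congr_left fun _ => exists_congr fun a => exists_congr fun b =>
      and_congr_right fun _ => and_congr_right fun _ => ?_
    rw [← map_smul, ← map_smul, ← map_add]
    exact L.injective.eq_iff
  have h2 := L.measurePreserving.measure_preimage_emb
    L.toHomeomorph.measurableEmbedding (sector (L X) (L Y) ∩ Metric.ball 0 1)
  rw [h1] at h2
  rw [measureReal_def, measureReal_def, h2]

lemma sector_smul {X Y : ℂ} {c : ℝ} (hc : 0 < c) : sector (c • X) Y = sector X Y := by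
  ext ζ
  constructor
  · rintro ⟨a, b, ha, hb, rfl⟩
    exact ⟨a * c, b, by positivity, hb, by rw [smul_smul]⟩
  · rintro ⟨a, b, ha, hb, rfl⟩
    exact ⟨a / c, b, by positivity, hb, by rw [smul_smul, div_mul_cancel₀ _ hc.ne']⟩

/-- In polar coordinates the sector of the unit disc is the rectangle 0 < r < 1, 0 < θ < arg Y; with
the factor r its integral is arg Y / 2. -/
lemma measureReal_sector_one {Y : ℂ} (hY : 0 < Y.im) :
    volume.real (sector 1 Y ∩ Metric.ball 0 1) = Y.arg / 2 := by
  have hD : (1 : ℂ).re * Y.im - (1 : ℂ).im * Y.re ≠ 0 := by simpa using hY.ne'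
  have hY0 : Y ≠ 0 := by rintro rfl; simp at hY
  have hn : 0 < ‖Y‖ := norm_pos_iff.2 hY0
  have hα0 : 0 < Y.arg := by
    refine lt_of_le_of_ne (Complex.arg_nonneg_iff.2 hY.le) fun h0 => ?_
    have := (Complex.arg_eq_zero_iff.1 h0.symm).2
    exact hY.ne' this
  have hαπ : Y.arg < Real.pi := by
    refine lt_of_le_of_ne (Complex.arg_le_pi Y) fun h0 => ?_
    exact hY.ne' (Complex.arg_eq_pi_iff.1 h0).2
  have hms : MeasurableSet (sector 1 Y ∩ Metric.ball 0 1) :=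
    (measurableSet_sector hD).inter measurableSet_ball
  have hre : Y.re = ‖Y‖ * Real.cos Y.arg := by rw [Complex.cos_arg hY0]; field_simp
  have him : Y.im = ‖Y‖ * Real.sin Y.arg := by rw [Complex.sin_arg]; field_simp
  set α := Y.arg with hα
  have hsα : 0 < Real.sin α := Real.sin_pos_of_pos_of_lt_pi hα0 hαπ
  rw [← integral_indicator_one hms, ← Complex.integral_comp_polarCoord_symm,
    polarCoord_target]
  have hmem : ∀ p ∈ Ioi (0 : ℝ) ×ˢ Ioo (-Real.pi) Real.pi,
      (Complex.polarCoord.symm p ∈ sector 1 Y ∩ Metric.ball 0 1 ↔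
        p ∈ Ioo (0 : ℝ) 1 ×ˢ Ioo 0 α) := by
    rintro ⟨r, θ⟩ ⟨hr, hθ⟩
    simp only [mem_Ioi] at hr
    simp only [mem_inter_iff, mem_sector hD, mem_ball_zero_iff, Complex.norm_polarCoord_symm,
      abs_of_pos hr, mem_prod, mem_Ioo, hr, true_and]
    have e1 : (Complex.polarCoord.symm (r, θ)).re = r * Real.cos θ := by
      simp [Complex.polarCoord_symm_apply, Complex.cos_ofReal_re, Complex.sin_ofReal_re]
    have e2 : (Complex.polarCoord.symm (r, θ)).im = r * Real.sin θ := by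
      simp [Complex.polarCoord_symm_apply, Complex.cos_ofReal_re, Complex.sin_ofReal_re]
    rw [e1, e2]
    have e3 : ((1 : ℂ).re * Y.im - (1 : ℂ).im * Y.re) *
        (r * Real.cos θ * Y.im - r * Real.sin θ * Y.re) =
        (Y.im * (r * ‖Y‖)) * Real.sin (α - θ) := by
      rw [Real.sin_sub, hre, him]; simp; ring
    have e4 : ((1 : ℂ).re * Y.im - (1 : ℂ).im * Y.re) *
        ((1 : ℂ).re * (r * Real.sin θ) - (1 : ℂ).im * (r * Real.cos θ)) =
        (Y.im * r) * Real.sin θ := by simp; ring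
    rw [e3, e4, mul_pos_iff_of_pos_left (by positivity), mul_pos_iff_of_pos_left (by positivity)]
    have k1 : 0 < Real.sin θ ↔ 0 < θ := by
      refine ⟨fun h => ?_, fun h => Real.sin_pos_of_pos_of_lt_pi h hθ.2⟩
      by_contra! h'
      exact absurd h (not_lt.2 (Real.sin_nonpos_of_nonpos_of_neg_pi_le h' hθ.1.le))
    rw [k1]
    constructor
    · rintro ⟨⟨h1, h2⟩, h3⟩
      refine ⟨h3, h2, ?_⟩
      by_contra! h'
      exact absurd h1 (not_lt.2 (Real.sin_nonpos_of_nonpos_of_neg_pi_le (by linarith)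
        (by linarith [hθ.2])))
    · rintro ⟨h1, h2, h3⟩
      exact ⟨⟨Real.sin_pos_of_pos_of_lt_pi (by linarith) (by linarith), h2⟩, h1⟩
  have hsub : Ioo (0 : ℝ) 1 ×ˢ Ioo 0 α ⊆ Ioi (0 : ℝ) ×ˢ Ioo (-Real.pi) Real.pi :=
    prod_mono Ioo_subset_Ioi_self (Ioo_subset_Ioo (by linarith [Real.pi_pos]) hαπ.le)
  have hfun : EqOn (fun p : ℝ × ℝ => p.1 •
      (sector 1 Y ∩ Metric.ball 0 1).indicator (1 : ℂ → ℝ) (Complex.polarCoord.symm p))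
      ((Ioo (0 : ℝ) 1 ×ˢ Ioo 0 α).indicator fun p => p.1) (Ioi (0 : ℝ) ×ˢ Ioo (-Real.pi) Real.pi) := by
    intro p hp
    by_cases h1 : p ∈ Ioo (0 : ℝ) 1 ×ˢ Ioo 0 α
    · simp only [indicator_of_mem h1, indicator_of_mem ((hmem p hp).2 h1)]; simp
    · simp only [indicator_of_notMem h1, indicator_of_notMem (fun h' => h1 ((hmem p hp).1 h'))]
      simp
  rw [setIntegral_congr_fun (measurableSet_Ioi.prod measurableSet_Ioo) hfun,
    setIntegral_indicator (measurableSet_Ioo.prod measurableSet_Ioo),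
    inter_eq_self_of_subset_right hsub]
  have := setIntegral_prod_mul (μ := (volume : Measure ℝ)) (ν := (volume : Measure ℝ))
    (fun r : ℝ => r) (fun _ : ℝ => (1 : ℝ)) (Ioo (0 : ℝ) 1) (Ioo 0 α)
  simp only [mul_one] at this
  rw [Measure.volume_eq_prod, this, ← integral_Ioc_eq_integral_Ioo,
    ← intervalIntegral.integral_of_le zero_le_one]
  simp [hα0.le]
  ring

/-- The area of a sector of the unit disc is half its angle. -/
lemma measureReal_sector {X Y : ℂ} (hD : X.re * Y.im - X.im * Y.re ≠ 0) :
    volume.real (sector X Y ∩ Metric.ball 0 1) = InnerProductGeometry.angle X Y / 2 := by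
  have hX : X ≠ 0 := by rintro rfl; simp at hD
  have hn : 0 < ‖X‖ := norm_pos_iff.2 hX
  have pos : ∀ Y : ℂ, 0 < Y.im →
      volume.real (sector 1 Y ∩ Metric.ball 0 1) = InnerProductGeometry.angle 1 Y / 2 := by
    intro Y hY
    rw [measureReal_sector_one hY, Complex.angle_one_left (by rintro rfl; simp at hY),
      abs_of_nonneg (Complex.arg_nonneg_iff.2 hY.le)]
  have gen : ∀ Y : ℂ, Y.im ≠ 0 →
      volume.real (sector 1 Y ∩ Metric.ball 0 1) = InnerProductGeometry.angle 1 Y / 2 := by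
    intro Y hY
    rcases hY.lt_or_gt with h | h
    · have h1 := pos (Complex.conjLIE Y) (by simpa using h)
      have h2 := measureReal_sector_map Complex.conjLIE 1 Y
      have h3 := Complex.conjLIE.toLinearIsometry.angle_map 1 Y
      simp only [LinearIsometryEquiv.coe_toLinearIsometry] at h3
      rw [show Complex.conjLIE 1 = 1 by simp] at h2 h3
      rw [← h2, h1, h3]
    · exact pos Y h
  have hLX : rotation (Circle.exp (-X.arg)) X = ‖X‖ • (1 : ℂ) := by
    rw [rotation_apply, Circle.coe_exp]
    conv_lhs => rw [← Complex.norm_mul_exp_arg_mul_I X]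
    rw [mul_left_comm, ← Complex.exp_add]
    simp
  have hLi : ∀ u : Circle, (starRingEnd ℂ (rotation u X) * rotation u Y).im =
      X.re * Y.im - X.im * Y.re := by
    intro u
    rw [rotation_apply, rotation_apply, map_mul,
      show starRingEnd ℂ (u : ℂ) * starRingEnd ℂ X * (u * Y) =
        (starRingEnd ℂ (u : ℂ) * u) * (starRingEnd ℂ X * Y) by ring, Complex.conj_mul',
      Circle.norm_coe]
    simp
    ring
  set L := rotation (Circle.exp (-X.arg)) with hL
  have hLY : (L Y).im ≠ 0 := by
    intro h0
    have h1 := hLi (Circle.exp (-X.arg))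
    rw [← hL, hLX] at h1
    simp [h0] at h1
    exact hD h1.symm
  have h3 := L.toLinearIsometry.angle_map X Y
  simp only [LinearIsometryEquiv.coe_toLinearIsometry] at h3
  rw [← measureReal_sector_map L, hLX, sector_smul hn, gen _ hLY, ← h3, hLX,
    InnerProductGeometry.angle_smul_left_of_pos _ _ hn]

/-- A coordinate that is positive at q stays positive for small times; one that vanishes becomes
positive if the velocity has a positive component, uniformly for nearby velocities. Vertices use the
second alternative twice, interior points of an edge use one of each. -/
lemma eventually_add_smul_mem_interior {q v : ℝ × ℝ} (h1 : 0 < q.1 ∨ 0 ≤ q.1 ∧ 0 < v.1)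
    (h2 : 0 < q.2 ∨ 0 ≤ q.2 ∧ 0 < v.2) (h3 : q.1 + q.2 < 1) :
    ∀ᶠ e : ℝ × (ℝ × ℝ) in 𝓝[>] 0 ×ˢ 𝓝 v, q + e.1 • e.2 ∈ interior stdTriangle := by
  have hle : (𝓝[>] (0 : ℝ) ×ˢ 𝓝 v) ≤ 𝓝 ((0 : ℝ), v) := by
    have h0 : 𝓝[>] (0 : ℝ) ≤ 𝓝 0 := nhdsWithin_le_nhds
    exact (Filter.prod_mono_left _ h0).trans nhds_prod_eq.ge
  have hpos : ∀ᶠ e : ℝ × (ℝ × ℝ) in 𝓝[>] 0 ×ˢ 𝓝 v, 0 < e.1 :=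
    (tendsto_fst (f := 𝓝[>] (0 : ℝ)) (g := 𝓝 v)).eventually
      (eventually_mem_nhdsWithin (a := (0 : ℝ)) (s := Ioi 0))
  have c : ∀ (f : ℝ × ℝ → ℝ), Continuous f → 0 < f q →
      ∀ᶠ e : ℝ × (ℝ × ℝ) in 𝓝[>] 0 ×ˢ 𝓝 v, 0 < f (q + e.1 • e.2) := by
    intro f hf h0
    have h4 : ContinuousAt (fun e : ℝ × (ℝ × ℝ) => f (q + e.1 • e.2)) (0, v) := by fun_prop
    exact (h4.eventually_mem (Ioi_mem_nhds (by simpa using h0))).filter_mono hle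
  have d : ∀ (f : ℝ × ℝ →L[ℝ] ℝ), 0 < f q ∨ 0 ≤ f q ∧ 0 < f v →
      ∀ᶠ e : ℝ × (ℝ × ℝ) in 𝓝[>] 0 ×ˢ 𝓝 v, 0 < f (q + e.1 • e.2) := by
    rintro f (h0 | ⟨h0, h0'⟩)
    · exact c f f.continuous h0
    · have h4 : ∀ᶠ w in 𝓝 v, 0 < f w := f.continuous.continuousAt.eventually_mem
        (Ioi_mem_nhds h0')
      filter_upwards [hpos,
        (tendsto_snd (f := 𝓝[>] (0 : ℝ)) (g := 𝓝 v)).eventually h4] with e he1 he2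
      rw [map_add, map_smul]
      exact add_pos_of_nonneg_of_pos h0 (mul_pos he1 he2)
  filter_upwards [d (ContinuousLinearMap.fst ℝ ℝ ℝ) h1, d (ContinuousLinearMap.snd ℝ ℝ ℝ) h2,
    c (fun p => 1 - p.1 - p.2) (by fun_prop) (by linarith)] with e e1 e2 e3
  exact mem_interior_stdTriangle.2 ⟨e1, e2, by linarith⟩

/-! ### The angles around a vertex -/

lemma exists_triFace_eq {X : Type*} {x : X} {t : Finset X} (ht : t.card = 3) (hx : x ∈ t) :
    ∃ y z, triFace x y z = t ∧ x ≠ y ∧ x ≠ z ∧ y ≠ z := by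
  classical
  have h1 : (t.erase x).card = 2 := by rw [Finset.card_erase_of_mem hx, ht]
  obtain ⟨y, z, hyz, he⟩ := Finset.card_eq_two.1 h1
  have hy : y ∈ t.erase x := by rw [he]; simp
  have hz : z ∈ t.erase x := by rw [he]; simp
  refine ⟨y, z, ?_, (Finset.ne_of_mem_erase hy).symm, (Finset.ne_of_mem_erase hz).symm, hyz⟩
  rw [← Finset.insert_erase hx, he]
  ext; simp

lemma eq_or_swap_of_triFace_eq {X : Type*} {K : Set (Finset X)} {x y z y' z' : X}
    (h : IsTriangle K x y z) (h' : IsTriangle K x y' z') (he : triFace x y z = triFace x y' z') :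
    (y' = y ∧ z' = z) ∨ (y' = z ∧ z' = y) := by
  have hy : y' ∈ triFace x y z := by rw [he]; simp
  have hz : z' ∈ triFace x y z := by rw [he]; simp
  simp only [mem_triFace] at hy hz
  obtain ⟨-, h1, h2, h3⟩ := h'
  rcases hy with rfl | rfl | rfl
  · exact absurd rfl h1
  · rcases hz with rfl | rfl | rfl
    · exact absurd rfl h2
    · exact absurd rfl h3
    · exact Or.inl ⟨rfl, rfl⟩
  · rcases hz with rfl | rfl | rfl
    · exact absurd rfl h2
    · exact Or.inr ⟨rfl, rfl⟩
    · exact absurd rfl h3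

/-- Complex coordinates on the tangent plane. -/
noncomputable def planeComplex (B : OrthonormalBasis (Fin 4) ℝ E4) : E4 →L[ℝ] ℂ :=
  (Complex.equivRealProdCLM.symm : ℝ × ℝ →L[ℝ] ℂ) ∘L
    IsChartedTriangulation.planeCoord B

lemma planeComplex_re (B : OrthonormalBasis (Fin 4) ℝ E4) (v : E4) :
    (planeComplex B v).re = ⟪B 0, v⟫ := by
  simp [planeComplex, IsChartedTriangulation.planeCoord_apply]

lemma planeComplex_im (B : OrthonormalBasis (Fin 4) ℝ E4) (v : E4) :
    (planeComplex B v).im = ⟪B 1, v⟫ := by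
  simp [planeComplex, IsChartedTriangulation.planeCoord_apply]

lemma planeProj_eq_of_planeComplex_eq {B : OrthonormalBasis (Fin 4) ℝ E4} {v w : E4}
    (h : planeComplex B v = planeComplex B w) : planeProj B v = planeProj B w := by
  rw [planeProj_apply, planeProj_apply, ← planeComplex_re, ← planeComplex_im, h, planeComplex_re,
    planeComplex_im]

lemma inner_planeComplex {B : OrthonormalBasis (Fin 4) ℝ E4} {v : E4} (hv : planeProj B v = v)
    (w : E4) : ⟪planeComplex B v, planeComplex B w⟫ = ⟪v, w⟫ := by
  conv_rhs => rw [← hv, planeProj_apply]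
  rw [Complex.inner]
  simp [planeComplex_re, planeComplex_im, inner_add_left, inner_smul_left]
  ring

lemma angle_planeComplex {B : OrthonormalBasis (Fin 4) ℝ E4} {v w : E4} (hv : planeProj B v = v)
    (hw : planeProj B w = w) :
    InnerProductGeometry.angle (planeComplex B v) (planeComplex B w) =
      InnerProductGeometry.angle v w := by
  have hn : ∀ u : E4, planeProj B u = u → ‖planeComplex B u‖ = ‖u‖ := fun u hu => by
    rw [← sq_eq_sq₀ (norm_nonneg _) (norm_nonneg _), ← real_inner_self_eq_norm_sq,
      ← real_inner_self_eq_norm_sq, inner_planeComplex hu]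
  rw [InnerProductGeometry.angle, InnerProductGeometry.angle, inner_planeComplex hv, hn v hv,
    hn w hw]

namespace IsChartedTriangulation

variable {N : ℕ} {K : Geometry.SimplicialComplex ℝ (EuclideanSpace ℝ (Fin N))} {S : Set E4}
  {h : K.space ≃ₜ S} {Γ : Finset (EuclideanSpace ℝ (Fin N)) → EuclideanSpace ℝ (Fin N) → E4}
  {O : Finset (EuclideanSpace ℝ (Fin N)) → Set (EuclideanSpace ℝ (Fin N))}
  {x : EuclideanSpace ℝ (Fin N)}

/-- The angles of the triangles at a vertex add up to `2 π`; here every triangle is counted twice,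
once for each order of the other two vertices. -/
lemma sum_cornerAngle (H : IsChartedTriangulation K h Γ O) (hS : IsClosedSurface S)
    (hK : K.faces.Finite) (hx : x ∈ K.vertices)
    {P : Finset (EuclideanSpace ℝ (Fin N) × EuclideanSpace ℝ (Fin N))}
    (hP : ∀ p, p ∈ P ↔ IsTriangle K.faces x p.1 p.2) :
    ∑ p ∈ P, cornerAngle Γ x p.1 p.2 = 4 * Real.pi := by
  classical
  obtain ⟨V, B, Z, Y, ψ, hψ, hB⟩ := hS.exists_isGraphChart
    (h ⟨x, K.vertices_subset_space hx⟩).2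
  set x₀ : K.space := ⟨x, K.vertices_subset_space hx⟩ with hx₀
  set τ := planeComplex B with hτ
  have m0 : ((0, 0) : ℝ × ℝ) ∈ stdTriangle := by simp [stdTriangle]
  have t0 : ∀ y z : EuclideanSpace ℝ (Fin N), triPoint x y z (0, 0) = x := fun y z => by
    simp [triPoint]
  set D : EuclideanSpace ℝ (Fin N) × EuclideanSpace ℝ (Fin N) → ℝ × ℝ →L[ℝ] E4 :=
    fun p => fderiv ℝ (triMap Γ x p.1 p.2) (0, 0) with hD
  have hplane : ∀ p ∈ P, ∀ w, planeProj B (D p w) = D p w := by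
    intro p hp w
    have hT := (hP p).1 hp
    have hm := H.triPoint_mem hT m0
    refine hψ.planeProj_fderiv hB
      ((H.contDiffAt_triMap hT hm).differentiableAt (by simp)).hasFDerivAt ?_ ?_ w
    · rw [H.triMap_eq hT m0]; congr 3; exact t0 _ _
    · have : ∀ᶠ q in 𝓝 ((0, 0) : ℝ × ℝ), triPoint x p.1 p.2 q ∈ O (triFace x p.1 p.2) :=
        contDiff_triPoint.continuous.continuousAt.eventually_mem ((H.isOpen _ hT.1).mem_nhds hm)
      exact this.mono fun q hq => H.maps _ hT.1 _ hq
  have hinj : ∀ p ∈ P, ∀ w, τ (D p w) = 0 → w = 0 := by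
    intro p hp w hw
    refine H.fderiv_triMap_injective ((hP p).1 hp) m0 ?_
    change D p w = 0
    rw [← hplane p hp, planeProj_eq_of_planeComplex_eq (w := 0) (by rw [← hτ, hw, map_zero]),
      map_zero]
  set X : EuclideanSpace ℝ (Fin N) × EuclideanSpace ℝ (Fin N) → ℂ := fun p => τ (D p (1, 0))
    with hX
  set X' : EuclideanSpace ℝ (Fin N) × EuclideanSpace ℝ (Fin N) → ℂ := fun p => τ (D p (0, 1))
    with hX'
  have hlin : ∀ p, ∀ w : ℝ × ℝ, τ (D p w) = w.1 • X p + w.2 • X' p := by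
    intro p w
    have : w = w.1 • (1, 0) + w.2 • (0, 1) := by ext <;> simp
    conv_lhs => rw [this, map_add, map_smul, map_smul, map_add, map_smul, map_smul]
  have hdet : ∀ p ∈ P, (X p).re * (X' p).im - (X p).im * (X' p).re ≠ 0 := by
    intro p hp h0
    have h1 := hinj p hp ((X' p).re, -(X p).re) (by
      rw [hlin]; apply Complex.ext <;> simp <;> linarith)
    have h2 := hinj p hp ((X' p).im, -(X p).im) (by
      rw [hlin]; apply Complex.ext <;> simp <;> linarith)
    simp only [Prod.mk_eq_zero, neg_eq_zero] at h1 h2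
    have h3 := hinj p hp (1, 0) (Complex.ext h1.2 h2.2)
    simp at h3
  have hvel : ∀ p ∈ P, ∀ w : ℝ × ℝ, D p w = fderiv ℝ (Γ (triFace x p.1 p.2)) x
      (w.1 • (p.1 - x) + w.2 • (p.2 - x)) := by
    intro p hp w
    rw [hD]
    simp only
    rw [H.fderiv_triMap ((hP p).1 hp) (H.triPoint_mem ((hP p).1 hp) m0), t0]
    rfl
  have hangle : ∀ p ∈ P, cornerAngle Γ x p.1 p.2 =
      2 * volume.real (sector (X p) (X' p) ∩ Metric.ball 0 1) := by
    intro p hp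
    rw [measureReal_sector (hdet p hp), hX, hX', angle_planeComplex (hplane p hp _)
      (hplane p hp _), hvel p hp, hvel p hp, cornerAngle]
    simp only [one_smul, zero_smul, add_zero, zero_add]
    ring
  have hswapP : ∀ p ∈ P, p.swap ∈ P := fun p hp => (hP _).2 ((hP p).1 hp).swap
  have hXswap : ∀ p ∈ P, X p.swap = X' p ∧ X' p.swap = X p := by
    intro p hp
    simp only [hX, hX', hvel p hp, hvel _ (hswapP p hp), Prod.fst_swap, Prod.snd_swap,
      triFace_swap]
    simp
  -- Every tangent vector is reached in some triangle at x by a velocity with nonnegative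
  -- coordinates. If ζ is not on a line spanned by an edge direction, both coordinates are positive.
  have hcover : ∀ ζ : ℂ, (∀ p ∈ P, ζ ∉ (Submodule.span ℝ {X p} : Submodule ℝ ℂ)) →
      ∃ p ∈ P, ζ ∈ sector (X p) (X' p) := by
    intro ζ hζ
    obtain ⟨t, ht, ht3, hxt, hseq⟩ := H.exists_seq_triangle hS hK hψ hB
      (ζ := ζ.re • B 0 + ζ.im • B 1)
      (by simp [planeProj_apply, inner_add_right, inner_smul_right])
    obtain ⟨y, z, hyz, hne⟩ := exists_triFace_eq ht3 ((K.vertex_mem_convexHull_iff hx ht).1 hxt)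
    have hT : IsTriangle K.faces x y z := ⟨by rw [hyz]; exact ht, hne⟩
    obtain ⟨c, q, v, hc, hq, hv, hvζ⟩ := hseq x y z hyz hT (0, 0) m0 (t0 y z)
    have hp : (y, z) ∈ P := (hP _).2 hT
    have hv1 : 0 ≤ v.1 := ge_of_tendsto ((continuous_fst.tendsto _).comp hv)
      (Eventually.of_forall fun k => by simpa using mul_nonneg (hc k).le (hq k).1)
    have hv2 : 0 ≤ v.2 := ge_of_tendsto ((continuous_snd.tendsto _).comp hv)
      (Eventually.of_forall fun k => by simpa using mul_nonneg (hc k).le (hq k).2.1)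
    have hζv : v.1 • X (y, z) + v.2 • X' (y, z) = ζ := by
      rw [← hlin, hD]
      simp only
      rw [hvζ]
      apply Complex.ext <;>
        simp [hτ, planeComplex_re, planeComplex_im]
    refine ⟨(y, z), hp, v.1, v.2, lt_of_le_of_ne hv1 fun h0 => ?_,
      lt_of_le_of_ne hv2 fun h0 => ?_, hζv⟩
    · refine hζ _ (hswapP _ hp) (Submodule.mem_span_singleton.2 ⟨v.2, ?_⟩)
      rw [(hXswap _ hp).1, ← hζv, ← h0, zero_smul, zero_add]
    · refine hζ _ hp (Submodule.mem_span_singleton.2 ⟨v.1, ?_⟩)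
      rw [← hζv, ← h0, zero_smul, add_zero]
  -- A vector in two open sectors is a velocity entering both triangles, which are then equal; the
  -- pairs can differ only in order.
  have hunique : ∀ ζ : ℂ, ∀ p ∈ P, ∀ p' ∈ P, ζ ∈ sector (X p) (X' p) →
      ζ ∈ sector (X p') (X' p') → p' = p ∨ p' = p.swap := by
    rintro ζ p hp p' hp' ⟨a, b, ha, hb, hab⟩ ⟨a', b', ha', hb', hab'⟩
    have hT := (hP p).1 hp
    have hT' := (hP p').1 hp'
    have he := H.triFace_eq_of_velocity hS hT hT' (v := (a, b)) (v' := (a', b')) m0 m0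
      (by rw [t0, t0]) (by
        change D p (a, b) = D p' (a', b')
        rw [← hplane p hp, ← hplane p' hp']
        refine planeProj_eq_of_planeComplex_eq ?_
        rw [← hτ, hlin, hlin, hab, hab'])
      (eventually_add_smul_mem_interior (Or.inr ⟨le_rfl, ha⟩) (Or.inr ⟨le_rfl, hb⟩) (by simp))
      (eventually_add_smul_mem_interior (Or.inr ⟨le_rfl, ha'⟩) (Or.inr ⟨le_rfl, hb'⟩) (by simp))
    rcases eq_or_swap_of_triFace_eq hT hT' he with ⟨h1, h2⟩ | ⟨h1, h2⟩
    · exact Or.inl (Prod.ext h1 h2)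
    · exact Or.inr (Prod.ext h1 h2)
  have hnull : ∀ᵐ ζ : ℂ, ∀ p ∈ P, ζ ∉ (Submodule.span ℝ {X p} : Submodule ℝ ℂ) := by
    refine (ae_ball_iff P.countable_toSet).2 fun p hp => ?_
    refine measure_eq_zero_iff_ae_notMem.1 (Measure.addHaar_submodule _ _ fun htop => ?_)
    have h1 : X' p ∈ (Submodule.span ℝ {X p} : Submodule ℝ ℂ) := by rw [htop]; trivial
    obtain ⟨a, ha⟩ := Submodule.mem_span_singleton.1 h1
    refine hdet p hp ?_
    rw [← ha]; simp; ring
  -- Almost every point of the unit disc lies in exactly two of the sectors, those of a pair and of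
  -- its swap. The sector areas therefore add up to 2π, and each is half an angle.
  have hcount : (fun ζ : ℂ => ∑ p ∈ P, (sector (X p) (X' p) ∩ Metric.ball 0 1).indicator
      (1 : ℂ → ℝ) ζ) =ᵐ[volume] (Metric.ball (0 : ℂ) 1).indicator fun _ => 2 := by
    filter_upwards [hnull] with ζ hζ
    by_cases hb : ζ ∈ Metric.ball (0 : ℂ) 1
    · rw [indicator_of_mem hb]
      obtain ⟨p, hp, hpζ⟩ := hcover ζ hζ
      have hfil : P.filter (fun p => ζ ∈ sector (X p) (X' p) ∩ Metric.ball 0 1) =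
          {p, p.swap} := by
        ext p'
        simp only [Finset.mem_filter, Finset.mem_insert, Finset.mem_singleton]
        constructor
        · rintro ⟨hp', hp'ζ, -⟩
          exact hunique ζ p hp p' hp' hpζ hp'ζ
        · rintro (rfl | rfl)
          · exact ⟨hp, hpζ, hb⟩
          · refine ⟨hswapP p hp, ?_, hb⟩
            rw [(hXswap p hp).1, (hXswap p hp).2, sector_swap]
            exact hpζ
      have hne : p ≠ p.swap := fun h0 => ((hP p).1 hp).2.2.2 (congrArg Prod.fst h0)
      simp only [indicator_apply, Pi.one_apply]
      rw [← Finset.sum_filter, hfil, Finset.sum_pair hne]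
      norm_num
    · rw [indicator_of_notMem hb]
      exact Finset.sum_eq_zero fun p _ => indicator_of_notMem (fun h' => hb h'.2) _
  have hms : ∀ p ∈ P, MeasurableSet (sector (X p) (X' p) ∩ Metric.ball 0 1) := fun p hp =>
    (measurableSet_sector (hdet p hp)).inter measurableSet_ball
  have hsum : ∑ p ∈ P, volume.real (sector (X p) (X' p) ∩ Metric.ball 0 1) = 2 * Real.pi := by
    calc ∑ p ∈ P, volume.real (sector (X p) (X' p) ∩ Metric.ball 0 1)
        = ∑ p ∈ P, ∫ ζ, (sector (X p) (X' p) ∩ Metric.ball 0 1).indicator (1 : ℂ → ℝ) ζ :=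
          Finset.sum_congr rfl fun p hp => (integral_indicator_one (hms p hp)).symm
      _ = ∫ ζ, ∑ p ∈ P, (sector (X p) (X' p) ∩ Metric.ball 0 1).indicator (1 : ℂ → ℝ) ζ := by
          refine (integral_finsetSum _ fun p hp => ?_).symm
          refine (integrable_indicator_iff (hms p hp)).2 (integrableOn_const ?_)
          exact ((measure_mono inter_subset_right).trans_lt measure_ball_lt_top).ne
      _ = 2 * Real.pi := by
          rw [integral_congr_ae hcount, integral_indicator measurableSet_ball, setIntegral_const,
            measureReal_def, Complex.volume_ball]
          simp [mul_comm]
  rw [Finset.sum_congr rfl hangle, ← Finset.mul_sum, hsum]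
  ring

end IsChartedTriangulation

/-! ### The two triangles along an edge -/

lemma exists_triFace_eq_of_mem {X : Type*} {x y : X} {t : Finset X} (ht : t.card = 3) (hx : x ∈ t)
    (hy : y ∈ t) (hxy : x ≠ y) : ∃ z, triFace x y z = t ∧ x ≠ z ∧ y ≠ z := by
  obtain ⟨a, b, hab, h1, h2, h3⟩ := exists_triFace_eq ht hx
  have hy' := hy
  rw [← hab, mem_triFace] at hy'
  rcases hy' with h4 | rfl | rfl
  · exact absurd h4.symm hxy
  · exact ⟨b, hab, h2, h3⟩
  · exact ⟨a, by rw [triFace_swap]; exact hab, h1, h3.symm⟩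

/-- F is the quarter turn of e / |e| inside the plane. F and -F single out the two sides of an edge
with velocity e. -/
lemma exists_orthogonal_of_planeProj {B : OrthonormalBasis (Fin 4) ℝ E4} {e : E4}
    (he : planeProj B e = e) (h0 : e ≠ 0) : ∃ F, ⟪F, F⟫ = 1 ∧ planeProj B F = F ∧ ⟪e, F⟫ = 0 ∧
      ∀ Z, planeProj B Z = Z → Z = (⟪e, Z⟫ / ‖e‖ ^ 2) • e + ⟪F, Z⟫ • F := by
  have hn : ‖e‖ ≠ 0 := norm_ne_zero_iff.2 h0
  have hi : ∀ w : E4, ⟪e, w⟫ = ⟪B 0, e⟫ * ⟪B 0, w⟫ + ⟪B 1, e⟫ * ⟪B 1, w⟫ := by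
    intro w
    conv_lhs => rw [← he, planeProj_apply]
    simp [inner_add_left, inner_smul_left]
  have hne : ⟪B 0, e⟫ ^ 2 + ⟪B 1, e⟫ ^ 2 = ‖e‖ ^ 2 := by
    rw [← real_inner_self_eq_norm_sq, hi]; ring
  set a := ⟪B 0, e⟫ with ha
  set b := ⟪B 1, e⟫ with hb
  have hF : ∀ Z : E4, ⟪‖e‖⁻¹ • (-b • B 0 + a • B 1), Z⟫ =
      ‖e‖⁻¹ * (-b * ⟪B 0, Z⟫ + a * ⟪B 1, Z⟫) := by
    intro Z
    simp [inner_add_left, inner_smul_left]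
    ring
  refine ⟨‖e‖⁻¹ • (-b • B 0 + a • B 1), ?_, ?_, ?_, fun Z hZ => ?_⟩
  · rw [hF]
    simp [inner_add_right, inner_smul_right]
    field_simp
    linarith
  · simp [planeProj_apply, inner_add_right, inner_smul_right]
    module
  · rw [real_inner_comm, hF, ← ha, ← hb]; ring
  · rw [hF, hi]
    have he' : e = a • B 0 + b • B 1 := by rw [ha, hb, ← planeProj_apply, he]
    have e0 : ⟪B 0, Z⟫ = (a * ⟪B 0, Z⟫ + b * ⟪B 1, Z⟫) / ‖e‖ ^ 2 * a +
        ‖e‖⁻¹ * (-b * ⟪B 0, Z⟫ + a * ⟪B 1, Z⟫) * (‖e‖⁻¹ * -b) := by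
      field_simp; rw [← hne]; ring
    have e1 : ⟪B 1, Z⟫ = (a * ⟪B 0, Z⟫ + b * ⟪B 1, Z⟫) / ‖e‖ ^ 2 * b +
        ‖e‖⁻¹ * (-b * ⟪B 0, Z⟫ + a * ⟪B 1, Z⟫) * (‖e‖⁻¹ * a) := by
      field_simp; rw [← hne]; ring
    calc Z = ⟪B 0, Z⟫ • B 0 + ⟪B 1, Z⟫ • B 1 := by rw [← planeProj_apply, hZ]
      _ = ((a * ⟪B 0, Z⟫ + b * ⟪B 1, Z⟫) / ‖e‖ ^ 2) • (a • B 0 + b • B 1) +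
          (‖e‖⁻¹ * (-b * ⟪B 0, Z⟫ + a * ⟪B 1, Z⟫)) • ‖e‖⁻¹ • (-b • B 0 + a • B 1) := by
        conv_lhs => rw [e0, e1]
        module
      _ = _ := by rw [← he']

lemma conormal_eq_of_decomposition {e Z G : E4} (he : e ≠ 0) (hG : ⟪G, G⟫ = 1) (heG : ⟪e, G⟫ = 0)
    (hZ : Z = (⟪e, Z⟫ / ‖e‖ ^ 2) • e + ⟪G, Z⟫ • G) (hpos : 0 < ⟪G, Z⟫) : conormal e Z = G := by
  have hn : 0 < ‖e‖ := norm_pos_iff.2 he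
  have h1 := conormal_eq (E := ‖e‖⁻¹ • e) (F := G) (X := e) (Z := Z) (a := ‖e‖) (b := 0)
    (c := ⟪e, Z⟫ / ‖e‖) (d := ⟪G, Z⟫)
    (by rw [inner_smul_left, inner_smul_right, real_inner_self_eq_norm_sq]; simp; field_simp)
    hG (by rw [inner_smul_left, heG, mul_zero]) (by simp [smul_smul, hn.ne'])
    (by
      conv_lhs => rw [hZ]
      rw [smul_smul]; congr 2; field_simp)
    (by simpa using mul_pos hn hpos)
  rw [h1]
  simp [Real.sqrt_sq hn.le, smul_smul, hn.ne']

namespace IsChartedTriangulation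

variable {N : ℕ} {K : Geometry.SimplicialComplex ℝ (EuclideanSpace ℝ (Fin N))} {S : Set E4}
  {h : K.space ≃ₜ S} {Γ : Finset (EuclideanSpace ℝ (Fin N)) → EuclideanSpace ℝ (Fin N) → E4}
  {O : Finset (EuclideanSpace ℝ (Fin N)) → Set (EuclideanSpace ℝ (Fin N))}
  {x y : EuclideanSpace ℝ (Fin N)}

lemma add_smul_mem_edge (x y : EuclideanSpace ℝ (Fin N)) {u : ℝ} (hu : u ∈ Icc (0 : ℝ) 1) :
    x + u • (y - x) ∈ convexHull ℝ (edgeFace x y : Set (EuclideanSpace ℝ (Fin N))) := by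
  rw [coe_edgeFace, convexHull_pair, segment_eq_image']
  exact ⟨u, hu, rfl⟩

lemma edgeFace_subset (x y z : EuclideanSpace ℝ (Fin N)) : edgeFace x y ⊆ triFace x y z := by
  intro w hw
  simp only [mem_edgeFace, mem_triFace] at hw ⊢
  tauto

lemma edge_mem (x y z : EuclideanSpace ℝ (Fin N)) {w : EuclideanSpace ℝ (Fin N)}
    (hw : w ∈ convexHull ℝ (edgeFace x y : Set (EuclideanSpace ℝ (Fin N)))) :
    w ∈ convexHull ℝ (triFace x y z : Set (EuclideanSpace ℝ (Fin N))) :=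
  convexHull_mono (Finset.coe_subset.2 (edgeFace_subset x y z)) hw

lemma eq_on_edge (H : IsChartedTriangulation K h Γ O) {z z' : EuclideanSpace ℝ (Fin N)}
    (hT : IsTriangle K.faces x y z) (hT' : IsTriangle K.faces x y z')
    {w : EuclideanSpace ℝ (Fin N)}
    (hw : w ∈ convexHull ℝ (edgeFace x y : Set (EuclideanSpace ℝ (Fin N)))) :
    Γ (triFace x y z) w = Γ (triFace x y z') w := by
  have hws := K.convexHull_subset_space hT.1 (edge_mem x y z hw)
  rw [H.eq _ hT.1 ⟨w, hws⟩ (edge_mem x y z hw), H.eq _ hT'.1 ⟨w, hws⟩ (edge_mem x y z' hw)]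

lemma fderiv_eq_on_edge (H : IsChartedTriangulation K h Γ O) {z z' : EuclideanSpace ℝ (Fin N)}
    (hT : IsTriangle K.faces x y z) (hT' : IsTriangle K.faces x y z')
    {w : EuclideanSpace ℝ (Fin N)}
    (hw : w ∈ convexHull ℝ (edgeFace x y : Set (EuclideanSpace ℝ (Fin N)))) :
    fderiv ℝ (Γ (triFace x y z)) w (y - x) = fderiv ℝ (Γ (triFace x y z')) w (y - x) := by
  refine fderiv_eqOn_vectorSpan (convex_convexHull ℝ _) hw
    (H.hasFDerivAt hT.1 (H.subset _ hT.1 (edge_mem x y z hw))).differentiableAt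
    (H.hasFDerivAt hT'.1 (H.subset _ hT'.1 (edge_mem x y z' hw))).differentiableAt
    (fun v hv => H.eq_on_edge hT hT' hv) ?_
  rw [vectorSpan_convexHull]
  exact vsub_mem_vectorSpan ℝ (by simp) (by simp)

/-- At an interior point of an edge exactly two triangles meet, with opposite conormals. -/
lemma exists_opposite_conormals (H : IsChartedTriangulation K h Γ O) (hS : IsClosedSurface S)
    (hK : K.faces.Finite) (hxy : x ≠ y) (he : edgeFace x y ∈ K.faces) {u : ℝ}
    (hu : u ∈ Ioo (0 : ℝ) 1) :
    ∃ z z', z ≠ z' ∧ (∀ w, IsTriangle K.faces x y w ↔ w = z ∨ w = z') ∧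
      sideConormal Γ x y z' u = -sideConormal Γ x y z u := by
  classical
  have huI := Ioo_subset_Icc_self hu
  set p := x + u • (y - x) with hp
  have hpe := add_smul_mem_edge x y huI
  set x₀ : K.space := ⟨p, K.convexHull_subset_space he hpe⟩ with hx₀
  obtain ⟨V, B, Z, Y, ψ, hψ, hB⟩ := hS.exists_isGraphChart (h x₀).2
  have m0 : ((u, 0) : ℝ × ℝ) ∈ stdTriangle := ⟨hu.1.le, le_rfl, by simpa using hu.2.le⟩
  have t0 : ∀ z : EuclideanSpace ℝ (Fin N), triPoint x y z (u, 0) = p := fun z => by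
    simp [triPoint, hp]
  set D : EuclideanSpace ℝ (Fin N) → ℝ × ℝ →L[ℝ] E4 := fun z => fderiv ℝ (triMap Γ x y z) (u, 0)
    with hD
  have hplane : ∀ z, IsTriangle K.faces x y z → ∀ w, planeProj B (D z w) = D z w := by
    intro z hT w
    have hm := H.triPoint_mem hT m0
    refine hψ.planeProj_fderiv hB
      ((H.contDiffAt_triMap hT hm).differentiableAt (by simp)).hasFDerivAt ?_ ?_ w
    · rw [H.triMap_eq hT m0]; congr 3; exact t0 _
    · have : ∀ᶠ q in 𝓝 ((u, 0) : ℝ × ℝ), triPoint x y z q ∈ O (triFace x y z) :=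
        contDiff_triPoint.continuous.continuousAt.eventually_mem ((H.isOpen _ hT.1).mem_nhds hm)
      exact this.mono fun q hq => H.maps _ hT.1 _ hq
  have hvel : ∀ z, IsTriangle K.faces x y z → ∀ w : ℝ × ℝ, D z w = fderiv ℝ (Γ (triFace x y z)) p
      (w.1 • (y - x) + w.2 • (z - x)) := by
    intro z hT w
    simp only [hD]
    rw [H.fderiv_triMap hT (H.triPoint_mem hT m0), t0]
    rfl
  have hlin : ∀ z, ∀ w : ℝ × ℝ, D z w = w.1 • D z (1, 0) + w.2 • D z (0, 1) := by
    intro z w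
    have : w = w.1 • (1, 0) + w.2 • (0, 1) := by ext <;> simp
    conv_lhs => rw [this, map_add, map_smul, map_smul]
  obtain ⟨t, ht, ht3, het⟩ := H.exists_triangle_superset hS hK he
  obtain ⟨z₀, hz₀, hz₀'⟩ := exists_triFace_eq_of_mem ht3 (het (by simp)) (het (by simp)) hxy
  have hT₀ : IsTriangle K.faces x y z₀ := ⟨by rw [hz₀]; exact ht, hxy, hz₀'⟩
  set e := D z₀ (1, 0) with hed
  have hDe : ∀ z, IsTriangle K.faces x y z → D z (1, 0) = e := by
    intro z hT
    rw [hed, hvel z hT, hvel z₀ hT₀]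
    simpa using H.fderiv_eq_on_edge hT hT₀ hpe
  have he0 : e ≠ 0 := by
    intro h0
    have := H.fderiv_triMap_injective hT₀ m0 h0
    simp at this
  have hen : ‖e‖ ^ 2 ≠ 0 := by positivity
  obtain ⟨F, hF1, hFp, heF, hFd⟩ := exists_orthogonal_of_planeProj (hplane z₀ hT₀ (1, 0)) he0
  have hcon : ∀ z, IsTriangle K.faces x y z → sideConormal Γ x y z u = conormal e (D z (0, 1)) := by
    intro z hT
    rw [sideConormal, ← hDe z hT, hvel z hT, hvel z hT]
    simp only [one_smul, zero_smul, add_zero, zero_add, ← hp]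
  -- Used for G = F and G = -F, the two sides of the edge. Existence: G is a velocity in some
  -- triangle at the point, this triangle contains the edge, and the third vertex must lie on the
  -- side of G. Uniqueness: on a triangle of that side, a combination of the edge direction and the
  -- direction of the third vertex gives G itself and enters the interior, so two such triangles
  -- share a velocity.
  have key : ∀ G : E4, ⟪G, G⟫ = 1 → planeProj B G = G → ⟪e, G⟫ = 0 →
      (∀ Z, planeProj B Z = Z → Z = (⟪e, Z⟫ / ‖e‖ ^ 2) • e + ⟪G, Z⟫ • G) →
      (∃ z, IsTriangle K.faces x y z ∧ 0 < ⟪G, D z (0, 1)⟫) ∧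
      (∀ z z', IsTriangle K.faces x y z → IsTriangle K.faces x y z' → 0 < ⟪G, D z (0, 1)⟫ →
        0 < ⟪G, D z' (0, 1)⟫ → z = z') ∧
      ∀ z, IsTriangle K.faces x y z → 0 < ⟪G, D z (0, 1)⟫ → sideConormal Γ x y z u = G := by
    intro G hG hGp heG hGd
    refine ⟨?_, ?_, ?_⟩
    · obtain ⟨t, ht, ht3, hxt, hseq⟩ := H.exists_seq_triangle hS hK hψ hB hGp
      have het := pair_subset_of_mem he hxy hu ht hxt
      obtain ⟨z, hz, hz'⟩ := exists_triFace_eq_of_mem ht3 (het (by simp)) (het (by simp)) hxy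
      have hT : IsTriangle K.faces x y z := ⟨by rw [hz]; exact ht, hxy, hz'⟩
      obtain ⟨c, q, v, hc, hq, hv, hvζ⟩ := hseq x y z hz hT (u, 0) m0 (t0 z)
      have hv2 : 0 ≤ v.2 := ge_of_tendsto ((continuous_snd.tendsto _).comp hv)
        (Eventually.of_forall fun k => by simpa using mul_nonneg (hc k).le (hq k).2.1)
      refine ⟨z, hT, ?_⟩
      have h1 : D z v = G := hvζ
      rw [hlin, hDe z hT] at h1
      have h2 := congrArg (fun w => ⟪G, w⟫) h1
      simp only [inner_add_right, inner_smul_right, hG] at h2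
      rw [real_inner_comm, heG, mul_zero, zero_add] at h2
      by_contra! h3
      nlinarith [mul_nonneg_of_nonpos_of_nonpos (neg_nonpos.2 hv2) h3]
    · intro z z' hT hT' hz hz'
      have hG' : ∀ z, IsTriangle K.faces x y z → 0 < ⟪G, D z (0, 1)⟫ →
          D z (-(⟪e, D z (0, 1)⟫ / ‖e‖ ^ 2) / ⟪G, D z (0, 1)⟫, ⟪G, D z (0, 1)⟫⁻¹) = G := by
        intro z hT hz
        rw [hlin, hDe z hT]
        have h1 := hGd _ (hplane z hT (0, 1))
        simp only
        set d := ⟪G, D z (0, 1)⟫ with hd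
        set c := ⟪e, D z (0, 1)⟫ / ‖e‖ ^ 2 with hc
        rw [h1, smul_add, smul_smul, smul_smul, inv_mul_cancel₀ hz.ne', one_smul, ← add_assoc,
          ← add_smul, show -c / d + d⁻¹ * c = 0 by field_simp; ring, zero_smul, zero_add]
      have he' := H.triFace_eq_of_velocity hS hT hT' m0 m0 (by rw [t0, t0])
        ((hG' z hT hz).trans (hG' z' hT' hz').symm)
        (eventually_add_smul_mem_interior (Or.inl hu.1) (Or.inr ⟨le_rfl, inv_pos.2 hz⟩)
          (by simpa using hu.2))
        (eventually_add_smul_mem_interior (Or.inl hu.1) (Or.inr ⟨le_rfl, inv_pos.2 hz'⟩)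
          (by simpa using hu.2))
      rcases eq_or_swap_of_triFace_eq hT hT' he' with ⟨h1, h2⟩ | ⟨h1, h2⟩
      · exact h2.symm
      · exact absurd h1 hT.2.2.2
    · intro z hT hz
      rw [hcon z hT]
      exact conormal_eq_of_decomposition he0 hG heG (hGd _ (hplane z hT _)) hz
  obtain ⟨⟨z, hT, hz⟩, huz, hcz⟩ := key F hF1 hFp heF hFd
  obtain ⟨⟨z', hT', hz'⟩, huz', hcz'⟩ := key (-F) (by simpa using hF1) (by rw [map_neg, hFp])
    (by rw [inner_neg_right, heF, neg_zero]) (fun Z hZ => by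
      rw [inner_neg_left, neg_smul_neg]; exact hFd Z hZ)
  refine ⟨z, z', ?_, fun w => ⟨fun hw => ?_, ?_⟩, ?_⟩
  · rintro rfl
    rw [inner_neg_left] at hz'
    linarith
  -- With no component along F, the direction of the third vertex would be proportional to e,
  -- against the immersion property.
  · rcases lt_trichotomy ⟪F, D w (0, 1)⟫ 0 with h1 | h1 | h1
    · exact Or.inr (huz' w z' hw hT' (by rw [inner_neg_left]; linarith) hz')
    · exfalso
      have h2 := hFd _ (hplane w hw (0, 1))
      rw [h1, zero_smul, add_zero] at h2
      have h3 : D w (-(⟪e, D w (0, 1)⟫ / ‖e‖ ^ 2), 1) = 0 := by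
        rw [hlin, hDe w hw, one_smul]
        simp only
        rw [neg_smul, neg_add_eq_zero]
        exact h2.symm
      have h4 := H.fderiv_triMap_injective hw m0 h3
      simp at h4
    · exact Or.inl (huz w z hw hT h1 hz)
  · rintro (rfl | rfl)
    exacts [hT, hT']
  · rw [hcz z hT hz, hcz' z' hT' hz']

/-- Along every edge the curvatures of the two triangles cancel. -/
lemma card_eq_two_and_sum_sideCurv (H : IsChartedTriangulation K h Γ O) (hS : IsClosedSurface S)
    (hK : K.faces.Finite) (hxy : x ≠ y) (he : edgeFace x y ∈ K.faces)
    {Q : Finset (EuclideanSpace ℝ (Fin N))} (hQ : ∀ z, z ∈ Q ↔ IsTriangle K.faces x y z) :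
    Q.card = 2 ∧ ∑ z ∈ Q, sideCurv Γ x y z = 0 := by
  classical
  -- The set of triangles containing the edge does not depend on u, so one interior point names both
  -- of them.
  obtain ⟨z, z', hne, hzz, -⟩ := H.exists_opposite_conormals hS hK hxy he (u := 1 / 2)
    (by norm_num)
  have hQe : Q = {z, z'} := by ext w; rw [hQ, hzz]; simp
  have hT := (hzz z).2 (Or.inl rfl)
  have hT' := (hzz z').2 (Or.inr rfl)
  refine ⟨by rw [hQe, Finset.card_pair hne], ?_⟩
  -- The conormals are known to be opposite only at interior points of the edge; passing to the open
  -- interval does not change the integrals.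
  rw [hQe, Finset.sum_pair hne, add_eq_zero_iff_eq_neg', sideCurv, sideCurv,
    intervalIntegral.integral_of_le zero_le_one, intervalIntegral.integral_of_le zero_le_one,
    integral_Ioc_eq_integral_Ioo, integral_Ioc_eq_integral_Ioo, ← integral_neg]
  refine setIntegral_congr_fun measurableSet_Ioo fun u hu => ?_
  obtain ⟨w, w', -, hww, hc⟩ := H.exists_opposite_conormals hS hK hxy he hu
  have hc' : sideConormal Γ x y z' u = -sideConormal Γ x y z u := by
    rcases (hww z).1 hT with rfl | rfl <;> rcases (hww z').1 hT' with rfl | rfl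
    · exact absurd rfl hne
    · exact hc
    · rw [hc, neg_neg]
    · exact absurd rfl hne
  have hγ : (fun t : ℝ => Γ (triFace x y z') (x + t • (y - x))) =ᶠ[𝓝 u]
      fun t : ℝ => Γ (triFace x y z) (x + t • (y - x)) := by
    filter_upwards [Ioo_mem_nhds hu.1 hu.2] with t ht
    exact H.eq_on_edge hT' hT (add_smul_mem_edge x y (Ioo_subset_Icc_self ht))
  rw [hc', hγ.deriv.deriv_eq,
    H.fderiv_eq_on_edge hT' hT (add_smul_mem_edge x y (Ioo_subset_Icc_self hu)),
    inner_neg_right, neg_div]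

end IsChartedTriangulation

/-! ### Counting ordered triangles, edges and vertices -/

section Counting

variable {N : ℕ} {K : Geometry.SimplicialComplex ℝ (EuclideanSpace ℝ (Fin N))}

lemma mem_vertices_of_mem {s : Finset (EuclideanSpace ℝ (Fin N))} (hs : s ∈ K.faces)
    {x : EuclideanSpace ℝ (Fin N)} (hx : x ∈ s) : x ∈ K.vertices :=
  K.down_closed hs (Finset.singleton_subset_iff.2 hx) (Finset.singleton_nonempty x)

variable {𝓥 : Finset (EuclideanSpace ℝ (Fin N))}

open Classical in
/-- A sum over the ordered triangles as a sum over the triangles. -/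
lemma sum_isTriangle_eq (h𝓥 : ∀ x, x ∈ 𝓥 ↔ x ∈ K.vertices)
    (hK : K.faces.Finite)
    {o : (hK.toFinset.filter fun s => s.card = 3) → EuclideanSpace ℝ (Fin N) ×
      EuclideanSpace ℝ (Fin N) × EuclideanSpace ℝ (Fin N)}
    (ho : ∀ t, triFace (o t).1 (o t).2.1 (o t).2.2 = t.1)
    (ho' : ∀ t, IsTriangle K.faces (o t).1 (o t).2.1 (o t).2.2)
    (f : EuclideanSpace ℝ (Fin N) → EuclideanSpace ℝ (Fin N) → EuclideanSpace ℝ (Fin N) → ℝ) :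
    ∑ T ∈ (𝓥 ×ˢ 𝓥 ×ˢ 𝓥).filter (fun T => IsTriangle K.faces T.1 T.2.1 T.2.2),
        f T.1 T.2.1 T.2.2 =
      ∑ t, (f (o t).1 (o t).2.1 (o t).2.2 + f (o t).2.1 (o t).2.2 (o t).1 +
        f (o t).2.2 (o t).1 (o t).2.1) +
      ∑ t, (f (o t).1 (o t).2.2 (o t).2.1 + f (o t).2.2 (o t).2.1 (o t).1 +
        f (o t).2.1 (o t).1 (o t).2.2) := by
  have hcard : ∀ {x y z : EuclideanSpace ℝ (Fin N)}, IsTriangle K.faces x y z →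
      (triFace x y z).card = 3 := by
    rintro x y z ⟨-, h1, h2, h3⟩
    exact Finset.card_eq_three.2 ⟨x, y, z, h1, h2, h3, by ext; simp⟩
  rw [← Finset.sum_fiberwise_of_maps_to (g := fun T => triFace T.1 T.2.1 T.2.2)
    (t := hK.toFinset.filter fun s => s.card = 3) (by
      intro T hT
      have hT' := (Finset.mem_filter.1 hT).2
      exact Finset.mem_filter.2 ⟨hK.mem_toFinset.2 hT'.1, hcard hT'⟩),
    ← Finset.sum_coe_sort, ← Finset.sum_add_distrib]
  refine Finset.sum_congr rfl fun t _ => ?_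
  have hot := ho t
  have hT := ho' t
  generalize o t = T at hot hT ⊢
  obtain ⟨x, y, z⟩ := T
  simp only at hot hT ⊢
  obtain ⟨-, hxy, hxz, hyz⟩ := id hT
  -- The fibre over a triangle consists of its six orderings: three rotations of the chosen one and
  -- three of its reversal.
  have hfib : ((𝓥 ×ˢ 𝓥 ×ˢ 𝓥).filter (fun T => IsTriangle K.faces T.1 T.2.1 T.2.2)).filter
      (fun T => triFace T.1 T.2.1 T.2.2 = t) =
      {(x, y, z), (y, z, x), (z, x, y), (x, z, y), (z, y, x), (y, x, z)} := by
    ext ⟨a, b, c⟩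
    simp only [Finset.mem_filter, Finset.mem_product, Finset.mem_insert, Finset.mem_singleton,
      Prod.mk.injEq]
    constructor
    · rintro ⟨⟨-, h1⟩, h2⟩
      have ha : a ∈ triFace x y z := by rw [hot, ← h2]; simp
      rw [mem_triFace] at ha
      rcases ha with rfl | rfl | rfl
      · rcases eq_or_swap_of_triFace_eq hT h1 (by rw [hot, h2]) with ⟨h3, h4⟩ | ⟨h3, h4⟩ <;>
          simp [h3, h4]
      · rcases eq_or_swap_of_triFace_eq hT.rotate h1 (by rw [triFace_rotate, hot, h2]) with
          ⟨h3, h4⟩ | ⟨h3, h4⟩ <;> simp [h3, h4]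
      · rcases eq_or_swap_of_triFace_eq hT.rotate.rotate h1
          (by rw [triFace_rotate, triFace_rotate, hot, h2]) with ⟨h3, h4⟩ | ⟨h3, h4⟩ <;>
          simp [h3, h4]
    · have main : ∀ {a b c : EuclideanSpace ℝ (Fin N)}, IsTriangle K.faces a b c →
          triFace a b c = t → ((a ∈ 𝓥 ∧ b ∈ 𝓥 ∧ c ∈ 𝓥) ∧ IsTriangle K.faces a b c) ∧
            triFace a b c = t := fun h1 h2 =>
        ⟨⟨⟨(h𝓥 _).2 (mem_vertices_of_mem h1.1 (by simp)),
          (h𝓥 _).2 (mem_vertices_of_mem h1.1 (by simp)),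
          (h𝓥 _).2 (mem_vertices_of_mem h1.1 (by simp))⟩, h1⟩, h2⟩
      rintro (⟨rfl, rfl, rfl⟩ | ⟨rfl, rfl, rfl⟩ | ⟨rfl, rfl, rfl⟩ | ⟨rfl, rfl, rfl⟩ |
        ⟨rfl, rfl, rfl⟩ | ⟨rfl, rfl, rfl⟩)
      · exact main hT hot
      · exact main hT.rotate (by rw [triFace_rotate, hot])
      · exact main hT.rotate.rotate (by rw [triFace_rotate, triFace_rotate, hot])
      · exact main hT.swap (by rw [triFace_swap, hot])
      · exact main hT.swap.rotate (by rw [triFace_rotate, triFace_swap, hot])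
      · exact main hT.swap.rotate.rotate
          (by rw [triFace_rotate, triFace_rotate, triFace_swap, hot])
  rw [hfib]
  have := hxy.symm
  have := hxz.symm
  have := hyz.symm
  rw [Finset.sum_insert (by simp [*]), Finset.sum_insert (by simp [*]),
    Finset.sum_insert (by simp [*]), Finset.sum_insert (by simp [*]),
    Finset.sum_insert (by simp [*]), Finset.sum_singleton]
  ring

open Classical in
/-- A sum over the ordered triangles, vertex by vertex. -/
lemma sum_isTriangle_vertex
    (f : EuclideanSpace ℝ (Fin N) → EuclideanSpace ℝ (Fin N) → EuclideanSpace ℝ (Fin N) → ℝ) :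
    ∑ T ∈ (𝓥 ×ˢ 𝓥 ×ˢ 𝓥).filter (fun T => IsTriangle K.faces T.1 T.2.1 T.2.2),
        f T.1 T.2.1 T.2.2 =
      ∑ x ∈ 𝓥, ∑ p ∈ (𝓥 ×ˢ 𝓥).filter (fun p => IsTriangle K.faces x p.1 p.2), f x p.1 p.2 := by
  rw [Finset.sum_filter, Finset.sum_product]
  exact Finset.sum_congr rfl fun x _ => (Finset.sum_filter _ _).symm

open Classical in
/-- A sum over the ordered triangles, edge by edge. -/
lemma sum_isTriangle_edge
    (f : EuclideanSpace ℝ (Fin N) → EuclideanSpace ℝ (Fin N) → EuclideanSpace ℝ (Fin N) → ℝ) :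
    ∑ T ∈ (𝓥 ×ˢ 𝓥 ×ˢ 𝓥).filter (fun T => IsTriangle K.faces T.1 T.2.1 T.2.2),
        f T.1 T.2.1 T.2.2 =
      ∑ p ∈ (𝓥 ×ˢ 𝓥).filter (fun p => p.1 ≠ p.2 ∧ edgeFace p.1 p.2 ∈ K.faces),
        ∑ z ∈ 𝓥.filter (fun z => IsTriangle K.faces p.1 p.2 z), f p.1 p.2 z := by
  rw [sum_isTriangle_vertex, Finset.sum_filter, Finset.sum_product]
  refine Finset.sum_congr rfl fun x _ => ?_
  rw [Finset.sum_filter, Finset.sum_product]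
  refine Finset.sum_congr rfl fun y _ => ?_
  simp only
  split_ifs with h1
  · rw [Finset.sum_filter]
  · refine Finset.sum_eq_zero fun z _ => if_neg fun h2 => h1 ⟨h2.2.1, ?_⟩
    exact K.down_closed h2.1 (IsChartedTriangulation.edgeFace_subset x y z)
      ⟨x, by simp⟩

open Classical in
lemma card_orderedEdges (h𝓥 : ∀ x, x ∈ 𝓥 ↔ x ∈ K.vertices)
    (hK : K.faces.Finite) :
    ((𝓥 ×ˢ 𝓥).filter (fun p => p.1 ≠ p.2 ∧ edgeFace p.1 p.2 ∈ K.faces)).card =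
      2 * (hK.toFinset.filter fun s => s.card = 2).card := by
  rw [Finset.card_eq_sum_card_fiberwise (f := fun p => edgeFace p.1 p.2)
    (t := hK.toFinset.filter fun s => s.card = 2)]
  · rw [Finset.sum_const_nat (m := 2), mul_comm]
    intro s hs
    obtain ⟨hs1, hs2⟩ := Finset.mem_filter.1 hs
    rw [hK.mem_toFinset] at hs1
    obtain ⟨x, y, hxy, rfl⟩ := Finset.card_eq_two.1 hs2
    have he : ({x, y} : Finset (EuclideanSpace ℝ (Fin N))) = edgeFace x y := by ext; simp
    rw [he] at hs1 ⊢
    have hx := (h𝓥 x).2 (mem_vertices_of_mem hs1 (by simp))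
    have hy := (h𝓥 y).2 (mem_vertices_of_mem hs1 (by simp))
    have : (((𝓥 ×ˢ 𝓥).filter (fun p => p.1 ≠ p.2 ∧ edgeFace p.1 p.2 ∈ K.faces)).filter
        fun p => edgeFace p.1 p.2 = edgeFace x y) = {(x, y), (y, x)} := by
      ext ⟨a, b⟩
      simp only [Finset.mem_filter, Finset.mem_product, Finset.mem_insert, Finset.mem_singleton,
        Prod.mk.injEq]
      constructor
      · rintro ⟨⟨-, h1, -⟩, h2⟩
        have ha : a ∈ edgeFace x y := by rw [← h2]; simp
        have hb : b ∈ edgeFace x y := by rw [← h2]; simp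
        rw [mem_edgeFace] at ha hb
        rcases ha with rfl | rfl <;> rcases hb with rfl | rfl <;> simp_all
      · rintro (⟨rfl, rfl⟩ | ⟨rfl, rfl⟩)
        · exact ⟨⟨⟨hx, hy⟩, hxy, hs1⟩, rfl⟩
        · exact ⟨⟨⟨hy, hx⟩, hxy.symm, by rwa [edgeFace_comm]⟩, edgeFace_comm _ _⟩
    rw [this, Finset.card_pair]
    exact fun h0 => hxy (congrArg Prod.fst h0)
  · intro p hp
    obtain ⟨-, h1, h2⟩ := Finset.mem_filter.1 hp
    refine Finset.mem_filter.2 ⟨hK.mem_toFinset.2 h2, ?_⟩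
    exact Finset.card_eq_two.2 ⟨p.1, p.2, h1, by ext; simp⟩

open Classical in
lemma card_vertexFaces (h𝓥 : ∀ x, x ∈ 𝓥 ↔ x ∈ K.vertices)
    (hK : K.faces.Finite) :
    (hK.toFinset.filter fun s => s.card = 1).card = 𝓥.card := by
  rw [← Finset.card_image_of_injective 𝓥 Finset.singleton_injective]
  congr 1
  ext s
  simp only [Finset.mem_filter, hK.mem_toFinset, Finset.mem_image]
  constructor
  · rintro ⟨h1, h2⟩
    obtain ⟨x, rfl⟩ := Finset.card_eq_one.1 h2
    exact ⟨x, (h𝓥 x).2 h1, rfl⟩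
  · rintro ⟨x, hx, rfl⟩
    exact ⟨(h𝓥 x).1 hx, Finset.card_singleton x⟩

lemma eulerCharacteristic_eq (hK : K.faces.Finite) (h3 : ∀ s ∈ K.faces, s.card ≤ 3) :
    eulerCharacteristic hK = (hK.toFinset.filter fun s => s.card = 1).card -
      (hK.toFinset.filter fun s => s.card = 2).card +
      (hK.toFinset.filter fun s => s.card = 3).card := by
  simp only [Finset.card_filter, Nat.cast_sum]
  rw [eulerCharacteristic, ← Finset.sum_sub_distrib, ← Finset.sum_add_distrib]
  refine Finset.sum_congr rfl fun s hs => ?_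
  have h1 := h3 s (hK.mem_toFinset.1 hs)
  have h2 := (K.nonempty_of_mem_faces (hK.mem_toFinset.1 hs)).card_pos
  have h4 : s.card = 1 ∨ s.card = 2 ∨ s.card = 3 := by omega
  rcases h4 with h | h | h <;> simp [h]

end Counting


/-! ### The degree integral and the Euler characteristic -/

section Global

variable {N : ℕ} {K : Geometry.SimplicialComplex ℝ (EuclideanSpace ℝ (Fin N))} {S A : Set E4}
  {h : K.space ≃ₜ S} {Γ : Finset (EuclideanSpace ℝ (Fin N)) → EuclideanSpace ℝ (Fin N) → E4}
  {O : Finset (EuclideanSpace ℝ (Fin N)) → Set (EuclideanSpace ℝ (Fin N))}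
  {n : E4 → E4} {δ : ℝ} {W : Set E4} {P : E4 → E4} {σ : E4 → ℝ} {β : ℝ → ℝ} {r : ℝ}

/-- The contribution of a corner of a triangle to its total curvature. -/
noncomputable def cornerCurv
    (Γ : Finset (EuclideanSpace ℝ (Fin N)) → EuclideanSpace ℝ (Fin N) → E4)
    (x y z : EuclideanSpace ℝ (Fin N)) : ℝ :=
  cornerAngle Γ x y z - Real.pi / 3 - sideCurv Γ x y z

namespace IsChartedTriangulation

/-- The degree integral in terms of the triangles, with any choice of their orientations. -/
lemma integral_det_rotMap_eq (H : IsChartedTriangulation K h Γ O) (hS : IsClosedSurface S)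
    (hA : ∃ a ∈ Metric.sphere (0 : E4) 1 \ S,
      A = connectedComponentIn (Metric.sphere (0 : E4) 1 \ S) a)
    (hn : IsUnitNormalInto S A n) (ht : IsTube S A n δ W P σ)
    (hr : 0 ≤ r) (hrδ : r < δ) (hβ : ContDiff ℝ ∞ β) (hβ1 : ∀ s, s ≤ -r → β s = s)
    (hβ2 : ∀ s, r ≤ s → β s = s - Real.pi) (hK : K.faces.Finite)
    {o : (hK.toFinset.filter fun s => s.card = 3) → EuclideanSpace ℝ (Fin N) ×
      EuclideanSpace ℝ (Fin N) × EuclideanSpace ℝ (Fin N)}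
    (ho : ∀ t, triFace (o t).1 (o t).2.1 (o t).2.2 = t.1)
    (ho' : ∀ t, IsTriangle K.faces (o t).1 (o t).2.1 (o t).2.2) :
    ∫ x : S3, (fderiv ℝ (rotMap A n W P σ β) (x : E4)).det ∂sphereMeasure =
      2 * Real.pi ^ 2 - Real.pi / 2 *
        ∑ t, (cornerCurv Γ (o t).1 (o t).2.1 (o t).2.2 + cornerCurv Γ (o t).2.1 (o t).2.2 (o t).1 +
          cornerCurv Γ (o t).2.2 (o t).1 (o t).2.1) := by
  choose U E F hEF hUS hΔ hI using fun t => H.exists_isAdaptedFrame_triMap hS hn ht (ho' t)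
  -- On the standard triangle the parametrizations factor through the homeomorphism h, so
  -- coincidences on S are coincidences in the complex. This supplies injectivity and disjointness
  -- of the triangles.
  have hpt : ∀ t t' {q q' : ℝ × ℝ}, q ∈ stdTriangle → q' ∈ stdTriangle →
      triMap Γ (o t).1 (o t).2.1 (o t).2.2 q = triMap Γ (o t').1 (o t').2.1 (o t').2.2 q' →
      triPoint (o t).1 (o t).2.1 (o t).2.2 q = triPoint (o t').1 (o t').2.1 (o t').2.2 q' := by
    intro t t' q q' hq hq' he
    rw [H.triMap_eq (ho' t) hq, H.triMap_eq (ho' t') hq'] at he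
    exact congrArg Subtype.val (h.injective (Subtype.ext he))
  rw [integral_det_rotMap hS hA hn ht hr hrδ hβ hβ1 hβ2 hEF hUS hΔ]
  · congr 2
    refine Finset.sum_congr rfl fun t _ => ?_
    rw [hI]
    simp only [cornerCurv]
    ring
  · intro t q hq q' hq' he
    exact (ho' t).triPoint_injective (hpt t t (interior_subset hq) (interior_subset hq') he)
  · intro t t' hne
    refine disjoint_left.2 ?_
    rintro _ ⟨q, hq, rfl⟩ ⟨q', hq', he⟩
    refine hne (Subtype.ext ?_)
    have h1 := hpt t' t (interior_subset hq') (interior_subset hq) he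
    rw [← ho t, ← ho t']
    refine subset_antisymm ?_ ?_
    · exact (ho' t).subset_of_mem hq (ho' t').1 (by
        rw [← h1]; exact triPoint_mem_convexHull _ _ _ (interior_subset hq'))
    · exact (ho' t').subset_of_mem hq' (ho' t).1 (by
        rw [h1]; exact triPoint_mem_convexHull _ _ _ (interior_subset hq))
  · intro p hp
    obtain ⟨s, hs, hs3, hxs⟩ := H.exists_triangle hS hK (h.symm ⟨p, hp⟩)
    set t : (hK.toFinset.filter fun s => s.card = 3) :=
      ⟨s, Finset.mem_filter.2 ⟨hK.mem_toFinset.2 hs, hs3⟩⟩ with htd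
    have hxs' : (h.symm ⟨p, hp⟩ : EuclideanSpace ℝ (Fin N)) ∈
        convexHull ℝ (triFace (o t).1 (o t).2.1 (o t).2.2 : Set _) := by rw [ho t]; exact hxs
    obtain ⟨q, hq, hqx⟩ := exists_triPoint_eq hxs'
    refine mem_iUnion.2 ⟨t, q, hq, ?_⟩
    rw [H.triMap_eq (ho' t) hq]
    have h1 : (⟨triPoint (o t).1 (o t).2.1 (o t).2.2 q, K.convexHull_subset_space (ho' t).1
        (triPoint_mem_convexHull _ _ _ hq)⟩ : K.space) = h.symm ⟨p, hp⟩ := Subtype.ext hqx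
    rw [h1, h.apply_symm_apply]

/-- The degree integral in terms of the Euler characteristic. -/
lemma integral_det_rotMap_eulerCharacteristic (H : IsChartedTriangulation K h Γ O)
    (hS : IsClosedSurface S)
    (hA : ∃ a ∈ Metric.sphere (0 : E4) 1 \ S,
      A = connectedComponentIn (Metric.sphere (0 : E4) 1 \ S) a)
    (hn : IsUnitNormalInto S A n) (ht : IsTube S A n δ W P σ)
    (hr : 0 ≤ r) (hrδ : r < δ) (hβ : ContDiff ℝ ∞ β) (hβ1 : ∀ s, s ≤ -r → β s = s)
    (hβ2 : ∀ s, r ≤ s → β s = s - Real.pi) (hK : K.faces.Finite) :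
    ∫ x : S3, (fderiv ℝ (rotMap A n W P σ β) (x : E4)).det ∂sphereMeasure =
      2 * Real.pi ^ 2 - Real.pi ^ 2 * (eulerCharacteristic hK : ℝ) := by
  classical
  have hVfin : K.vertices.Finite :=
    hK.preimage (f := fun x => ({x} : Finset (EuclideanSpace ℝ (Fin N))))
      Finset.singleton_injective.injOn
  set 𝓥 := hVfin.toFinset with h𝓥d
  have h𝓥 : ∀ x, x ∈ 𝓥 ↔ x ∈ K.vertices := fun x => hVfin.mem_toFinset
  have hex : ∀ t : (hK.toFinset.filter fun s => s.card = 3), ∃ T : EuclideanSpace ℝ (Fin N) ×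
      EuclideanSpace ℝ (Fin N) × EuclideanSpace ℝ (Fin N),
      triFace T.1 T.2.1 T.2.2 = t.1 ∧ IsTriangle K.faces T.1 T.2.1 T.2.2 := by
    rintro ⟨t, ht⟩
    obtain ⟨h1, h2⟩ := Finset.mem_filter.1 ht
    rw [hK.mem_toFinset] at h1
    obtain ⟨x, hx⟩ := K.nonempty_of_mem_faces h1
    obtain ⟨y, z, hyz, hne⟩ := exists_triFace_eq h2 hx
    exact ⟨(x, y, z), hyz, by rw [hyz]; exact h1, hne⟩
  choose o ho ho' using hex
  have e1 := H.integral_det_rotMap_eq hS hA hn ht hr hrδ hβ hβ1 hβ2 hK ho ho'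
  -- The formula holds for either cyclic order of each triangle. Adding both versions gives a sum
  -- over all ordered triangles, which can be regrouped by vertices or by ordered edges.
  have e2 := H.integral_det_rotMap_eq hS hA hn ht hr hrδ hβ hβ1 hβ2 hK
    (o := fun t => ((o t).1, (o t).2.2, (o t).2.1)) (fun t => by rw [triFace_swap, ho])
    (fun t => (ho' t).swap)
  simp only at e2
  have e3 := sum_isTriangle_eq h𝓥 hK ho ho' (cornerCurv Γ)
  have e4 := sum_isTriangle_eq h𝓥 hK ho ho' (fun _ _ _ => 1)
  have hQ : ∀ x y z, z ∈ 𝓥.filter (fun z => IsTriangle K.faces x y z) ↔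
      IsTriangle K.faces x y z := by
    intro x y z
    rw [Finset.mem_filter, h𝓥, and_iff_right_iff_imp]
    exact fun h1 => mem_vertices_of_mem h1.1 (by simp)
  have hP : ∀ x (p : EuclideanSpace ℝ (Fin N) × EuclideanSpace ℝ (Fin N)),
      p ∈ (𝓥 ×ˢ 𝓥).filter (fun p => IsTriangle K.faces x p.1 p.2) ↔
      IsTriangle K.faces x p.1 p.2 := by
    intro x p
    rw [Finset.mem_filter, Finset.mem_product, h𝓥, h𝓥, and_iff_right_iff_imp]
    exact fun h1 => ⟨mem_vertices_of_mem h1.1 (by simp), mem_vertices_of_mem h1.1 (by simp)⟩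
  -- Every ordered edge lies in two triangles, so there are 4E ordered triangles; by `e4` there are
  -- also 6F. Hence 2E = 3F.
  have e5 := (sum_isTriangle_edge (K := K) (𝓥 := 𝓥) (fun _ _ _ => 1)).trans
    (Finset.sum_congr rfl (g := fun _ => (2 : ℝ)) fun p hp => by
      obtain ⟨-, h1, h2⟩ := Finset.mem_filter.1 hp
      rw [Finset.sum_const, (H.card_eq_two_and_sum_sideCurv hS hK h1 h2 (hQ _ _)).1]
      norm_num)
  have e6 := (sum_isTriangle_edge (K := K) (𝓥 := 𝓥) (sideCurv Γ)).trans
    (Finset.sum_eq_zero fun p hp => by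
      obtain ⟨-, h1, h2⟩ := Finset.mem_filter.1 hp
      exact (H.card_eq_two_and_sum_sideCurv hS hK h1 h2 (hQ _ _)).2)
  have e7 := (sum_isTriangle_vertex (K := K) (𝓥 := 𝓥) (cornerAngle Γ)).trans
    (Finset.sum_congr rfl (g := fun _ => 4 * Real.pi) fun x hx =>
      H.sum_cornerAngle hS hK ((h𝓥 x).1 hx) (hP x))
  have e8 := card_orderedEdges h𝓥 hK
  have e9 := card_vertexFaces h𝓥 hK
  have hsum : ∀ a b c d R : ℝ, R = a - b * c → R = a - b * d → 2 * R = 2 * a - b * (c + d) := by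
    intro a b c d R h1 h2; linarith
  have e11 := hsum _ _ _ _ _ e1 e2
  have e10 := eulerCharacteristic_eq hK fun s hs => H.card_le_three hS hs
  rw [← e3] at e11
  simp only [cornerCurv, Finset.sum_sub_distrib] at e11
  rw [e6, e7] at e11
  simp only [Finset.sum_const, nsmul_eq_mul, mul_one, Finset.card_univ, Fintype.card_coe]
    at e4 e5 e11
  rw [e8] at e5
  rw [e10, e9]
  push_cast at e5 ⊢
  generalize hR : ∫ x : S3, (fderiv ℝ (rotMap A n W P σ β) (x : E4)).det ∂sphereMeasure = R
    at e11 ⊢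
  -- With T ordered triangles, `e11` says 2R = 4π² - (π/2)(4πV - πT/3). Since T = 6F = 4E, the term
  -- π²T/12 in R equals π²(E - F), and V, E, F combine to the Euler characteristic.
  linear_combination e11 / 2 + Real.pi ^ 2 * e5 / 4 - Real.pi ^ 2 * e4 / 6

end IsChartedTriangulation

end Global


/-! ### The smooth angle and the conclusion -/

/-- A smooth function, homotopic to the angle of the centre, that turns by `π` across the tube. -/
noncomputable def smoothAngle (ε s : ℝ) : ℝ := s - Real.pi * Real.smoothTransition (s / ε + 1 / 2)

lemma contDiff_smoothAngle (ε : ℝ) : ContDiff ℝ ∞ (smoothAngle ε) :=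
  contDiff_id.sub (contDiff_const.mul
    (Real.smoothTransition.contDiff.comp ((contDiff_id.div_const ε).add contDiff_const)))

lemma smoothAngle_of_le {ε s : ℝ} (hε : 0 < ε) (hs : s ≤ -(ε / 2)) : smoothAngle ε s = s := by
  have : s / ε ≤ -(1 / 2) := by rw [div_le_iff₀ hε]; linarith
  rw [smoothAngle, Real.smoothTransition.zero_of_nonpos (by linarith), mul_zero, sub_zero]

lemma smoothAngle_of_ge {ε s : ℝ} (hε : 0 < ε) (hs : ε / 2 ≤ s) :
    smoothAngle ε s = s - Real.pi := by
  have : 1 / 2 ≤ s / ε := by rw [le_div_iff₀ hε]; linarith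
  rw [smoothAngle, Real.smoothTransition.one_of_one_le (by linarith), mul_one]

lemma smoothTransition_half : Real.smoothTransition (1 / 2) = 1 / 2 := by
  have h1 := Real.smoothTransition.pos_denom (1 / 2)
  rw [Real.smoothTransition]
  norm_num at h1 ⊢
  field_simp
  norm_num

/-- For |s| ≤ ε both angles have made at least half of their turn by -π when s ≥ 0 and at most half
when s ≤ 0, so the difference is at most π/2 + ε, and ε < 1/2. Beyond ε both turns are the same,
complete or not yet begun, and the angles differ by s(1 - φ(|s|)), which is less than 1 in absolute
value. -/
lemma abs_smoothAngle_sub_centreAngle_lt {ε : ℝ} {φ : ℝ → ℝ} (hφ : IsProfile ε φ) (hε : 0 < ε)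
    (hε1 : 2 * ε < 1) (s : ℝ) : |smoothAngle ε s - centreAngle ε φ s| < Real.pi := by
  have hpi := Real.pi_gt_three
  rcases le_or_gt |s| ε with h1 | h1
  · have h2 := abs_le.1 h1
    rw [centreAngle_of_abs_le hφ h1, smoothAngle, abs_lt]
    have h3 := Real.arcsin_le_pi_div_two (s / ε)
    have h4 := Real.neg_pi_div_two_le_arcsin (s / ε)
    have h5 := Real.smoothTransition.nonneg (s / ε + 1 / 2)
    have h6 := Real.smoothTransition.le_one (s / ε + 1 / 2)
    rcases le_total 0 s with h0 | h0
    · have h7 : 0 ≤ s / ε := div_nonneg h0 hε.le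
      have h8 : 1 / 2 ≤ Real.smoothTransition (s / ε + 1 / 2) := by
        conv_lhs => rw [← smoothTransition_half]
        exact Real.smoothTransition.monotone (by linarith)
      have h9 := Real.arcsin_nonneg.2 h7
      constructor <;> nlinarith
    · have h7 : s / ε ≤ 0 := div_nonpos_of_nonpos_of_nonneg h0 hε.le
      have h8 : Real.smoothTransition (s / ε + 1 / 2) ≤ 1 / 2 := by
        conv_rhs => rw [← smoothTransition_half]
        exact Real.smoothTransition.monotone (by linarith)
      have h9 := Real.arcsin_nonpos.2 h7
      constructor <;> nlinarith
  · have h2 : smoothAngle ε s - centreAngle ε φ s = s * (1 - φ |s|) := by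
      rcases lt_abs.1 h1 with h3 | h3
      · rw [smoothAngle_of_ge hε (by linarith), centreAngle_of_ge hε h3.le]; ring
      · rw [smoothAngle_of_le hε (by linarith), centreAngle_of_le hε (by linarith)]; ring
    rw [h2, abs_mul]
    rcases le_or_gt (2 * ε) |s| with h3 | h3
    · rw [hφ.2.2.2 _ h3, sub_self, abs_zero, mul_zero]; linarith
    · have m1 : ε ∈ Icc ε (2 * ε) := ⟨le_rfl, by linarith⟩
      have m2 : 2 * ε ∈ Icc ε (2 * ε) := ⟨by linarith, le_rfl⟩
      have m : |s| ∈ Icc ε (2 * ε) := ⟨h1.le, h3.le⟩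
      have h4 := hφ.2.2.1.monotoneOn m1 m h1.le
      have h5 := hφ.2.2.1.monotoneOn m m2 h3.le
      rw [hφ.2.1 _ le_rfl] at h4
      rw [hφ.2.2.2 _ le_rfl] at h5
      have h6 : |(1 - φ (|s|))| ≤ 1 := abs_le.2 ⟨by linarith, by linarith⟩
      calc |s| * |(1 - φ (|s|))| ≤ |s| * 1 := by gcongr
        _ < Real.pi := by linarith

lemma sphereMeasure_real_univ : sphereMeasure.real univ = 2 * Real.pi ^ 2 := by
  rw [sphereMeasure, Measure.toSphere_real_apply_univ, volume_real_ball_E4]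
  simp
  ring

theorem mainTheorem4 (S : Set E4) (hS : IsClosedSurface S) (g : ℕ) (hg : HasGenus S g)
    (A : Set E4) (hA : ∃ a ∈ Metric.sphere (0 : E4) 1 \ S,
      A = connectedComponentIn (Metric.sphere (0 : E4) 1 \ S) a)
    (n : E4 → E4) (hn : IsUnitNormalInto S A n) :
    ∃ ε₀ > 0, ∀ ε ∈ Ioo 0 ε₀, ∀ φ : ℝ → ℝ, IsProfile ε φ →
      ∀ ρ : E4 → ℝ, IsRadiusExtension S A n ε ρ →
      ∀ (f : Cube4 ≃ₜ Ball4) (hf : PreservesBoundary f),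
      ∃ Q : C(cubeBoundary, S3),
        IsCentreMap (canonicalFamily S A n ε φ ρ f) Q ∧
        (∀ Q' : cubeBoundary → S3, IsCentreMap (canonicalFamily S A n ε φ ρ f) Q' → Q' = Q) ∧
        HasDegree (Q.comp (sphereToCubeBoundary f hf)) (g : ℤ) := by
  obtain ⟨δ, W, P, σ, hT⟩ := exists_isTube hS hA hn
  obtain ⟨N, K, hK, h, hh, hχ⟩ := hg
  obtain ⟨Γ, O, H⟩ := hh.exists_charts hT
  -- 2ε < δ keeps the half tube of radius 2ε over the tubular neighbourhood. 2ε < 1 keeps 1 - s₁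
  -- positive on it and bounds the difference between the two angles.
  refine ⟨min (δ / 2) (1 / 2), lt_min (half_pos hT.pos) one_half_pos, ?_⟩
  rintro ε ⟨hε, hε'⟩ φ hφ ρ hρ f hf
  have hεδ : 2 * ε < δ := by linarith [hε'.trans_le (min_le_left _ _)]
  have hε1 : 2 * ε < 1 := by linarith [hε'.trans_le (min_le_right _ _)]
  obtain ⟨q, hq⟩ := exists_continuousMap_rotMap (β := centreAngle ε φ) (r := 2 * ε) hS hA hn hT
    (fun s hs => by
      rw [centreAngle_of_le hε (by linarith), hφ.2.2.2 _ (by linarith [neg_le_abs s]), one_mul])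
    (fun s hs => by
      rw [centreAngle_of_ge hε (by linarith), hφ.2.2.2 _ (by linarith [le_abs_self s]), one_mul])
    (by linarith) hεδ (continuous_centreAngle hφ)
  obtain ⟨F, hF⟩ := exists_continuousMap_rotMap (β := smoothAngle ε) (r := ε / 2) hS hA hn hT
    (fun s hs => smoothAngle_of_le hε hs) (fun s hs => smoothAngle_of_ge hε hs)
    (by linarith) (by linarith) (contDiff_smoothAngle ε).continuous
  have hf1 : ∀ x : cubeBoundary, (f x : E4) ∈ Metric.sphere (0 : E4) 1 := fun x =>
    mem_sphere_zero_iff_norm.2 ((hf x).1 x.2)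
  set Q : C(cubeBoundary, S3) := ⟨fun x => q ⟨f x, hf1 x⟩, by fun_prop⟩ with hQ
  have hQc : IsCentreMap (canonicalFamily S A n ε φ ρ f) Q :=
    isCentreMap_canonicalFamily hρ hf fun x => by
      rw [sphereCentre_eq_rotMap hS hn hT hφ hε hεδ hε1 ((hf x).1 x.2)]
      exact hq ⟨f x, hf1 x⟩
  refine ⟨Q, hQc, fun Q' hQ' => isCentreMap_unique hQc hQ', ?_⟩
  -- The identification inverts `f`, so the map whose degree is wanted is the rotation with the
  -- centre angle, whatever `f` is.
  have hcomp : Q.comp (sphereToCubeBoundary f hf) = q := by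
    ext1 v
    change q _ = q v
    congr 1
    exact Subtype.ext (by simp [sphereToCubeBoundary])
  rw [hcomp]
  have hext := homogeneousExtension_eq_rotMap hS hn hT hF
  refine ⟨F, ?_, homotopic_rotMap hS hn hT (fun s _ => ?_) hq hF, ?_⟩
  · rw [hext]
    exact fun y hy => (contDiffAt_rotMap hS hA hT (fun s hs => smoothAngle_of_le hε hs)
      (fun s hs => smoothAngle_of_ge hε hs) (by linarith) (by linarith)
      (contDiff_smoothAngle ε) hy).contDiffWithinAt
  · rw [abs_sub_comm]
    exact abs_smoothAngle_sub_centreAngle_lt hφ hε hε1 s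
  -- For χ = 2 - 2g the value 2π² - π²χ is g · 2π², and 2π² is the volume of the sphere.
  · rw [hext, H.integral_det_rotMap_eulerCharacteristic hS hA hn hT (r := ε / 2) (by linarith)
      (by linarith) (contDiff_smoothAngle ε) (fun s hs => smoothAngle_of_le hε hs)
      (fun s hs => smoothAngle_of_ge hε hs) hK, hχ, sphereMeasure_real_univ]
    push_cast
    ring
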